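/- Let $1<\alpha<2$, $a<b$, $T>0$, let $\lambda_1,\dots,\lambda_4,\omega_1,\omega_2$ be real constants and $N\ge 0$ an integer. For $0<\mu<1$ let $$\Delta_{-\mu/2}f(x)=\frac{1}{2\cos(\pi\mu/2)\,\Gamma(\mu)}\Big(\int_{-\infty}^x\frac{f(s)\,ds}{(x-s)^{1-\mu}}+\int_x^{\infty}\frac{f(s)\,ds}{(s-x)^{1-\mu}}\Big),$$ and let $-(-\Delta)^{\alpha/2}$ be the Riesz derivative, i.e. $-\frac{1}{2\cos(\pi\alpha/2)}$ times the sum of the left and right Caputo derivatives of order $\alpha$ on $\mathbb R$; it equals $\Delta_{(\alpha-2)/2}\,\partial_x^2$. Consider the linear strongly coupled system $$i u_t-\lambda_1(-\Delta)^{\alpha/2}u+\omega_1u+\omega_2v+\lambda_2u=G_1,\qquad i v_t-\lambda_3(-\Delta)^{\alpha/2}v+\omega_2u+\omega_1v+\lambda_4v=G_2$$ for $x\in(a,b)$, $t\in[0,T]$, with homogeneous boundary conditions $u=v=0$ for $x\notin(a,b)$. The source terms $G_1,G_2$ are arbitrary; $G_1=G_2=0$ is the homogeneous system. **Scheme.**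 Let $a=x_{1/2}<x_{3/2}<\dots<x_{K+1/2}=b$ be any mesh with elements $D^k=[x_{k-1/2},x_{k+1/2}]$, $h=\max_k|D^k|$, and let $V_h$ be the space of functions that are polynomials of degree at most $N$ on each $D^k$, extended by zero outside $[a,b]$. The semidiscrete LDG solution is $u_h=p_h+iq_h$, $v_h=\upsilon_h+i\theta_h$, where $p_h,q_h,\upsilon_h,\theta_h$ and the auxiliary functions $T_h,r_h,s_h$; $H_h,w_h,z_h$; $L_h,\rho_h,\varpi_h$; $E_h,\xi_h,\varrho_h$ lie in $V_h$ for $t\in[0,T]$, with $p_h,q_h,\upsilon_h,\theta_h$ differentiable in $t$, and satisfy, for all $k$, all $t\in[0,T]$ and every polynomial $\phi$ of degree at most $N$, with $(\cdot,\cdot)$ the $L^2(D^k)$ inner product, $$\begin{aligned} (\partial_tp_h,\phi)+\lambda_1(T_h,\phi)+\omega_1(q_h,\phi)+\omega_2(\theta_h,\phi)+\lambda_2(q_h,\phi)&=(\operatorname{Im}G_1,\phi),\\ (\partial_tq_h,\phi)-\lambda_1(H_h,\phi)-\omega_1(p_h,\phi)-\omega_2(\upsilon_h,\phi)-\lambda_2(p_h,\phi)&=-(\operatorname{Re}G_1,\phi),\\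 (\partial_t\upsilon_h,\phi)+\lambda_3(L_h,\phi)+\omega_2(q_h,\phi)+\omega_1(\theta_h,\phi)+\lambda_4(\theta_h,\phi)&=(\operatorname{Im}G_2,\phi),\\ (\partial_t\theta_h,\phi)-\lambda_3(E_h,\phi)-\omega_2(p_h,\phi)-\omega_1(\upsilon_h,\phi)-\lambda_4(\upsilon_h,\phi)&=-(\operatorname{Re}G_2,\phi), \end{aligned}$$ and, for each of $(q,s,r,e)=(q_h,s_h,r_h,T_h),\,(p_h,z_h,w_h,H_h),\,(\theta_h,\varpi_h,\rho_h,L_h),\,(\upsilon_h,\varrho_h,\xi_h,E_h)$, $$(e,\phi)=(\Delta_{(\alpha-2)/2}r,\phi),\quad (r,\phi)=-(s,\phi_x)+[s^+\phi]_{x_{k-1/2}}^{x_{k+1/2}},\quad (s,\phi)=-(q,\phi_x)+[q^-\phi]_{x_{k-1/2}}^{x_{k+1/2}}.$$ Here $w^\pm$ are the one-sided limits at the nodes of functions extended by zero (so $q^-=0$ at $a$ and $s^+=0$ at $b$), while $\phi,\phi_x$ are evaluated from inside $D^k$. The initial values are $p_h(0)=\mathcal P^-\operatorname{Re}u(\cdot,0)$,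 $q_h(0)=\mathcal P^-\operatorname{Im}u(\cdot,0)$, $\upsilon_h(0)=\mathcal P^-\operatorname{Re}v(\cdot,0)$, $\theta_h(0)=\mathcal P^-\operatorname{Im}v(\cdot,0)$, where $\mathcal P^-f\in V_h$ satisfies on each $D^k$ that $\mathcal P^-f-f$ is $L^2(D^k)$-orthogonal to the polynomials of degree at most $N-1$ and $(\mathcal P^-f)(x_{k+1/2}^-)=f(x_{k+1/2})$. **Theorem.** For each $N$ there is an integer $m$ such that for all $\alpha,a,b,T,\lambda_j,\omega_j$ as above and every $R$ there are $C>0$ and $h_0>0$ with the following property. If $(u,v)$ is an exact solution (for some $G_1,G_2$) with $u,v\in C^m(\mathbb R\times[0,T])$ and all derivatives up to order $m$ bounded by $R$, then for every mesh with $h\le h_0$ and every semidiscrete LDG solution $(u_h,v_h)$ as above, $$\|u(\cdot,T)-u_h(\cdot,T)\|_{L^2(a,b)}+\|v(\cdot,T)-v_h(\cdot,T)\|_{L^2(a,b)}\le C\,h^{N+1}.$$ -/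

import Mathlib

open MeasureTheory Set
open scoped Polynomial

namespace FracLDG

noncomputable section

/-! ### Fractional calculus on the real line -/

section Fractional

variable {E : Type*} [NormedAddCommGroup E] [NormedSpace ℝ E]

/-- Left Riemann-Liouville integral of order `μ > 0` with base point `-∞`. -/
def rlLeft (μ : ℝ) (f : ℝ → E) (x : ℝ) : E :=
  (Real.Gamma μ)⁻¹ • ∫ s in Iio x, (x - s) ^ (μ - 1) • f s

/-- Right Riemann-Liouville integral of order `μ > 0` with base point `+∞`. -/
def rlRight (μ : ℝ) (f : ℝ → E) (x : ℝ) : E :=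
  (Real.Gamma μ)⁻¹ • ∫ s in Ioi x, (s - x) ^ (μ - 1) • f s

/-- Left Caputo derivative of (non-integer) order `α`, with `n = ⌈α⌉`. -/
def caputoLeft (α : ℝ) (f : ℝ → E) (x : ℝ) : E :=
  rlLeft (⌈α⌉₊ - α) (iteratedDeriv ⌈α⌉₊ f) x

/-- Right Caputo derivative of (non-integer) order `α`, with `n = ⌈α⌉`. -/
def caputoRight (α : ℝ) (f : ℝ → E) (x : ℝ) : E :=
  (-1 : ℝ) ^ ⌈α⌉₊ • rlRight (⌈α⌉₊ - α) (iteratedDeriv ⌈α⌉₊ f) x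

/-- The Riesz fractional derivative `∂^α/∂|x|^α = -(-Δ)^(α/2)`. -/
def rieszDeriv (α : ℝ) (f : ℝ → E) (x : ℝ) : E :=
  (-(2 * Real.cos (Real.pi * α / 2))⁻¹) • (caputoLeft α f x + caputoRight α f x)

/-- The fractional integral operator `Δ_{-μ/2}`, for `0 < μ < 1`. -/
def fracInt (μ : ℝ) (f : ℝ → E) (x : ℝ) : E :=
  (2 * Real.cos (Real.pi * μ / 2))⁻¹ • (rlLeft μ f x + rlRight μ f x)

end Fractional

/-! ### Meshes and piecewise polynomials -/

/-- A partition `a = x_0 < x_1 < ⋯ < x_K = b` of `[a, b]`; the element number `k : Fin K` is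
`[x_k, x_{k+1}]`. -/
structure Mesh (a b : ℝ) where
  K : ℕ
  node : Fin (K + 1) → ℝ
  node_strictMono : StrictMono node
  node_zero : node 0 = a
  node_last : node (Fin.last K) = b

namespace Mesh

variable {a b : ℝ} (𝓜 : Mesh a b)

/-- Left endpoint of an element. -/
def left (k : Fin 𝓜.K) : ℝ := 𝓜.node k.castSucc

/-- Right endpoint of an element. -/
def right (k : Fin 𝓜.K) : ℝ := 𝓜.node k.succ

/-- The mesh size `h = max_k Δx_k`. -/
def size : ℝ := ⨆ k, (𝓜.right k - 𝓜.left k)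

/-- Piecewise polynomial functions: one polynomial for each element. -/
abbrev Piecewise : Type := Fin 𝓜.K → ℝ[X]

/-- The discontinuous finite element space: degree at most `N` on each element. -/
def space (N : ℕ) : Set 𝓜.Piecewise := {w | ∀ k, (w k).natDegree ≤ N}

/-- The function on the real line given by a piecewise polynomial, extended by zero outside `[a, b]`
(and set to zero at the finitely many nodes). -/
def toFun (w : 𝓜.Piecewise) (x : ℝ) : ℝ :=
  ∑ k, (Ioo (𝓜.left k) (𝓜.right k)).indicator (fun y => (w k).eval y) x

/-- Inner product `(f, g)` on the element number `k`. -/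
def inn (k : Fin 𝓜.K) (f g : ℝ → ℝ) : ℝ := ∫ x in 𝓜.left k..𝓜.right k, f x * g x

/-- The trace `w⁻` from the left at each node; zero at `a`, since functions vanish outside
`[a, b]`. -/
def traceMinus (w : 𝓜.Piecewise) : Fin (𝓜.K + 1) → ℝ :=
  Fin.cases 0 (fun k => (w k).eval (𝓜.right k))

/-- The trace `w⁺` from the right at each node; zero at `b`, since functions vanish outside
`[a, b]`. -/
def tracePlus (w : 𝓜.Piecewise) : Fin (𝓜.K + 1) → ℝ :=
  Fin.lastCases 0 (fun k => (w k).eval (𝓜.left k))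

/-- `(n · w^*, φ)` on the boundary of the element number `k`, for the numerical trace `F = w^*`. -/
def bdry (k : Fin 𝓜.K) (F : Fin (𝓜.K + 1) → ℝ) (φ : ℝ[X]) : ℝ :=
  F k.succ * φ.eval (𝓜.right k) - F k.castSucc * φ.eval (𝓜.left k)

/-- The LDG equations for the chain `s = ∂_x q`, `r = ∂_x s`, `e = Δ_{(α-2)/2} r`, with the
alternating numerical traces `q^* = q⁻`, `s^* = s⁺`. -/
structure FracChain (N : ℕ) (α : ℝ) (q s r e : 𝓜.Piecewise) : Prop where
  eq_e : ∀ k, ∀ β : ℝ[X], β.natDegree ≤ N →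
    𝓜.inn k (fun x => (e k).eval x) (fun x => β.eval x) =
      𝓜.inn k (fracInt (2 - α) (𝓜.toFun r)) (fun x => β.eval x)
  eq_r : ∀ k, ∀ φ : ℝ[X], φ.natDegree ≤ N →
    𝓜.inn k (fun x => (r k).eval x) (fun x => φ.eval x) =
      -𝓜.inn k (fun x => (s k).eval x) (fun x => φ.derivative.eval x)
        + 𝓜.bdry k (𝓜.tracePlus s) φ
  eq_s : ∀ k, ∀ φ : ℝ[X], φ.natDegree ≤ N →
    𝓜.inn k (fun x => (s k).eval x) (fun x => φ.eval x) =
      -𝓜.inn k (fun x => (q k).eval x) (fun x => φ.derivative.eval x)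
        + 𝓜.bdry k (𝓜.traceMinus q) φ

/-- `w = 𝒫⁻ f`: on each element `w - f` is orthogonal to the polynomials of degree `≤ N - 1`, and
`w = f` at the right endpoint. -/
structure IsProjMinus (N : ℕ) (f : ℝ → ℝ) (w : 𝓜.Piecewise) : Prop where
  mem : w ∈ 𝓜.space N
  orth : ∀ k, ∀ v : ℝ[X], v.degree < N →
    𝓜.inn k (fun x => (w k).eval x - f x) (fun x => v.eval x) = 0
  right_eq : ∀ k, (w k).eval (𝓜.right k) = f (𝓜.right k)

/-- The norm in `L²(Ω_h)` of a function given on each element. -/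
def l2Norm (f : Fin 𝓜.K → ℝ → ℂ) : ℝ :=
  Real.sqrt (∑ k, ∫ x in 𝓜.left k..𝓜.right k, ‖f k x‖ ^ 2)

end Mesh

/-! ### The coupled system and its semidiscrete LDG scheme -/

/-- Parameters of the linear coupled system. -/
structure Coeffs where
  (l1 l2 l3 l4 w1 w2 : ℝ)

/-- The unknowns of the semidiscrete scheme, as functions of time: `u_h = p + i q`,
`v_h = υ + i θ`, and the auxiliary variables of the four chains
`q ↦ (s, r, T)`, `p ↦ (z, w, H)`, `θ ↦ (ϖ, ρ, L)`, `υ ↦ (ϱ, ξ, E)`. -/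
structure Fields {a b : ℝ} (𝓜 : Mesh a b) where
  (p q s r T z w H υ θ ϖ ρ L ϱ ξ E : ℝ → 𝓜.Piecewise)

/-- All unknowns lie in the finite element space at time `t`. -/
def Fields.MemSpace {a b : ℝ} {𝓜 : Mesh a b} (F : Fields 𝓜) (N : ℕ) (t : ℝ) : Prop :=
  F.p t ∈ 𝓜.space N ∧ F.q t ∈ 𝓜.space N ∧ F.s t ∈ 𝓜.space N ∧ F.r t ∈ 𝓜.space N ∧
  F.T t ∈ 𝓜.space N ∧ F.z t ∈ 𝓜.space N ∧ F.w t ∈ 𝓜.space N ∧ F.H t ∈ 𝓜.space N ∧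
  F.υ t ∈ 𝓜.space N ∧ F.θ t ∈ 𝓜.space N ∧ F.ϖ t ∈ 𝓜.space N ∧ F.ρ t ∈ 𝓜.space N ∧
  F.L t ∈ 𝓜.space N ∧ F.ϱ t ∈ 𝓜.space N ∧ F.ξ t ∈ 𝓜.space N ∧ F.E t ∈ 𝓜.space N

/-- `w` is differentiable in time on `[0, τ]`. -/
def TimeDiff {a b : ℝ} {𝓜 : Mesh a b} (τ : ℝ) (w : ℝ → 𝓜.Piecewise) : Prop :=
  ∀ k, ∀ x, DifferentiableOn ℝ (fun t => (w t k).eval x) (Icc 0 τ)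

/-- The time derivative `∂w/∂t (·, t)` on the element number `k`. -/
def timeDeriv {a b : ℝ} {𝓜 : Mesh a b} (τ : ℝ) (w : ℝ → 𝓜.Piecewise) (t : ℝ) (k : Fin 𝓜.K)
    (x : ℝ) : ℝ :=
  derivWithin (fun σ => (w σ k).eval x) (Icc 0 τ) t

/-- `F` solves on `[0, τ]` the semidiscrete LDG scheme for
`i u_t - λ₁ (-Δ)^(α/2) u + ω₁ u + ω₂ v + λ₂ u = G₁`,
`i v_t - λ₃ (-Δ)^(α/2) v + ω₂ u + ω₁ v + λ₄ v = G₂`. -/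
structure IsLDGSolution {a b : ℝ} (𝓜 : Mesh a b) (N : ℕ) (α : ℝ) (c : Coeffs) (τ : ℝ)
    (G₁ G₂ : ℝ → ℝ → ℂ) (F : Fields 𝓜) : Prop where
  mem : ∀ t ∈ Icc 0 τ, F.MemSpace N t
  diff : TimeDiff τ F.p ∧ TimeDiff τ F.q ∧ TimeDiff τ F.υ ∧ TimeDiff τ F.θ
  eq_p : ∀ t ∈ Icc 0 τ, ∀ k, ∀ v : ℝ[X], v.natDegree ≤ N →
    𝓜.inn k (timeDeriv τ F.p t k) (fun x => v.eval x)
      + c.l1 * 𝓜.inn k (fun x => (F.T t k).eval x) (fun x => v.eval x)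
      + c.w1 * 𝓜.inn k (fun x => (F.q t k).eval x) (fun x => v.eval x)
      + c.w2 * 𝓜.inn k (fun x => (F.θ t k).eval x) (fun x => v.eval x)
      + c.l2 * 𝓜.inn k (fun x => (F.q t k).eval x) (fun x => v.eval x)
      = 𝓜.inn k (fun x => (G₁ x t).im) (fun x => v.eval x)
  chain_q : ∀ t ∈ Icc 0 τ, 𝓜.FracChain N α (F.q t) (F.s t) (F.r t) (F.T t)
  eq_q : ∀ t ∈ Icc 0 τ, ∀ k, ∀ v : ℝ[X], v.natDegree ≤ N →
    𝓜.inn k (timeDeriv τ F.q t k) (fun x => v.eval x)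
      - c.l1 * 𝓜.inn k (fun x => (F.H t k).eval x) (fun x => v.eval x)
      - c.w1 * 𝓜.inn k (fun x => (F.p t k).eval x) (fun x => v.eval x)
      - c.w2 * 𝓜.inn k (fun x => (F.υ t k).eval x) (fun x => v.eval x)
      - c.l2 * 𝓜.inn k (fun x => (F.p t k).eval x) (fun x => v.eval x)
      = -𝓜.inn k (fun x => (G₁ x t).re) (fun x => v.eval x)
  chain_p : ∀ t ∈ Icc 0 τ, 𝓜.FracChain N α (F.p t) (F.z t) (F.w t) (F.H t)
  eq_υ : ∀ t ∈ Icc 0 τ, ∀ k, ∀ v : ℝ[X], v.natDegree ≤ N →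
    𝓜.inn k (timeDeriv τ F.υ t k) (fun x => v.eval x)
      + c.l3 * 𝓜.inn k (fun x => (F.L t k).eval x) (fun x => v.eval x)
      + c.w2 * 𝓜.inn k (fun x => (F.q t k).eval x) (fun x => v.eval x)
      + c.w1 * 𝓜.inn k (fun x => (F.θ t k).eval x) (fun x => v.eval x)
      + c.l4 * 𝓜.inn k (fun x => (F.θ t k).eval x) (fun x => v.eval x)
      = 𝓜.inn k (fun x => (G₂ x t).im) (fun x => v.eval x)
  chain_θ : ∀ t ∈ Icc 0 τ, 𝓜.FracChain N α (F.θ t) (F.ϖ t) (F.ρ t) (F.L t)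
  eq_θ : ∀ t ∈ Icc 0 τ, ∀ k, ∀ v : ℝ[X], v.natDegree ≤ N →
    𝓜.inn k (timeDeriv τ F.θ t k) (fun x => v.eval x)
      - c.l3 * 𝓜.inn k (fun x => (F.E t k).eval x) (fun x => v.eval x)
      - c.w2 * 𝓜.inn k (fun x => (F.p t k).eval x) (fun x => v.eval x)
      - c.w1 * 𝓜.inn k (fun x => (F.υ t k).eval x) (fun x => v.eval x)
      - c.l4 * 𝓜.inn k (fun x => (F.υ t k).eval x) (fun x => v.eval x)
      = -𝓜.inn k (fun x => (G₂ x t).re) (fun x => v.eval x)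
  chain_υ : ∀ t ∈ Icc 0 τ, 𝓜.FracChain N α (F.υ t) (F.ϱ t) (F.ξ t) (F.E t)

/-- The initial values of the scheme are the projections `𝒫⁻` of the real and imaginary parts of
the exact initial values. -/
structure HasInitialData {a b : ℝ} (𝓜 : Mesh a b) (N : ℕ) (u₀ v₀ : ℝ → ℂ) (F : Fields 𝓜) :
    Prop where
  p : 𝓜.IsProjMinus N (fun x => (u₀ x).re) (F.p 0)
  q : 𝓜.IsProjMinus N (fun x => (u₀ x).im) (F.q 0)
  υ : 𝓜.IsProjMinus N (fun x => (v₀ x).re) (F.υ 0)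
  θ : 𝓜.IsProjMinus N (fun x => (v₀ x).im) (F.θ 0)

/-- `(u, v)` solves the linear coupled fractional Schrödinger system with sources `G₁`, `G₂` for
`x ∈ (a, b)`, `t ∈ [0, τ]`, with homogeneous boundary conditions `u = v = 0` outside `(a, b)`. -/
structure IsExactSolution (a b α : ℝ) (c : Coeffs) (τ : ℝ) (G₁ G₂ : ℝ → ℝ → ℂ)
    (u v : ℝ → ℝ → ℂ) : Prop where
  bdry : ∀ t ∈ Icc 0 τ, ∀ x, x ∉ Ioo a b → u x t = 0 ∧ v x t = 0
  eq_u : ∀ t ∈ Icc 0 τ, ∀ x ∈ Ioo a b,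
    Complex.I * derivWithin (fun σ => u x σ) (Icc 0 τ) t
      + c.l1 * rieszDeriv α (fun y => u y t) x
      + c.w1 * u x t + c.w2 * v x t + c.l2 * u x t = G₁ x t
  eq_v : ∀ t ∈ Icc 0 τ, ∀ x ∈ Ioo a b,
    Complex.I * derivWithin (fun σ => v x σ) (Icc 0 τ) t
      + c.l3 * rieszDeriv α (fun y => v y t) x
      + c.w2 * u x t + c.w1 * v x t + c.l4 * v x t = G₂ x t

/-- `u` is of class `C^m` on `ℝ × [0, τ]`, with all derivatives up to order `m` bounded by `R`. -/
def SmoothBound (m : ℕ) (R τ : ℝ) (u : ℝ → ℝ → ℂ) : Prop :=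
  ContDiffOn ℝ m (Function.uncurry u) (univ ×ˢ Icc 0 τ) ∧
    ∀ j ≤ m, ∀ z ∈ (univ : Set ℝ) ×ˢ Icc 0 τ,
      ‖iteratedFDerivWithin ℝ j (Function.uncurry u) (univ ×ˢ Icc 0 τ) z‖ ≤ R

/-- The error `‖u(·,t) - u_h(·,t)‖ + ‖v(·,t) - v_h(·,t)‖` in `L²(Ω_h)`. -/
def ldgError {a b : ℝ} (𝓜 : Mesh a b) (F : Fields 𝓜) (u v : ℝ → ℝ → ℂ) (t : ℝ) : ℝ :=
  𝓜.l2Norm (fun k x => u x t - (⟨(F.p t k).eval x, (F.q t k).eval x⟩ : ℂ))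
    + 𝓜.l2Norm (fun k x => v x t - (⟨(F.υ t k).eval x, (F.θ t k).eval x⟩ : ℂ))

end

end FracLDG

/-! On the finite element space the scheme is a real linear system of four ODEs driven by one
operator `A = c P D⁺ D⁻` (`rieszOp`). Here `D⁻` and `D⁺` (`Dm`, `Dp`) are the discrete derivatives
with the alternating traces, and `P` (`pot`) is the projected Riesz potential of order `μ = 2 - α`.
The traces are chosen so that `D⁺` is minus the adjoint of `D⁻` (`inner_Dm`), and `P` is symmetric.
The product `A` need not be symmetric in `L²`, but it is symmetric for the form `⟪D⁻ x, D⁻ y⟫`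
(`inner_Dm_rieszOp`). The Schrödinger structure then gives an energy estimate for `‖D⁻ e‖` in which
`A` leaves no trace (`energy_bound`), and a discrete Poincaré inequality (`exists_norm_le_Dm`)
returns to `L²`.

The error `e`, endpoint projection of the exact solution minus discrete solution, starts from zero
and solves the same system with a residual `r` (`isSystem_errors`). Bounding `D⁻ r` directly would
lose powers of `h`. Instead one writes `r = A y`. Where the dispersion coefficient is nonzero, `A y`
is absorbed into `A e` by shifting `e` by a multiple of `y` turned by a right angle; what remains
involves only `y` and its time derivative, so that the two quantities to bound are `‖D⁻ A⁻¹ r‖` and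
`‖D⁻ A⁻¹ ∂ₜr‖`. If a dispersion coefficient vanishes the corresponding residual is small in `L²`
itself, and a Duhamel argument settles the mixed case (`exists_stability`).

The function `X = D⁻ A⁻¹ r` solves `c P D⁺ X = r`. With `z = D⁺ X` one has that `-X` is the
left-endpoint projection of the tail primitive of `z`, so `‖X‖` is bounded by the `L²` norm of that
primitive (`exists_norm_le_Jb`). Two kinds of residual occur. If `P z` is the projection of the
potential of a function `g`, testing with `z` suffices (`exists_norm_le_of_pot_eq`). If `P z` is
merely of size `d_k^(N+1)` on the element of length `d_k`, then (`exists_norm_le_of_pot_small`) the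
full potential `I z` is split into `P z` and the part `f` lost by projection. The primitive of `z`
is controlled by `I z` in `L²` (`integral_Jb_sq_le_Ik`), while `‖f‖² ≤ C h^μ ⟨z, I z⟩` since `f` has
mean zero on each element (`exists_kerForm_le_size`). Finally `h^μ ⟨z, I z⟩` is `O(h^(2N+2))` by the
inverse inequality `∑ d_k^μ ‖z‖²_k ≤ C ⟨z, I z⟩` (`exists_inverse_kerForm`). All weights are local,
so meshes of any grading are allowed.

The facts about the quadratic form of `|x - s|^(μ-1)` come from writing this kernel as a
superposition of the kernels `exp(-t |x - s|)` with weight `t^(-μ)` (`kerForm_eq_integral_expForm`);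
each of these is a sum of squares of causal averages `L` with `L' + t L = f` (`expForm_eq`). The a
priori estimate `integral_Jb_sq_le_Ik` is of another nature: on a half line with power weights the
Riesz potential factors into one-sided fractional integrals (`integral_kp_weight_Im`). The weight is
removed by a commutator (`integral_Ip_sq_le`), left and right fractional integrals of order below
`1/2` are compared in `L²` (`integral_Im_sq_le`), and the estimates from the two ends of the
interval are glued. -/

namespace FracLDG

/-! ### Bounded measurable functions and Fubini arguments -/

/-- Lebesgue measure restricted to `(a, b]`. -/
noncomputable abbrev vol (a b : ℝ) : Measure ℝ := volume.restrict (Ioc a b)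

/-- Measurable functions that are bounded on `(a, b]`. -/
structure BM (a b : ℝ) (f : ℝ → ℝ) : Prop where
  meas : Measurable f
  bdd : ∃ M, ∀ x ∈ Ioc a b, |f x| ≤ M

theorem BM.exists_pos {a b : ℝ} {f : ℝ → ℝ} (h : BM a b f) :
    ∃ M, 0 < M ∧ ∀ x ∈ Ioc a b, |f x| ≤ M := by
  obtain ⟨M, hM⟩ := h.bdd
  exact ⟨max M 1, by positivity, fun x hx => (hM x hx).trans (le_max_left _ _)⟩

theorem ae_vol {a b : ℝ} {p : ℝ → Prop} (h : ∀ x ∈ Ioc a b, p x) : ∀ᵐ x ∂vol a b, p x :=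
  (ae_restrict_iff' measurableSet_Ioc).2 (Filter.Eventually.of_forall h)

theorem BM.integrable {a b : ℝ} {f : ℝ → ℝ} (h : BM a b f) : Integrable f (vol a b) := by
  obtain ⟨M, hM⟩ := h.bdd
  exact Integrable.of_bound h.meas.aestronglyMeasurable M (ae_vol hM)

theorem BM.mul {a b : ℝ} {f g : ℝ → ℝ} (hf : BM a b f) (hg : BM a b g) :
    BM a b (fun x => f x * g x) := by
  obtain ⟨M, hM0, hM⟩ := hf.exists_pos
  obtain ⟨M', hM'⟩ := hg.bdd
  refine ⟨hf.meas.mul hg.meas, M * M', fun x hx => ?_⟩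
  rw [abs_mul]
  exact mul_le_mul (hM x hx) (hM' x hx) (abs_nonneg _) hM0.le

theorem BM.add {a b : ℝ} {f g : ℝ → ℝ} (hf : BM a b f) (hg : BM a b g) :
    BM a b (fun x => f x + g x) := by
  obtain ⟨M, hM⟩ := hf.bdd
  obtain ⟨M', hM'⟩ := hg.bdd
  exact ⟨hf.meas.add hg.meas, M + M', fun x hx =>
    (abs_add_le _ _).trans (add_le_add (hM x hx) (hM' x hx))⟩

theorem BM.sub {a b : ℝ} {f g : ℝ → ℝ} (hf : BM a b f) (hg : BM a b g) :
    BM a b (fun x => f x - g x) := by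
  obtain ⟨M, hM⟩ := hf.bdd
  obtain ⟨M', hM'⟩ := hg.bdd
  exact ⟨hf.meas.sub hg.meas, M + M', fun x hx =>
    (abs_sub _ _).trans (add_le_add (hM x hx) (hM' x hx))⟩

theorem BM.const_mul {a b : ℝ} {f : ℝ → ℝ} (hf : BM a b f) (c : ℝ) :
    BM a b (fun x => c * f x) := by
  obtain ⟨M, hM⟩ := hf.bdd
  exact ⟨hf.meas.const_mul c, |c| * M, fun x hx => by
    rw [abs_mul]; exact mul_le_mul_of_nonneg_left (hM x hx) (abs_nonneg _)⟩

theorem BM.of_continuous {a b : ℝ} {f : ℝ → ℝ} (hf : Continuous f) : BM a b f := by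
  obtain ⟨M, hM⟩ := (isCompact_Icc (a := a) (b := b)).exists_bound_of_continuousOn hf.continuousOn
  exact ⟨hf.measurable, M, fun x hx => by simpa using hM x (Ioc_subset_Icc_self hx)⟩

/-- Integrability on a product from an integrable bound for the inner integrals. -/
theorem integrable_prod_of_bound {α β : Type*} [MeasurableSpace α] [MeasurableSpace β]
    {μ : Measure α} {ν : Measure β} [SFinite μ] [SFinite ν] {F : α → β → ℝ}
    (hm : Measurable (Function.uncurry F)) {H : α → ℝ} (hH : Integrable H μ)
    (h1 : ∀ᵐ x ∂μ, Integrable (F x) ν) (h2 : ∀ᵐ x ∂μ, ∫ y, |F x y| ∂ν ≤ H x) :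
    Integrable (Function.uncurry F) (μ.prod ν) := by
  rw [integrable_prod_iff hm.aestronglyMeasurable]
  refine ⟨h1, ?_⟩
  refine hH.mono ?_ ?_
  · exact (hm.norm.aestronglyMeasurable (μ := μ.prod ν)).integral_prod_right'
  · filter_upwards [h2] with x hx
    rw [Real.norm_of_nonneg (integral_nonneg fun y => norm_nonneg _)]
    exact hx.trans (le_abs_self _)

/-- The Gram identity for a pair of integral transforms. -/
theorem integral_mul_transform {ν ν' l : Measure ℝ} [SFinite ν] [SFinite ν'] [SFinite l]
    {f g : ℝ → ℝ} {G₁ G₂ : ℝ → ℝ → ℝ}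
    (h : Integrable (fun q : (ℝ × ℝ) × ℝ => f q.1.1 * g q.1.2 * (G₁ q.2 q.1.1 * G₂ q.2 q.1.2))
      ((ν.prod ν').prod l)) :
    ∫ y, (∫ x, G₁ y x * f x ∂ν) * (∫ x, G₂ y x * g x ∂ν') ∂l =
      ∫ p, f p.1 * g p.2 * (∫ y, G₁ y p.1 * G₂ y p.2 ∂l) ∂(ν.prod ν') := by
  have h1 := integral_integral_swap (f := fun (p : ℝ × ℝ) y =>
    f p.1 * g p.2 * (G₁ y p.1 * G₂ y p.2)) h
  simp only [integral_const_mul (_ * _)] at h1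
  rw [h1]
  congr 1
  ext y
  rw [← integral_prod_mul]
  congr 1
  ext p
  ring

theorem ae_vol_prod {a b c d : ℝ} {p : ℝ × ℝ → Prop} (h : ∀ x ∈ Ioc a b, ∀ y ∈ Ioc c d, p (x, y)) :
    ∀ᵐ q ∂(vol a b).prod (vol c d), p q := by
  rw [Measure.prod_restrict]
  exact (ae_restrict_iff' (measurableSet_Ioc.prod measurableSet_Ioc)).2
    (Filter.Eventually.of_forall fun q hq => h q.1 hq.1 q.2 hq.2)

theorem ae_vol_prod_ne {a b c d : ℝ} : ∀ᵐ q ∂(vol a b).prod (vol c d), q.1 ≠ q.2 := by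
  have : MeasurableSet {q : ℝ × ℝ | q.1 ≠ q.2} :=
    (measurableSet_eq_fun measurable_fst measurable_snd).compl
  rw [Measure.ae_prod_iff_ae_ae this]
  refine Filter.Eventually.of_forall fun x => ?_
  have : ∀ᵐ y ∂(vol c d), y ≠ x := ae_restrict_of_ae (Measure.ae_ne volume x)
  filter_upwards [this] with y hy using hy.symm

/-! ### Exponential kernels -/

/-- The causal exponential kernel. -/
noncomputable def expK (t y s : ℝ) : ℝ := if s ≤ y then Real.exp (-(t * (y - s))) else 0

/-- The causal exponential average of `f` over `(a, y]`. -/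
noncomputable def expL (a b t : ℝ) (f : ℝ → ℝ) (y : ℝ) : ℝ := ∫ s, expK t y s * f s ∂vol a b

/-- The quadratic form of the kernel `exp (-t |x - s|)`. -/
noncomputable def expForm (a b t : ℝ) (f : ℝ → ℝ) : ℝ :=
  ∫ p, f p.1 * f p.2 * Real.exp (-(t * |p.1 - p.2|)) ∂(vol a b).prod (vol a b)

theorem expK_nonneg (t y s : ℝ) : 0 ≤ expK t y s := by
  unfold expK; split_ifs <;> positivity

theorem expK_le_one {t : ℝ} (ht : 0 ≤ t) (y s : ℝ) : expK t y s ≤ 1 := by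
  unfold expK
  split_ifs with h
  · rw [Real.exp_le_one_iff]
    have := mul_nonneg ht (sub_nonneg.2 h)
    linarith
  · norm_num

theorem measurable_expK (t : ℝ) : Measurable (Function.uncurry (expK t)) := by
  unfold expK Function.uncurry
  refine Measurable.ite (measurableSet_le measurable_snd measurable_fst) ?_ measurable_const
  fun_prop

/-- The integrand lives on `y ≥ max x s`. The lower limit produces the symmetric kernel, the upper
limit the product of the two causal kernels at `b`: up to this rank-one term the symmetric kernel is
a Gram matrix of causal ones. -/
theorem integral_expK_mul {a b t x s : ℝ} (ht : 0 < t) (hx : x ∈ Ioc a b) (hs : s ∈ Ioc a b) :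
    2 * t * ∫ y, expK t y x * expK t y s ∂vol a b =
      Real.exp (-(t * |x - s|)) - expK t b x * expK t b s := by
  set m := max x s with hm
  have hma : a < m := lt_max_of_lt_left hx.1
  have hmb : m ≤ b := max_le hx.2 hs.2
  have h1 : ∫ y, expK t y x * expK t y s ∂vol a b =
      ∫ y in Icc m b, Real.exp (-(t * (2 * y - x - s))) := by
    have : ∀ y, expK t y x * expK t y s =
        (Ici m).indicator (fun y => Real.exp (-(t * (2 * y - x - s)))) y := by
      intro y
      unfold expK
      by_cases h : m ≤ y
      · rw [indicator_of_mem (by exact h), if_pos ((le_max_left _ _).trans h),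
          if_pos ((le_max_right _ _).trans h), ← Real.exp_add]
        congr 1; ring
      · rw [indicator_of_notMem (by exact h)]
        rw [hm, max_le_iff, not_and_or] at h
        rcases h with h | h <;> simp [h]
    simp_rw [this]
    rw [integral_indicator measurableSet_Ici, vol, Measure.restrict_restrict measurableSet_Ici]
    congr 2
    ext y
    simp only [mem_inter_iff, mem_Ici, mem_Ioc, mem_Icc]
    constructor
    · rintro ⟨h, -, h'⟩; exact ⟨h, h'⟩
    · rintro ⟨h, h'⟩; exact ⟨h, hma.trans_le h, h'⟩
  have h2 : ∫ y in Icc m b, Real.exp (-(t * (2 * y - x - s))) =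
      (-Real.exp (-(t * (2 * b - x - s))) / (2 * t)) - (-Real.exp (-(t * (2 * m - x - s))) / (2 * t)) := by
    rw [integral_Icc_eq_integral_Ioc, ← intervalIntegral.integral_of_le hmb]
    refine intervalIntegral.integral_eq_sub_of_hasDerivAt (f := fun y =>
      -Real.exp (-(t * (2 * y - x - s))) / (2 * t)) (fun y _ => ?_)
      (Continuous.intervalIntegrable (by fun_prop) _ _)
    have h3 : HasDerivAt (fun y => -(t * (2 * y - x - s))) (-(t * 2)) y := by
      have := ((((hasDerivAt_id y).const_mul 2).sub_const x).sub_const s).const_mul t |>.neg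
      exact this.congr_deriv (by ring)
    have := (h3.exp.neg).div_const (2 * t)
    refine this.congr_deriv ?_
    field_simp
  have h4 : expK t b x * expK t b s = Real.exp (-(t * (2 * b - x - s))) := by
    unfold expK
    rw [if_pos hx.2, if_pos hs.2, ← Real.exp_add]
    congr 1; ring
  have h5 : 2 * m - x - s = |x - s| := by
    rw [hm]
    rcases le_total x s with h | h
    · rw [max_eq_right h, abs_of_nonpos (by linarith)]; ring
    · rw [max_eq_left h, abs_of_nonneg (by linarith)]; ring
  rw [h1, h2, h4, h5]
  field_simp
  ring

theorem BM.expL {a b t : ℝ} (ht : 0 ≤ t) {f : ℝ → ℝ} (hf : BM a b f) :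
    BM a b (FracLDG.expL a b t f) := by
  obtain ⟨M, hM0, hM⟩ := hf.exists_pos
  refine ⟨?_, ∫ s, |f s| ∂vol a b, fun x hx => ?_⟩
  · have : StronglyMeasurable (Function.uncurry fun y s => expK t y s * f s) :=
      ((measurable_expK t).mul (hf.meas.comp measurable_snd)).stronglyMeasurable
    exact (this.integral_prod_right (ν := vol a b)).measurable
  · refine (abs_integral_le_integral_abs).trans ?_
    refine integral_mono_of_nonneg (Filter.Eventually.of_forall fun s => abs_nonneg _)
      hf.integrable.abs (Filter.Eventually.of_forall fun s => ?_)
    simp only [abs_mul, abs_of_nonneg (expK_nonneg t x s)]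
    exact mul_le_of_le_one_left (abs_nonneg _) (expK_le_one ht _ _)

theorem integrable_prod_of_BM {a b : ℝ} {f : ℝ → ℝ} (hf : BM a b f) :
    Integrable (fun p : ℝ × ℝ => f p.1 * f p.2) ((vol a b).prod (vol a b)) :=
  hf.integrable.mul_prod hf.integrable

/-- The Gram identity turns the form into a sum of squares of the causal average of `f`. This is the
source of positivity and of every upper and lower bound for the Riesz form below. -/
theorem expForm_eq {a b t : ℝ} (ht : 0 < t) {f : ℝ → ℝ} (hf : BM a b f) :
    expForm a b t f = 2 * t * ∫ y, expL a b t f y ^ 2 ∂vol a b + expL a b t f b ^ 2 := by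
  have hi : Integrable (fun q : (ℝ × ℝ) × ℝ => f q.1.1 * f q.1.2 *
      (expK t q.2 q.1.1 * expK t q.2 q.1.2)) (((vol a b).prod (vol a b)).prod (vol a b)) := by
    have h1 : Integrable (fun q : (ℝ × ℝ) × ℝ => f q.1.1 * f q.1.2)
        (((vol a b).prod (vol a b)).prod (vol a b)) := (integrable_prod_of_BM hf).comp_fst _
    refine h1.mul_bdd (c := 1) ?_ (Filter.Eventually.of_forall fun q => ?_)
    · have := measurable_expK t
      have e1 : Measurable fun q : (ℝ × ℝ) × ℝ => expK t q.2 q.1.1 :=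
        this.comp (measurable_snd.prodMk measurable_fst.fst)
      have e2 : Measurable fun q : (ℝ × ℝ) × ℝ => expK t q.2 q.1.2 :=
        this.comp (measurable_snd.prodMk measurable_fst.snd)
      exact (e1.mul e2).aestronglyMeasurable
    · rw [Real.norm_of_nonneg (mul_nonneg (expK_nonneg _ _ _) (expK_nonneg _ _ _))]
      exact mul_le_one₀ (expK_le_one ht.le _ _) (expK_nonneg _ _ _) (expK_le_one ht.le _ _)
  have h1 := integral_mul_transform hi
  have h2 : ∫ y, expL a b t f y ^ 2 ∂vol a b =
      ∫ p, f p.1 * f p.2 * (∫ y, expK t y p.1 * expK t y p.2 ∂vol a b)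
        ∂(vol a b).prod (vol a b) := by
    rw [← h1]; congr 1; ext y; rw [sq]; rfl
  have h3 : expL a b t f b ^ 2 = ∫ p, f p.1 * f p.2 * (expK t b p.1 * expK t b p.2)
        ∂(vol a b).prod (vol a b) := by
    rw [sq, expL, ← integral_prod_mul]; congr 1; ext y; ring
  have h4 : Integrable (fun p : ℝ × ℝ => f p.1 * f p.2 * (expK t b p.1 * expK t b p.2))
      ((vol a b).prod (vol a b)) := by
    have hb : BM a b fun s => expK t b s * f s := by
      obtain ⟨M, hM0, hM⟩ := hf.exists_pos
      refine ⟨((measurable_expK t).comp (measurable_const.prodMk measurable_id)).mul hf.meas, M,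
        fun x hx => ?_⟩
      rw [abs_mul, abs_of_nonneg (expK_nonneg t _ _)]
      exact (mul_le_of_le_one_left (abs_nonneg _) (expK_le_one ht.le _ _)).trans (hM x hx)
    refine (integrable_prod_of_BM hb).congr (Filter.Eventually.of_forall fun p => ?_)
    simp only; ring
  rw [h2, h3, ← integral_const_mul, expForm, ← integral_add _ h4]
  · refine integral_congr_ae ?_
    refine ae_vol_prod fun x hx s hs => ?_
    have := integral_expK_mul ht hx hs
    simp only
    linear_combination (-f x * f s) * this
  · exact (hi.integral_prod_left.const_mul (2 * t)).congr (Filter.Eventually.of_forall fun p => by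
      simp only [integral_const_mul])

/-! ### Power kernels -/

/-- The one-sided power kernel `(x - y)_+^(p-1)`. -/
noncomputable def kp (p x y : ℝ) : ℝ := if y < x then (x - y) ^ (p - 1) else 0

theorem kp_nonneg (p x y : ℝ) : 0 ≤ kp p x y := by
  unfold kp; split_ifs with h
  · exact Real.rpow_nonneg (sub_nonneg.2 h.le) _
  · rfl

theorem measurable_kp (p : ℝ) : Measurable (Function.uncurry (kp p)) := by
  unfold kp Function.uncurry
  refine Measurable.ite (measurableSet_lt measurable_snd measurable_fst) ?_ measurable_const
  exact (measurable_fst.sub measurable_snd).pow_const _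

theorem measurable_kp_left (p x : ℝ) : Measurable (kp p x) :=
  (measurable_kp p).comp (measurable_const.prodMk measurable_id)

theorem measurable_kp_right (p y : ℝ) : Measurable (fun x => kp p x y) :=
  (measurable_kp p).comp (measurable_id.prodMk measurable_const)

theorem abs_rpow_eq_kp {p x s : ℝ} (h : x ≠ s) : |x - s| ^ (p - 1) = kp p x s + kp p s x := by
  unfold kp
  rcases lt_or_gt_of_ne h with h | h
  · rw [if_neg (not_lt.2 h.le), if_pos h, abs_of_neg (by linarith), neg_sub, zero_add]
  · rw [if_pos h, if_neg (not_lt.2 h.le), abs_of_pos (by linarith), add_zero]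

theorem kp_integrable_left {a b p x : ℝ} (hp : 0 < p) (hx : x ∈ Icc a b) :
    Integrable (kp p x) (vol a b) ∧ ∫ y, kp p x y ∂vol a b = (x - a) ^ p / p := by
  have e : kp p x = (Iio x).indicator (fun y => (x - y) ^ (p - 1)) := by
    ext y
    unfold kp
    by_cases h : y < x
    · rw [indicator_of_mem (by exact h), if_pos h]
    · rw [indicator_of_notMem (by exact h), if_neg h]
  have e2 : (Iio x ∩ Ioc a b : Set ℝ) = Ioo a x := by
    ext y; simp only [mem_inter_iff, mem_Iio, mem_Ioc, mem_Ioo]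
    constructor
    · rintro ⟨h, h', -⟩; exact ⟨h', h⟩
    · rintro ⟨h, h'⟩; exact ⟨h', h, (h'.trans_le hx.2).le⟩
  have h1 : IntervalIntegrable (fun y => y ^ (p - 1)) volume 0 (x - a) :=
    intervalIntegral.intervalIntegrable_rpow' (by linarith)
  have h2 : IntervalIntegrable (fun y => (x - y) ^ (p - 1)) volume a x := by
    have := (h1.comp_sub_left x).symm
    simpa using this
  rw [intervalIntegrable_iff_integrableOn_Ioo_of_le hx.1] at h2
  rw [e]
  constructor
  · rw [integrable_indicator_iff measurableSet_Iio, IntegrableOn, vol,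
      Measure.restrict_restrict measurableSet_Iio, e2]
    exact h2
  · rw [integral_indicator measurableSet_Iio, vol, Measure.restrict_restrict measurableSet_Iio, e2,
      ← integral_Ioc_eq_integral_Ioo, ← intervalIntegral.integral_of_le hx.1,
      intervalIntegral.integral_comp_sub_left (fun y => y ^ (p - 1)), sub_self,
      integral_rpow (Or.inl (by linarith))]
    simp [Real.zero_rpow hp.ne']

theorem kp_integrable_right {a b p y : ℝ} (hp : 0 < p) (hy : y ∈ Icc a b) :
    Integrable (fun x => kp p x y) (vol a b) ∧ ∫ x, kp p x y ∂vol a b = (b - y) ^ p / p := by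
  have e : (fun x => kp p x y) = (Ioi y).indicator (fun x => (x - y) ^ (p - 1)) := by
    ext x
    unfold kp
    by_cases h : y < x
    · rw [indicator_of_mem (by exact h), if_pos h]
    · rw [indicator_of_notMem (by exact h), if_neg h]
  have e2 : (Ioi y ∩ Ioc a b : Set ℝ) = Ioc y b := by
    ext x; simp only [mem_inter_iff, mem_Ioi, mem_Ioc]
    constructor
    · rintro ⟨h, -, h'⟩; exact ⟨h, h'⟩
    · rintro ⟨h, h'⟩; exact ⟨h, hy.1.trans_lt h, h'⟩
  have h1 : IntervalIntegrable (fun y => y ^ (p - 1)) volume 0 (b - y) :=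
    intervalIntegral.intervalIntegrable_rpow' (by linarith)
  have h2 : IntervalIntegrable (fun x => (x - y) ^ (p - 1)) volume y b := by
    have := (h1.comp_sub_right y)
    simpa using this
  rw [intervalIntegrable_iff_integrableOn_Ioc_of_le hy.2] at h2
  rw [e]
  constructor
  · rw [integrable_indicator_iff measurableSet_Ioi, IntegrableOn, vol,
      Measure.restrict_restrict measurableSet_Ioi, e2]
    exact h2
  · rw [integral_indicator measurableSet_Ioi, vol, Measure.restrict_restrict measurableSet_Ioi, e2,
      ← intervalIntegral.integral_of_le hy.2,
      intervalIntegral.integral_comp_sub_right (fun y => y ^ (p - 1)), sub_self,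
      integral_rpow (Or.inl (by linarith))]
    simp [Real.zero_rpow hp.ne']

theorem integrable_abs_rpow {a b p x : ℝ} (hp : 0 < p) (hx : x ∈ Icc a b) :
    Integrable (fun s => |x - s| ^ (p - 1)) (vol a b) ∧
      ∫ s, |x - s| ^ (p - 1) ∂vol a b ≤ 2 * (b - a) ^ p / p := by
  have e : (fun s => |x - s| ^ (p - 1)) =ᵐ[vol a b] fun s => kp p x s + kp p s x := by
    filter_upwards [ae_restrict_of_ae (Measure.ae_ne volume x)] with s hs
    exact abs_rpow_eq_kp (Ne.symm hs)
  obtain ⟨i1, v1⟩ := kp_integrable_left hp hx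
  obtain ⟨i2, v2⟩ := kp_integrable_right hp hx
  refine ⟨(i1.add i2).congr e.symm, ?_⟩
  rw [integral_congr_ae e, integral_add i1 i2, v1, v2, ← add_div]
  have h1 : (x - a) ^ p ≤ (b - a) ^ p :=
    Real.rpow_le_rpow (by linarith [hx.1]) (by linarith [hx.2]) hp.le
  have h2 : (b - x) ^ p ≤ (b - a) ^ p :=
    Real.rpow_le_rpow (by linarith [hx.2]) (by linarith [hx.1]) hp.le
  gcongr
  linarith

/-- Integral against a kernel with uniformly bounded row integrals. -/
theorem BM.transform {a b C : ℝ} {K : ℝ → ℝ → ℝ} (hK : Measurable (Function.uncurry K))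
    (h0 : ∀ x s, 0 ≤ K x s) (hi : ∀ x ∈ Ioc a b, Integrable (K x) (vol a b))
    (hC : ∀ x ∈ Ioc a b, ∫ s, K x s ∂vol a b ≤ C) {f : ℝ → ℝ} (hf : BM a b f) :
    BM a b (fun x => ∫ s, K x s * f s ∂vol a b) := by
  obtain ⟨M, hM0, hM⟩ := hf.exists_pos
  refine ⟨?_, C * M, fun x hx => ?_⟩
  · have : StronglyMeasurable (Function.uncurry fun y s => K y s * f s) :=
      (hK.mul (hf.meas.comp measurable_snd)).stronglyMeasurable
    exact (this.integral_prod_right (ν := vol a b)).measurable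
  · refine abs_integral_le_integral_abs.trans ?_
    calc ∫ s, |K x s * f s| ∂vol a b ≤ ∫ s, K x s * M ∂vol a b := by
          refine integral_mono_of_nonneg (Filter.Eventually.of_forall fun s => abs_nonneg _)
            ((hi x hx).mul_const M) (ae_vol fun s hs => ?_)
          simp only [abs_mul, abs_of_nonneg (h0 x s)]
          exact mul_le_mul_of_nonneg_left (hM s hs) (h0 x s)
      _ ≤ C * M := by
          rw [integral_mul_const]
          exact mul_le_mul_of_nonneg_right (hC x hx) hM0.le

theorem integrable_transform {a b : ℝ} {k : ℝ → ℝ} (hi : Integrable k (vol a b)) {f : ℝ → ℝ}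
    (hf : BM a b f) : Integrable (fun s => k s * f s) (vol a b) := by
  obtain ⟨M, hM⟩ := hf.bdd
  exact hi.mul_bdd (c := M) hf.meas.aestronglyMeasurable (ae_vol hM)

/-- The symmetric Riesz kernel operator `f ↦ ∫ |x - s|^(μ-1) f(s) ds`. -/
noncomputable def Ik (μ a b : ℝ) (f : ℝ → ℝ) (x : ℝ) : ℝ := ∫ s, |x - s| ^ (μ - 1) * f s ∂vol a b

theorem measurable_abs_rpow (r : ℝ) :
    Measurable (Function.uncurry fun x s : ℝ => |x - s| ^ r) := by
  unfold Function.uncurry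
  exact ((measurable_fst.sub measurable_snd).abs).pow_const _

theorem BM.Ik {μ a b : ℝ} (hμ : 0 < μ) {f : ℝ → ℝ} (hf : BM a b f) :
    BM a b (FracLDG.Ik μ a b f) :=
  BM.transform (K := fun x s => |x - s| ^ (μ - 1)) (measurable_abs_rpow _)
    (fun _ _ => Real.rpow_nonneg (abs_nonneg _) _)
    (fun _ hx => (integrable_abs_rpow hμ (Ioc_subset_Icc_self hx)).1)
    (fun _ hx => (integrable_abs_rpow hμ (Ioc_subset_Icc_self hx)).2) hf

theorem integrable_abs_rpow_prod {μ a b : ℝ} (hμ : 0 < μ) :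
    Integrable (fun p : ℝ × ℝ => |p.1 - p.2| ^ (μ - 1)) ((vol a b).prod (vol a b)) := by
  refine integrable_prod_of_bound (F := fun x s : ℝ => |x - s| ^ (μ - 1)) (measurable_abs_rpow _)
    (H := fun _ => 2 * (b - a) ^ μ / μ) (integrable_const _)
    (ae_vol fun x hx => (integrable_abs_rpow hμ (Ioc_subset_Icc_self hx)).1)
    (ae_vol fun x hx => ?_)
  simp only [abs_of_nonneg (Real.rpow_nonneg (abs_nonneg _) _)]
  exact (integrable_abs_rpow hμ (Ioc_subset_Icc_self hx)).2

/-- The bilinear form of the Riesz kernel. -/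
noncomputable def kerForm (μ a b : ℝ) (f g : ℝ → ℝ) : ℝ :=
  ∫ p, f p.1 * g p.2 * |p.1 - p.2| ^ (μ - 1) ∂(vol a b).prod (vol a b)

theorem integrable_kerForm {μ a b : ℝ} (hμ : 0 < μ) {f g : ℝ → ℝ} (hf : BM a b f)
    (hg : BM a b g) : Integrable (fun p : ℝ × ℝ => f p.1 * g p.2 * |p.1 - p.2| ^ (μ - 1))
      ((vol a b).prod (vol a b)) := by
  obtain ⟨M, hM0, hM⟩ := hf.exists_pos
  obtain ⟨M', hM0', hM'⟩ := hg.exists_pos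
  refine (integrable_abs_rpow_prod hμ).bdd_mul (c := M * M') ?_ (ae_vol_prod fun x hx y hy => ?_)
  · exact ((hf.meas.comp measurable_fst).mul (hg.meas.comp measurable_snd)).aestronglyMeasurable
  · rw [Real.norm_eq_abs, abs_mul]
    exact mul_le_mul (hM x hx) (hM' y hy) (abs_nonneg _) hM0.le

theorem integral_mul_Ik {μ a b : ℝ} (hμ : 0 < μ) {f g : ℝ → ℝ} (hf : BM a b f) (hg : BM a b g) :
    ∫ x, f x * Ik μ a b g x ∂vol a b = kerForm μ a b f g := by
  rw [kerForm, integral_prod _ (integrable_kerForm hμ hf hg)]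
  congr 1
  ext x
  rw [Ik, ← integral_const_mul]
  congr 1
  ext s
  ring

theorem kerForm_comm (μ a b : ℝ) (f g : ℝ → ℝ) : kerForm μ a b f g = kerForm μ a b g f := by
  rw [kerForm, ← integral_prod_swap]
  refine integral_congr_ae (Filter.Eventually.of_forall fun p => ?_)
  simp only [Prod.fst_swap, Prod.snd_swap]
  rw [abs_sub_comm]; ring

theorem kerForm_add_smul {μ a b : ℝ} (hμ : 0 < μ) {f g h : ℝ → ℝ} (hf : BM a b f) (hg : BM a b g)
    (hh : BM a b h) (c : ℝ) :
    kerForm μ a b (fun x => f x + c * g x) h = kerForm μ a b f h + c * kerForm μ a b g h := by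
  rw [kerForm, kerForm, kerForm, ← integral_const_mul,
    ← integral_add (integrable_kerForm hμ hf hh) ((integrable_kerForm hμ hg hh).const_mul c)]
  congr 1
  ext p
  ring

theorem measurable_expForm_integrand {f : ℝ → ℝ} (hf : Measurable f) (μ : ℝ) :
    Measurable (Function.uncurry fun (p : ℝ × ℝ) (t : ℝ) =>
      t ^ (-μ) * (f p.1 * f p.2 * Real.exp (-(t * |p.1 - p.2|)))) := by
  unfold Function.uncurry
  have h1 : Measurable fun q : (ℝ × ℝ) × ℝ => f q.1.1 := hf.comp measurable_fst.fst
  have h2 : Measurable fun q : (ℝ × ℝ) × ℝ => f q.1.2 := hf.comp measurable_fst.snd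
  have h3 : Measurable fun q : (ℝ × ℝ) × ℝ => q.2 ^ (-μ) := measurable_snd.pow_const _
  have h4 : Measurable fun q : (ℝ × ℝ) × ℝ => Real.exp (-(q.2 * |q.1.1 - q.1.2|)) := by fun_prop
  exact h3.mul ((h1.mul h2).mul h4)

/-- The Riesz kernel as a superposition of exponential kernels. -/
theorem kerForm_eq_integral_expForm {μ a b : ℝ} (hμ : 0 < μ) (hμ1 : μ < 1) {f : ℝ → ℝ}
    (hf : BM a b f) :
    IntegrableOn (fun t => t ^ (-μ) * expForm a b t f) (Ioi 0) ∧
      Real.Gamma (1 - μ) * kerForm μ a b f f = ∫ t in Ioi 0, t ^ (-μ) * expForm a b t f := by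
  set F : ℝ × ℝ → ℝ → ℝ := fun p t =>
    t ^ (-μ) * (f p.1 * f p.2 * Real.exp (-(t * |p.1 - p.2|))) with hF
  have hval : ∀ d : ℝ, 0 < d → IntegrableOn (fun t => t ^ (-μ) * Real.exp (-(t * d))) (Ioi 0) ∧
      ∫ t in Ioi (0 : ℝ), t ^ (-μ) * Real.exp (-(t * d)) = Real.Gamma (1 - μ) * d ^ (μ - 1) := by
    intro d hd
    have h := Real.integral_rpow_mul_exp_neg_mul_Ioi (a := 1 - μ) (r := d) (by linarith) hd
    have e : ∀ t : ℝ, t ^ (1 - μ - 1) * Real.exp (-(d * t)) = t ^ (-μ) * Real.exp (-(t * d)) := by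
      intro t; rw [mul_comm d t]; congr 2; ring
    simp_rw [e] at h
    have h2 : (1 / d) ^ (1 - μ) = d ^ (μ - 1) := by
      rw [one_div, Real.inv_rpow hd.le, ← Real.rpow_neg hd.le]; congr 1; ring
    rw [h2] at h
    refine ⟨?_, by rw [h, mul_comm]⟩
    -- A non-integrable function has integral `0` by convention, while the value just computed is
    -- positive, so integrability comes for free.
    by_contra hc
    rw [integral_undef hc] at h
    have : 0 < d ^ (μ - 1) * Real.Gamma (1 - μ) :=
      mul_pos (Real.rpow_pos_of_pos hd _) (Real.Gamma_pos_of_pos (by linarith))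
    linarith
  have hint : Integrable (Function.uncurry F)
      (((vol a b).prod (vol a b)).prod (volume.restrict (Ioi 0))) := by
    -- The inner integral of the absolute value is the Gamma integral again, so the dominating
    -- function is the Riesz integrand itself.
    refine integrable_prod_of_bound (measurable_expForm_integrand hf.meas μ)
      (H := fun p => Real.Gamma (1 - μ) * |f p.1 * f p.2 * |p.1 - p.2| ^ (μ - 1)|)
      ((integrable_kerForm hμ hf hf).abs.const_mul _) ?_ ?_
    · filter_upwards [ae_vol_prod_ne] with p hp
      have := (hval _ (abs_pos.2 (sub_ne_zero.2 hp))).1.const_mul (f p.1 * f p.2)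
      refine this.congr (Filter.Eventually.of_forall fun t => ?_)
      simp only [hF]; ring
    · filter_upwards [ae_vol_prod_ne] with p hp
      have h1 := hval _ (abs_pos.2 (sub_ne_zero.2 hp))
      have h2 : ∫ t in Ioi 0, |F p t| = ∫ t in Ioi 0, |f p.1 * f p.2| *
          (t ^ (-μ) * Real.exp (-(t * |p.1 - p.2|))) := by
        refine setIntegral_congr_fun measurableSet_Ioi fun t ht => ?_
        have : 0 < t := ht
        simp only [hF, abs_mul, abs_of_pos (Real.rpow_pos_of_pos this _), Real.abs_exp]
        ring
      rw [h2, integral_const_mul, h1.2, abs_mul (f p.1 * f p.2),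
        abs_of_nonneg (Real.rpow_nonneg (abs_nonneg (p.1 - p.2)) (μ - 1))]
      apply le_of_eq; ring
  have hsw := integral_integral_swap hint
  have e1 : ∀ t, ∫ p, F p t ∂(vol a b).prod (vol a b) = t ^ (-μ) * expForm a b t f := by
    intro t; simp only [hF, integral_const_mul, expForm]
  constructor
  · have := hint.integral_prod_right
    exact this.congr (Filter.Eventually.of_forall e1)
  · simp only [e1] at hsw
    rw [← hsw, kerForm, ← integral_const_mul]
    refine integral_congr_ae ?_
    filter_upwards [ae_vol_prod_ne] with p hp
    rw [mul_left_comm, ← (hval _ (abs_pos.2 (sub_ne_zero.2 hp))).2, ← integral_const_mul]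
    congr 1
    ext t
    simp only [hF]; ring

theorem expForm_nonneg {a b t : ℝ} (ht : 0 < t) {f : ℝ → ℝ} (hf : BM a b f) :
    0 ≤ expForm a b t f := by
  rw [expForm_eq ht hf]
  have : 0 ≤ ∫ y, expL a b t f y ^ 2 ∂vol a b := integral_nonneg fun y => sq_nonneg _
  positivity

theorem kerForm_self_nonneg {μ a b : ℝ} (hμ : 0 < μ) (hμ1 : μ < 1) {f : ℝ → ℝ}
    (hf : BM a b f) : 0 ≤ kerForm μ a b f f := by
  have h := (kerForm_eq_integral_expForm hμ hμ1 hf).2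
  have h2 : 0 ≤ ∫ t in Ioi 0, t ^ (-μ) * expForm a b t f :=
    setIntegral_nonneg measurableSet_Ioi fun t ht =>
      mul_nonneg (Real.rpow_nonneg (le_of_lt ht) _) (expForm_nonneg ht hf)
  have := Real.Gamma_pos_of_pos (show 0 < 1 - μ by linarith)
  rw [← h] at h2
  exact nonneg_of_mul_nonneg_right h2 this

/-- Cauchy–Schwarz for a positive semidefinite form: the quadratic polynomial `c ↦ kerForm (f + c
g)` has nonpositive discriminant. -/
theorem kerForm_sq_le {μ a b : ℝ} (hμ : 0 < μ) (hμ1 : μ < 1) {f g : ℝ → ℝ}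
    (hf : BM a b f) (hg : BM a b g) :
    kerForm μ a b f g ^ 2 ≤ kerForm μ a b f f * kerForm μ a b g g := by
  have key : ∀ c : ℝ, 0 ≤ kerForm μ a b g g * (c * c) + 2 * kerForm μ a b f g * c +
      kerForm μ a b f f := by
    intro c
    have h := kerForm_self_nonneg hμ hμ1 (hf.add (hg.const_mul c))
    rw [kerForm_add_smul hμ hf hg (hf.add (hg.const_mul c)), kerForm_comm μ a b f,
      kerForm_comm μ a b g, kerForm_add_smul hμ hf hg hf, kerForm_add_smul hμ hf hg hg,
      kerForm_comm μ a b g f] at h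
    linarith
  have := discrim_le_zero key
  rw [discrim] at this
  nlinarith

/-! ### Primitives and two-sided bounds for the Riesz form -/

theorem BM.intervalIntegrable {a b x y : ℝ} {f : ℝ → ℝ} (hf : BM a b f) (hx : x ∈ Icc a b)
    (hy : y ∈ Icc a b) : IntervalIntegrable f volume x y := by
  rw [intervalIntegrable_iff]
  refine IntegrableOn.mono_set (t := Ioc a b) hf.integrable ?_
  intro z hz
  rw [mem_uIoc] at hz
  rcases hz with h | h
  · exact ⟨hx.1.trans_lt h.1, h.2.trans hy.2⟩
  · exact ⟨hy.1.trans_lt h.1, h.2.trans hx.2⟩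

theorem BM.mono {a b c d : ℝ} {f : ℝ → ℝ} (hf : BM a b f) (h : Ioc c d ⊆ Ioc a b) : BM c d f :=
  ⟨hf.meas, by obtain ⟨M, hM⟩ := hf.bdd; exact ⟨M, fun x hx => hM x (h hx)⟩⟩

theorem BM.sq_integrable {a b : ℝ} {f : ℝ → ℝ} (hf : BM a b f) :
    Integrable (fun x => f x ^ 2) (vol a b) := by
  simpa [sq] using (hf.mul hf).integrable

theorem integral_expK_fst {a x t s : ℝ} (ht : 0 < t) (hs : a < s) :
    t * ∫ y, expK t y s ∂vol a x = if s ≤ x then 1 - Real.exp (-(t * (x - s))) else 0 := by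
  have e : (fun y => expK t y s) = (Ici s).indicator (fun y => Real.exp (-(t * (y - s)))) := by
    ext y
    unfold expK
    by_cases h : s ≤ y
    · rw [indicator_of_mem (by exact h), if_pos h]
    · rw [indicator_of_notMem (by exact h), if_neg h]
  have e2 : (Ici s ∩ Ioc a x : Set ℝ) = Icc s x := by
    ext y; simp only [mem_inter_iff, mem_Ici, mem_Ioc, mem_Icc]
    constructor
    · rintro ⟨h, -, h'⟩; exact ⟨h, h'⟩
    · rintro ⟨h, h'⟩; exact ⟨h, hs.trans_le h, h'⟩
  rw [e, integral_indicator measurableSet_Ici, vol, Measure.restrict_restrict measurableSet_Ici, e2]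
  split_ifs with h
  · rw [integral_Icc_eq_integral_Ioc, ← intervalIntegral.integral_of_le h,
      intervalIntegral.integral_eq_sub_of_hasDerivAt (f := fun y =>
      -Real.exp (-(t * (y - s))) / t) (fun y _ => ?_)
      (Continuous.intervalIntegrable (by fun_prop) _ _)]
    · simp only [sub_self, mul_zero, neg_zero, Real.exp_zero]
      field_simp
      ring
    · have h3 : HasDerivAt (fun y => -(t * (y - s))) (-t) y := by
        have := ((hasDerivAt_id y).sub_const s).const_mul t |>.neg
        exact this.congr_deriv (by ring)
      refine ((h3.exp.neg).div_const t).congr_deriv ?_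
      field_simp
  · rw [Icc_eq_empty h]; simp

theorem integral_expK_snd_le {a b x t : ℝ} (ht : 0 < t) (hx : x ∈ Ioc a b) :
    t * ∫ s, expK t x s ∂vol a b ≤ 1 := by
  have e : (fun s => expK t x s) = (Iic x).indicator (fun s => Real.exp (-(t * (x - s)))) := by
    ext y
    unfold expK
    by_cases h : y ≤ x
    · rw [indicator_of_mem (by exact h), if_pos h]
    · rw [indicator_of_notMem (by exact h), if_neg h]
  have e2 : (Iic x ∩ Ioc a b : Set ℝ) = Ioc a x := by
    ext y; simp only [mem_inter_iff, mem_Iic, mem_Ioc]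
    constructor
    · rintro ⟨h, h', -⟩; exact ⟨h', h⟩
    · rintro ⟨h, h'⟩; exact ⟨h', h, h'.trans hx.2⟩
  rw [e, integral_indicator measurableSet_Iic, vol, Measure.restrict_restrict measurableSet_Iic, e2]
  rw [← intervalIntegral.integral_of_le hx.1.le,
      intervalIntegral.integral_eq_sub_of_hasDerivAt (f := fun y =>
      Real.exp (-(t * (x - y))) / t) (fun y _ => ?_)
      (Continuous.intervalIntegrable (by fun_prop) _ _)]
  · simp only [sub_self, mul_zero, neg_zero, Real.exp_zero]
    have := Real.exp_pos (-(t * (x - a)))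
    rw [mul_sub, mul_div_cancel₀ _ ht.ne', mul_div_cancel₀ _ ht.ne']
    linarith
  · have h3 : HasDerivAt (fun y => -(t * (x - y))) t y := by
      have := ((hasDerivAt_id y).const_sub x).const_mul t |>.neg
      exact this.congr_deriv (by ring)
    refine (h3.exp.div_const t).congr_deriv ?_
    field_simp

theorem integrable_expK_prod {a b c d t : ℝ} (ht : 0 < t) {f : ℝ → ℝ} (hf : BM a b f) :
    Integrable (Function.uncurry fun y s => expK t y s * f s) ((vol c d).prod (vol a b)) := by
  have h1 : Integrable (fun q : ℝ × ℝ => f q.2) ((vol c d).prod (vol a b)) := hf.integrable.comp_snd _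
  refine (h1.bdd_mul (c := 1) (measurable_expK t).aestronglyMeasurable
    (Filter.Eventually.of_forall fun q => ?_))
  rw [Real.norm_of_nonneg (expK_nonneg _ _ _)]
  exact expK_le_one ht.le _ _

/-- A primitive of `f` in terms of its exponential average. -/
theorem integral_eq_expL {a b t x : ℝ} (ht : 0 < t) {f : ℝ → ℝ} (hf : BM a b f)
    (hx : x ∈ Icc a b) :
    ∫ s in a..x, f s = expL a b t f x + t * ∫ y in a..x, expL a b t f y := by
  -- By Fubini; the lemma is the integrated form of `L' + t L = f`, `L(a) = 0`, stated without
  -- differentiating since `f` is only bounded and measurable.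
  have h1 : t * ∫ y in a..x, expL a b t f y =
      ∫ s, (if s ≤ x then 1 - Real.exp (-(t * (x - s))) else 0) * f s ∂vol a b := by
    rw [intervalIntegral.integral_of_le hx.1]
    change t * ∫ y, (∫ s, expK t y s * f s ∂vol a b) ∂vol a x = _
    rw [integral_integral_swap (integrable_expK_prod ht hf), ← integral_const_mul]
    refine integral_congr_ae (ae_vol fun s hs => ?_)
    simp only [integral_mul_const]
    rw [← mul_assoc, integral_expK_fst ht hs.1]
  have h2 : ∫ s in a..x, f s = ∫ s, (if s ≤ x then f s else 0) ∂vol a b := by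
    rw [intervalIntegral.integral_of_le hx.1]
    have : (fun s => if s ≤ x then f s else 0) = (Iic x).indicator f := by
      ext s; simp [indicator]
    rw [this, integral_indicator measurableSet_Iic, vol, Measure.restrict_restrict measurableSet_Iic]
    congr 2
    ext y; simp only [mem_inter_iff, mem_Iic, mem_Ioc]
    constructor
    · rintro ⟨h, h'⟩; exact ⟨h', h, h'.trans hx.2⟩
    · rintro ⟨h, h', -⟩; exact ⟨h', h⟩
  have i1 : Integrable (fun s => expK t x s * f s) (vol a b) := by
    refine hf.integrable.bdd_mul (c := 1) ((measurable_expK t).comp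
      (measurable_const.prodMk measurable_id)).aestronglyMeasurable
      (Filter.Eventually.of_forall fun q => ?_)
    rw [Real.norm_of_nonneg (expK_nonneg _ _ _)]
    exact expK_le_one ht.le _ _
  have i2 : Integrable (fun s => if s ≤ x then f s else 0) (vol a b) := by
    have : (fun s => if s ≤ x then f s else 0) = (Iic x).indicator f := by
      ext s; simp [indicator]
    rw [this]
    exact hf.integrable.indicator measurableSet_Iic
  have h3 : ∫ s, (if s ≤ x then 1 - Real.exp (-(t * (x - s))) else 0) * f s ∂vol a b =
      ∫ s, (if s ≤ x then f s else 0) ∂vol a b - expL a b t f x := by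
    rw [expL, ← integral_sub i2 i1]
    congr 1
    ext s
    unfold expK
    split_ifs <;> ring
  rw [h1, h2, h3]; ring

theorem sq_integral_le {a b x y : ℝ} {f : ℝ → ℝ} (hf : BM a b f) (hx : x ∈ Icc a b)
    (hy : y ∈ Icc a b) (hxy : x ≤ y) :
    (∫ s in x..y, f s) ^ 2 ≤ (y - x) * ∫ s in x..y, f s ^ 2 := by
  have i1 := hf.intervalIntegrable hx hy
  have i2 : IntervalIntegrable (fun s => f s ^ 2) volume x y := by
    simpa [sq] using (hf.mul hf).intervalIntegrable hx hy
  rcases hxy.eq_or_lt with rfl | hlt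
  · simp
  -- Cauchy–Schwarz obtained as nonnegativity of the variance of `f` about its mean `m`.
  set m := (∫ s in x..y, f s) / (y - x)
  have h0 : 0 ≤ ∫ s in x..y, (f s - m) ^ 2 :=
    intervalIntegral.integral_nonneg hxy fun s _ => sq_nonneg _
  have h1 : ∫ s in x..y, (f s - m) ^ 2 =
      (∫ s in x..y, f s ^ 2) - 2 * m * (∫ s in x..y, f s) + m ^ 2 * (y - x) := by
    have : ∀ s, (f s - m) ^ 2 = f s ^ 2 - 2 * m * f s + m ^ 2 := fun s => by ring
    simp_rw [this]
    rw [intervalIntegral.integral_add (i2.sub (i1.const_mul _)) intervalIntegrable_const,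
      intervalIntegral.integral_sub i2 (i1.const_mul _), intervalIntegral.integral_const_mul,
      intervalIntegral.integral_const, smul_eq_mul]
    ring
  have hm : m * (y - x) = ∫ s in x..y, f s := div_mul_cancel₀ _ (sub_pos.2 hlt).ne'
  rw [h1] at h0
  have hpos := sub_pos.2 hlt
  rw [← hm] at h0 ⊢
  nlinarith [mul_nonneg hpos.le h0]

theorem integral_sq_mono {a b x y : ℝ} {f : ℝ → ℝ} (hf : BM a b f) (hx : x ∈ Icc a b)
    (hy : y ∈ Icc a b) (hxy : x ≤ y) : ∫ s in x..y, f s ^ 2 ≤ ∫ s, f s ^ 2 ∂vol a b := by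
  rw [intervalIntegral.integral_of_le hxy]
  refine setIntegral_mono_set hf.sq_integrable (ae_vol fun s _ => sq_nonneg _)
    (Filter.Eventually.of_forall ?_)
  intro s hs
  exact ⟨hx.1.trans_lt hs.1, hs.2.trans hy.2⟩

/-- The tail integral `∫_x^b f`. -/
noncomputable def Jb (b : ℝ) (f : ℝ → ℝ) (x : ℝ) : ℝ := ∫ s in x..b, f s

theorem continuousOn_primitive {a b : ℝ} {f : ℝ → ℝ} (hf : BM a b f) (hab : a ≤ b) :
    ContinuousOn (fun x => ∫ s in a..x, f s) (Icc a b) := by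
  have := intervalIntegral.continuousOn_primitive_interval (μ := volume) (a := a) (b := b) (f := f)
    (by rw [uIcc_of_le hab, integrableOn_Icc_iff_integrableOn_Ioc]; exact hf.integrable)
  rwa [uIcc_of_le hab] at this

/-- Subtracting the relation `∫ f = L + t ∫ L` at `x` from that at `b` gives the tail integral as
`L(b) - L(x) + t ∫_x^b L`. The square of three terms costs a factor `3`, and `t ≤ 2` makes the last
coefficient `3 · 4`. -/
theorem Jb_sq_le_expForm {a b t : ℝ} (hab : a ≤ b) (ht : 1 ≤ t) (ht2 : t ≤ 2) {f : ℝ → ℝ}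
    (hf : BM a b f) {x : ℝ} (hx : x ∈ Icc a b) :
    Jb b f x ^ 2 ≤ 3 * expL a b t f b ^ 2 + 3 * expL a b t f x ^ 2 +
      12 * (b - a) * ∫ y, expL a b t f y ^ 2 ∂vol a b := by
  have ht0 : 0 < t := by linarith
  have hL := hf.expL ht0.le
  have ha : a ∈ Icc a b := ⟨le_rfl, hab⟩
  have hb : b ∈ Icc a b := ⟨hab, le_rfl⟩
  have e1 := integral_eq_expL ht0 hf hb
  have e2 := integral_eq_expL ht0 hf hx
  have e3 := intervalIntegral.integral_add_adjacent_intervals (hf.intervalIntegrable ha hx)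
    (hf.intervalIntegrable hx hb)
  have e4 := intervalIntegral.integral_add_adjacent_intervals (hL.intervalIntegrable ha hx)
    (hL.intervalIntegrable hx hb)
  have e5 : Jb b f x = expL a b t f b - expL a b t f x + t * ∫ y in x..b, expL a b t f y := by
    unfold Jb
    have : t * ∫ y in a..b, expL a b t f y =
        t * (∫ y in a..x, expL a b t f y) + t * ∫ y in x..b, expL a b t f y := by
      rw [← e4]; ring
    linarith
  have h6 := sq_integral_le hL hx hb hx.2
  have h7 := integral_sq_mono hL hx hb hx.2
  set I := ∫ y in x..b, expL a b t f y
  set A := ∫ y, expL a b t f y ^ 2 ∂vol a b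
  set A' := ∫ y in x..b, expL a b t f y ^ 2
  have h8 : I ^ 2 ≤ (b - a) * A := by
    have hA' : 0 ≤ A' := intervalIntegral.integral_nonneg hx.2 fun y _ => sq_nonneg _
    calc I ^ 2 ≤ (b - x) * A' := h6
      _ ≤ (b - a) * A := mul_le_mul (by linarith [hx.1]) h7 hA' (by linarith)
  have h9 : t ^ 2 * I ^ 2 ≤ 4 * ((b - a) * A) :=
    mul_le_mul (by nlinarith) h8 (sq_nonneg _) (by norm_num)
  rw [e5]
  nlinarith [sq_nonneg (expL a b t f b + expL a b t f x), sq_nonneg (expL a b t f b - t * I),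
    sq_nonneg (expL a b t f x + t * I)]

theorem continuousOn_Jb {a b : ℝ} {f : ℝ → ℝ} (hf : BM a b f) (hab : a ≤ b) :
    ContinuousOn (Jb b f) (Icc a b) := by
  have h := (continuousOn_const (c := ∫ s in a..b, f s)).sub (continuousOn_primitive hf hab)
  refine h.congr fun x hx => ?_
  have := intervalIntegral.integral_add_adjacent_intervals
    (hf.intervalIntegrable ⟨le_rfl, hab⟩ hx) (hf.intervalIntegrable hx ⟨hab, le_rfl⟩)
  simp only [Jb, Pi.sub_apply]
  linarith

theorem integrable_sq_of_continuousOn {a b : ℝ} {f : ℝ → ℝ} (hf : ContinuousOn f (Icc a b)) :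
    Integrable (fun x => f x ^ 2) (vol a b) :=
  ((hf.pow 2).integrableOn_Icc).mono_set Ioc_subset_Icc_self

/-- The Riesz form controls the `L²` norm of a primitive. -/
theorem integral_Jb_sq_le {μ a b : ℝ} (hμ : 0 < μ) (hμ1 : μ < 1) (hab : a ≤ b) :
    ∃ C, 0 < C ∧ ∀ f, BM a b f → ∫ x, Jb b f x ^ 2 ∂vol a b ≤ C * kerForm μ a b f f := by
  have hΓ := Real.Gamma_pos_of_pos (show 0 < 1 - μ by linarith)
  set C1 : ℝ := 3 * (b - a) + 3 + 12 * (b - a) ^ 2 with hC1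
  have hba : 0 ≤ b - a := sub_nonneg.2 hab
  have hC1p : 0 < C1 := by positivity
  refine ⟨2 * C1 * Real.Gamma (1 - μ), by positivity, fun f hf => ?_⟩
  set S := ∫ x, Jb b f x ^ 2 ∂vol a b with hS
  obtain ⟨hi, hk⟩ := kerForm_eq_integral_expForm hμ hμ1 hf
  -- Frequencies in `(1, 2]` already control the primitive. All others are discarded later, their
  -- contribution being nonnegative.
  have h1 : ∀ t ∈ Ioc (1 : ℝ) 2, S ≤ C1 * expForm a b t f := by
    intro t ht
    have ht0 : 0 < t := by linarith [ht.1]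
    have hL := (hf.expL ht0.le).sq_integrable
    have hfin : IsFiniteMeasure (vol a b) := inferInstance
    rw [expForm_eq ht0 hf]
    set A := ∫ y, expL a b t f y ^ 2 ∂vol a b with hA
    set B := expL a b t f b ^ 2 with hB
    have hA0 : 0 ≤ A := integral_nonneg fun y => sq_nonneg _
    have hB0 : 0 ≤ B := sq_nonneg _
    have h2 : S ≤ ∫ x, ((3 * B + 12 * (b - a) * A) + 3 * expL a b t f x ^ 2) ∂vol a b := by
      refine integral_mono_ae (integrable_sq_of_continuousOn (continuousOn_Jb hf hab))
        ((integrable_const _).add (hL.const_mul 3)) (ae_vol fun x hx => ?_)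
      have := Jb_sq_le_expForm hab ht.1.le ht.2 hf (Ioc_subset_Icc_self hx)
      simp only
      linarith
    have h3 : ∫ x, ((3 * B + 12 * (b - a) * A) + 3 * expL a b t f x ^ 2) ∂vol a b =
        (b - a) * (3 * B + 12 * (b - a) * A) + 3 * A := by
      rw [integral_add (integrable_const _) (hL.const_mul 3), integral_const_mul, integral_const]
      simp [measureReal_def, hba]
      rfl
    rw [h3] at h2
    refine h2.trans ?_
    have e1 : 3 * (b - a) * B ≤ C1 * B := by
      refine mul_le_mul_of_nonneg_right ?_ hB0
      rw [hC1]; nlinarith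
    have e2 : (3 + 12 * (b - a) ^ 2) * A ≤ C1 * (2 * t * A) := by
      have : (3 + 12 * (b - a) ^ 2) ≤ C1 * (2 * t) := by
        have h5 : (3 + 12 * (b - a) ^ 2) ≤ C1 := by rw [hC1]; linarith
        nlinarith [ht.1]
      nlinarith
    nlinarith
  have h2 : S / (2 * C1) ≤ ∫ t in Ioc (1 : ℝ) 2, t ^ (-μ) * expForm a b t f := by
    have : ∫ t in Ioc (1 : ℝ) 2, S / (2 * C1) = S / (2 * C1) := by
      simp [measureReal_def]; norm_num
    rw [← this]
    refine setIntegral_mono_on (by simp) (hi.mono_set fun t ht => ?_) measurableSet_Ioc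
      fun t ht => ?_
    · exact lt_trans zero_lt_one ht.1
    · have ht0 : (0 : ℝ) < t := by linarith [ht.1]
      -- On `(1, 2]` the weight is at least `2 ^ (-1)` because `μ < 1`.
      have h5 : (1 / 2 : ℝ) ≤ t ^ (-μ) := by
        calc (1 / 2 : ℝ) = (2 : ℝ) ^ (-1 : ℝ) := by rw [Real.rpow_neg_one]; norm_num
          _ ≤ t ^ (-1 : ℝ) := Real.rpow_le_rpow_of_nonpos ht0 ht.2 (by norm_num)
          _ ≤ t ^ (-μ) := Real.rpow_le_rpow_of_exponent_le ht.1.le (by linarith)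
      have h6 := h1 t ht
      have h7 := expForm_nonneg ht0 hf
      calc S / (2 * C1) ≤ (C1 * expForm a b t f) / (2 * C1) := by gcongr
        _ = 1 / 2 * expForm a b t f := by field_simp
        _ ≤ _ := mul_le_mul_of_nonneg_right h5 h7
  have h3 : ∫ t in Ioc (1 : ℝ) 2, t ^ (-μ) * expForm a b t f ≤
      ∫ t in Ioi (0 : ℝ), t ^ (-μ) * expForm a b t f := by
    refine setIntegral_mono_set hi ?_ (Filter.Eventually.of_forall fun t ht => ?_)
    · refine (ae_restrict_iff' measurableSet_Ioi).2 (Filter.Eventually.of_forall fun t ht => ?_)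
      exact mul_nonneg (Real.rpow_nonneg (le_of_lt ht) _) (expForm_nonneg ht hf)
    · exact lt_trans zero_lt_one ht.1
  rw [← hk] at h3
  have h4 := h2.trans h3
  rw [div_le_iff₀ (by positivity)] at h4
  linarith

/-- A Schur argument: `f(x) f(s)` is at most the mean of the squares, and the mass of `exp(-t |x -
s|)` in one variable is at most `2 / t`. The bound is the efficient one for high frequencies. -/
theorem expForm_le_of_large {a b t : ℝ} (ht : 0 < t) {f : ℝ → ℝ} (hf : BM a b f) :
    t * expForm a b t f ≤ 2 * ∫ x, f x ^ 2 ∂vol a b := by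
  have hk : Integrable (Function.uncurry fun y s => expK t y s * f s ^ 2)
      ((vol a b).prod (vol a b)) := by
    have : BM a b fun s => f s ^ 2 := by simpa [sq] using hf.mul hf
    exact integrable_expK_prod ht this
  have hk' : Integrable (fun p : ℝ × ℝ => expK t p.2 p.1 * f p.1 ^ 2)
      ((vol a b).prod (vol a b)) := hk.swap
  have hk2 : Integrable (fun p : ℝ × ℝ => expK t p.1 p.2 * f p.1 ^ 2)
      ((vol a b).prod (vol a b)) := by
    have h1 : Integrable (fun q : ℝ × ℝ => f q.1 ^ 2) ((vol a b).prod (vol a b)) :=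
      hf.sq_integrable.comp_fst _
    refine h1.bdd_mul (c := 1) (measurable_expK t).aestronglyMeasurable
      (Filter.Eventually.of_forall fun q => ?_)
    rw [Real.norm_of_nonneg (expK_nonneg _ _ _)]
    exact expK_le_one ht.le _ _
  have hS0 : 0 ≤ ∫ x, f x ^ 2 ∂vol a b := integral_nonneg fun x => sq_nonneg _
  have v1 : t * ∫ p, expK t p.2 p.1 * f p.1 ^ 2 ∂(vol a b).prod (vol a b) ≤
      ∫ x, f x ^ 2 ∂vol a b := by
    rw [integral_prod _ hk', ← integral_const_mul]
    refine integral_mono_ae (hk'.integral_prod_left.const_mul t) hf.sq_integrable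
      (ae_vol fun x hx => ?_)
    simp only [integral_mul_const]
    rw [← mul_assoc, integral_expK_fst ht hx.1, if_pos hx.2]
    have := Real.exp_pos (-(t * (b - x)))
    nlinarith [sq_nonneg (f x)]
  have v2 : t * ∫ p, expK t p.1 p.2 * f p.1 ^ 2 ∂(vol a b).prod (vol a b) ≤
      ∫ x, f x ^ 2 ∂vol a b := by
    rw [integral_prod _ hk2, ← integral_const_mul]
    refine integral_mono_ae (hk2.integral_prod_left.const_mul t) hf.sq_integrable
      (ae_vol fun x hx => ?_)
    simp only [integral_mul_const]
    rw [← mul_assoc]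
    exact mul_le_of_le_one_left (sq_nonneg _) (integral_expK_snd_le ht hx)
  -- The symmetric kernel is dominated by the sum of the two causal kernels; the two differ on the
  -- diagonal only.
  set E : ℝ × ℝ → ℝ := fun p => expK t p.1 p.2 + expK t p.2 p.1 with hE
  have hEp : ∀ p : ℝ × ℝ, Real.exp (-(t * |p.1 - p.2|)) ≤ E p := by
    intro p
    simp only [hE, expK]
    rcases le_total p.1 p.2 with h | h
    · rw [if_pos h, abs_of_nonpos (by linarith), neg_sub]
      split_ifs <;> simp [Real.exp_nonneg]
    · rw [if_pos h, abs_of_nonneg (by linarith)]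
      split_ifs <;> simp [Real.exp_nonneg]
  have hsum : Integrable (fun p : ℝ × ℝ => E p * f p.1 ^ 2) ((vol a b).prod (vol a b)) := by
    refine (hk2.add hk').congr (Filter.Eventually.of_forall fun p => ?_)
    simp only [hE, Pi.add_apply]; ring
  have hsum' : Integrable (fun p : ℝ × ℝ => E p * f p.2 ^ 2) ((vol a b).prod (vol a b)) := by
    refine hsum.swap.congr (Filter.Eventually.of_forall fun p => ?_)
    simp only [hE, Function.comp, Prod.fst_swap, Prod.snd_swap]; ring
  have hval : ∫ p, E p * f p.1 ^ 2 ∂(vol a b).prod (vol a b) =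
      ∫ p, expK t p.1 p.2 * f p.1 ^ 2 ∂(vol a b).prod (vol a b) +
      ∫ p, expK t p.2 p.1 * f p.1 ^ 2 ∂(vol a b).prod (vol a b) := by
    rw [← integral_add hk2 hk']
    congr 1; ext p; simp only [hE]; ring
  have hval' : ∫ p, E p * f p.2 ^ 2 ∂(vol a b).prod (vol a b) =
      ∫ p, E p * f p.1 ^ 2 ∂(vol a b).prod (vol a b) := by
    rw [← integral_prod_swap]
    congr 1; ext p; simp only [hE, Prod.fst_swap, Prod.snd_swap]; ring
  have hle : expForm a b t f ≤ ∫ p, (1 / 2 * (E p * f p.1 ^ 2) + 1 / 2 * (E p * f p.2 ^ 2))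
      ∂(vol a b).prod (vol a b) := by
    have hl : Integrable (fun p : ℝ × ℝ => f p.1 * f p.2 * Real.exp (-(t * |p.1 - p.2|)))
        ((vol a b).prod (vol a b)) := by
      refine (integrable_prod_of_BM hf).mul_bdd (c := 1)
        (Continuous.aestronglyMeasurable (by fun_prop)) (Filter.Eventually.of_forall fun p => ?_)
      rw [Real.norm_of_nonneg (Real.exp_nonneg _), Real.exp_le_one_iff]
      have := mul_nonneg ht.le (abs_nonneg (p.1 - p.2))
      linarith
    refine integral_mono hl ((hsum.const_mul _).add (hsum'.const_mul _)) fun p => ?_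
    have h0 := Real.exp_nonneg (-(t * |p.1 - p.2|))
    have h1 := hEp p
    simp only
    have h2 : f p.1 * f p.2 ≤ 1 / 2 * (f p.1 ^ 2 + f p.2 ^ 2) := by
      nlinarith [sq_nonneg (f p.1 - f p.2)]
    calc f p.1 * f p.2 * Real.exp (-(t * |p.1 - p.2|))
        ≤ 1 / 2 * (f p.1 ^ 2 + f p.2 ^ 2) * Real.exp (-(t * |p.1 - p.2|)) :=
          mul_le_mul_of_nonneg_right h2 h0
      _ ≤ 1 / 2 * (f p.1 ^ 2 + f p.2 ^ 2) * E p := mul_le_mul_of_nonneg_left h1 (by positivity)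
      _ = _ := by ring
  rw [integral_add (hsum.const_mul _) (hsum'.const_mul _), integral_const_mul, integral_const_mul,
    hval', hval] at hle
  nlinarith

/-- The primitive is `F = L + t Λ` with `Λ' = L`, so `∫ F² = ∫ L² + t Λ(b)² + t² ∫ Λ²`. The
condition `F(b) = 0` identifies the endpoint term `L(b)²` of the form with `t² Λ(b)²`, which the
middle term covers. The bound is the efficient one for low frequencies. -/
theorem expForm_le_of_primitive {a b t : ℝ} (hab : a ≤ b) (ht : 0 < t) {f : ℝ → ℝ}
    (hf : BM a b f) (h0 : ∫ s in a..b, f s = 0) :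
    expForm a b t f ≤ 2 * t * ∫ x, (∫ s in a..x, f s) ^ 2 ∂vol a b := by
  have hL := hf.expL ht.le
  have hb : b ∈ Icc a b := ⟨hab, le_rfl⟩
  have ha : a ∈ Icc a b := ⟨le_rfl, hab⟩
  set L := expL a b t f with hLdef
  set Λ : ℝ → ℝ := fun x => ∫ y in a..x, L y with hΛ
  have hΛc : ContinuousOn Λ (Icc a b) := continuousOn_primitive hL hab
  have hFc := continuousOn_primitive hf hab
  have hF : ∀ x ∈ Icc a b, ∫ s in a..x, f s = L x + t * Λ x := fun x hx => integral_eq_expL ht hf hx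
  have hLc : ContinuousOn L (Icc a b) := by
    refine (hFc.sub (hΛc.const_smul t)).congr fun x hx => ?_
    have := hF x hx
    simp only [Pi.sub_apply, Pi.smul_apply, smul_eq_mul]
    linarith
  have hder : ∀ x ∈ Ioo a b, HasDerivAt Λ (L x) x := fun x hx =>
    intervalIntegral.integral_hasDerivAt_right (hL.intervalIntegrable ha (Ioo_subset_Icc_self hx))
      (hL.meas.stronglyMeasurable.stronglyMeasurableAtFilter)
      (hLc.continuousAt (Icc_mem_nhds hx.1 hx.2))
  have h1 : ∫ x, 2 * (L x * Λ x) ∂vol a b = Λ b ^ 2 := by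
    rw [← intervalIntegral.integral_of_le hab,
      intervalIntegral.integral_eq_sub_of_hasDerivAt_of_le hab (f := fun x => Λ x ^ 2) (hΛc.pow 2)
        (fun x hx => ?_)]
    · simp [hΛ]
    · have := ((hLc.mul hΛc).const_smul (2 : ℝ))
      refine ContinuousOn.intervalIntegrable ?_
      rw [uIcc_of_le hab]
      exact this
    · refine ((hder x hx).pow 2).congr_deriv ?_
      simp; ring
  have iL := hL.sq_integrable
  have iΛ := integrable_sq_of_continuousOn hΛc
  have iLΛ : Integrable (fun x => 2 * (L x * Λ x)) (vol a b) :=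
    (((hLc.mul hΛc).const_smul (2 : ℝ)).integrableOn_Icc).mono_set Ioc_subset_Icc_self
  have iS : Integrable (fun x => L x ^ 2 + t * (2 * (L x * Λ x))) (vol a b) :=
    iL.add (iLΛ.const_mul t)
  have h2 : ∫ x, (∫ s in a..x, f s) ^ 2 ∂vol a b =
      ∫ x, L x ^ 2 ∂vol a b + t * Λ b ^ 2 + t ^ 2 * ∫ x, Λ x ^ 2 ∂vol a b := by
    rw [← h1, ← integral_const_mul, ← integral_const_mul, ← integral_add iL (iLΛ.const_mul t),
      ← integral_add iS (iΛ.const_mul _)]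
    refine integral_congr_ae (ae_vol fun x hx => ?_)
    simp only [hF x (Ioc_subset_Icc_self hx)]
    ring
  have h3 : L b = -(t * Λ b) := by
    have := hF b hb
    rw [h0] at this
    linarith
  have h4 : 0 ≤ ∫ x, Λ x ^ 2 ∂vol a b := integral_nonneg fun x => sq_nonneg _
  rw [expForm_eq ht hf, h2, ← hLdef, h3]
  have h5 : 0 ≤ t ^ 3 * ∫ x, Λ x ^ 2 ∂vol a b := mul_nonneg (by positivity) h4
  nlinarith [sq_nonneg (t * Λ b)]

/-- The Riesz form gains a factor `h^μ` on functions whose primitive is of relative size `h`. -/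
theorem kerForm_le_of_primitive {μ a b h : ℝ} (hμ : 0 < μ) (hμ1 : μ < 1) (hab : a ≤ b)
    (hh : 0 < h) {f : ℝ → ℝ} (hf : BM a b f) (h0 : ∫ s in a..b, f s = 0)
    (hF : ∫ x, (∫ s in a..x, f s) ^ 2 ∂vol a b ≤ h ^ 2 * ∫ x, f x ^ 2 ∂vol a b) :
    kerForm μ a b f f ≤
      (2 / (2 - μ) + 2 / μ) / Real.Gamma (1 - μ) * h ^ μ * ∫ x, f x ^ 2 ∂vol a b := by
  obtain ⟨hi, hk⟩ := kerForm_eq_integral_expForm hμ hμ1 hf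
  set S := ∫ x, f x ^ 2 ∂vol a b with hS
  have hS0 : 0 ≤ S := integral_nonneg fun x => sq_nonneg _
  have hΓ := Real.Gamma_pos_of_pos (show 0 < 1 - μ by linarith)
  have hh' : 0 < 1 / h := by positivity
  -- The frequencies are cut at `1 / h`. Below, the primitive bound gives `t ^ (1 - μ) h²`; above,
  -- the trivial bound gives `t ^ (-μ - 1)`. Both integrate to a multiple of `h ^ μ`.
  have hsplit : ∫ t in Ioi (0 : ℝ), t ^ (-μ) * expForm a b t f =
      (∫ t in Ioc (0 : ℝ) (1 / h), t ^ (-μ) * expForm a b t f) +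
        ∫ t in Ioi (1 / h), t ^ (-μ) * expForm a b t f := by
    rw [← setIntegral_union (Ioc_disjoint_Ioi le_rfl) measurableSet_Ioi
      (hi.mono_set Ioc_subset_Ioi_self) (hi.mono_set (Ioi_subset_Ioi hh'.le)),
      Ioc_union_Ioi_eq_Ioi hh'.le]
  have hsm : ∫ t in Ioc (0 : ℝ) (1 / h), t ^ (-μ) * expForm a b t f ≤
      2 / (2 - μ) * h ^ μ * S := by
    have hii : IntervalIntegrable (fun t : ℝ => t ^ (1 - μ)) volume 0 (1 / h) :=
      intervalIntegral.intervalIntegrable_rpow' (by linarith)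
    rw [intervalIntegrable_iff_integrableOn_Ioc_of_le hh'.le] at hii
    calc ∫ t in Ioc (0 : ℝ) (1 / h), t ^ (-μ) * expForm a b t f
        ≤ ∫ t in Ioc (0 : ℝ) (1 / h), t ^ (1 - μ) * (2 * h ^ 2 * S) := by
          refine setIntegral_mono_on (hi.mono_set Ioc_subset_Ioi_self) (hii.mul_const _)
            measurableSet_Ioc fun t ht => ?_
          have h1 := expForm_le_of_primitive hab ht.1 hf h0
          have h2 : t ^ (1 - μ) = t ^ (-μ) * t := by
            rw [show (1 : ℝ) - μ = -μ + 1 by ring, Real.rpow_add ht.1, Real.rpow_one]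
          rw [h2, mul_assoc]
          refine mul_le_mul_of_nonneg_left (h1.trans ?_) (Real.rpow_nonneg ht.1.le _)
          have := mul_le_mul_of_nonneg_left hF (show 0 ≤ 2 * t by linarith [ht.1])
          linarith
      _ = 2 / (2 - μ) * h ^ μ * S := by
          rw [integral_mul_const, ← intervalIntegral.integral_of_le hh'.le,
            integral_rpow (Or.inl (by linarith)), Real.zero_rpow (by linarith),
            show (1 : ℝ) - μ + 1 = 2 - μ by ring, Real.div_rpow zero_le_one hh.le, Real.one_rpow,
            Real.rpow_sub hh, sub_zero]
          have := (Real.rpow_pos_of_pos hh μ).ne'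
          have h2 : (2 - μ) ≠ 0 := by linarith
          norm_num
          field_simp
  have hlg : ∫ t in Ioi (1 / h), t ^ (-μ) * expForm a b t f ≤ 2 / μ * h ^ μ * S := by
    have hii : IntegrableOn (fun t : ℝ => t ^ (-μ - 1)) (Ioi (1 / h)) :=
      integrableOn_Ioi_rpow_of_lt (by linarith) hh'
    calc ∫ t in Ioi (1 / h), t ^ (-μ) * expForm a b t f
        ≤ ∫ t in Ioi (1 / h), t ^ (-μ - 1) * (2 * S) := by
          refine setIntegral_mono_on (hi.mono_set (Ioi_subset_Ioi hh'.le)) (hii.mul_const _)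
            measurableSet_Ioi fun t ht => ?_
          have ht0 : 0 < t := hh'.trans ht
          have h1 := expForm_le_of_large ht0 hf
          rw [Real.rpow_sub ht0, Real.rpow_one, div_mul_eq_mul_div, le_div_iff₀ ht0, mul_assoc]
          refine mul_le_mul_of_nonneg_left ?_ (Real.rpow_nonneg ht0.le _)
          linarith
      _ = 2 / μ * h ^ μ * S := by
          rw [integral_mul_const, integral_Ioi_rpow_of_lt (by linarith) hh',
            show -μ - 1 + 1 = -μ by ring, Real.div_rpow zero_le_one hh.le, Real.one_rpow,
            Real.rpow_neg hh.le]
          field_simp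
  rw [hsplit] at hk
  have : Real.Gamma (1 - μ) * kerForm μ a b f f ≤ (2 / (2 - μ) + 2 / μ) * h ^ μ * S := by
    rw [hk]; linarith
  rw [div_mul_eq_mul_div, div_mul_eq_mul_div, le_div_iff₀ hΓ]
  linarith

/-! ### Beta-type integrals -/

/-- The Euler beta integral. -/
noncomputable def bt (p q : ℝ) : ℝ := ∫ u in Ioo (0 : ℝ) 1, (1 - u) ^ (p - 1) * u ^ (q - 1)

theorem bt_integrable {p q : ℝ} (hp : 0 < p) (hq : 0 < q) :
    IntegrableOn (fun u : ℝ => (1 - u) ^ (p - 1) * u ^ (q - 1)) (Ioo 0 1) := by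
  have h := (Complex.betaIntegral_convergent (u := q) (v := p) (by simpa) (by simpa)).norm
  rw [intervalIntegrable_iff_integrableOn_Ioo_of_le zero_le_one] at h
  refine h.congr_fun (fun u hu => ?_) measurableSet_Ioo
  have h1 : ((u : ℂ) ^ ((q : ℂ) - 1)) = ((u ^ (q - 1) : ℝ) : ℂ) := by
    rw [Complex.ofReal_cpow hu.1.le]; simp
  have h2 : ((1 - u : ℂ) ^ ((p : ℂ) - 1)) = (((1 - u) ^ (p - 1) : ℝ) : ℂ) := by
    rw [Complex.ofReal_cpow (by linarith [hu.2])]; simp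
  simp only [h1, h2, norm_mul, Complex.norm_real, Real.norm_eq_abs]
  rw [abs_of_nonneg (Real.rpow_nonneg hu.1.le _),
    abs_of_nonneg (Real.rpow_nonneg (by linarith [hu.2]) _), mul_comm]

theorem bt_pos {p q : ℝ} (hp : 0 < p) (hq : 0 < q) : 0 < bt p q := by
  rw [bt, ← integral_Ioc_eq_integral_Ioo, ← intervalIntegral.integral_of_le zero_le_one]
  refine intervalIntegral.intervalIntegral_pos_of_pos_on ?_ (fun u hu => ?_) zero_lt_one
  · rw [intervalIntegrable_iff_integrableOn_Ioo_of_le zero_le_one]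
    exact bt_integrable hp hq
  · exact mul_pos (Real.rpow_pos_of_pos (by linarith [hu.2]) _) (Real.rpow_pos_of_pos hu.1 _)

/-- Composition of one-sided power kernels. -/
theorem kp_comp {a b p q x s : ℝ} (hp : 0 < p) (hq : 0 < q) (hs : a ≤ s) (hx : x ≤ b) :
    Integrable (fun y => kp p x y * kp q y s) (vol a b) ∧
      ∫ y, kp p x y * kp q y s ∂vol a b = bt p q * kp (p + q) x s := by
  by_cases hsx : s < x
  · set d := x - s with hd
    have hd0 : 0 < d := sub_pos.2 hsx
    have e : (fun y => kp p x y * kp q y s) =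
        (Ioo s x).indicator (fun y => (x - y) ^ (p - 1) * (y - s) ^ (q - 1)) := by
      ext y
      unfold kp
      by_cases h : y ∈ Ioo s x
      · rw [indicator_of_mem h, if_pos h.2, if_pos h.1]
      · rw [indicator_of_notMem h]
        rw [mem_Ioo, not_and_or] at h
        rcases h with h | h <;> simp [h]
    have e2 : (Ioo s x ∩ Ioc a b : Set ℝ) = Ioo s x := by
      refine inter_eq_left.2 fun y hy => ⟨hs.trans_lt hy.1, (hy.2.trans_le hx).le⟩
    -- The substitution `y = s + d u` reduces the composition to the Euler beta integral.
    have him : (fun u : ℝ => s + d * u) '' Ioo 0 1 = Ioo s x := by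
      have : (fun u : ℝ => s + d * u) = fun u => d * u + s := by ext u; ring
      rw [this, Set.image_affine_Ioo hd0]
      simp [hd]
    have hinj : InjOn (fun u : ℝ => s + d * u) (Ioo 0 1) := by
      intro u _ v _ h
      have := add_left_cancel h
      exact mul_left_cancel₀ hd0.ne' this
    have hder : ∀ u ∈ Ioo (0 : ℝ) 1, HasDerivWithinAt (fun u : ℝ => s + d * u) d (Ioo 0 1) u := by
      intro u _
      have := ((hasDerivAt_id u).const_mul d).const_add s
      exact (this.congr_deriv (by ring)).hasDerivWithinAt
    have hval : ∀ u ∈ Ioo (0 : ℝ) 1, |d| • ((x - (s + d * u)) ^ (p - 1) * (s + d * u - s) ^ (q - 1)) =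
        d ^ (p + q - 1) * ((1 - u) ^ (p - 1) * u ^ (q - 1)) := by
      intro u hu
      have h1 : x - (s + d * u) = d * (1 - u) := by rw [hd]; ring
      have h2 : s + d * u - s = d * u := by ring
      rw [h1, h2, Real.mul_rpow hd0.le (by linarith [hu.2]), Real.mul_rpow hd0.le hu.1.le,
        abs_of_pos hd0, smul_eq_mul, show p + q - 1 = 1 + (p - 1) + (q - 1) by ring,
        Real.rpow_add hd0, Real.rpow_add hd0, Real.rpow_one]
      ring
    rw [e]
    constructor
    · rw [integrable_indicator_iff measurableSet_Ioo, IntegrableOn, vol,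
        Measure.restrict_restrict measurableSet_Ioo, e2, ← him, ← IntegrableOn,
        integrableOn_image_iff_integrableOn_abs_deriv_smul measurableSet_Ioo hder hinj]
      refine Integrable.congr ((bt_integrable hp hq).const_mul (d ^ (p + q - 1))) ?_
      exact (ae_restrict_iff' measurableSet_Ioo).2
        (Filter.Eventually.of_forall fun u hu => (hval u hu).symm)
    · rw [integral_indicator measurableSet_Ioo, vol, Measure.restrict_restrict measurableSet_Ioo,
        e2, ← him, integral_image_eq_integral_abs_deriv_smul measurableSet_Ioo hder hinj,
        setIntegral_congr_fun measurableSet_Ioo hval, integral_const_mul, kp, if_pos hsx, bt,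
        mul_comm]
  · have e : (fun y => kp p x y * kp q y s) = fun _ => 0 := by
      ext y
      unfold kp
      by_cases h : y < x
      · rw [if_neg (show ¬ s < y by intro h'; exact hsx (h'.trans h)), mul_zero]
      · rw [if_neg h, zero_mul]
    rw [e]
    simp [kp, hsx]

/-- The integral `∫_0^∞ r^(p-1) (1+r)^(p-1) dr`. -/
noncomputable def btInf (p : ℝ) : ℝ := ∫ r in Ioi (0 : ℝ), r ^ (p - 1) * (1 + r) ^ (p - 1)

/-- Positivity of `p` gives integrability at `0`; at infinity the integrand decays like `r ^ (2 p -
2)`, whence the restriction `p < 1 / 2`. -/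
theorem btInf_integrable {p : ℝ} (hp : 0 < p) (hp2 : p < 1 / 2) :
    IntegrableOn (fun r : ℝ => r ^ (p - 1) * (1 + r) ^ (p - 1)) (Ioi 0) := by
  have hm : Measurable (fun r : ℝ => r ^ (p - 1) * (1 + r) ^ (p - 1)) :=
    (measurable_id.pow_const _).mul ((measurable_const.add measurable_id).pow_const _)
  have h1 : IntegrableOn (fun r : ℝ => r ^ (p - 1) * (1 + r) ^ (p - 1)) (Ioc 0 1) := by
    have hii : IntervalIntegrable (fun t : ℝ => t ^ (p - 1)) volume 0 1 :=
      intervalIntegral.intervalIntegrable_rpow' (by linarith)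
    rw [intervalIntegrable_iff_integrableOn_Ioc_of_le zero_le_one] at hii
    refine hii.mono' hm.aestronglyMeasurable ?_
    refine (ae_restrict_iff' measurableSet_Ioc).2 (Filter.Eventually.of_forall fun r hr => ?_)
    have h0 := Real.rpow_nonneg hr.1.le (p - 1)
    have h2 : (1 + r) ^ (p - 1) ≤ 1 :=
      Real.rpow_le_one_of_one_le_of_nonpos (by linarith [hr.1]) (by linarith)
    have h3 := Real.rpow_nonneg (show 0 ≤ 1 + r by linarith [hr.1]) (p - 1)
    rw [Real.norm_of_nonneg (mul_nonneg h0 h3)]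
    exact mul_le_of_le_one_right h0 h2
  have h2 : IntegrableOn (fun r : ℝ => r ^ (p - 1) * (1 + r) ^ (p - 1)) (Ioi 1) := by
    have hii : IntegrableOn (fun t : ℝ => t ^ (2 * p - 2)) (Ioi 1) :=
      integrableOn_Ioi_rpow_of_lt (by linarith) zero_lt_one
    refine hii.mono' hm.aestronglyMeasurable ?_
    refine (ae_restrict_iff' measurableSet_Ioi).2 (Filter.Eventually.of_forall fun r hr => ?_)
    have hr0 : 0 < r := lt_trans zero_lt_one hr
    have h0 := Real.rpow_nonneg hr0.le (p - 1)
    have h2 : (1 + r) ^ (p - 1) ≤ r ^ (p - 1) :=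
      Real.rpow_le_rpow_of_nonpos hr0 (by linarith) (by linarith)
    have h3 := Real.rpow_nonneg (show 0 ≤ 1 + r by linarith) (p - 1)
    rw [Real.norm_of_nonneg (mul_nonneg h0 h3), show 2 * p - 2 = (p - 1) + (p - 1) by ring,
      Real.rpow_add hr0]
    exact mul_le_mul_of_nonneg_left h2 h0
  rw [← Ioc_union_Ioi_eq_Ioi zero_le_one]
  exact h1.union h2

/-- With `x < s` and `d = s - x`, the substitution `y = x - d r` extracts `d ^ (2 p - 1)`. On the
whole line the Riesz kernel of order `2 p` is therefore a Gram kernel of one-sided power kernels of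
order `p`. -/
theorem kp_mul_kp_integral {p x s : ℝ} (hp : 0 < p) (hp2 : p < 1 / 2) (hxs : x ≠ s) :
    Integrable (fun y => kp p x y * kp p s y) volume ∧
      ∫ y, kp p x y * kp p s y = btInf p * |x - s| ^ (2 * p - 1) := by
  wlog h : x < s generalizing x s
  · have := this hxs.symm (lt_of_le_of_ne (not_lt.1 h) hxs.symm)
    simp_rw [mul_comm (kp p s _)] at this
    rwa [abs_sub_comm] at this
  set d := s - x with hd
  have hd0 : 0 < d := sub_pos.2 h
  have e : (fun y => kp p x y * kp p s y) =
      (Iio x).indicator (fun y => (x - y) ^ (p - 1) * (s - y) ^ (p - 1)) := by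
    ext y
    unfold kp
    by_cases hy : y < x
    · rw [indicator_of_mem (by exact hy), if_pos hy, if_pos (hy.trans h)]
    · rw [indicator_of_notMem (by exact hy), if_neg hy, zero_mul]
  have him : (fun r : ℝ => x - d * r) '' Ioi 0 = Iio x := by
    ext y
    simp only [mem_image, mem_Ioi, mem_Iio]
    constructor
    · rintro ⟨r, hr, rfl⟩; nlinarith [mul_pos hd0 hr]
    · intro hy
      exact ⟨(x - y) / d, div_pos (sub_pos.2 hy) hd0, by field_simp; ring⟩
  have hinj : InjOn (fun u : ℝ => x - d * u) (Ioi 0) := by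
    intro u _ v _ h
    have := sub_right_injective h
    exact mul_left_cancel₀ hd0.ne' this
  have hder : ∀ u ∈ Ioi (0 : ℝ), HasDerivWithinAt (fun u : ℝ => x - d * u) (-d) (Ioi 0) u := by
    intro u _
    have := ((hasDerivAt_id u).const_mul d).const_sub x
    exact (this.congr_deriv (by ring)).hasDerivWithinAt
  have hval : ∀ u ∈ Ioi (0 : ℝ), |-d| • ((x - (x - d * u)) ^ (p - 1) * (s - (x - d * u)) ^ (p - 1)) =
      d ^ (2 * p - 1) * (u ^ (p - 1) * (1 + u) ^ (p - 1)) := by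
    intro u hu
    have hu' : 0 < u := hu
    have h1 : x - (x - d * u) = d * u := by ring
    have h2 : s - (x - d * u) = d * (1 + u) := by rw [hd]; ring
    rw [h1, h2, Real.mul_rpow hd0.le hu'.le, Real.mul_rpow hd0.le (by linarith), abs_neg,
      abs_of_pos hd0, smul_eq_mul, show 2 * p - 1 = 1 + (p - 1) + (p - 1) by ring,
      Real.rpow_add hd0, Real.rpow_add hd0, Real.rpow_one]
    ring
  rw [e]
  constructor
  · rw [integrable_indicator_iff measurableSet_Iio, ← him,
      integrableOn_image_iff_integrableOn_abs_deriv_smul measurableSet_Ioi hder hinj]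
    refine Integrable.congr ((btInf_integrable hp hp2).const_mul (d ^ (2 * p - 1))) ?_
    exact (ae_restrict_iff' measurableSet_Ioi).2
      (Filter.Eventually.of_forall fun u hu => (hval u hu).symm)
  · rw [integral_indicator measurableSet_Iio, ← him,
      integral_image_eq_integral_abs_deriv_smul measurableSet_Ioi hder hinj,
      setIntegral_congr_fun measurableSet_Ioi hval, integral_const_mul, btInf, abs_sub_comm,
      ← hd, abs_of_pos hd0, mul_comm]

/-- Factorization of the Riesz kernel on a half line with power weights. -/
theorem kp_mul_kp_weight_integral {b p x s : ℝ} (hp : 0 < p) (hp2 : p < 1 / 2) (hxs : x ≠ s)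
    (hx : x ∈ Ioc 0 b) (hs : s ∈ Ioc 0 b) :
    Integrable (fun y => kp p x y * kp p s y * kp (1 - 2 * p) y 0) (vol 0 b) ∧
      ∫ y, kp p x y * kp p s y * kp (1 - 2 * p) y 0 ∂vol 0 b =
        bt (1 - 2 * p) p * (x ^ (-p) * s ^ (-p) * |x - s| ^ (2 * p - 1)) := by
  wlog h : x < s generalizing x s
  · have := this hxs.symm hs hx (lt_of_le_of_ne (not_lt.1 h) hxs.symm)
    simp_rw [mul_comm (kp p s _)] at this
    rwa [abs_sub_comm, mul_comm (s ^ (-p))] at this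
  have hx0 := hx.1
  have hs0 := hs.1
  set d := s - x with hd
  have hd0 : 0 < d := sub_pos.2 h
  have e : (fun y => kp p x y * kp p s y * kp (1 - 2 * p) y 0) =
      (Ioo 0 x).indicator (fun y => (x - y) ^ (p - 1) * (s - y) ^ (p - 1) * y ^ (-(2 * p))) := by
    ext y
    unfold kp
    by_cases hy : y ∈ Ioo 0 x
    · rw [indicator_of_mem hy, if_pos hy.2, if_pos (hy.2.trans h), if_pos hy.1, sub_zero]
      congr 2; ring
    · rw [indicator_of_notMem hy]
      rw [mem_Ioo, not_and_or] at hy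
      rcases hy with hy | hy <;> simp [hy]
  have e2 : (Ioo 0 x ∩ Ioc 0 b : Set ℝ) = Ioo 0 x :=
    inter_eq_left.2 fun y hy => ⟨hy.1, (hy.2.trans_le hx.2).le⟩
  -- A Möbius map of `(0, 1)` onto `(0, x)`. It makes `φ`, `x - φ` and `s - φ` monomials in `t`, `1
  -- - t` and the common denominator `D = s - t x`; the power of `D` in the integrand times the
  -- Jacobian is then zero, and a pure beta integral remains.
  set φ : ℝ → ℝ := fun t => x * s * (1 - t) / (s - t * x) with hφ
  have hD : ∀ t ∈ Ioo (0 : ℝ) 1, 0 < s - t * x := fun t ht => by nlinarith [ht.1, ht.2]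
  have hxφ : ∀ t ∈ Ioo (0 : ℝ) 1, x - φ t = t * x * d / (s - t * x) := fun t ht => by
    have := (hD t ht).ne'
    simp only [hφ, hd]; rw [eq_div_iff this, sub_mul, div_mul_cancel₀ _ this]; ring
  have hsφ : ∀ t ∈ Ioo (0 : ℝ) 1, s - φ t = s * d / (s - t * x) := fun t ht => by
    have := (hD t ht).ne'
    simp only [hφ, hd]; rw [eq_div_iff this, sub_mul, div_mul_cancel₀ _ this]; ring
  have hφ0 : ∀ t ∈ Ioo (0 : ℝ) 1, 0 < φ t := fun t ht =>
    div_pos (mul_pos (mul_pos hx0 hs0) (by linarith [ht.2])) (hD t ht)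
  have him : φ '' Ioo 0 1 = Ioo 0 x := by
    ext y
    simp only [mem_image]
    constructor
    · rintro ⟨t, ht, rfl⟩
      refine ⟨hφ0 t ht, ?_⟩
      have h1 := hxφ t ht
      have : 0 < t * x * d / (s - t * x) :=
        div_pos (mul_pos (mul_pos ht.1 hx0) hd0) (hD t ht)
      linarith
    · intro hy
      have hsy : 0 < s - y := by linarith [hy.2]
      have hxy : 0 < x - y := by linarith [hy.2]
      refine ⟨s * (x - y) / (x * (s - y)), ⟨by positivity, ?_⟩, ?_⟩
      · rw [div_lt_one (by positivity)]
        nlinarith [mul_pos hy.1 hd0]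
      · simp only [hφ]
        have h3 : s - s * (x - y) / (x * (s - y)) * x = s * d / (s - y) := by
          field_simp; rw [hd]; ring
        have h4 : 1 - s * (x - y) / (x * (s - y)) = y * d / (x * (s - y)) := by
          field_simp; rw [hd]; ring
        rw [h3, h4]
        field_simp
  have hinj : InjOn φ (Ioo 0 1) := by
    intro u hu v hv huv
    have h1 := hxφ u hu
    have h2 := hxφ v hv
    have h3 := hsφ u hu
    have h4 := hsφ v hv
    rw [huv] at h1 h3
    rw [h2, div_eq_div_iff (hD v hv).ne' (hD u hu).ne'] at h1
    have : x * d * s * (u - v) = 0 := by linear_combination -h1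
    rcases mul_eq_zero.1 this with h5 | h5
    · exact absurd h5 (by positivity)
    · linarith
  have hder : ∀ t ∈ Ioo (0 : ℝ) 1,
      HasDerivWithinAt φ (-(x * s * d / (s - t * x) ^ 2)) (Ioo 0 1) t := by
    intro t ht
    have h1 : HasDerivAt (fun t => x * s * (1 - t)) (-(x * s)) t := by
      have := ((hasDerivAt_id t).const_sub 1).const_mul (x * s)
      exact this.congr_deriv (by ring)
    have h2 : HasDerivAt (fun t => s - t * x) (-x) t := by
      have := ((hasDerivAt_id t).mul_const x).const_sub s
      exact this.congr_deriv (by ring)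
    refine ((h1.div h2 (hD t ht).ne').congr_deriv ?_).hasDerivWithinAt
    have := (hD t ht).ne'
    rw [hd]
    field_simp
    ring
  have hval : ∀ t ∈ Ioo (0 : ℝ) 1, |-(x * s * d / (s - t * x) ^ 2)| •
      ((x - φ t) ^ (p - 1) * (s - φ t) ^ (p - 1) * φ t ^ (-(2 * p))) =
      (x ^ (-p) * s ^ (-p) * d ^ (2 * p - 1)) * ((1 - t) ^ ((1 - 2 * p) - 1) * t ^ (p - 1)) := by
    intro t ht
    have hDt := hD t ht
    have ht0 := ht.1
    have ht1 : 0 < 1 - t := by linarith [ht.2]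
    rw [hxφ t ht, hsφ t ht]
    simp only [hφ]
    rw [abs_neg, abs_of_pos (by positivity), smul_eq_mul]
    set D := s - t * x
    -- Every factor is written as an exponential, so that comparing exponents becomes a linear
    -- identity between logarithms.
    have e0 : x * s * d / D ^ 2 = Real.exp (Real.log x + Real.log s + Real.log d - 2 * Real.log D) := by
      rw [Real.exp_sub, Real.exp_add, Real.exp_add, two_mul, Real.exp_add, Real.exp_log hx0,
        Real.exp_log hs0, Real.exp_log hd0, Real.exp_log hDt, sq]
    rw [e0, Real.rpow_def_of_pos (by positivity), Real.rpow_def_of_pos (by positivity),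
      Real.rpow_def_of_pos (by positivity), Real.rpow_def_of_pos hx0, Real.rpow_def_of_pos hs0,
      Real.rpow_def_of_pos hd0, Real.rpow_def_of_pos ht1, Real.rpow_def_of_pos ht0,
      ← Real.exp_add, ← Real.exp_add, ← Real.exp_add, ← Real.exp_add, ← Real.exp_add,
      ← Real.exp_add, ← Real.exp_add]
    congr 1
    rw [Real.log_div (by positivity) hDt.ne', Real.log_div (by positivity) hDt.ne',
      Real.log_div (by positivity) hDt.ne', Real.log_mul (by positivity) hd0.ne',
      Real.log_mul ht0.ne' hx0.ne', Real.log_mul hs0.ne' hd0.ne',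
      Real.log_mul (by positivity) ht1.ne', Real.log_mul hx0.ne' hs0.ne']
    ring
  have hbi := bt_integrable (p := 1 - 2 * p) (q := p) (by linarith) hp
  rw [e]
  constructor
  · rw [integrable_indicator_iff measurableSet_Ioo, IntegrableOn, vol,
      Measure.restrict_restrict measurableSet_Ioo, e2, ← him, ← IntegrableOn,
      integrableOn_image_iff_integrableOn_abs_deriv_smul measurableSet_Ioo hder hinj]
    refine Integrable.congr (hbi.const_mul (x ^ (-p) * s ^ (-p) * d ^ (2 * p - 1))) ?_
    exact (ae_restrict_iff' measurableSet_Ioo).2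
      (Filter.Eventually.of_forall fun u hu => (hval u hu).symm)
  · rw [integral_indicator measurableSet_Ioo, vol, Measure.restrict_restrict measurableSet_Ioo,
      e2, ← him, integral_image_eq_integral_abs_deriv_smul measurableSet_Ioo hder hinj,
      setIntegral_congr_fun measurableSet_Ioo hval, integral_const_mul, abs_sub_comm, ← hd,
      abs_of_pos hd0, bt, mul_comm]

/-! ### An a priori bound for the Riesz kernel equation on an interval -/

theorem integral_mul_sq_le {α : Type*} [MeasurableSpace α] {μ : Measure α} {f g : α → ℝ}
    (hf : AEStronglyMeasurable f μ) (hg : AEStronglyMeasurable g μ)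
    (hf2 : Integrable (fun x => f x ^ 2) μ) (hg2 : Integrable (fun x => g x ^ 2) μ) :
    Integrable (fun x => f x * g x) μ ∧
      (∫ x, f x * g x ∂μ) ^ 2 ≤ (∫ x, f x ^ 2 ∂μ) * ∫ x, g x ^ 2 ∂μ := by
  have hfg : Integrable (fun x => f x * g x) μ := by
    refine (hf2.add hg2).mono' (hf.mul hg) (Filter.Eventually.of_forall fun x => ?_)
    rw [Real.norm_eq_abs, abs_mul, Pi.add_apply]
    nlinarith [sq_abs (f x), sq_abs (g x), sq_nonneg (|f x| - |g x|), sq_nonneg (|f x| + |g x|)]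
  refine ⟨hfg, ?_⟩
  have key : ∀ c : ℝ, 0 ≤ (∫ x, g x ^ 2 ∂μ) * (c * c) + 2 * (∫ x, f x * g x ∂μ) * c +
      ∫ x, f x ^ 2 ∂μ := by
    intro c
    have h0 : 0 ≤ ∫ x, (f x + c * g x) ^ 2 ∂μ := integral_nonneg fun x => sq_nonneg _
    have h1 : ∫ x, (f x + c * g x) ^ 2 ∂μ = ∫ x, f x ^ 2 ∂μ + (2 * c) * ∫ x, f x * g x ∂μ +
        c ^ 2 * ∫ x, g x ^ 2 ∂μ := by
      have i2 : Integrable (fun x => f x ^ 2 + 2 * c * (f x * g x)) μ := hf2.add (hfg.const_mul _)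
      rw [← integral_const_mul, ← integral_const_mul, ← integral_add hf2 (hfg.const_mul _),
        ← integral_add i2 (hg2.const_mul _)]
      congr 1; ext x; ring
    rw [h1] at h0
    linarith
  have := discrim_le_zero key
  rw [discrim] at this
  nlinarith

/-- Fubini for a functional `k` applied after an integral operator `K`. The row bound `R` need only
be integrable against `|k|`, which leaves room for weights singular at an endpoint. -/
theorem transform_comp {a b : ℝ} {k : ℝ → ℝ} {K : ℝ → ℝ → ℝ} {R : ℝ → ℝ} {f : ℝ → ℝ}
    (hk : Measurable k) (hK : Measurable (Function.uncurry K)) (hK0 : ∀ y u, 0 ≤ K y u)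
    (hKi : ∀ y ∈ Ioc a b, Integrable (K y) (vol a b))
    (hR : ∀ y ∈ Ioc a b, ∫ u, K y u ∂vol a b ≤ R y)
    (hkR : Integrable (fun y => |k y| * R y) (vol a b)) (hf : BM a b f) :
    ∫ y, k y * (∫ u, K y u * f u ∂vol a b) ∂vol a b =
      ∫ u, (∫ y, k y * K y u ∂vol a b) * f u ∂vol a b := by
  obtain ⟨M, hM0, hM⟩ := hf.exists_pos
  have hi : Integrable (Function.uncurry fun y u => k y * (K y u * f u))
      ((vol a b).prod (vol a b)) := by
    refine integrable_prod_of_bound (F := fun y u => k y * (K y u * f u))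
      (H := fun y => |k y| * R y * M) ?_ (hkR.mul_const M) (ae_vol fun y hy => ?_)
      (ae_vol fun y hy => ?_)
    · exact (hk.comp measurable_fst).mul (hK.mul (hf.meas.comp measurable_snd))
    · exact (integrable_transform (hKi y hy) hf).const_mul _
    · calc ∫ u, |k y * (K y u * f u)| ∂vol a b ≤ ∫ u, |k y| * (K y u * M) ∂vol a b := by
            refine integral_mono_of_nonneg (Filter.Eventually.of_forall fun u => abs_nonneg _)
              (((hKi y hy).mul_const M).const_mul _) (ae_vol fun u hu => ?_)
            simp only [abs_mul, abs_of_nonneg (hK0 y u)]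
            exact mul_le_mul_of_nonneg_left (mul_le_mul_of_nonneg_left (hM u hu) (hK0 y u))
              (abs_nonneg _)
        _ ≤ |k y| * R y * M := by
            rw [integral_const_mul, integral_mul_const, mul_assoc]
            exact mul_le_mul_of_nonneg_left (mul_le_mul_of_nonneg_right (hR y hy) hM0.le)
              (abs_nonneg _)
  have := integral_integral_swap hi
  simp only [integral_const_mul] at this
  rw [this]
  congr 1
  ext u
  rw [← integral_mul_const]
  congr 1
  ext y
  ring

/-- Schur's test. -/
theorem schur_test {a b C₁ C₂ : ℝ} {K : ℝ → ℝ → ℝ} {f : ℝ → ℝ}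
    (hK : Measurable (Function.uncurry K)) (hK0 : ∀ y u, 0 ≤ K y u)
    (h1 : ∀ x ∈ Ioc a b, Integrable (K x) (vol a b))
    (h1' : ∀ x ∈ Ioc a b, ∫ y, K x y ∂vol a b ≤ C₁)
    (h2' : ∀ y ∈ Ioc a b, ∫ x, K x y ∂vol a b ≤ C₂) (hC : 0 ≤ C₁) (hf : BM a b f) :
    ∫ x, (∫ y, K x y * f y ∂vol a b) ^ 2 ∂vol a b ≤ C₁ * C₂ * ∫ y, f y ^ 2 ∂vol a b := by
  have hf2 : BM a b fun y => f y ^ 2 := by simpa [sq] using hf.mul hf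
  have hT := BM.transform hK hK0 h1 h1' hf
  have hT2 := BM.transform hK hK0 h1 h1' hf2
  have hcs : ∀ x ∈ Ioc a b, (∫ y, K x y * f y ∂vol a b) ^ 2 ≤
      C₁ * ∫ y, K x y * f y ^ 2 ∂vol a b := by
    intro x hx
    have hKm : Measurable (K x) := hK.comp (measurable_const.prodMk measurable_id)
    -- The kernel is split as `√K · √K` for Cauchy–Schwarz, one factor carrying `f`.
    have e1 : ∀ y, √(K x y) ^ 2 = K x y := fun y => Real.sq_sqrt (hK0 x y)
    have e2 : ∀ y, (√(K x y) * f y) ^ 2 = K x y * f y ^ 2 := fun y => by rw [mul_pow, e1]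
    have e3 : ∀ y, √(K x y) * (√(K x y) * f y) = K x y * f y := fun y => by
      rw [← mul_assoc, ← sq, e1]
    have := (integral_mul_sq_le (μ := vol a b) (f := fun y => √(K x y))
      (g := fun y => √(K x y) * f y) hKm.sqrt.aestronglyMeasurable
      (hKm.sqrt.mul hf.meas).aestronglyMeasurable
      (by simp only [e1]; exact h1 x hx)
      (by simp only [e2]; exact integrable_transform (h1 x hx) hf2)).2
    simp only [e1, e2, e3] at this
    refine this.trans (mul_le_mul_of_nonneg_right (h1' x hx) ?_)
    exact integral_nonneg fun y => mul_nonneg (hK0 x y) (sq_nonneg _)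
  have hC1 : Integrable (fun y => |(1 : ℝ)| * C₁) (vol a b) := integrable_const _
  calc ∫ x, (∫ y, K x y * f y ∂vol a b) ^ 2 ∂vol a b
      ≤ ∫ x, C₁ * ∫ y, K x y * f y ^ 2 ∂vol a b ∂vol a b :=
        integral_mono_ae hT.sq_integrable (hT2.integrable.const_mul _) (ae_vol hcs)
    _ = C₁ * ∫ y, (∫ x, K x y ∂vol a b) * f y ^ 2 ∂vol a b := by
        rw [integral_const_mul]
        congr 1
        have := transform_comp (k := fun _ => 1) measurable_const hK hK0 h1 h1' hC1 hf2
        simpa using this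
    _ ≤ C₁ * ∫ y, C₂ * f y ^ 2 ∂vol a b := by
        refine mul_le_mul_of_nonneg_left ?_ hC
        refine integral_mono_of_nonneg (ae_vol fun y hy => ?_) (hf.sq_integrable.const_mul _)
          (ae_vol fun y hy => ?_)
        · exact mul_nonneg (integral_nonneg fun x => hK0 x y) (sq_nonneg _)
        · exact mul_le_mul_of_nonneg_right (h2' y hy) (sq_nonneg _)
    _ = _ := by rw [integral_const_mul]; ring

theorem kp_left_le {b p x : ℝ} (hp : 0 < p) (hx : x ∈ Ioc 0 b) :
    ∫ y, kp p x y ∂vol 0 b ≤ b ^ p / p := by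
  rw [(kp_integrable_left hp (Ioc_subset_Icc_self hx)).2, sub_zero]
  have := Real.rpow_le_rpow hx.1.le hx.2 hp.le
  gcongr

theorem kp_right_le {b p y : ℝ} (hp : 0 < p) (hy : y ∈ Ioc 0 b) :
    ∫ x, kp p x y ∂vol 0 b ≤ b ^ p / p := by
  rw [(kp_integrable_right hp (Ioc_subset_Icc_self hy)).2]
  have := Real.rpow_le_rpow (sub_nonneg.2 hy.2) (show b - y ≤ b by linarith [hy.1]) hp.le
  gcongr

theorem measurable_kp_swap (p : ℝ) : Measurable (Function.uncurry fun y x => kp p x y) :=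
  (measurable_kp p).comp measurable_swap

/-! ### One-sided fractional integrals and their comparison in `L²` -/

/-- Right-sided fractional integral (unnormalized). -/
noncomputable def Im (b p : ℝ) (f : ℝ → ℝ) (y : ℝ) : ℝ := ∫ s, kp p s y * f s ∂vol 0 b

/-- Left-sided fractional integral (unnormalized). -/
noncomputable def Ip (b p : ℝ) (f : ℝ → ℝ) (x : ℝ) : ℝ := ∫ y, kp p x y * f y ∂vol 0 b

theorem BM.Im {b p : ℝ} (hp : 0 < p) {f : ℝ → ℝ} (hf : BM 0 b f) : BM 0 b (FracLDG.Im b p f) :=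
  BM.transform (K := fun y s => kp p s y) (measurable_kp_swap p) (fun _ _ => kp_nonneg _ _ _)
    (fun _ hy => (kp_integrable_right hp (Ioc_subset_Icc_self hy)).1)
    (fun _ hy => kp_right_le hp hy) hf

theorem BM.Ip {b p : ℝ} (hp : 0 < p) {f : ℝ → ℝ} (hf : BM 0 b f) : BM 0 b (FracLDG.Ip b p f) :=
  BM.transform (K := kp p) (measurable_kp p) (fun _ _ => kp_nonneg _ _ _)
    (fun _ hy => (kp_integrable_left hp (Ioc_subset_Icc_self hy)).1)
    (fun _ hy => kp_left_le hp hy) hf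

/-- The semigroup law; since the integrals are not normalized by Gamma factors, the beta constant
remains. -/
theorem Im_Im {b p q : ℝ} (hp : 0 < p) (hq : 0 < q) {f : ℝ → ℝ} (hf : BM 0 b f) {x : ℝ}
    (hx : x ∈ Ioc 0 b) : Im b p (Im b q f) x = bt q p * Im b (q + p) f x := by
  have hi := (kp_integrable_right hp (Ioc_subset_Icc_self hx)).1
  have h := transform_comp (a := 0) (b := b) (k := fun y => kp p y x) (K := fun y u => kp q u y)
    (R := fun _ => b ^ q / q) (measurable_kp_right p x) (measurable_kp_swap q)
    (fun _ _ => kp_nonneg _ _ _) (fun _ hy => (kp_integrable_right hq (Ioc_subset_Icc_self hy)).1)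
    (fun _ hy => kp_right_le hq hy) (by
      refine (hi.abs).mul_const _) hf
  rw [Im, Im, ← integral_const_mul]
  unfold Im
  rw [h]
  refine integral_congr_ae (ae_vol fun u hu => ?_)
  have := (kp_comp (a := 0) (b := b) hq hp hx.1.le hu.2).2
  simp only [mul_comm (kp p _ x)]
  rw [this, mul_assoc]

/-- The two one-sided fractional integrals of order `< 1/2` are comparable in `L²`. -/
theorem integral_Im_sq_le {b p : ℝ} (hp : 0 < p) (hp2 : p < 1 / 2) {W : ℝ → ℝ}
    (hW : BM 0 b W) : ∫ y, Im b p W y ^ 2 ∂vol 0 b ≤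
      (2 * btInf p / bt p p) ^ 2 * ∫ y, Ip b p W y ^ 2 ∂vol 0 b := by
  have h2p : 0 < 2 * p := by linarith
  set Q := kerForm (2 * p) 0 b W W with hQ
  have hbt := bt_pos hp hp
  have hbi : 0 ≤ btInf p := setIntegral_nonneg measurableSet_Ioi fun r hr =>
    mul_nonneg (Real.rpow_nonneg (le_of_lt hr) _)
      (Real.rpow_nonneg (add_nonneg zero_le_one (le_of_lt hr)) _)
  have hQ0 : 0 ≤ Q := kerForm_self_nonneg h2p (by linarith) hW
  have hM := hW.Im hp
  have hP := hW.Ip hp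
  have hWm1 : Measurable fun q : (ℝ × ℝ) × ℝ => W q.1.1 * W q.1.2 :=
    (hW.meas.comp measurable_fst.fst).mul (hW.meas.comp measurable_fst.snd)
  have hk1 : Measurable fun q : (ℝ × ℝ) × ℝ => kp p q.1.1 q.2 :=
    (measurable_kp p).comp (measurable_fst.fst.prodMk measurable_snd)
  have hk2 : Measurable fun q : (ℝ × ℝ) × ℝ => kp p q.1.2 q.2 :=
    (measurable_kp p).comp (measurable_fst.snd.prodMk measurable_snd)
  have hk3 : Measurable fun q : (ℝ × ℝ) × ℝ => kp p q.2 q.1.1 :=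
    (measurable_kp p).comp (measurable_snd.prodMk measurable_fst.fst)
  have hWW := (integrable_kerForm h2p hW hW).abs
  -- the full-line Gram identity
  have hupper : ∫ y, Im b p W y ^ 2 ∂vol 0 b ≤ btInf p * Q := by
    have hi : Integrable (fun q : (ℝ × ℝ) × ℝ => W q.1.1 * W q.1.2 *
        (kp p q.1.1 q.2 * kp p q.1.2 q.2)) (((vol 0 b).prod (vol 0 b)).prod volume) := by
      refine integrable_prod_of_bound (F := fun (x : ℝ × ℝ) y => W x.1 * W x.2 *
        (kp p x.1 y * kp p x.2 y)) (hWm1.mul (hk1.mul hk2)) (hWW.mul_const (btInf p)) ?_ ?_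
      · filter_upwards [ae_vol_prod_ne] with x hx
        exact (kp_mul_kp_integral hp hp2 hx).1.const_mul _
      · filter_upwards [ae_vol_prod_ne] with x hx
        simp only [abs_mul (W x.1 * W x.2),
          abs_of_nonneg (mul_nonneg (kp_nonneg p x.1 _) (kp_nonneg p x.2 _)), integral_const_mul]
        rw [(kp_mul_kp_integral hp hp2 hx).2,
          abs_of_nonneg (Real.rpow_nonneg (abs_nonneg (x.1 - x.2)) (2 * p - 1))]
        apply le_of_eq; ring
    have hg := integral_mul_transform (G₁ := fun y s => kp p s y) (G₂ := fun y s => kp p s y) hi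
    have hint : Integrable (fun y => Im b p W y ^ 2) volume := by
      refine hi.integral_prod_right.congr (Filter.Eventually.of_forall fun y => ?_)
      simp only
      rw [Im, sq, ← integral_prod_mul]
      congr 1; ext x; ring
    have e : ∫ y, Im b p W y ^ 2 = btInf p * Q := by
      simp only [sq, Im]
      rw [hg, hQ, kerForm, ← integral_const_mul]
      refine integral_congr_ae ?_
      filter_upwards [ae_vol_prod_ne] with x hx
      rw [(kp_mul_kp_integral hp hp2 hx).2]; ring
    rw [← e]
    exact setIntegral_le_integral hint (Filter.Eventually.of_forall fun y => sq_nonneg _)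
  -- the mixed Gram identity
  have hmixed : 2 * ∫ y, Ip b p W y * Im b p W y ∂vol 0 b = bt p p * Q := by
    have hi : Integrable (fun q : (ℝ × ℝ) × ℝ => W q.1.1 * W q.1.2 *
        (kp p q.2 q.1.1 * kp p q.1.2 q.2)) (((vol 0 b).prod (vol 0 b)).prod (vol 0 b)) := by
      refine integrable_prod_of_bound (F := fun (x : ℝ × ℝ) y => W x.1 * W x.2 *
        (kp p y x.1 * kp p x.2 y)) (hWm1.mul (hk3.mul hk2)) (hWW.mul_const (bt p p)) ?_ ?_
      · refine ae_vol_prod fun x hx s hs => ?_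
        have := (kp_comp (a := 0) (b := b) hp hp hx.1.le hs.2).1.const_mul (W x * W s)
        exact this.congr (Filter.Eventually.of_forall fun y => by simp only; ring)
      · have h1 : ∀ᵐ q ∂(vol 0 b).prod (vol 0 b),
            ∫ y, |W q.1 * W q.2 * (kp p y q.1 * kp p q.2 y)| ∂vol 0 b =
              |W q.1 * W q.2| * (bt p p * kp (p + p) q.2 q.1) := by
          refine ae_vol_prod fun x hx s hs => ?_
          simp only [abs_mul (W x * W s),
            abs_of_nonneg (mul_nonneg (kp_nonneg p _ x) (kp_nonneg p s _)), integral_const_mul]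
          rw [← (kp_comp (a := 0) (b := b) hp hp hx.1.le hs.2).2]
          simp only [mul_comm]
        filter_upwards [h1, ae_vol_prod_ne] with q hq hne
        rw [hq, abs_mul (W q.1 * W q.2),
          abs_of_nonneg (Real.rpow_nonneg (abs_nonneg (q.1 - q.2)) (2 * p - 1)),
          abs_rpow_eq_kp hne, ← two_mul p]
        have := kp_nonneg (2 * p) q.1 q.2
        have h3 := mul_nonneg (mul_nonneg (abs_nonneg (W q.1 * W q.2)) hbt.le) this
        nlinarith
    have hg := integral_mul_transform (G₁ := fun y s => kp p y s) (G₂ := fun y s => kp p s y) hi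
    have e1 : ∫ y, Ip b p W y * Im b p W y ∂vol 0 b =
        ∫ q, W q.1 * W q.2 * (bt p p * kp (2 * p) q.2 q.1) ∂(vol 0 b).prod (vol 0 b) := by
      simp only [Ip, Im]
      rw [hg]
      refine integral_congr_ae (ae_vol_prod fun x hx s hs => ?_)
      simp only
      rw [two_mul p, ← (kp_comp (a := 0) (b := b) hp hp hx.1.le hs.2).2]
      simp only [mul_comm]
    have hiQ : Integrable (fun q : ℝ × ℝ => W q.1 * W q.2 * (bt p p * kp (2 * p) q.2 q.1))
        ((vol 0 b).prod (vol 0 b)) := by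
      refine (hWW.mul_const (bt p p)).mono' ?_ ?_
      · exact (((hW.meas.comp measurable_fst).mul (hW.meas.comp measurable_snd)).mul
          (((measurable_kp (2 * p)).comp measurable_swap).const_mul _)).aestronglyMeasurable
      · filter_upwards [ae_vol_prod_ne] with q hne
        rw [Real.norm_eq_abs, abs_mul (W q.1 * W q.2), abs_mul (W q.1 * W q.2),
          abs_of_nonneg (Real.rpow_nonneg (abs_nonneg (q.1 - q.2)) (2 * p - 1)),
          abs_rpow_eq_kp hne, abs_of_nonneg (mul_nonneg hbt.le (kp_nonneg (2 * p) q.2 q.1))]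
        have := kp_nonneg (2 * p) q.1 q.2
        have h3 := mul_nonneg (mul_nonneg (abs_nonneg (W q.1 * W q.2)) hbt.le) this
        nlinarith
    have e2 : ∫ q, W q.1 * W q.2 * (bt p p * kp (2 * p) q.2 q.1) ∂(vol 0 b).prod (vol 0 b) =
        ∫ q, W q.1 * W q.2 * (bt p p * kp (2 * p) q.1 q.2) ∂(vol 0 b).prod (vol 0 b) := by
      rw [← integral_prod_swap]
      congr 1; ext q; simp only [Prod.fst_swap, Prod.snd_swap]; ring
    have hiQ' : Integrable (fun q : ℝ × ℝ => W q.1 * W q.2 * (bt p p * kp (2 * p) q.1 q.2))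
        ((vol 0 b).prod (vol 0 b)) := by
      refine hiQ.swap.congr (Filter.Eventually.of_forall fun q => ?_)
      simp only [Function.comp, Prod.fst_swap, Prod.snd_swap]; ring
    rw [two_mul, e1]
    nth_rewrite 2 [e2]
    rw [← integral_add hiQ hiQ', hQ, kerForm, ← integral_const_mul]
    refine integral_congr_ae ?_
    filter_upwards [ae_vol_prod_ne] with q hne
    rw [abs_rpow_eq_kp hne]; ring
  have hcs := (integral_mul_sq_le hP.meas.aestronglyMeasurable hM.meas.aestronglyMeasurable
    hP.sq_integrable hM.sq_integrable).2
  set X := ∫ y, Im b p W y ^ 2 ∂vol 0 b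
  set Y := ∫ y, Ip b p W y ^ 2 ∂vol 0 b
  set D := ∫ y, Ip b p W y * Im b p W y ∂vol 0 b
  have hX0 : 0 ≤ X := integral_nonneg fun y => sq_nonneg _
  have hY0 : 0 ≤ Y := integral_nonneg fun y => sq_nonneg _
  -- The right integral satisfies `X ≤ btInf p · Q` because its Gram identity holds on the full
  -- line, whereas the mixed product is an exact multiple of the same `Q`. Eliminating `Q` gives `X
  -- ≤ c D`, and Cauchy–Schwarz `D² ≤ Y X` allows one factor `X` to be cancelled.
  have hQD : Q = 2 * D / bt p p := by rw [hmixed]; field_simp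
  set c := 2 * btInf p / bt p p with hc
  have hXD : X ≤ c * D := by
    refine hupper.trans (le_of_eq ?_)
    rw [hQD, hc]; ring
  rcases hX0.eq_or_lt with h | h
  · rw [← h]; positivity
  have h5 : X * X ≤ c ^ 2 * (Y * X) := by
    calc X * X ≤ (c * D) * (c * D) := mul_le_mul hXD hXD hX0 (hX0.trans hXD)
      _ = c ^ 2 * D ^ 2 := by ring
      _ ≤ c ^ 2 * (Y * X) := mul_le_mul_of_nonneg_left hcs (sq_nonneg c)
  have h6 : X * X ≤ (c ^ 2 * Y) * X := by linarith
  exact le_of_mul_le_mul_right h6 h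

theorem kp_one {x y : ℝ} (h : y < x) : kp 1 x y = 1 := by simp [kp, h]

theorem kp_one_of_le {p x y : ℝ} (h : x ≤ y) : kp p x y = 0 := by simp [kp, not_lt.2 h]

theorem kp_zero_right {p x : ℝ} (h : 0 < x) : kp p x 0 = x ^ (p - 1) := by simp [kp, h]

theorem Im_one {b x : ℝ} (hx : x ∈ Ioc 0 b) (f : ℝ → ℝ) : Im b 1 f x = Jb b f x := by
  have e : (fun s => kp 1 s x * f s) = (Ioi x).indicator f := by
    ext s
    by_cases h : x < s
    · rw [indicator_of_mem (mem_Ioi.2 h), kp_one h, one_mul]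
    · rw [indicator_of_notMem (by simpa using h), kp_one_of_le (not_lt.1 h), zero_mul]
  rw [Im, e, integral_indicator measurableSet_Ioi, vol, Measure.restrict_restrict measurableSet_Ioi,
    Jb, intervalIntegral.integral_of_le hx.2]
  congr 2
  ext s
  simp only [mem_inter_iff, mem_Ioi, mem_Ioc]
  exact ⟨fun h => ⟨h.1, h.2.2⟩, fun h => ⟨h.1, hx.1.trans h.1, h.2⟩⟩

theorem BM.rpow_mul {b p : ℝ} (hp : 0 ≤ p) {z : ℝ → ℝ} (hz : BM 0 b z) :
    BM 0 b fun s => s ^ p * z s := by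
  refine BM.mul (f := fun s : ℝ => s ^ p) ⟨by fun_prop, b ^ p, fun x hx => ?_⟩ hz
  rw [abs_of_nonneg (Real.rpow_nonneg hx.1.le _)]
  exact Real.rpow_le_rpow hx.1.le hx.2 hp

theorem vol_ae_ne (a b u : ℝ) : ∀ᵐ x ∂vol a b, x ≠ u :=
  ae_restrict_of_ae (compl_mem_ae_iff.2 (measure_singleton u))

/-- The weighted fractional integral of `Im b p (s ^ p * z)` is the Riesz potential of `z`. -/
theorem integral_kp_weight_Im {b p x : ℝ} (hp : 0 < p) (hp2 : p < 1 / 2) {z : ℝ → ℝ}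
    (hz : BM 0 b z) (hx : x ∈ Ioc 0 b) :
    ∫ y, kp p x y * kp (1 - 2 * p) y 0 * Im b p (fun s => s ^ p * z s) y ∂vol 0 b =
      bt (1 - 2 * p) p * (x ^ (-p) * Ik (2 * p) 0 b z x) := by
  have hq : 0 < 1 - 2 * p := by linarith
  have h := transform_comp (a := 0) (b := b) (k := fun y => kp p x y * kp (1 - 2 * p) y 0)
    (K := fun y u => kp p u y) (R := fun _ => b ^ p / p)
    ((measurable_kp_left p x).mul (measurable_kp_right _ 0)) (measurable_kp_swap p)
    (fun _ _ => kp_nonneg _ _ _) (fun _ hy => (kp_integrable_right hp (Ioc_subset_Icc_self hy)).1)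
    (fun _ hy => kp_right_le hp hy)
    ((kp_comp hp hq le_rfl hx.2).1.abs.mul_const _) (hz.rpow_mul hp.le)
  unfold Im
  rw [h, Ik, ← integral_const_mul, ← integral_const_mul]
  refine integral_congr_ae ?_
  filter_upwards [vol_ae_ne 0 b x, ae_vol (p := fun u => u ∈ Ioc 0 b) fun u hu => hu] with u hu hu2
  have e := (kp_mul_kp_weight_integral (b := b) hp hp2 (Ne.symm hu) hx hu2).2
  have e' : ∫ y, kp p x y * kp (1 - 2 * p) y 0 * kp p u y ∂vol 0 b =
      bt (1 - 2 * p) p * (x ^ (-p) * u ^ (-p) * |x - u| ^ (2 * p - 1)) := by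
    rw [← e]; congr 1; ext y; ring
  rw [e']
  have : u ^ (-p) * u ^ p = 1 := by
    rw [← Real.rpow_add hu2.1]; simp
  calc _ = bt (1 - 2 * p) p * (x ^ (-p) * (|x - u| ^ (2 * p - 1) * z u)) * (u ^ (-p) * u ^ p) := by
        ring
    _ = _ := by rw [this, mul_one]

/-- The primitive of the weighted fractional integral. -/
theorem integral_kp_one_weight {b p η : ℝ} (hp : 0 < p) (hp2 : p < 1 / 2) {W : ℝ → ℝ}
    (hW : BM 0 b W) (hη : η ∈ Ioc 0 b) :
    bt (1 - p) p * ∫ y, kp 1 η y * (kp (1 - 2 * p) y 0 * W y) ∂vol 0 b =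
      ∫ x, kp (1 - p) η x * ∫ y, kp p x y * kp (1 - 2 * p) y 0 * W y ∂vol 0 b ∂vol 0 b := by
  have hq : 0 < 1 - 2 * p := by linarith
  have hq' : 0 < 1 - p := by linarith
  have h := transform_comp (a := 0) (b := b) (k := fun x => kp (1 - p) η x)
    (K := fun x y => kp p x y * kp (1 - 2 * p) y 0)
    (R := fun x => bt p (1 - 2 * p) * kp (p + (1 - 2 * p)) x 0)
    (measurable_kp_left _ η)
    ((measurable_kp p).mul ((measurable_kp_right (1 - 2 * p) 0).comp measurable_snd))
    (fun _ _ => mul_nonneg (kp_nonneg _ _ _) (kp_nonneg _ _ _))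
    (fun x hx => (kp_comp hp hq le_rfl hx.2).1)
    (fun x hx => (kp_comp hp hq le_rfl hx.2).2.le) (by
      have := (kp_comp (a := 0) (b := b) (x := η) (s := 0) hq'
        (show 0 < p + (1 - 2 * p) by linarith) le_rfl hη.2).1.const_mul (bt p (1 - 2 * p))
      refine this.congr (Filter.Eventually.of_forall fun x => ?_)
      simp only [abs_of_nonneg (kp_nonneg _ _ _)]
      ring) hW
  rw [h, ← integral_const_mul]
  refine integral_congr_ae (ae_vol fun y hy => ?_)
  -- Kernels of orders `1 - p` and `p` compose to order `1`, that is, to an ordinary primitive: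
  -- Abel's inversion.
  have := (kp_comp (a := 0) (b := b) hq' hp hy.1.le hη.2).2
  rw [sub_add_cancel] at this
  simp only
  rw [← mul_assoc, ← this, ← integral_mul_const, ← integral_mul_const]
  congr 1; ext x; ring

/-- By Abel inversion the primitive of `y ^ (-2 p) W` is an integral of order `1 - p` of `x ^ (-p)`
times the Riesz potential of `z`. Cauchy–Schwarz against the potential leaves the square of the
kernel, again a beta integral. -/
theorem integral_kp_one_weight_sq_le {b p : ℝ} (hp : 0 < p) (hp2 : p < 1 / 2) :
    ∃ C > 0, ∀ z : ℝ → ℝ, BM 0 b z → ∀ η ∈ Ioc 0 b,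
      (∫ y, kp 1 η y * (kp (1 - 2 * p) y 0 * Im b p (fun s => s ^ p * z s) y) ∂vol 0 b) ^ 2 ≤
        C * (η ^ (1 - 4 * p) * ∫ x, Ik (2 * p) 0 b z x ^ 2 ∂vol 0 b) := by
  have hq : 0 < 1 - 2 * p := by linarith
  have hq' : 0 < 1 - p := by linarith
  have b1 := bt_pos hq' hp
  have b2 := bt_pos hq hp
  have b3 := bt_pos hq hq
  refine ⟨(bt (1 - 2 * p) p) ^ 2 * bt (1 - 2 * p) (1 - 2 * p) / (bt (1 - p) p) ^ 2, by positivity,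
    fun z hz η hη => ?_⟩
  have hW := (hz.rpow_mul hp.le).Im hp
  have hg := hz.Ik (show 0 < 2 * p by linarith)
  have h1 := integral_kp_one_weight hp hp2 hW hη
  have h2 : ∫ x, kp (1 - p) η x * ∫ y, kp p x y * kp (1 - 2 * p) y 0 *
      Im b p (fun s => s ^ p * z s) y ∂vol 0 b ∂vol 0 b = bt (1 - 2 * p) p *
        ∫ x, (kp (1 - p) η x * x ^ (-p)) * Ik (2 * p) 0 b z x ∂vol 0 b := by
    rw [← integral_const_mul]
    refine integral_congr_ae (ae_vol fun x hx => ?_)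
    simp only
    rw [integral_kp_weight_Im hp hp2 hz hx]; ring
  -- Squaring doubles the exponents `-p` to `-2 p`, still integrable because `2 p < 1`; hence the
  -- power `η ^ (1 - 4 p)`.
  have hsq : ∀ x ∈ Ioc 0 b, kp (1 - 2 * p) η x * kp (1 - 2 * p) x 0 =
      (kp (1 - p) η x * x ^ (-p)) ^ 2 := by
    intro x hx
    rw [kp_zero_right hx.1, mul_pow, ← Real.rpow_mul_natCast hx.1.le]
    congr 1
    · unfold kp
      split_ifs with h
      · rw [← Real.rpow_mul_natCast (sub_nonneg.2 h.le)]; congr 1; push_cast; ring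
      · simp
    · congr 1; push_cast; ring
  have hc := kp_comp (a := 0) (b := b) hq hq le_rfl hη.2
  have hcs := (integral_mul_sq_le (μ := vol 0 b) (f := fun x => kp (1 - p) η x * x ^ (-p))
    ((measurable_kp_left _ _).mul (by fun_prop)).aestronglyMeasurable
    hg.meas.aestronglyMeasurable (hc.1.congr (ae_vol hsq)) hg.sq_integrable).2
  rw [← integral_congr_ae (ae_vol hsq), hc.2, kp_zero_right hη.1] at hcs
  rw [h2] at h1
  set Γ := ∫ y, kp 1 η y * (kp (1 - 2 * p) y 0 * Im b p (fun s => s ^ p * z s) y) ∂vol 0 b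
  set G := ∫ x, Ik (2 * p) 0 b z x ^ 2 ∂vol 0 b
  set S := ∫ x, (kp (1 - p) η x * x ^ (-p)) * Ik (2 * p) 0 b z x ∂vol 0 b
  have e : Γ = bt (1 - 2 * p) p * S / bt (1 - p) p := by rw [← h1]; field_simp
  have e4 : 1 - 2 * p + (1 - 2 * p) - 1 = 1 - 4 * p := by ring
  rw [e4] at hcs
  rw [e, div_pow, mul_pow, div_mul_eq_mul_div]
  refine div_le_div_of_nonneg_right ?_ (by positivity)
  calc _ ≤ bt (1 - 2 * p) p ^ 2 * (bt (1 - 2 * p) (1 - 2 * p) * η ^ (1 - 4 * p) * G) :=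
        mul_le_mul_of_nonneg_left hcs (sq_nonneg _)
    _ = _ := by ring

/-- The graph of the concave power lies below its tangent at `η`; this is Bernoulli's inequality. -/
theorem rpow_sub_rpow_le {r x η : ℝ} (hr : 0 < r) (hr1 : r ≤ 1) (hη : 0 < η) (hx : η ≤ x) :
    x ^ r - η ^ r ≤ r * η ^ (r - 1) * (x - η) := by
  have h := rpow_one_add_le_one_add_mul_self (s := (x - η) / η) (p := r)
    (by have : 0 ≤ (x - η) / η := div_nonneg (sub_nonneg.2 hx) hη.le
        linarith) hr.le hr1
  have e : 1 + (x - η) / η = x / η := by field_simp; ring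
  rw [e, Real.div_rpow (hη.le.trans hx) hη.le, div_le_iff₀ (Real.rpow_pos_of_pos hη _)] at h
  rw [Real.rpow_sub_one hη.ne']
  have : (1 + r * ((x - η) / η)) * η ^ r = η ^ r + r * (η ^ r / η) * (x - η) := by ring
  linarith

/-! ### Removing the power weight by a commutator -/

/-- The kernel of the commutator of a one-sided fractional integral with a power weight. -/
noncomputable def commKer (p x η : ℝ) : ℝ :=
  if η < x then 2 * p * η ^ (2 * p - 1) * (x - η) ^ (p - 1) -
    (1 - p) * (x - η) ^ (p - 2) * (x ^ (2 * p) - η ^ (2 * p)) else 0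

theorem measurable_commKer (p x : ℝ) : Measurable (commKer p x) := by
  unfold commKer
  exact Measurable.ite measurableSet_Iio (by fun_prop) measurable_const

/-- The tangent bound shows that the subtracted term is at most the first one, since `1 - p ≤ 1`.
The kernel is thus nonnegative and no more singular than its first term. -/
theorem commKer_bounds {p x η : ℝ} (hp : 0 < p) (hp2 : p < 1 / 2) (hη : 0 < η) :
    0 ≤ commKer p x η ∧ commKer p x η ≤ 2 * p * (kp p x η * kp (2 * p) η 0) := by
  unfold commKer
  split_ifs with h
  · have hd : 0 < x - η := sub_pos.2 h
    have h1 := rpow_sub_rpow_le (r := 2 * p) (by linarith) (by linarith) hη h.le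
    have h0 : 0 ≤ x ^ (2 * p) - η ^ (2 * p) :=
      sub_nonneg.2 (Real.rpow_le_rpow hη.le h.le (by linarith))
    have e : (x - η) ^ (p - 1) = (x - η) ^ (p - 2) * (x - η) := by
      rw [← Real.rpow_add_one hd.ne']; congr 1; ring
    have hA : 0 ≤ (x - η) ^ (p - 2) := Real.rpow_nonneg hd.le _
    rw [kp_zero_right hη, kp, if_pos h]
    constructor
    · rw [sub_nonneg]
      calc (1 - p) * (x - η) ^ (p - 2) * (x ^ (2 * p) - η ^ (2 * p))
          ≤ 1 * (x - η) ^ (p - 2) * (2 * p * η ^ (2 * p - 1) * (x - η)) := by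
            gcongr; linarith
        _ = _ := by rw [e]; ring
    · have : 0 ≤ (1 - p) * (x - η) ^ (p - 2) * (x ^ (2 * p) - η ^ (2 * p)) :=
        mul_nonneg (mul_nonneg (by linarith) hA) h0
      linarith
  · rw [kp_one_of_le (not_lt.1 h)]; simp

theorem commKer_integrable {b p x : ℝ} (hp : 0 < p) (hp2 : p < 1 / 2) (hx : x ≤ b) :
    Integrable (commKer p x) (vol 0 b) := by
  refine (((kp_comp (a := 0) (b := b) (s := 0) hp (show 0 < 2 * p by linarith) le_rfl
    hx).1).const_mul (2 * p)).mono' (measurable_commKer p x).aestronglyMeasurable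
    (ae_vol fun η hη => ?_)
  obtain ⟨h1, h2⟩ := commKer_bounds (x := x) hp hp2 hη.1
  rwa [Real.norm_eq_abs, abs_of_nonneg h1]

/-- The kernel is the `η`-derivative of `-(x - η) ^ (p - 1) (x ^ (2 p) - η ^ (2 p))`, which tends to
zero as `η → x` because the difference of powers is `O(x - η)`. Only the value at `η = y` survives.
-/
theorem integral_commKer {b p x y : ℝ} (hp : 0 < p) (hp2 : p < 1 / 2) (hx : x ∈ Ioc 0 b)
    (hy : y ∈ Ioc 0 b) : ∫ η, commKer p x η * kp 1 η y ∂vol 0 b =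
      kp p x y * (x ^ (2 * p) - y ^ (2 * p)) := by
  by_cases hyx : x ≤ y
  · rw [kp_one_of_le hyx, zero_mul]
    refine integral_eq_zero_of_ae (ae_vol fun η hη => ?_)
    by_cases h : η < x
    · simp [kp_one_of_le (p := 1) (h.le.trans hyx)]
    · simp [commKer, h]
  have hyx := not_le.1 hyx
  have e : (fun η => commKer p x η * kp 1 η y) = (Ioo y x).indicator (commKer p x) := by
    ext η
    by_cases h : η ∈ Ioo y x
    · rw [indicator_of_mem h, kp_one h.1, mul_one]
    · rw [indicator_of_notMem h]
      rw [mem_Ioo, not_and_or, not_lt, not_lt] at h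
      rcases h with h | h
      · rw [kp_one_of_le h, mul_zero]
      · simp [commKer, not_lt.2 h]
  have e2 : (Ioo y x ∩ Ioc 0 b : Set ℝ) = Ioo y x :=
    inter_eq_left.2 fun s hs => ⟨hy.1.trans hs.1, (hs.2.trans_le hx.2).le⟩
  rw [e, integral_indicator measurableSet_Ioo, vol, Measure.restrict_restrict measurableSet_Ioo, e2,
    ← integral_Ioc_eq_integral_Ioo, ← intervalIntegral.integral_of_le hyx.le]
  have hder : ∀ η ∈ Ioo y x, HasDerivAt
      (fun η => -((x - η) ^ (p - 1) * (x ^ (2 * p) - η ^ (2 * p)))) (commKer p x η) η := by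
    intro η hη
    have hη0 : 0 < η := hy.1.trans hη.1
    have hd : 0 < x - η := sub_pos.2 hη.2
    have h1 : HasDerivAt (fun η => (x - η) ^ (p - 1)) (-1 * (p - 1) * (x - η) ^ (p - 1 - 1)) η :=
      ((hasDerivAt_id η).const_sub x).rpow_const (Or.inl hd.ne')
    have h2 : HasDerivAt (fun η : ℝ => η ^ (2 * p)) (2 * p * η ^ (2 * p - 1)) η :=
      Real.hasDerivAt_rpow_const (Or.inl hη0.ne')
    refine ((h1.mul (h2.const_sub (x ^ (2 * p)))).neg).congr_deriv ?_
    have e3 : commKer p x η = 2 * p * η ^ (2 * p - 1) * (x - η) ^ (p - 1) -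
        (1 - p) * (x - η) ^ (p - 2) * (x ^ (2 * p) - η ^ (2 * p)) := if_pos hη.2
    rw [e3, show p - 1 - 1 = p - 2 by ring]
    ring
  have hint : IntervalIntegrable (commKer p x) volume y x := by
    rw [intervalIntegrable_iff_integrableOn_Ioc_of_le hyx.le]
    exact IntegrableOn.mono_set (commKer_integrable (b := b) hp hp2 hx.2)
      fun s hs => ⟨hy.1.trans hs.1, hs.2.trans hx.2⟩
  have hlimy : Filter.Tendsto (fun η => -((x - η) ^ (p - 1) * (x ^ (2 * p) - η ^ (2 * p))))
      (nhdsWithin y (Ioi y)) (nhds (-((x - y) ^ (p - 1) * (x ^ (2 * p) - y ^ (2 * p))))) := by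
    have h1 : ContinuousAt (fun η => (x - η) ^ (p - 1)) y :=
      ContinuousAt.rpow_const (by fun_prop) (Or.inl (sub_pos.2 hyx).ne')
    have h2 : ContinuousAt (fun η : ℝ => η ^ (2 * p)) y :=
      Real.continuousAt_rpow_const _ _ (Or.inl hy.1.ne')
    exact ((h1.mul (continuousAt_const.sub h2)).neg).tendsto.mono_left nhdsWithin_le_nhds
  have hlimx : Filter.Tendsto (fun η => -((x - η) ^ (p - 1) * (x ^ (2 * p) - η ^ (2 * p))))
      (nhdsWithin x (Iio x)) (nhds 0) := by
    -- The majorant gains a full factor `x - η` from the tangent bound, which raises the exponent `p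
    -- - 1` to `p > 0`.
    have hg : Filter.Tendsto (fun η => 2 * p * y ^ (2 * p - 1) * (x - η) ^ p)
        (nhdsWithin x (Iio x)) (nhds 0) := by
      have : ContinuousAt (fun η => 2 * p * y ^ (2 * p - 1) * (x - η) ^ p) x :=
        continuousAt_const.mul (ContinuousAt.rpow_const (by fun_prop) (Or.inr hp.le))
      have h := this.tendsto.mono_left (nhdsWithin_le_nhds (s := Iio x))
      simpa [Real.zero_rpow hp.ne'] using h
    refine squeeze_zero_norm' ?_ hg
    filter_upwards [Ioo_mem_nhdsLT hyx] with η hη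
    have hη0 : 0 < η := hy.1.trans hη.1
    have hd : 0 < x - η := sub_pos.2 hη.2
    have h1 := rpow_sub_rpow_le (r := 2 * p) (by linarith) (by linarith) hη0 hη.2.le
    have h0 : 0 ≤ x ^ (2 * p) - η ^ (2 * p) :=
      sub_nonneg.2 (Real.rpow_le_rpow hη0.le hη.2.le (by linarith))
    have h3 : η ^ (2 * p - 1) ≤ y ^ (2 * p - 1) :=
      Real.rpow_le_rpow_of_nonpos hy.1 hη.1.le (by linarith)
    rw [norm_neg, Real.norm_eq_abs, abs_of_nonneg (mul_nonneg (Real.rpow_nonneg hd.le _) h0)]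
    calc (x - η) ^ (p - 1) * (x ^ (2 * p) - η ^ (2 * p))
        ≤ (x - η) ^ (p - 1) * (2 * p * y ^ (2 * p - 1) * (x - η)) := by
          refine mul_le_mul_of_nonneg_left (h1.trans ?_) (Real.rpow_nonneg hd.le _)
          gcongr
      _ = 2 * p * y ^ (2 * p - 1) * (x - η) ^ p := by
          rw [Real.rpow_sub_one hd.ne']; field_simp
  rw [intervalIntegral.integral_eq_sub_of_hasDerivAt_of_tendsto hyx hder hint hlimy hlimx, kp,
    if_pos hyx]
  ring

/-- Commutator of the one-sided fractional integral with a power weight. -/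
theorem Ip_eq_sub_commKer {b p x : ℝ} (hp : 0 < p) (hp2 : p < 1 / 2) {W : ℝ → ℝ} (hW : BM 0 b W)
    (hx : x ∈ Ioc 0 b) : Ip b p W x =
      x ^ (2 * p) * (∫ y, kp p x y * kp (1 - 2 * p) y 0 * W y ∂vol 0 b) -
        ∫ η, commKer p x η * ∫ y, kp 1 η y * kp (1 - 2 * p) y 0 * W y ∂vol 0 b ∂vol 0 b := by
  have hq : 0 < 1 - 2 * p := by linarith
  have hR : ∀ η ∈ Ioc 0 b, kp (1 + (1 - 2 * p)) η 0 ≤ b ^ (1 - 2 * p) := fun η hη => by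
    rw [kp_zero_right hη.1, show 1 + (1 - 2 * p) - 1 = 1 - 2 * p by ring]
    exact Real.rpow_le_rpow hη.1.le hη.2 hq.le
  have hb1 := bt_pos one_pos hq
  have h := transform_comp (a := 0) (b := b) (k := commKer p x)
    (K := fun η y => kp 1 η y * kp (1 - 2 * p) y 0)
    (R := fun _ => bt 1 (1 - 2 * p) * b ^ (1 - 2 * p)) (measurable_commKer p x)
    ((measurable_kp 1).mul ((measurable_kp_right (1 - 2 * p) 0).comp measurable_snd))
    (fun _ _ => mul_nonneg (kp_nonneg _ _ _) (kp_nonneg _ _ _))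
    (fun x hx => (kp_comp one_pos hq le_rfl hx.2).1)
    (fun η hη => by
      rw [(kp_comp one_pos hq le_rfl hη.2).2]
      exact mul_le_mul_of_nonneg_left (hR η hη) hb1.le)
    ((commKer_integrable hp hp2 hx.2).abs.mul_const _) hW
  have hi := integrable_transform (kp_comp (a := 0) (b := b) hp hq le_rfl hx.2).1 hW
  have hi2 := integrable_transform (kp_integrable_left (a := 0) (b := b) hp
    (Ioc_subset_Icc_self hx)).1 hW
  rw [h, ← integral_const_mul, Ip, eq_sub_iff_add_eq]
  have e : ∀ y ∈ Ioc 0 b, (∫ η, commKer p x η * (kp 1 η y * kp (1 - 2 * p) y 0) ∂vol 0 b) * W y =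
      x ^ (2 * p) * (kp p x y * kp (1 - 2 * p) y 0 * W y) - kp p x y * W y := by
    intro y hy
    simp only [← mul_assoc]
    rw [integral_mul_const, integral_commKer hp hp2 hx hy, kp_zero_right hy.1]
    have : y ^ (2 * p) * y ^ (1 - 2 * p - 1) = 1 := by
      rw [← Real.rpow_add hy.1]; ring_nf; simp
    linear_combination (-(kp p x y * W y)) * this
  rw [integral_congr_ae (ae_vol e), integral_sub (hi.const_mul _) hi2]
  ring

/-- With `W` the right integral of `s ^ p z`, the left integral of `y ^ (-2 p) W` is a multiple of
`x ^ (-p)` times the potential `g`. Multiplying by `x ^ (2 p)` gives the harmless `x ^ p g`, and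
moving the weight inside costs the commutator, bounded pointwise by a multiple of `‖g‖ x ^ (p - 1 /
2)`, which is square integrable since `p > 0`. -/
theorem integral_Ip_sq_le {b p : ℝ} (hb : 0 < b) (hp : 0 < p) (hp2 : p < 1 / 2) :
    ∃ C > 0, ∀ z : ℝ → ℝ, BM 0 b z →
      ∫ x, Ip b p (Im b p fun s => s ^ p * z s) x ^ 2 ∂vol 0 b ≤
        C * ∫ x, Ik (2 * p) 0 b z x ^ 2 ∂vol 0 b := by
  obtain ⟨C, hC, h⟩ := integral_kp_one_weight_sq_le (b := b) hp hp2
  have b2 := bt_pos (show 0 < 1 - 2 * p by linarith) hp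
  have b3 := bt_pos hp (show (0 : ℝ) < 1 / 2 by norm_num)
  set c0 := bt (1 - 2 * p) p
  set D := 2 * p * √C * bt p (1 / 2)
  have h2p : 0 < 2 * p := by linarith
  have hint : Integrable (fun x : ℝ => kp (2 * p) x 0) (vol 0 b) ∧
      ∫ x, kp (2 * p) x 0 ∂vol 0 b = (b - 0) ^ (2 * p) / (2 * p) :=
    kp_integrable_right h2p ⟨le_rfl, hb.le⟩
  refine ⟨2 * (c0 ^ 2 * b ^ (2 * p)) + 2 * (D ^ 2 * (b ^ (2 * p) / (2 * p))), by positivity,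
    fun z hz => ?_⟩
  have hW := (hz.rpow_mul hp.le).Im hp
  have hP := hW.Ip hp
  have hg := hz.Ik h2p
  set W := Im b p fun s => s ^ p * z s
  set g := Ik (2 * p) 0 b z
  set G := ∫ x, g x ^ 2 ∂vol 0 b with hG
  have hG0 : 0 ≤ G := integral_nonneg fun x => sq_nonneg _
  have key : ∀ x ∈ Ioc 0 b, Ip b p W x ^ 2 ≤
      2 * (c0 ^ 2 * b ^ (2 * p)) * g x ^ 2 + 2 * (D ^ 2 * G) * kp (2 * p) x 0 := by
    intro x hx
    rw [Ip_eq_sub_commKer hp hp2 hW hx, integral_kp_weight_Im hp hp2 hz hx]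
    set A := ∫ η, commKer p x η * ∫ y, kp 1 η y * kp (1 - 2 * p) y 0 * W y ∂vol 0 b ∂vol 0 b
    have hk := kp_comp (a := 0) (b := b) hp (show (0 : ℝ) < 1 / 2 by norm_num) le_rfl hx.2
    -- The kernel bound carries `η ^ (2 p - 1)` and the primitive bound `η ^ (1 / 2 - 2 p)`. Their
    -- product `η ^ (-1 / 2)` is a power kernel of order `1 / 2` at the origin.
    have hA : |A| ≤ D * √G * x ^ (p - 1 / 2) := by
      have h1 : |A| ≤ ∫ η, 2 * p * √C * √G * (kp p x η * kp (1 / 2) η 0) ∂vol 0 b := by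
        rw [← Real.norm_eq_abs]
        refine (norm_integral_le_of_norm_le (hk.1.const_mul _) (ae_vol fun η hη => ?_))
        obtain ⟨k0, k1⟩ := commKer_bounds (x := x) hp hp2 hη.1
        rw [norm_mul, Real.norm_eq_abs, Real.norm_eq_abs, abs_of_nonneg k0]
        have hη0 : 0 < η := hη.1
        have h3 := h z hz η hη
        simp only [← mul_assoc] at h3
        have h4 : |∫ y, kp 1 η y * kp (1 - 2 * p) y 0 * W y ∂vol 0 b| ≤
            √C * √G * η ^ (1 / 2 - 2 * p) := by
          refine abs_le_of_sq_le_sq (h3.trans (le_of_eq ?_)) (by positivity)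
          rw [mul_pow, mul_pow, Real.sq_sqrt hC.le, Real.sq_sqrt hG0,
            ← Real.rpow_mul_natCast hη.1.le]
          have : (1 / 2 - 2 * p) * ((2 : ℕ) : ℝ) = 1 - 4 * p := by push_cast; ring
          rw [this]; ring
        calc _ ≤ 2 * p * (kp p x η * kp (2 * p) η 0) * (√C * √G * η ^ (1 / 2 - 2 * p)) :=
              mul_le_mul k1 h4 (abs_nonneg _) (k0.trans k1)
          _ = _ := by
              rw [kp_zero_right hη.1, kp_zero_right hη.1]
              have : η ^ (2 * p - 1) * η ^ (1 / 2 - 2 * p) = η ^ ((1 : ℝ) / 2 - 1) := by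
                rw [← Real.rpow_add hη.1]; congr 1; ring
              rw [← this]; ring
      rw [integral_const_mul, hk.2, kp_zero_right hx.1] at h1
      refine h1.trans (le_of_eq ?_)
      rw [show p + 1 / 2 - 1 = p - 1 / 2 by ring]; ring
    have hA2 : A ^ 2 ≤ D ^ 2 * G * kp (2 * p) x 0 := by
      rw [← sq_abs]
      refine (pow_le_pow_left₀ (abs_nonneg _) hA 2).trans (le_of_eq ?_)
      rw [mul_pow, mul_pow, Real.sq_sqrt hG0, kp_zero_right hx.1, ← Real.rpow_mul_natCast hx.1.le]
      congr 2; push_cast; ring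
    have e : x ^ (2 * p) * (c0 * (x ^ (-p) * g x)) = c0 * x ^ p * g x := by
      have : x ^ (2 * p) * x ^ (-p) = x ^ p := by rw [← Real.rpow_add hx.1]; congr 1; ring
      rw [← this]; ring
    rw [e]
    have h5 : (c0 * x ^ p * g x) ^ 2 ≤ c0 ^ 2 * b ^ (2 * p) * g x ^ 2 := by
      rw [mul_pow, mul_pow, ← Real.rpow_mul_natCast hx.1.le]
      have : x ^ (p * ((2 : ℕ) : ℝ)) ≤ b ^ (2 * p) := by
        rw [show p * ((2 : ℕ) : ℝ) = 2 * p by push_cast; ring]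
        exact Real.rpow_le_rpow hx.1.le hx.2 h2p.le
      gcongr
    nlinarith [sq_nonneg (c0 * x ^ p * g x + A)]
  have i1 := hg.sq_integrable.const_mul (2 * (c0 ^ 2 * b ^ (2 * p)))
  have i2 := hint.1.const_mul (2 * (D ^ 2 * G))
  refine (integral_mono_ae hP.sq_integrable (i1.add i2) (ae_vol key)).trans (le_of_eq ?_)
  simp only [Pi.add_apply]
  rw [integral_add i1 i2, integral_const_mul, integral_const_mul, hint.2, sub_zero, ← hG]
  ring

theorem Im_congr {b p : ℝ} {f g : ℝ → ℝ} (h : ∀ x ∈ Ioc 0 b, f x = g x) (y : ℝ) :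
    Im b p f y = Im b p g y :=
  integral_congr_ae (ae_vol fun s hs => by simp only [h s hs])

theorem Im_const_mul (b p c : ℝ) (f : ℝ → ℝ) (y : ℝ) :
    Im b p (fun s => c * f s) y = c * Im b p f y := by
  rw [Im, Im, ← integral_const_mul]; congr 1; ext s; ring

/-- An ordinary primitive has order `1 = p + p + (1 - 2 p)`. The inner right integral is the
function `W` of the commutator estimate, the second is exchanged for a left one by the comparison in
`L²`, and the outer one is bounded on `L²` by Schur's test. -/
theorem integral_Jb_weight_sq_le {b p : ℝ} (hb : 0 < b) (hp : 0 < p) (hp2 : p < 1 / 2) :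
    ∃ C > 0, ∀ z : ℝ → ℝ, BM 0 b z →
      ∫ x, Jb b (fun s => s ^ p * z s) x ^ 2 ∂vol 0 b ≤
        C * ∫ x, Ik (2 * p) 0 b z x ^ 2 ∂vol 0 b := by
  obtain ⟨C, hC, h⟩ := integral_Ip_sq_le hb hp hp2
  have hq : 0 < 1 - 2 * p := by linarith
  have h2p : 0 < 2 * p := by linarith
  have b1 := bt_pos hp hp
  have b2 := bt_pos h2p hq
  set K := (2 * btInf p / bt p p) ^ 2
  set S := b ^ (1 - 2 * p) / (1 - 2 * p)
  have hS : 0 ≤ S := by positivity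
  refine ⟨(bt p p * bt (2 * p) (1 - 2 * p))⁻¹ ^ 2 * (S * S * (K * C)) + 1, by positivity,
    fun z hz => ?_⟩
  have hζ := hz.rpow_mul hp.le
  set ζ : ℝ → ℝ := fun s => s ^ p * z s
  have hW := hζ.Im hp
  have hG0 : 0 ≤ ∫ x, Ik (2 * p) 0 b z x ^ 2 ∂vol 0 b := integral_nonneg fun x => sq_nonneg _
  have e : ∀ x ∈ Ioc 0 b, Jb b ζ x ^ 2 =
      (bt p p * bt (2 * p) (1 - 2 * p))⁻¹ ^ 2 * Im b (1 - 2 * p) (Im b p (Im b p ζ)) x ^ 2 := by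
    intro x hx
    have h1 : Im b (1 - 2 * p) (Im b p (Im b p ζ)) x =
        bt p p * bt (2 * p) (1 - 2 * p) * Jb b ζ x := by
      rw [Im_congr (fun y hy => Im_Im hp hp hζ hy), Im_const_mul, ← two_mul p,
        Im_Im hq h2p hζ hx, add_sub_cancel, Im_one hx]; ring
    rw [h1]; field_simp
  rw [integral_congr_ae (ae_vol e), integral_const_mul]
  have hschur := schur_test (a := 0) (b := b) (K := fun y s => kp (1 - 2 * p) s y)
    (measurable_kp_swap _) (fun _ _ => kp_nonneg _ _ _)
    (fun _ hy => (kp_integrable_right hq (Ioc_subset_Icc_self hy)).1)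
    (fun _ hy => kp_right_le hq hy) (fun _ hy => kp_left_le hq hy) hS (hW.Im hp)
  have h3 : ∫ x, Im b (1 - 2 * p) (Im b p (Im b p ζ)) x ^ 2 ∂vol 0 b ≤
      S * S * (K * C) * ∫ x, Ik (2 * p) 0 b z x ^ 2 ∂vol 0 b := by
    refine hschur.trans ?_
    rw [mul_assoc (S * S), mul_assoc K]
    refine mul_le_mul_of_nonneg_left ?_ (by positivity)
    refine (integral_Im_sq_le hp hp2 hW).trans ?_
    exact mul_le_mul_of_nonneg_left (h z hz) (by positivity)
  have h4 := mul_le_mul_of_nonneg_left h3 (sq_nonneg (bt p p * bt (2 * p) (1 - 2 * p))⁻¹)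
  linarith

/-- Integration by parts of `z = s ^ (-p) (s ^ p z)`, carried out by Fubini because `z` is only
bounded and measurable. -/
theorem Jb_eq_weight {b p x : ℝ} (hp : 0 < p) {z : ℝ → ℝ} (hz : BM 0 b z) (hx : x ∈ Ioc 0 b) :
    Jb b z x = x ^ (-p) * Jb b (fun s => s ^ p * z s) x -
      p * ∫ η in x..b, η ^ (-p - 1) * Jb b (fun s => s ^ p * z s) η := by
  have hζ := hz.rpow_mul hp.le
  set ζ : ℝ → ℝ := fun s => s ^ p * z s with hζd
  have hb : 0 < b := hx.1.trans_le hx.2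
  -- Cutting the weight off at `x > 0` keeps it bounded although it is singular at the origin.
  set k : ℝ → ℝ := (Ioi x).indicator fun η => η ^ (-p - 1) with hk
  have hkm : Measurable k := Measurable.indicator (by fun_prop) measurableSet_Ioi
  have hkb : BM 0 b k := by
    refine ⟨hkm, x ^ (-p - 1), fun η _ => ?_⟩
    rw [hk]
    by_cases h : x < η
    · rw [indicator_of_mem (mem_Ioi.2 h), abs_of_nonneg (Real.rpow_nonneg (hx.1.trans h).le _)]
      exact Real.rpow_le_rpow_of_nonpos hx.1 h.le (by linarith)
    · rw [indicator_of_notMem (by simpa using h), abs_zero]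
      exact Real.rpow_nonneg hx.1.le _
  have h := transform_comp (a := 0) (b := b) (k := k) (K := fun η s => kp 1 s η)
    (R := fun _ => b ^ (1 : ℝ) / 1) hkm (measurable_kp_swap 1)
    (fun _ _ => kp_nonneg _ _ _)
    (fun _ hy => (kp_integrable_right one_pos (Ioc_subset_Icc_self hy)).1)
    (fun _ hy => kp_right_le one_pos hy) (hkb.integrable.abs.mul_const _) hζ
  have hset : (Ioi x ∩ Ioc 0 b : Set ℝ) = Ioc x b := by
    ext s
    simp only [mem_inter_iff, mem_Ioi, mem_Ioc]
    exact ⟨fun h => ⟨h.1, h.2.2⟩, fun h => ⟨h.1, hx.1.trans h.1, h.2⟩⟩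
  have hl : ∫ η in x..b, η ^ (-p - 1) * Jb b ζ η =
      ∫ η, k η * (∫ s, kp 1 s η * ζ s ∂vol 0 b) ∂vol 0 b := by
    have e1 : ∀ η ∈ Ioc 0 b, k η * (∫ s, kp 1 s η * ζ s ∂vol 0 b) =
        (Ioi x).indicator (fun η => η ^ (-p - 1) * Jb b ζ η) η := by
      intro η hη
      have := Im_one hη ζ
      rw [Im] at this
      rw [this, hk]
      by_cases h : x < η
      · rw [indicator_of_mem (mem_Ioi.2 h), indicator_of_mem (mem_Ioi.2 h)]
      · rw [indicator_of_notMem (by simpa using h), indicator_of_notMem (by simpa using h),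
          zero_mul]
    rw [integral_congr_ae (ae_vol e1), integral_indicator measurableSet_Ioi, vol,
      Measure.restrict_restrict measurableSet_Ioi, hset, intervalIntegral.integral_of_le hx.2]
  have hin : ∀ s ∈ Ioc 0 b, p * ((∫ η, k η * kp 1 s η ∂vol 0 b) * ζ s) =
      (Ioi x).indicator (fun s => x ^ (-p) * ζ s - z s) s := by
    intro s hs
    have e : (fun η => k η * kp 1 s η) = (Ioo x s).indicator fun η => η ^ (-p - 1) := by
      ext η
      rw [hk]
      by_cases h1 : x < η
      · by_cases h2 : η < s
        · rw [indicator_of_mem (mem_Ioi.2 h1), indicator_of_mem (mem_Ioo.2 ⟨h1, h2⟩), kp_one h2,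
            mul_one]
        · rw [kp_one_of_le (not_lt.1 h2), mul_zero, indicator_of_notMem fun h => h2 h.2]
      · rw [indicator_of_notMem (by simpa using h1), zero_mul,
          indicator_of_notMem fun h => h1 h.1]
    by_cases hxs : x < s
    · have e2 : (Ioo x s ∩ Ioc 0 b : Set ℝ) = Ioo x s :=
        inter_eq_left.2 fun η hη => ⟨hx.1.trans hη.1, hη.2.le.trans hs.2⟩
      rw [e, integral_indicator measurableSet_Ioo, vol,
        Measure.restrict_restrict measurableSet_Ioo, e2, ← integral_Ioc_eq_integral_Ioo,
        ← intervalIntegral.integral_of_le hxs.le, indicator_of_mem (mem_Ioi.2 hxs),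
        integral_rpow (Or.inr ⟨by linarith, fun h0 => by
          rw [uIcc_of_le hxs.le] at h0; linarith [h0.1, hx.1]⟩)]
      have : s ^ (-p) * s ^ p = 1 := by rw [← Real.rpow_add hs.1]; simp
      rw [show -p - 1 + 1 = -p by ring, hζd]
      field_simp
      linear_combination (-(z s)) * this
    · rw [e, Ioo_eq_empty hxs, indicator_empty, indicator_of_notMem (by simpa using hxs)]
      simp
  have hr : p * ∫ s, (∫ η, k η * kp 1 s η ∂vol 0 b) * ζ s ∂vol 0 b =
      x ^ (-p) * Jb b ζ x - Jb b z x := by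
    have hxI : x ∈ Icc 0 b := Ioc_subset_Icc_self hx
    have hbI : b ∈ Icc 0 b := ⟨hb.le, le_rfl⟩
    rw [← integral_const_mul, integral_congr_ae (ae_vol hin), integral_indicator measurableSet_Ioi,
      vol, Measure.restrict_restrict measurableSet_Ioi, hset,
      ← intervalIntegral.integral_of_le hx.2, intervalIntegral.integral_sub
        ((hζ.intervalIntegrable hxI hbI).const_mul _) (hz.intervalIntegrable hxI hbI),
      intervalIntegral.integral_const_mul, Jb, Jb]
  rw [hl, h, hr]
  ring

/-- Away from the origin the weights `x ^ (-p)` and `η ^ (-p - 1)` are bounded by their values at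
`m`, so the weighted estimate yields the unweighted one there. -/
theorem integral_Jb_sq_le_of_pos {b p m : ℝ} (hp : 0 < p) (hp2 : p < 1 / 2) (hm : 0 < m)
    (hmb : m < b) : ∃ C > 0, ∀ z : ℝ → ℝ, BM 0 b z →
      ∫ x in m..b, Jb b z x ^ 2 ≤ C * ∫ x in 0..b, Ik (2 * p) 0 b z x ^ 2 := by
  have hb := hm.trans hmb
  obtain ⟨C, hC, h⟩ := integral_Jb_weight_sq_le hb hp hp2
  set M1 := m ^ (-p)
  set M2 := m ^ (-p - 1)
  refine ⟨(2 * M1 ^ 2 + 2 * p ^ 2 * M2 ^ 2 * b * b) * C, by positivity, fun z hz => ?_⟩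
  have hζ := hz.rpow_mul hp.le
  have hb0 : b ∈ Icc 0 b := ⟨hb.le, le_rfl⟩
  set ζ : ℝ → ℝ := fun s => s ^ p * z s
  have hZc := continuousOn_Jb hζ hb.le
  have hFc := continuousOn_Jb hz hb.le
  set Z := Jb b ζ
  have hZi := integrable_sq_of_continuousOn hZc
  have hsub : Icc m b ⊆ Icc 0 b := Icc_subset_Icc_left hm.le
  have hsub' : Ioc m b ⊆ Ioc 0 b := Ioc_subset_Ioc_left hm.le
  set Q := ∫ x, Z x ^ 2 ∂vol 0 b with hQ
  have hQ0 : 0 ≤ Q := integral_nonneg fun x => sq_nonneg _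
  have key : ∀ x ∈ Ioc m b, Jb b z x ^ 2 ≤ 2 * M1 ^ 2 * Z x ^ 2 + 2 * p ^ 2 * M2 ^ 2 * b * Q := by
    intro x hx
    have hx0 : 0 < x := hm.trans hx.1
    rw [Jb_eq_weight hp hz (hsub' hx), intervalIntegral.integral_of_le hx.2]
    have hxs : Ioc x b ⊆ Ioc 0 b := Ioc_subset_Ioc_left hx0.le
    have hkc : ContinuousOn (fun η : ℝ => η ^ (-p - 1)) (Icc x b) := fun η hη =>
      (Real.continuousAt_rpow_const _ _ (Or.inl (hx0.trans_le hη.1).ne')).continuousWithinAt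
    have hcs := (integral_mul_sq_le (μ := vol x b) (f := fun η => η ^ (-p - 1)) (g := Z)
      (Measurable.aestronglyMeasurable (by fun_prop))
      ((hZc.mono (Icc_subset_Icc_left hx0.le)).mono Ioc_subset_Icc_self
        |>.aestronglyMeasurable measurableSet_Ioc)
      (integrable_sq_of_continuousOn hkc)
      (integrable_sq_of_continuousOn (hZc.mono (Icc_subset_Icc_left hx0.le)))).2
    have h1 : ∫ η, (η ^ (-p - 1)) ^ 2 ∂vol x b ≤ M2 ^ 2 * b := by
      have : ∫ η, (η ^ (-p - 1)) ^ 2 ∂vol x b ≤ ∫ η, M2 ^ 2 ∂vol x b := by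
        refine integral_mono_ae (integrable_sq_of_continuousOn hkc) (integrable_const _)
          (ae_vol fun η hη => ?_)
        have : η ^ (-p - 1) ≤ M2 :=
          Real.rpow_le_rpow_of_nonpos hm (hx.1.trans hη.1).le (by linarith)
        exact pow_le_pow_left₀ (Real.rpow_nonneg (hx0.trans hη.1).le _) this 2
      refine this.trans ?_
      rw [← intervalIntegral.integral_of_le hx.2, intervalIntegral.integral_const, smul_eq_mul,
        mul_comm]
      exact mul_le_mul_of_nonneg_left (by linarith) (sq_nonneg _)
    have h2 : ∫ η, Z η ^ 2 ∂vol x b ≤ Q :=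
      setIntegral_mono_set hZi (Filter.Eventually.of_forall fun η => sq_nonneg _)
        (LE.le.eventuallyLE hxs)
    have h3 : (∫ η, η ^ (-p - 1) * Z η ∂vol x b) ^ 2 ≤ M2 ^ 2 * b * Q :=
      hcs.trans (mul_le_mul h1 h2 (integral_nonneg fun x => sq_nonneg _) (by positivity))
    have h4 : (x ^ (-p) * Z x) ^ 2 ≤ M1 ^ 2 * Z x ^ 2 := by
      rw [mul_pow]
      refine mul_le_mul_of_nonneg_right ?_ (sq_nonneg _)
      exact pow_le_pow_left₀ (Real.rpow_nonneg hx0.le _)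
        (Real.rpow_le_rpow_of_nonpos hm hx.1.le (by linarith)) 2
    have h5 : (p * ∫ η, η ^ (-p - 1) * Z η ∂vol x b) ^ 2 ≤ p ^ 2 * (M2 ^ 2 * b * Q) := by
      rw [mul_pow]; exact mul_le_mul_of_nonneg_left h3 (sq_nonneg _)
    change (x ^ (-p) * Z x - p * ∫ η, η ^ (-p - 1) * Z η ∂vol x b) ^ 2 ≤ _
    nlinarith [sq_nonneg (x ^ (-p) * Z x + p * ∫ η, η ^ (-p - 1) * Z η ∂vol x b)]
  have hi1 := integrable_sq_of_continuousOn (hZc.mono hsub)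
  rw [intervalIntegral.integral_of_le hmb.le, intervalIntegral.integral_of_le hb.le]
  have h6 : ∫ x, Z x ^ 2 ∂vol m b ≤ Q := setIntegral_mono_set hZi
    (Filter.Eventually.of_forall fun η => sq_nonneg _) (LE.le.eventuallyLE hsub')
  calc ∫ x, Jb b z x ^ 2 ∂vol m b
      ≤ ∫ x, (2 * M1 ^ 2 * Z x ^ 2 + 2 * p ^ 2 * M2 ^ 2 * b * Q) ∂vol m b :=
        integral_mono_ae (integrable_sq_of_continuousOn (hFc.mono hsub))
          ((hi1.const_mul _).add (integrable_const _)) (ae_vol key)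
    _ = 2 * M1 ^ 2 * (∫ x, Z x ^ 2 ∂vol m b) + (b - m) * (2 * p ^ 2 * M2 ^ 2 * b * Q) := by
        rw [integral_add (hi1.const_mul _) (integrable_const _), integral_const_mul,
          ← intervalIntegral.integral_of_le hmb.le (f := fun _ => 2 * p ^ 2 * M2 ^ 2 * b * Q),
          intervalIntegral.integral_const, smul_eq_mul]
    _ ≤ 2 * M1 ^ 2 * Q + b * (2 * p ^ 2 * M2 ^ 2 * b * Q) := by
        gcongr; linarith
    _ = (2 * M1 ^ 2 + 2 * p ^ 2 * M2 ^ 2 * b * b) * Q := by ring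
    _ ≤ (2 * M1 ^ 2 + 2 * p ^ 2 * M2 ^ 2 * b * b) *
          (C * ∫ x, Ik (2 * p) 0 b z x ^ 2 ∂vol 0 b) :=
        mul_le_mul_of_nonneg_left (h z hz) (by positivity)
    _ = _ := by ring

theorem BM.comp_add_left {a b : ℝ} {z : ℝ → ℝ} (hz : BM a b z) :
    BM 0 (b - a) fun s => z (a + s) := by
  obtain ⟨M, hM⟩ := hz.bdd
  exact ⟨hz.meas.comp (measurable_const_add a), M, fun x hx =>
    hM _ ⟨by linarith [hx.1], by linarith [hx.2]⟩⟩

theorem BM.comp_sub_left {a b : ℝ} {z : ℝ → ℝ} (hz : BM a b z) :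
    BM 0 (b - a) fun s => z (b - s) := by
  obtain ⟨M, hM⟩ := hz.bdd
  -- The reflection sends the included endpoint `b - a` to `a`, which is not in `(a, b]`; its value
  -- has to be added to the bound.
  refine ⟨hz.meas.comp (measurable_const_sub b), max M |z a|, fun x hx => ?_⟩
  rcases hx.2.eq_or_lt with h | h
  · rw [h, sub_sub_cancel]; exact le_max_right _ _
  · exact (hM _ ⟨by linarith, by linarith [hx.1]⟩).trans (le_max_left _ _)

/-- **A priori estimate for the Riesz potential on an interval**: the primitive of `z` is
controlled in `L²` by the Riesz potential of `z`. -/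
theorem integral_Jb_sq_le_Ik {a b μ : ℝ} (hab : a < b) (hμ : 0 < μ) (hμ1 : μ < 1) :
    ∃ C > 0, ∀ z : ℝ → ℝ, BM a b z →
      ∫ x, Jb b z x ^ 2 ∂vol a b ≤ C * ∫ x, Ik μ a b z x ^ 2 ∂vol a b := by
  -- The half-line estimate controls `∫_x^b z` off the left third, its reflection controls `∫_a^x z`
  -- off the right third. On the middle third both hold, hence so does a bound for the total
  -- integral `J`, and `J` gives `∫_x^b z` on the missing third.
  set m := (b - a) / 3 with hm
  have hm0 : 0 < m := by rw [hm]; linarith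
  obtain ⟨C, hC, h⟩ := integral_Jb_sq_le_of_pos (b := b - a) (p := μ / 2) (m := m)
    (by linarith) (by linarith) hm0 (by rw [hm]; linarith)
  have e2 : 2 * (μ / 2) = μ := by ring
  rw [e2] at h
  refine ⟨11 * C, by positivity, fun z hz => ?_⟩
  have h0 : (0 : ℝ) ≤ b - a := by linarith
  set G := ∫ x in a..b, Ik μ a b z x ^ 2 with hG
  have hF : ∫ x in (a + m)..b, Jb b z x ^ 2 ≤ C * G := by
    have hJ : ∀ x, Jb (b - a) (fun s => z (a + s)) x = Jb b z (a + x) := fun x => by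
      rw [Jb, Jb, intervalIntegral.integral_comp_add_left (fun s => z s), add_sub_cancel]
    have hI : ∀ x, Ik μ 0 (b - a) (fun s => z (a + s)) x = Ik μ a b z (a + x) := fun x => by
      rw [Ik, Ik, ← intervalIntegral.integral_of_le h0, ← intervalIntegral.integral_of_le hab.le]
      have := intervalIntegral.integral_comp_add_left (a := 0) (b := b - a)
        (fun s => |a + x - s| ^ (μ - 1) * z s) a
      rw [add_zero, add_sub_cancel] at this
      rw [← this]
      congr 1; ext s; rw [add_sub_add_left_eq_sub]
    have h1 := h _ hz.comp_add_left
    simp only [hJ, hI] at h1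
    rw [intervalIntegral.integral_comp_add_left (fun x => Jb b z x ^ 2),
      intervalIntegral.integral_comp_add_left (fun x => Ik μ a b z x ^ 2), add_zero,
      add_sub_cancel] at h1
    exact h1
  have hA : ∫ x in a..(b - m), (∫ s in a..x, z s) ^ 2 ≤ C * G := by
    have hJ : ∀ x, Jb (b - a) (fun s => z (b - s)) x = ∫ s in a..(b - x), z s := fun x => by
      rw [Jb, intervalIntegral.integral_comp_sub_left (fun s => z s), sub_sub_cancel]
    have hI : ∀ x, Ik μ 0 (b - a) (fun s => z (b - s)) x = Ik μ a b z (b - x) := fun x => by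
      rw [Ik, Ik, ← intervalIntegral.integral_of_le h0, ← intervalIntegral.integral_of_le hab.le]
      have := intervalIntegral.integral_comp_sub_left (a := 0) (b := b - a)
        (fun s => |b - x - s| ^ (μ - 1) * z s) b
      rw [sub_zero, sub_sub_cancel] at this
      rw [← this]
      congr 1; ext s; rw [sub_sub_sub_cancel_left, abs_sub_comm]
    have h1 := h _ hz.comp_sub_left
    simp only [hJ, hI] at h1
    rw [intervalIntegral.integral_comp_sub_left (fun x => (∫ s in a..x, z s) ^ 2),
      intervalIntegral.integral_comp_sub_left (fun x => Ik μ a b z x ^ 2), sub_zero,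
      sub_sub_cancel] at h1
    exact h1
  rw [← intervalIntegral.integral_of_le hab.le, ← intervalIntegral.integral_of_le hab.le, ← hG]
  have hFc : ContinuousOn (fun x => Jb b z x ^ 2) (Icc a b) := (continuousOn_Jb hz hab.le).pow 2
  have hAc : ContinuousOn (fun x => (∫ s in a..x, z s) ^ 2) (Icc a b) :=
    (continuousOn_primitive hz hab.le).pow 2
  set J := ∫ s in a..b, z s
  have hJ : ∀ x ∈ Icc a b, (∫ s in a..x, z s) + Jb b z x = J := fun x hx =>
    intervalIntegral.integral_add_adjacent_intervals
      (hz.intervalIntegrable (left_mem_Icc.2 hab.le) hx)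
      (hz.intervalIntegrable hx (right_mem_Icc.2 hab.le))
  have i0 : ∀ {f : ℝ → ℝ} {x y : ℝ}, ContinuousOn f (Icc a b) → a ≤ x → y ≤ b → x ≤ y →
      IntervalIntegrable f volume x y := fun hf hx hy hxy =>
    (hf.mono (by rw [uIcc_of_le hxy]; exact Icc_subset_Icc hx hy)).intervalIntegrable
  have l1 : a ≤ a + m := by linarith
  have l2 : a + m ≤ b - m := by rw [hm]; linarith
  have l3 : b - m ≤ b := by linarith
  have iF1 := i0 hFc le_rfl (l2.trans l3) l1
  have iF2 := i0 hFc l1 l3 l2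
  have iF3 := i0 hFc (l1.trans l2) le_rfl l3
  have iA1 := i0 hAc le_rfl (l2.trans l3) l1
  have iA2 := i0 hAc l1 l3 l2
  have sF := intervalIntegral.integral_add_adjacent_intervals iF1 (iF2.trans iF3)
  have sF2 := intervalIntegral.integral_add_adjacent_intervals iF2 iF3
  have sA := intervalIntegral.integral_add_adjacent_intervals iA1 iA2
  have nF : 0 ≤ ∫ x in (b - m)..b, Jb b z x ^ 2 :=
    intervalIntegral.integral_nonneg l3 fun x _ => sq_nonneg _
  have nA1 : 0 ≤ ∫ x in a..(a + m), (∫ s in a..x, z s) ^ 2 :=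
    intervalIntegral.integral_nonneg l1 fun x _ => sq_nonneg _
  have nA2 : 0 ≤ ∫ x in (a + m)..(b - m), (∫ s in a..x, z s) ^ 2 :=
    intervalIntegral.integral_nonneg l2 fun x _ => sq_nonneg _
  have hmJ : m * J ^ 2 ≤ 2 * (∫ x in (a + m)..(b - m), Jb b z x ^ 2) +
      2 * ∫ x in (a + m)..(b - m), (∫ s in a..x, z s) ^ 2 := by
    have e : m * J ^ 2 = ∫ _x in (a + m)..(b - m), J ^ 2 := by
      rw [intervalIntegral.integral_const, smul_eq_mul]; congr 1; rw [hm]; ring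
    rw [e, ← intervalIntegral.integral_const_mul, ← intervalIntegral.integral_const_mul,
      ← intervalIntegral.integral_add (iF2.const_mul _) (iA2.const_mul _)]
    refine intervalIntegral.integral_mono_on l2 (by simp)
      ((iF2.const_mul _).add (iA2.const_mul _)) fun x hx => ?_
    rw [← hJ x ⟨l1.trans hx.1, hx.2.trans l3⟩]
    nlinarith [sq_nonneg ((∫ s in a..x, z s) - Jb b z x)]
  have hF1 : ∫ x in a..(a + m), Jb b z x ^ 2 ≤ 2 * (m * J ^ 2) +
      2 * ∫ x in a..(a + m), (∫ s in a..x, z s) ^ 2 := by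
    have e : m * J ^ 2 = ∫ _x in a..(a + m), J ^ 2 := by
      rw [intervalIntegral.integral_const, smul_eq_mul]; ring
    rw [e, ← intervalIntegral.integral_const_mul, ← intervalIntegral.integral_const_mul,
      ← intervalIntegral.integral_add (by simp) (iA1.const_mul _)]
    refine intervalIntegral.integral_mono_on l1 iF1
      (IntervalIntegrable.add (by simp) (iA1.const_mul _)) fun x hx => ?_
    have := hJ x ⟨hx.1, hx.2.trans (l2.trans l3)⟩
    have e : Jb b z x = J - ∫ s in a..x, z s := by linarith
    rw [e]
    nlinarith [sq_nonneg (J + ∫ s in a..x, z s)]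
  linarith

/-! ### Polynomials of bounded degree on an interval -/

theorem exists_mem_Ioo_eval_ne_zero {a b : ℝ} (hab : a < b) {q : ℝ[X]} (hq : q ≠ 0) :
    ∃ x ∈ Ioo a b, q.eval x ≠ 0 := by
  by_contra! h
  exact hq (Polynomial.eq_zero_of_infinite_isRoot q ((Ioo_infinite hab).mono h))

theorem integral_bubble_pos {q : ℝ[X]} (hq : q ≠ 0) :
    0 < ∫ x in (0 : ℝ)..1, x * (1 - x) * q.eval x ^ 2 := by
  obtain ⟨x, hx, hx0⟩ := exists_mem_Ioo_eval_ne_zero zero_lt_one hq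
  refine intervalIntegral.integral_pos zero_lt_one (by fun_prop) (fun y hy => ?_)
    ⟨x, Ioo_subset_Icc_self hx, ?_⟩
  · exact mul_nonneg (mul_nonneg hy.1.le (by linarith [hy.2])) (sq_nonneg _)
  · exact mul_pos (mul_pos hx.1 (by linarith [hx.2])) (by positivity)

/-- The coefficients are controlled by a weighted `L²` norm. -/
theorem exists_coeff_sq_le (N : ℕ) : ∃ C > 0, ∀ q : ℝ[X], q.natDegree ≤ N → ∀ i,
    q.coeff i ^ 2 ≤ C * ∫ x in (0 : ℝ)..1, x * (1 - x) * q.eval x ^ 2 := by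
  set B : (Fin (N + 1) → ℝ) → ℝ := fun c =>
    ∫ x in (0 : ℝ)..1, x * (1 - x) * (∑ i, c i * x ^ (i : ℕ)) ^ 2 with hB
  have hcont : Continuous B := by
    refine intervalIntegral.continuous_parametric_intervalIntegral_of_continuous' ?_ 0 1
    unfold Function.uncurry
    fun_prop
  have hBq : ∀ q : ℝ[X], q.natDegree ≤ N → B (fun i => q.coeff i) =
      ∫ x in (0 : ℝ)..1, x * (1 - x) * q.eval x ^ 2 := by
    intro q hq
    refine intervalIntegral.integral_congr fun x _ => ?_
    simp only
    rw [Polynomial.eval_eq_sum_range' (Nat.lt_succ_of_le hq), Finset.sum_range]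
  have hBpos : ∀ c, c ≠ 0 → 0 < B c := by
    intro c hc
    set q : ℝ[X] := ∑ i : Fin (N + 1), Polynomial.C (c i) * Polynomial.X ^ (i : ℕ) with hq
    have he : ∀ x, q.eval x = ∑ i, c i * x ^ (i : ℕ) := fun x => by
      rw [hq, Polynomial.eval_finsetSum]; simp
    have hq0 : q ≠ 0 := by
      intro h0
      apply hc
      ext i
      have := congrArg (fun p => p.coeff (i : ℕ)) h0
      simp only [hq, Polynomial.finsetSum_coeff, Polynomial.coeff_C_mul, Polynomial.coeff_X_pow,
        Polynomial.coeff_zero] at this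
      rw [Finset.sum_eq_single i] at this
      · simpa using this
      · intro j _ hj
        rw [if_neg fun h => hj (Fin.ext h.symm), mul_zero]
      · simp
    have := integral_bubble_pos hq0
    simpa only [he] using this
  have hscale : ∀ (t : ℝ) c, B (t • c) = t ^ 2 * B c := by
    intro t c
    simp only [hB]
    rw [← intervalIntegral.integral_const_mul]
    congr 1; ext x
    simp only [Pi.smul_apply, smul_eq_mul, mul_assoc]
    rw [← Finset.mul_sum]; ring
  -- Compactness: the weighted quadratic form has a positive minimum on the unit sphere of
  -- coefficients, and it is homogeneous of degree two.
  obtain ⟨c₀, hc₀, hmin⟩ := (isCompact_sphere (0 : Fin (N + 1) → ℝ) 1).exists_isMinOn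
    (NormedSpace.sphere_nonempty.2 zero_le_one) hcont.continuousOn
  have hm : 0 < B c₀ := hBpos _ (by rintro rfl; simp at hc₀)
  have hB0 : ∀ c, ‖c‖ ^ 2 ≤ (B c₀)⁻¹ * B c := by
    intro c
    by_cases hc : c = 0
    · subst hc
      have : B 0 = 0 := by have := hscale 0 0; simpa using this
      simp [this]
    have hn : 0 < ‖c‖ := norm_pos_iff.2 hc
    have h1 : B c₀ ≤ B (‖c‖⁻¹ • c) := hmin (by simp [norm_smul, hn.ne'])
    rw [hscale] at h1
    rw [inv_pow, ← div_eq_inv_mul, le_div_iff₀ (by positivity)] at h1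
    rw [← div_eq_inv_mul, le_div_iff₀ hm]
    linarith
  refine ⟨(B c₀)⁻¹, by positivity, fun q hq i => ?_⟩
  rw [← hBq q hq]
  refine le_trans ?_ (hB0 _)
  by_cases hi : i < N + 1
  · rw [← sq_abs]
    exact pow_le_pow_left₀ (abs_nonneg _)
      (norm_le_pi_norm (fun i : Fin (N + 1) => q.coeff i) ⟨i, hi⟩) 2
  · rw [Polynomial.coeff_eq_zero_of_natDegree_lt (by omega), zero_pow two_ne_zero]
    exact sq_nonneg _

theorem abs_eval_le_of_coeff {N : ℕ} {q : ℝ[X]} (hq : q.natDegree ≤ N) {M : ℝ}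
    (h : ∀ i, |q.coeff i| ≤ M) {x : ℝ} (hx : x ∈ Icc (0 : ℝ) 1) : |q.eval x| ≤ (N + 1) * M := by
  rw [Polynomial.eval_eq_sum_range' (Nat.lt_succ_of_le hq)]
  refine (Finset.abs_sum_le_sum_abs _ _).trans ?_
  have : ∀ i ∈ Finset.range (N + 1), |q.coeff i * x ^ i| ≤ M := fun i _ => by
    rw [abs_mul, abs_of_nonneg (pow_nonneg hx.1 i)]
    calc |q.coeff i| * x ^ i ≤ |q.coeff i| * 1 :=
          mul_le_mul_of_nonneg_left (pow_le_one₀ hx.1 hx.2) (abs_nonneg _)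
      _ ≤ M := by rw [mul_one]; exact h i
  refine (Finset.sum_le_card_nsmul _ _ _ this).trans (le_of_eq ?_)
  simp

/-- Inverse estimates on the unit interval. -/
theorem exists_eval_sq_le (N : ℕ) : ∃ C > 0, ∀ q : ℝ[X], q.natDegree ≤ N → ∀ x ∈ Icc (0 : ℝ) 1,
    q.eval x ^ 2 ≤ C * ∫ y in (0 : ℝ)..1, y * (1 - y) * q.eval y ^ 2 ∧
    q.derivative.eval x ^ 2 ≤ C * ∫ y in (0 : ℝ)..1, y * (1 - y) * q.eval y ^ 2 := by
  obtain ⟨C, hC, h⟩ := exists_coeff_sq_le N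
  refine ⟨(N + 1) ^ 4 * C, by positivity, fun q hq x hx => ?_⟩
  set I := ∫ y in (0 : ℝ)..1, y * (1 - y) * q.eval y ^ 2
  have hI : 0 ≤ I := intervalIntegral.integral_nonneg zero_le_one fun y hy =>
    mul_nonneg (mul_nonneg hy.1 (by linarith [hy.2])) (sq_nonneg _)
  have hc : ∀ i, |q.coeff i| ≤ √(C * I) := fun i => Real.abs_le_sqrt (h q hq i)
  have hN : (1 : ℝ) ≤ N + 1 := by simp
  have h1 := abs_eval_le_of_coeff hq hc hx
  have hd : ∀ i, |q.derivative.coeff i| ≤ (N + 1) * √(C * I) := by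
    intro i
    rw [Polynomial.coeff_derivative, abs_mul]
    by_cases hi : i + 1 ≤ N
    · have : |(i : ℝ) + 1| ≤ N + 1 := by
        rw [abs_of_nonneg (by positivity)]
        have : ((i + 1 : ℕ) : ℝ) ≤ N := Nat.cast_le.2 hi
        push_cast at this; linarith
      rw [mul_comm]
      exact mul_le_mul this (hc _) (abs_nonneg _) (by positivity)
    · rw [Polynomial.coeff_eq_zero_of_natDegree_lt (by omega)]
      simp only [abs_zero, zero_mul]; positivity
  have h2 := abs_eval_le_of_coeff ((Polynomial.natDegree_derivative_le q).trans
    ((Nat.sub_le _ _).trans hq)) hd hx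
  have e : ((N + 1 : ℝ) * ((N + 1) * √(C * I))) ^ 2 = (N + 1) ^ 4 * C * I := by
    rw [mul_pow, mul_pow, Real.sq_sqrt (by positivity)]; ring
  constructor
  · rw [← e, ← sq_abs]
    refine pow_le_pow_left₀ (abs_nonneg _) (h1.trans ?_) 2
    have : 0 ≤ (N + 1 : ℝ) * √(C * I) := by positivity
    nlinarith
  · rw [← e, ← sq_abs]
    exact pow_le_pow_left₀ (abs_nonneg _) h2 2

/-- Inverse estimates on an interval, with a bubble weight. -/
theorem exists_inverse_bubble (N : ℕ) : ∃ C > 0, ∀ (l r : ℝ), l < r → ∀ q : ℝ[X],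
    q.natDegree ≤ N → ∀ x ∈ Icc l r,
      (r - l) ^ 3 * q.eval x ^ 2 ≤ C * ∫ y in l..r, (y - l) * (r - y) * q.eval y ^ 2 ∧
      (r - l) ^ 5 * q.derivative.eval x ^ 2 ≤
        C * ∫ y in l..r, (y - l) * (r - y) * q.eval y ^ 2 := by
  obtain ⟨C, hC, h⟩ := exists_eval_sq_le N
  refine ⟨C, hC, fun l r hlr q hq x hx => ?_⟩
  set d := r - l with hd
  have hd0 : 0 < d := sub_pos.2 hlr
  set Q := q.comp (Polynomial.C l + Polynomial.C d * Polynomial.X) with hQ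
  have hQN : Q.natDegree ≤ N := by
    refine Polynomial.natDegree_comp_le.trans ?_
    have : (Polynomial.C l + Polynomial.C d * Polynomial.X : ℝ[X]).natDegree ≤ 1 := by
      rw [add_comm]; exact Polynomial.natDegree_linear_le
    calc _ ≤ q.natDegree * 1 := Nat.mul_le_mul_left _ this
      _ ≤ N := by omega
  have he : ∀ y, Q.eval y = q.eval (l + d * y) := fun y => by simp [hQ]
  have hde : ∀ y, Q.derivative.eval y = d * q.derivative.eval (l + d * y) := fun y => by
    simp [hQ, Polynomial.derivative_comp]
  -- Scaling: the bubble contributes `d²` and the measure `d`, whence the exponent `3`; squaring a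
  -- derivative adds the two further powers in the exponent `5`.
  have hI : d ^ 3 * ∫ y in (0 : ℝ)..1, y * (1 - y) * Q.eval y ^ 2 =
      ∫ y in l..r, (y - l) * (r - y) * q.eval y ^ 2 := by
    have := intervalIntegral.integral_comp_add_mul (a := 0) (b := 1)
      (fun y => (y - l) * (r - y) * q.eval y ^ 2) hd0.ne' l
    rw [mul_zero, add_zero, mul_one, show l + d = r by rw [hd]; ring, smul_eq_mul] at this
    rw [eq_comm, inv_mul_eq_iff_eq_mul₀ hd0.ne', ← intervalIntegral.integral_const_mul] at this
    rw [this, ← intervalIntegral.integral_const_mul]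
    congr 1; ext y
    rw [he, show r - (l + d * y) = d * (1 - y) by rw [hd]; ring]; ring
  have hy : (x - l) / d ∈ Icc (0 : ℝ) 1 := by
    refine ⟨div_nonneg (by linarith [hx.1]) hd0.le, ?_⟩
    rw [div_le_one hd0, hd]; linarith [hx.2]
  have hxy : l + d * ((x - l) / d) = x := by field_simp; ring
  have := h Q hQN _ hy
  rw [he, hde, hxy] at this
  rw [← hI]
  have h3 : 0 < d ^ 3 := by positivity
  constructor
  · nlinarith [mul_le_mul_of_nonneg_left this.1 h3.le]
  · nlinarith [mul_le_mul_of_nonneg_left this.2 h3.le]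

theorem integral_bubble_le {l r : ℝ} (hlr : l ≤ r) (q : ℝ[X]) :
    ∫ y in l..r, (y - l) * (r - y) * q.eval y ^ 2 ≤ (r - l) ^ 2 * ∫ y in l..r, q.eval y ^ 2 := by
  rw [← intervalIntegral.integral_const_mul]
  refine intervalIntegral.integral_mono_on hlr
    (Continuous.intervalIntegrable (by fun_prop) _ _)
    (Continuous.intervalIntegrable (by fun_prop) _ _) fun y hy => ?_
  refine mul_le_mul_of_nonneg_right ?_ (sq_nonneg _)
  nlinarith [hy.1, hy.2, mul_nonneg (sub_nonneg.2 hy.1) (sub_nonneg.2 hlr),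
    mul_nonneg (sub_nonneg.2 hy.1) (sub_nonneg.2 hy.1)]

/-- Inverse estimate for the sup norm. -/
theorem exists_inverse_sup (N : ℕ) : ∃ C > 0, ∀ (l r : ℝ), l < r → ∀ q : ℝ[X],
    q.natDegree ≤ N → ∀ x ∈ Icc l r, (r - l) * q.eval x ^ 2 ≤ C * ∫ y in l..r, q.eval y ^ 2 := by
  obtain ⟨C, hC, h⟩ := exists_inverse_bubble N
  refine ⟨C, hC, fun l r hlr q hq x hx => ?_⟩
  have h1 := (h l r hlr q hq x hx).1
  have h2 := integral_bubble_le hlr.le q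
  have hd : 0 < r - l := sub_pos.2 hlr
  have h3 : (r - l) ^ 2 * ((r - l) * q.eval x ^ 2) ≤
      (r - l) ^ 2 * (C * ∫ y in l..r, q.eval y ^ 2) := by
    nlinarith [mul_le_mul_of_nonneg_left h2 hC.le]
  exact le_of_mul_le_mul_left h3 (by positivity)

/-- Integration of the pointwise inverse estimate: on polynomials of fixed degree the bubble weight
costs only a constant, after scaling. -/
theorem exists_bubble_lower (N : ℕ) : ∃ C > 0, ∀ (l r : ℝ), l < r → ∀ q : ℝ[X],
    q.natDegree ≤ N → (r - l) ^ 2 * (∫ y in l..r, q.eval y ^ 2) ≤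
      C * ∫ y in l..r, (y - l) * (r - y) * q.eval y ^ 2 := by
  obtain ⟨C, hC, h⟩ := exists_inverse_bubble N
  refine ⟨C, hC, fun l r hlr q hq => ?_⟩
  have hd : 0 < r - l := sub_pos.2 hlr
  set B := ∫ y in l..r, (y - l) * (r - y) * q.eval y ^ 2
  have h1 : ∫ y in l..r, (r - l) ^ 3 * q.eval y ^ 2 ≤ ∫ _y in l..r, C * B :=
    intervalIntegral.integral_mono_on hlr.le (Continuous.intervalIntegrable (by fun_prop) _ _)
      (by simp) fun y hy => (h l r hlr q hq y hy).1
  rw [intervalIntegral.integral_const_mul, intervalIntegral.integral_const, smul_eq_mul] at h1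
  have h2 : (r - l) * ((r - l) ^ 2 * ∫ y in l..r, q.eval y ^ 2) ≤ (r - l) * (C * B) := by
    linarith
  exact le_of_mul_le_mul_left h2 hd

/-- Factor `q = (x - c) v`. Then `v` is an admissible test function and `(x - c) v²` has one sign,
`c` being an endpoint. This is the uniqueness of the endpoint-matching projections. -/
theorem eq_zero_of_orthogonal {N : ℕ} {l r c : ℝ} (hlr : l < r) (hc : c = l ∨ c = r) {q : ℝ[X]}
    (hq : q.natDegree ≤ N)
    (ho : ∀ v : ℝ[X], v.degree < N → ∫ x in l..r, q.eval x * v.eval x = 0)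
    (hz : q.eval c = 0) : q = 0 := by
  by_contra hq0
  obtain ⟨v, hv⟩ := Polynomial.dvd_iff_isRoot.2 hz
  have hv0 : v ≠ 0 := by rintro rfl; simp at hv; exact hq0 hv
  have hdeg : v.degree < N := by
    have h1 : q.natDegree = 1 + v.natDegree := by
      rw [hv, Polynomial.natDegree_mul (Polynomial.X_sub_C_ne_zero c) hv0,
        Polynomial.natDegree_X_sub_C]
    rw [Polynomial.degree_eq_natDegree hv0, Nat.cast_lt]
    omega
  have h := ho v hdeg
  obtain ⟨x, hx, hx0⟩ := exists_mem_Ioo_eval_ne_zero hlr hv0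
  have e : ∀ x, q.eval x * v.eval x = (x - c) * v.eval x ^ 2 := fun x => by
    rw [hv]; simp; ring
  simp only [e] at h
  rcases hc with rfl | rfl
  · have : 0 < ∫ x in c..r, (x - c) * v.eval x ^ 2 := by
      refine intervalIntegral.integral_pos hlr (by fun_prop) (fun y hy => ?_)
        ⟨x, Ioo_subset_Icc_self hx, ?_⟩
      · exact mul_nonneg (by linarith [hy.1]) (sq_nonneg _)
      · exact mul_pos (by linarith [hx.1]) (by positivity)
    exact this.ne' h
  · have : 0 < ∫ x in l..c, -((x - c) * v.eval x ^ 2) := by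
      refine intervalIntegral.integral_pos hlr (by fun_prop) (fun y hy => ?_)
        ⟨x, Ioo_subset_Icc_self hx, ?_⟩
      · rw [← neg_mul]; exact mul_nonneg (by linarith [hy.2]) (sq_nonneg _)
      · rw [← neg_mul]; exact mul_pos (by linarith [hx.2]) (by positivity)
    rw [intervalIntegral.integral_neg, h, neg_zero] at this
    exact lt_irrefl _ this

/-- The `N` moments together with the value at `1` form a square linear system in `N + 1`
coefficients; it is injective by `eq_zero_of_orthogonal`, hence solvable. -/
theorem exists_legendre_unit (N : ℕ) : ∃ L : ℝ[X], L.natDegree ≤ N ∧ L.eval 1 = 1 ∧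
    ∀ v : ℝ[X], v.degree < N → ∫ x in (0 : ℝ)..1, L.eval x * v.eval x = 0 := by
  have hsum : ∀ (q v : ℝ[X]), v.degree < N → ∫ x in (0 : ℝ)..1, q.eval x * v.eval x =
      ∑ j ∈ Finset.range N, v.coeff j * ∫ x in (0 : ℝ)..1, q.eval x * x ^ j := by
    intro q v hv
    by_cases hv0 : v = 0
    · simp [hv0]
    have hn : v.natDegree < N := by
      rwa [Polynomial.degree_eq_natDegree hv0, Nat.cast_lt] at hv
    simp only [← intervalIntegral.integral_const_mul]
    rw [← intervalIntegral.integral_finsetSum fun j _ =>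
      Continuous.intervalIntegrable (by fun_prop) _ _]
    refine intervalIntegral.integral_congr fun x _ => ?_
    rw [Polynomial.eval_eq_sum_range' hn, Finset.mul_sum]
    exact Finset.sum_congr rfl fun j _ => by ring
  set P : (Fin (N + 1) → ℝ) →ₗ[ℝ] ℝ[X] :=
    (Polynomial.degreeLT ℝ (N + 1)).subtype ∘ₗ (Polynomial.degreeLTEquiv ℝ (N + 1)).symm with hP
  have hPdeg : ∀ c, (P c).natDegree ≤ N := fun c => by
    have := Polynomial.mem_degreeLT.1 ((Polynomial.degreeLTEquiv ℝ (N + 1)).symm c).2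
    by_cases h0 : P c = 0
    · simp [h0]
    · exact Nat.lt_succ_iff.1 ((Polynomial.natDegree_lt_iff_degree_lt h0).2 this)
  have hPinj : ∀ c, P c = 0 → c = 0 := fun c h => by
    have : (Polynomial.degreeLTEquiv ℝ (N + 1)).symm c = 0 := Subtype.ext h
    simpa using this
  let T : (Fin (N + 1) → ℝ) →ₗ[ℝ] (Fin (N + 1) → ℝ) :=
    { toFun := fun c j => if (j : ℕ) < N then ∫ x in (0 : ℝ)..1, (P c).eval x * x ^ (j : ℕ)
        else (P c).eval 1
      map_add' := fun c d => by
        ext j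
        simp only [map_add, Polynomial.eval_add, Pi.add_apply, add_mul]
        split_ifs
        · rw [intervalIntegral.integral_add] <;> exact Continuous.intervalIntegrable (by fun_prop) _ _
        · rfl
      map_smul' := fun s c => by
        ext j
        simp only [map_smul, Polynomial.eval_smul, Pi.smul_apply, smul_eq_mul, mul_assoc,
          RingHom.id_apply]
        split_ifs
        · rw [intervalIntegral.integral_const_mul]
        · rfl }
  have hT : ∀ c j, T c j = if (j : ℕ) < N then ∫ x in (0 : ℝ)..1, (P c).eval x * x ^ (j : ℕ)
        else (P c).eval 1 := fun c j => rfl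
  have horth : ∀ c, (∀ j : Fin (N + 1), (j : ℕ) < N → T c j = 0) → ∀ v : ℝ[X], v.degree < N →
      ∫ x in (0 : ℝ)..1, (P c).eval x * v.eval x = 0 := by
    intro c hc v hv
    rw [hsum _ _ hv]
    refine Finset.sum_eq_zero fun j hj => ?_
    have hj := Finset.mem_range.1 hj
    have := hc ⟨j, by omega⟩ hj
    rw [hT, if_pos hj] at this
    rw [this, mul_zero]
  have hinj : Function.Injective T := by
    rw [← LinearMap.ker_eq_bot, LinearMap.ker_eq_bot']
    intro c hc
    refine hPinj c (eq_zero_of_orthogonal zero_lt_one (Or.inr rfl) (hPdeg c)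
      (horth c fun j _ => by rw [hc]; rfl) ?_)
    have := hT c (Fin.last N)
    rw [hc] at this
    simpa using this.symm
  obtain ⟨c, hc⟩ := (LinearMap.injective_iff_surjective.1 hinj) (Pi.single (Fin.last N) 1)
  refine ⟨P c, hPdeg c, ?_, horth c fun j hj => ?_⟩
  · have := hT c (Fin.last N)
    rw [hc] at this
    simpa using this.symm
  · rw [hc, Pi.single_eq_of_ne]
    rintro rfl
    simp at hj

/-- A polynomial of degree at most `N`, orthogonal to those of degree less than `N`, normalized at
an endpoint. -/
theorem exists_legendre (N : ℕ) : ∃ C > 0, ∀ l r c : ℝ, l < r → c = l ∨ c = r →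
    ∃ L : ℝ[X], L.natDegree ≤ N ∧ L.eval c = 1 ∧
      (∀ v : ℝ[X], v.degree < N → ∫ x in l..r, L.eval x * v.eval x = 0) ∧
      ∀ x ∈ Icc l r, |L.eval x| ≤ C := by
  obtain ⟨Q, hQ, hQ1, hQo⟩ := exists_legendre_unit N
  obtain ⟨M, hM⟩ := isCompact_Icc.exists_bound_of_continuousOn (s := Icc (0 : ℝ) 1)
    (f := fun x => Q.eval x) (by fun_prop)
  refine ⟨max M 1, by positivity, fun l r c hlr hc => ?_⟩
  have hd : 0 < r - l := sub_pos.2 hlr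
  -- The affine map sends the chosen endpoint `c` to `1`, hence reverses orientation when `c = l`.
  obtain ⟨s, σ, hσ, h1, hmap, hends⟩ : ∃ s σ : ℝ, σ ≠ 0 ∧ s + σ * c = 1 ∧
      (∀ x ∈ Icc l r, s + σ * x ∈ Icc (0 : ℝ) 1) ∧
      (s + σ * l = 0 ∧ s + σ * r = 1 ∨ s + σ * l = 1 ∧ s + σ * r = 0) := by
    rcases hc with rfl | rfl
    · refine ⟨r / (r - c), -1 / (r - c), div_ne_zero (by norm_num) hd.ne', by field_simp; ring,
        fun x hx => ?_, Or.inr ⟨by field_simp; ring, by field_simp; ring⟩⟩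
      rw [show r / (r - c) + -1 / (r - c) * x = (r - x) / (r - c) by field_simp; ring, mem_Icc,
        div_le_one hd]
      exact ⟨div_nonneg (by linarith [hx.2]) hd.le, by linarith [hx.1]⟩
    · refine ⟨-l / (c - l), 1 / (c - l), div_ne_zero (by norm_num) hd.ne', by field_simp; ring,
        fun x hx => ?_, Or.inl ⟨by field_simp; ring, by field_simp; ring⟩⟩
      rw [show -l / (c - l) + 1 / (c - l) * x = (x - l) / (c - l) by field_simp; ring, mem_Icc,
        div_le_one hd]
      exact ⟨div_nonneg (by linarith [hx.1]) hd.le, by linarith [hx.2]⟩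
  set A : ℝ[X] := Polynomial.C s + Polynomial.C σ * Polynomial.X with hA
  set B : ℝ[X] := Polynomial.C (-s / σ) + Polynomial.C (1 / σ) * Polynomial.X with hB
  have hAe : ∀ x, (Q.comp A).eval x = Q.eval (s + σ * x) := fun x => by simp [hA]
  have hlin : ∀ u v : ℝ, (Polynomial.C u + Polynomial.C v * Polynomial.X : ℝ[X]).natDegree ≤ 1 :=
    fun u v => by rw [add_comm]; exact Polynomial.natDegree_linear_le
  refine ⟨Q.comp A, ?_, by rw [hAe, h1, hQ1], fun v hv => ?_, fun x hx => ?_⟩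
  · refine Polynomial.natDegree_comp_le.trans ((Nat.mul_le_mul_left _ (hlin s σ)).trans ?_)
    omega
  · have hvB : (v.comp B).degree < N := by
      by_cases hv0 : v = 0
      · simp [hv0]
      have hn : v.natDegree < N := by
        rwa [Polynomial.degree_eq_natDegree hv0, Nat.cast_lt] at hv
      refine (Polynomial.degree_le_natDegree).trans_lt (Nat.cast_lt.2 ?_)
      refine lt_of_le_of_lt (Polynomial.natDegree_comp_le.trans
        (Nat.mul_le_mul_left _ (hlin (-s / σ) (1 / σ)))) (by omega)
    have e : ∀ x, (Q.comp A).eval x * v.eval x =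
        (fun y => Q.eval y * (v.comp B).eval y) (s + σ * x) := fun x => by
      simp only [hAe]
      congr 1
      simp only [hB, Polynomial.eval_comp, Polynomial.eval_add, Polynomial.eval_C,
        Polynomial.eval_mul, Polynomial.eval_X]
      congr 1; field_simp; ring
    simp only [e]
    rw [intervalIntegral.integral_comp_add_mul (fun y => Q.eval y * (v.comp B).eval y) hσ]
    have := hQo _ hvB
    rcases hends with ⟨e1, e2⟩ | ⟨e1, e2⟩
    · rw [e1, e2, this, smul_zero]
    · rw [e1, e2, intervalIntegral.integral_symm, this, neg_zero, smul_zero]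
  · rw [hAe]
    exact (hM _ (hmap x hx)).trans (le_max_left _ _)

/-! ### Lower bound for exponentially smoothed polynomials, and polynomial approximation -/

/-- Here `x₁`, `x₂` stand for the distances to the endpoints and `v`, `w` for `q` and `q'` at a
point. The squared quantity is `t φ - φ'` for the test function `φ = x₁ x₂ q`, and the two
hypotheses on `M` are the inverse estimates with bubble weight. -/
theorem bubble_pointwise {x₁ x₂ d t v w M : ℝ} (ht : 0 ≤ t) (h₁ : 0 ≤ x₁) (h₂ : 0 ≤ x₂)
    (hd : x₁ + x₂ = d) (hv : d ^ 3 * v ^ 2 ≤ M) (hw : d ^ 5 * w ^ 2 ≤ M) :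
    d * (t * (x₁ * x₂ * v) - ((x₂ - x₁) * v + x₁ * x₂ * w)) ^ 2 ≤ 4 * (t * d + 1) ^ 2 * M := by
  have hd0 : 0 ≤ d := by linarith
  have htd : 0 ≤ t * d := mul_nonneg ht hd0
  have hM : 0 ≤ M := le_trans (by positivity) hv
  have hϖ0 : 0 ≤ x₁ * x₂ := mul_nonneg h₁ h₂
  have hϖ : x₁ * x₂ ≤ d ^ 2 := by
    rw [← hd]; linarith [sq_nonneg x₁, sq_nonneg x₂, add_sq x₁ x₂]
  have ha : |t * (x₁ * x₂) - (x₂ - x₁)| ≤ d * (t * d + 1) := by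
    have h3 := mul_le_mul_of_nonneg_left hϖ ht
    have h4 := mul_nonneg ht hϖ0
    have h5 : d * (t * d + 1) = t * d ^ 2 + d := by ring
    have h6 : 0 ≤ t * d ^ 2 := by positivity
    rw [h5, abs_le]; constructor <;> linarith
  have hA2 : (t * (x₁ * x₂) - (x₂ - x₁)) ^ 2 ≤ (d * (t * d + 1)) ^ 2 := by
    rw [← sq_abs]; exact pow_le_pow_left₀ (abs_nonneg _) ha 2
  have hW2 : (x₁ * x₂) ^ 2 ≤ (d ^ 2) ^ 2 := pow_le_pow_left₀ hϖ0 hϖ 2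
  have e : t * (x₁ * x₂ * v) - ((x₂ - x₁) * v + x₁ * x₂ * w) =
      (t * (x₁ * x₂) - (x₂ - x₁)) * v - x₁ * x₂ * w := by ring
  rw [e]
  set a := t * (x₁ * x₂) - (x₂ - x₁)
  set ϖ := x₁ * x₂
  have g1 : d * (a * v) ^ 2 ≤ (t * d + 1) ^ 2 * M := by
    calc d * (a * v) ^ 2 = a ^ 2 * (d * v ^ 2) := by ring
      _ ≤ (d * (t * d + 1)) ^ 2 * (d * v ^ 2) := mul_le_mul_of_nonneg_right hA2 (by positivity)
      _ = (t * d + 1) ^ 2 * (d ^ 3 * v ^ 2) := by ring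
      _ ≤ _ := mul_le_mul_of_nonneg_left hv (sq_nonneg _)
  have g2 : d * (ϖ * w) ^ 2 ≤ 1 * M := by
    calc d * (ϖ * w) ^ 2 = ϖ ^ 2 * (d * w ^ 2) := by ring
      _ ≤ (d ^ 2) ^ 2 * (d * w ^ 2) := mul_le_mul_of_nonneg_right hW2 (by positivity)
      _ = d ^ 5 * w ^ 2 := by ring
      _ ≤ _ := by rw [one_mul]; exact hw
  have g3 : 1 * M ≤ (t * d + 1) ^ 2 * M :=
    mul_le_mul_of_nonneg_right (one_le_pow₀ (by linarith)) hM
  have g4 : d * (a * v - ϖ * w) ^ 2 + d * (a * v + ϖ * w) ^ 2 =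
      2 * (d * (a * v) ^ 2) + 2 * (d * (ϖ * w) ^ 2) := by ring
  have g5 : 0 ≤ d * (a * v + ϖ * w) ^ 2 := by positivity
  linarith

/-- Lower bound for the exponentially smoothed polynomial. -/
theorem exists_smoothing_lower (N : ℕ) : ∃ C > 0, ∀ (l r t : ℝ), l < r → 0 ≤ t → ∀ q : ℝ[X],
    q.natDegree ≤ N → ∀ Λ : ℝ → ℝ, ContinuousOn Λ (Icc l r) →
    (∀ x ∈ Icc l r, Λ x = Λ l + (∫ y in l..x, q.eval y) - t * ∫ y in l..x, Λ y) →
    (r - l) ^ 2 * (∫ y in l..r, q.eval y ^ 2) ≤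
      C * ((t * (r - l) + 1) ^ 2 * ∫ y in l..r, Λ y ^ 2) := by
  obtain ⟨C, hC, h⟩ := exists_inverse_bubble N
  obtain ⟨C', hC', h'⟩ := exists_bubble_lower N
  refine ⟨C' * (4 * C), by positivity, fun l r t hlr ht q hq Λ hΛ hE => ?_⟩
  set d := r - l with hd
  have hd0 : 0 < d := sub_pos.2 hlr
  set B := ∫ y in l..r, (y - l) * (r - y) * q.eval y ^ 2 with hB
  set S := ∫ y in l..r, Λ y ^ 2 with hS
  have hS0 : 0 ≤ S := intervalIntegral.integral_nonneg hlr.le fun y _ => sq_nonneg _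
  have hB0 : 0 ≤ B := intervalIntegral.integral_nonneg hlr.le fun y hy =>
    mul_nonneg (mul_nonneg (by linarith [hy.1]) (by linarith [hy.2])) (sq_nonneg _)
  have hder : ∀ x ∈ Ioo l r, HasDerivAt Λ (q.eval x - t * Λ x) x := by
    intro x hx
    have hnh : Icc l r ∈ nhds x := Icc_mem_nhds hx.1 hx.2
    have h1 : HasDerivAt (fun u => ∫ y in l..u, q.eval y) (q.eval x) x :=
      intervalIntegral.integral_hasDerivAt_right
        (Continuous.intervalIntegrable (by fun_prop) _ _)
        (Continuous.stronglyMeasurableAtFilter (by fun_prop) _ _)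
        (Continuous.continuousAt (by fun_prop))
    have h2 : HasDerivAt (fun u => ∫ y in l..u, Λ y) (Λ x) x :=
      intervalIntegral.integral_hasDerivAt_right
        ((hΛ.mono (by rw [uIcc_of_le hx.1.le]; exact Icc_subset_Icc_right hx.2.le)).intervalIntegrable)
        (hΛ.stronglyMeasurableAtFilter_nhdsWithin measurableSet_Icc x |>.filter_mono
          (by rw [nhdsWithin_eq_nhds.2 hnh])) (hΛ.continuousAt hnh)
    refine ((h1.const_add (Λ l)).sub (h2.const_mul t)).congr_of_eventuallyEq ?_
    filter_upwards [hnh] with u hu using hE u hu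
  -- Testing `Λ' + t Λ = q` with `φ`. The bubble vanishes at both ends, so the uncontrolled endpoint
  -- values of `Λ` drop out of the integration by parts and `∫ φ q = ∫ (t φ - φ') Λ`.
  set φ : ℝ → ℝ := fun x => (x - l) * (r - x) * q.eval x with hφ
  set φ' : ℝ → ℝ := fun x => (l + r - 2 * x) * q.eval x + (x - l) * (r - x) * q.derivative.eval x
    with hφ'
  have hφd : ∀ x, HasDerivAt φ (φ' x) x := fun x => by
    have h1 := (((hasDerivAt_id x).sub_const l).mul ((hasDerivAt_id x).const_sub r)).mul
      (q.hasDerivAt x)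
    refine h1.congr_deriv ?_
    simp only [hφ', id, Pi.mul_apply]; ring
  have hΛu : ContinuousOn Λ (uIcc l r) := by rwa [uIcc_of_le hlr.le]
  have hΛi : IntervalIntegrable Λ volume l r := hΛu.intervalIntegrable
  have hqi : IntervalIntegrable (fun x => q.eval x) volume l r :=
    Continuous.intervalIntegrable (by fun_prop) _ _
  have hφc : Continuous φ := by fun_prop
  have hφ'c : Continuous φ' := by fun_prop
  have hparts := intervalIntegral.integral_mul_deriv_eq_deriv_mul_of_hasDerivAt (a := l) (b := r)
    (u := φ) (v := Λ) (u' := φ') (v' := fun x => q.eval x - t * Λ x) hφc.continuousOn hΛu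
    (fun x _ => hφd x) (by rw [min_eq_left hlr.le, max_eq_right hlr.le]; exact hder)
    (hφ'c.intervalIntegrable _ _) (hqi.sub (hΛi.const_mul t))
  have hφl : φ l = 0 := by simp [hφ]
  have hφr : φ r = 0 := by simp [hφ]
  rw [hφl, hφr, zero_mul, zero_mul, sub_zero, zero_sub] at hparts
  have hBeq : B = ∫ x in l..r, (t * φ x - φ' x) * Λ x := by
    have i1 : IntervalIntegrable (fun x => φ x * (t * Λ x)) volume l r :=
      (hΛi.const_mul t).continuousOn_mul hφc.continuousOn
    have i2 : IntervalIntegrable (fun x => φ x * (q.eval x - t * Λ x)) volume l r :=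
      (hqi.sub (hΛi.const_mul t)).continuousOn_mul hφc.continuousOn
    have i3 : IntervalIntegrable (fun x => φ' x * Λ x) volume l r :=
      hΛi.continuousOn_mul hφ'c.continuousOn
    have e1 : B = (∫ x in l..r, φ x * (q.eval x - t * Λ x)) + ∫ x in l..r, φ x * (t * Λ x) := by
      rw [← intervalIntegral.integral_add i2 i1, hB]
      refine intervalIntegral.integral_congr fun x _ => ?_
      simp only [hφ]; ring
    rw [e1, hparts, neg_add_eq_sub, ← intervalIntegral.integral_sub i1 i3]
    refine intervalIntegral.integral_congr fun x _ => ?_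
    ring
  have hψc : Continuous fun x => t * φ x - φ' x := by fun_prop
  have hcs := (integral_mul_sq_le (μ := vol l r) (f := fun x => t * φ x - φ' x) (g := Λ)
    hψc.measurable.aestronglyMeasurable
    ((hΛ.mono Ioc_subset_Icc_self).aestronglyMeasurable measurableSet_Ioc)
    (integrable_sq_of_continuousOn hψc.continuousOn) (integrable_sq_of_continuousOn hΛ)).2
  rw [← intervalIntegral.integral_of_le hlr.le, ← intervalIntegral.integral_of_le hlr.le,
    ← intervalIntegral.integral_of_le hlr.le, ← hBeq, ← hS] at hcs
  have hpt : ∀ x ∈ Icc l r, d * (t * φ x - φ' x) ^ 2 ≤ 4 * C * (t * d + 1) ^ 2 * B := by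
    intro x hx
    obtain ⟨h1, h2⟩ := h l r hlr q hq x hx
    rw [← hd, ← hB] at h1 h2
    have := bubble_pointwise (x₁ := x - l) (x₂ := r - x) ht (by linarith [hx.1])
      (by linarith [hx.2]) (show x - l + (r - x) = d by rw [hd]; ring) h1 h2
    refine le_trans (le_of_eq ?_) (this.trans (le_of_eq ?_))
    · simp only [hφ, hφ']; ring
    · ring
  have hI : ∫ x in l..r, (t * φ x - φ' x) ^ 2 ≤ 4 * C * (t * d + 1) ^ 2 * B := by
    have h1 : ∫ x in l..r, d * (t * φ x - φ' x) ^ 2 ≤ ∫ _x in l..r, 4 * C * (t * d + 1) ^ 2 * B :=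
      intervalIntegral.integral_mono_on hlr.le (Continuous.intervalIntegrable (by fun_prop) _ _)
        (by simp) hpt
    rw [intervalIntegral.integral_const_mul, intervalIntegral.integral_const, smul_eq_mul] at h1
    exact le_of_mul_le_mul_left h1 hd0
  -- Cauchy–Schwarz together with the pointwise bound gives `B²` at most a multiple of `B S`; one
  -- factor `B` cancels.
  have hBle : B ≤ 4 * C * (t * d + 1) ^ 2 * S := by
    rcases hB0.eq_or_lt with h0 | h0
    · rw [← h0]; positivity
    have : B * B ≤ (4 * C * (t * d + 1) ^ 2 * S) * B := by
      calc B * B = B ^ 2 := by ring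
        _ ≤ (4 * C * (t * d + 1) ^ 2 * B) * S := hcs.trans (mul_le_mul_of_nonneg_right hI hS0)
        _ = _ := by ring
    exact le_of_mul_le_mul_right this h0
  calc d ^ 2 * (∫ y in l..r, q.eval y ^ 2) ≤ C' * B := h' l r hlr q hq
    _ ≤ C' * (4 * C * (t * d + 1) ^ 2 * S) := mul_le_mul_of_nonneg_left hBle hC'.le
    _ = _ := by ring

theorem exists_antiderivative {n : ℕ} {q : ℝ[X]} (hq : q.natDegree ≤ n) (l c : ℝ) :
    ∃ Q : ℝ[X], Q.natDegree ≤ n + 1 ∧ Q.derivative = q ∧ Q.eval l = c := by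
  set Q₀ : ℝ[X] := ∑ i ∈ Finset.range (n + 1),
    Polynomial.C (q.coeff i / (i + 1)) * Polynomial.X ^ (i + 1) with hQ₀
  have hdeg : Q₀.natDegree ≤ n + 1 := by
    refine Polynomial.natDegree_sum_le_of_forall_le _ _ fun i hi => ?_
    refine (Polynomial.natDegree_C_mul_X_pow_le _ _).trans ?_
    have := Finset.mem_range.1 hi
    omega
  have hder : Q₀.derivative = q := by
    rw [hQ₀, Polynomial.derivative_sum]
    conv_rhs => rw [Polynomial.as_sum_range' q (n + 1) (Nat.lt_succ_of_le hq)]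
    refine Finset.sum_congr rfl fun i _ => ?_
    rw [Polynomial.derivative_C_mul_X_pow, ← Polynomial.C_mul_X_pow_eq_monomial]
    congr 2
    push_cast
    field_simp
  refine ⟨Q₀ + Polynomial.C (c - Q₀.eval l), ?_, by simp [hder], by simp⟩
  rwa [Polynomial.natDegree_add_C]

/-- `f` has `n` derivatives, the last of which is bounded by `M`. -/
def DerivBound : ℕ → ℝ → (ℝ → ℝ) → Prop
  | 0, M, f => ∀ x, |f x| ≤ M
  | n + 1, M, f => ∃ f' : ℝ → ℝ, (∀ x, HasDerivAt f (f' x) x) ∧ DerivBound n M f'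

theorem abs_sub_le_of_hasDerivAt {l r M : ℝ} {f f' : ℝ → ℝ} (hf : ∀ x, HasDerivAt f (f' x) x)
    (hM : ∀ x ∈ Icc l r, |f' x| ≤ M) {x : ℝ} (hx : x ∈ Icc l r) : |f x - f l| ≤ M * (r - l) := by
  have h := norm_image_sub_le_of_norm_deriv_le_segment' (f := f) (f' := f') (a := l) (b := r)
    (C := M) (fun y _ => (hf y).hasDerivWithinAt) (fun y hy => hM y (Ico_subset_Icc_self hy)) x hx
  have h0 : 0 ≤ M := (abs_nonneg _).trans (hM x hx)
  exact h.trans (mul_le_mul_of_nonneg_left (by linarith [hx.2]) h0)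

/-- Polynomial approximation of a smooth function on an interval. -/
theorem DerivBound.exists_approx {N : ℕ} {M : ℝ} {f : ℝ → ℝ} (h : DerivBound (N + 1) M f)
    {l r : ℝ} : ∃ T : ℝ[X], T.natDegree ≤ N ∧
      ∀ x ∈ Icc l r, |f x - T.eval x| ≤ M * (r - l) ^ (N + 1) := by
  induction N generalizing f with
  | zero =>
    obtain ⟨f', hf', hb⟩ := h
    refine ⟨Polynomial.C (f l), by simp, fun x hx => ?_⟩
    simpa using abs_sub_le_of_hasDerivAt hf' (fun y _ => hb y) hx
  | succ N ih =>
    obtain ⟨f', hf', hb⟩ := h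
    obtain ⟨T', hT', hT'b⟩ := ih hb
    obtain ⟨T, hT, hTd, hTl⟩ := exists_antiderivative hT' l (f l)
    refine ⟨T, hT, fun x hx => ?_⟩
    have := abs_sub_le_of_hasDerivAt (fun y => (hf' y).sub (T.hasDerivAt y))
      (M := M * (r - l) ^ (N + 1)) (l := l) (r := r) (fun y hy => by rw [hTd]; exact hT'b y hy) hx
    simp only [Pi.sub_apply, hTl, sub_self, sub_zero] at this
    rwa [mul_assoc, ← pow_succ] at this

theorem DerivBound.continuous {n : ℕ} {M : ℝ} {f : ℝ → ℝ} (h : DerivBound (n + 1) M f) :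
    Continuous f := by
  obtain ⟨f', hf', -⟩ := h
  exact continuous_iff_continuousAt.2 fun x => (hf' x).continuousAt

/-! ### Elements, and piecewise polynomials as functions on the line -/

namespace Mesh

variable {a b : ℝ} (𝓜 : Mesh a b)

theorem left_lt_right (k : Fin 𝓜.K) : 𝓜.left k < 𝓜.right k :=
  𝓜.node_strictMono Fin.castSucc_lt_succ

theorem node_mem (i : Fin (𝓜.K + 1)) : 𝓜.node i ∈ Icc a b := by
  constructor
  · exact 𝓜.node_zero.symm.le.trans (𝓜.node_strictMono.monotone (Fin.zero_le i))
  · exact (𝓜.node_strictMono.monotone (Fin.le_last i)).trans 𝓜.node_last.le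

theorem left_mem (k : Fin 𝓜.K) : 𝓜.left k ∈ Icc a b := 𝓜.node_mem _

theorem right_mem (k : Fin 𝓜.K) : 𝓜.right k ∈ Icc a b := 𝓜.node_mem _

theorem a_le_b (𝓜 : Mesh a b) : a ≤ b := (𝓜.node_mem 0).1.trans (𝓜.node_mem 0).2

theorem Icc_subset (k : Fin 𝓜.K) : Icc (𝓜.left k) (𝓜.right k) ⊆ Icc a b :=
  Icc_subset_Icc (𝓜.left_mem k).1 (𝓜.right_mem k).2

theorem Ioc_subset (k : Fin 𝓜.K) : Ioc (𝓜.left k) (𝓜.right k) ⊆ Ioc a b :=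
  Ioc_subset_Ioc (𝓜.left_mem k).1 (𝓜.right_mem k).2

theorem len_le_size (k : Fin 𝓜.K) : 𝓜.right k - 𝓜.left k ≤ 𝓜.size :=
  le_ciSup (f := fun k => 𝓜.right k - 𝓜.left k) (Finite.bddAbove_range _) k

theorem size_nonneg : 0 ≤ 𝓜.size :=
  Real.iSup_nonneg fun k => (sub_pos.2 (𝓜.left_lt_right k)).le

theorem sum_len : ∑ k, (𝓜.right k - 𝓜.left k) = b - a := by
  have h1 := Fin.sum_univ_succ 𝓜.node
  have h2 := Fin.sum_univ_castSucc 𝓜.node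
  rw [Finset.sum_sub_distrib]
  simp only [left, right]
  have := 𝓜.node_zero
  have := 𝓜.node_last
  linarith

theorem integral_eq_sum {f : ℝ → ℝ}
    (hf : ∀ k, IntervalIntegrable f volume (𝓜.left k) (𝓜.right k)) :
    ∫ x, f x ∂vol a b = ∑ k, ∫ x in 𝓜.left k..𝓜.right k, f x := by
  set x : ℕ → ℝ := fun n => if h : n < 𝓜.K + 1 then 𝓜.node ⟨n, h⟩ else b with hx
  have hl : ∀ k : Fin 𝓜.K, x k = 𝓜.left k := fun k => by
    have : (k : ℕ) < 𝓜.K + 1 := k.2.trans (Nat.lt_succ_self _)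
    simp only [hx, dif_pos this]; rfl
  have hr : ∀ k : Fin 𝓜.K, x (k + 1) = 𝓜.right k := fun k => by
    have : (k : ℕ) + 1 < 𝓜.K + 1 := Nat.succ_lt_succ k.2
    simp only [hx, dif_pos this]; rfl
  have h := intervalIntegral.sum_integral_adjacent_intervals (μ := volume) (f := f) (a := x)
    (n := 𝓜.K) (fun k hk => by rw [hl ⟨k, hk⟩, hr ⟨k, hk⟩]; exact hf ⟨k, hk⟩)
  have h0 : x 0 = a := by
    simp only [hx, dif_pos (Nat.succ_pos 𝓜.K)]; exact 𝓜.node_zero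
  have hK : x 𝓜.K = b := by
    simp only [hx, dif_pos (Nat.lt_succ_self 𝓜.K)]; exact 𝓜.node_last
  rw [h0, hK, intervalIntegral.integral_of_le 𝓜.a_le_b, Finset.sum_range] at h
  rw [← h]
  exact Finset.sum_congr rfl fun k _ => by rw [hl, hr]

theorem Ioo_disjoint {j k : Fin 𝓜.K} (h : j ≠ k) {x : ℝ} (hj : x ∈ Ioo (𝓜.left j) (𝓜.right j)) :
    x ∉ Ioo (𝓜.left k) (𝓜.right k) := by
  have key : ∀ {j k : Fin 𝓜.K}, j < k → 𝓜.right j ≤ 𝓜.left k := fun hjk =>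
    𝓜.node_strictMono.monotone (Fin.succ_le_castSucc_iff.2 hjk)
  intro hk
  rcases lt_or_gt_of_ne h with h | h
  · linarith [key h, hj.2, hk.1]
  · linarith [key h, hk.2, hj.1]

theorem toFun_eq (w : 𝓜.Piecewise) {k : Fin 𝓜.K} {x : ℝ} (hx : x ∈ Ioo (𝓜.left k) (𝓜.right k)) :
    𝓜.toFun w x = (w k).eval x := by
  rw [toFun, Finset.sum_eq_single k, indicator_of_mem hx]
  · intro j _ hj
    exact indicator_of_notMem (𝓜.Ioo_disjoint (Ne.symm hj) hx) _
  · simp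

theorem toFun_eq_zero (w : 𝓜.Piecewise) {x : ℝ} (hx : x ∉ Ioo a b) : 𝓜.toFun w x = 0 :=
  Finset.sum_eq_zero fun k _ => indicator_of_notMem
    (fun h => hx (Ioo_subset_Ioo (𝓜.left_mem k).1 (𝓜.right_mem k).2 h)) _

theorem toFun_add (w v : 𝓜.Piecewise) (x : ℝ) : 𝓜.toFun (w + v) x = 𝓜.toFun w x + 𝓜.toFun v x := by
  simp only [toFun, ← Finset.sum_add_distrib]
  refine Finset.sum_congr rfl fun k _ => ?_
  by_cases h : x ∈ Ioo (𝓜.left k) (𝓜.right k)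
  · simp [indicator_of_mem h]
  · simp [indicator_of_notMem h]

theorem toFun_smul (c : ℝ) (w : 𝓜.Piecewise) (x : ℝ) : 𝓜.toFun (c • w) x = c * 𝓜.toFun w x := by
  simp only [toFun, Finset.mul_sum]
  refine Finset.sum_congr rfl fun k _ => ?_
  by_cases h : x ∈ Ioo (𝓜.left k) (𝓜.right k)
  · simp [indicator_of_mem h]
  · simp [indicator_of_notMem h]

theorem BM_toFun (w : 𝓜.Piecewise) : BM a b (𝓜.toFun w) := by
  have hb : ∀ k, ∃ M, ∀ x ∈ Icc a b, |(w k).eval x| ≤ M := fun k => by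
    obtain ⟨M, hM⟩ := isCompact_Icc.exists_bound_of_continuousOn (s := Icc a b)
      (f := fun x => (w k).eval x) (by fun_prop)
    exact ⟨M, hM⟩
  choose M hM using hb
  refine ⟨?_, ∑ k, M k, fun x hx => ?_⟩
  · unfold toFun
    exact Finset.measurable_sum _ fun k _ => Measurable.indicator (by fun_prop) measurableSet_Ioo
  · refine (Finset.abs_sum_le_sum_abs _ _).trans (Finset.sum_le_sum fun k _ => ?_)
    have h1 := hM k x (Ioc_subset_Icc_self hx)
    by_cases h : x ∈ Ioo (𝓜.left k) (𝓜.right k)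
    · rwa [indicator_of_mem h]
    · rw [indicator_of_notMem h, abs_zero]; exact (abs_nonneg _).trans h1

theorem integral_congr_elem {k : Fin 𝓜.K} {f g : ℝ → ℝ}
    (h : ∀ x ∈ Ioo (𝓜.left k) (𝓜.right k), f x = g x) :
    ∫ x in 𝓜.left k..𝓜.right k, f x = ∫ x in 𝓜.left k..𝓜.right k, g x := by
  rw [intervalIntegral.integral_of_le (𝓜.left_lt_right k).le,
    intervalIntegral.integral_of_le (𝓜.left_lt_right k).le, integral_Ioc_eq_integral_Ioo,
    integral_Ioc_eq_integral_Ioo]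
  exact setIntegral_congr_fun measurableSet_Ioo h

theorem BM.elem {k : Fin 𝓜.K} {f : ℝ → ℝ} (hf : BM a b f) :
    BM (𝓜.left k) (𝓜.right k) f := hf.mono (𝓜.Ioc_subset k)

theorem BM.intervalIntegrable_elem (k : Fin 𝓜.K) {f : ℝ → ℝ} (hf : BM a b f) :
    IntervalIntegrable f volume (𝓜.left k) (𝓜.right k) :=
  hf.intervalIntegrable (𝓜.left_mem k) (𝓜.right_mem k)

theorem integral_mul_toFun {f : ℝ → ℝ} (hf : BM a b f) (w : 𝓜.Piecewise) :
    ∫ x, f x * 𝓜.toFun w x ∂vol a b = ∑ k, 𝓜.inn k f (fun x => (w k).eval x) := by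
  rw [𝓜.integral_eq_sum fun k => BM.intervalIntegrable_elem 𝓜 k (hf.mul (𝓜.BM_toFun w))]
  refine Finset.sum_congr rfl fun k _ => 𝓜.integral_congr_elem fun x hx => ?_
  rw [𝓜.toFun_eq w hx]

theorem integral_toFun_mul_toFun (v w : 𝓜.Piecewise) :
    ∫ x, 𝓜.toFun v x * 𝓜.toFun w x ∂vol a b =
      ∑ k, 𝓜.inn k (fun x => (v k).eval x) (fun x => (w k).eval x) := by
  rw [𝓜.integral_mul_toFun (𝓜.BM_toFun v) w]
  refine Finset.sum_congr rfl fun k _ => 𝓜.integral_congr_elem fun x hx => ?_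
  rw [𝓜.toFun_eq v hx]

theorem integral_toFun_sq (w : 𝓜.Piecewise) :
    ∫ x, 𝓜.toFun w x ^ 2 ∂vol a b = ∑ k, ∫ x in 𝓜.left k..𝓜.right k, (w k).eval x ^ 2 := by
  simp only [sq]
  exact 𝓜.integral_toFun_mul_toFun w w

end Mesh

open scoped InnerProductSpace

/-! ### The discontinuous finite element space as a Euclidean space -/

/-- The finite element space as a submodule. -/
def femSpace {a b : ℝ} (𝓜 : Mesh a b) (N : ℕ) : Submodule ℝ 𝓜.Piecewise where
  carrier := 𝓜.space N
  zero_mem' := fun k => by simp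
  add_mem' := fun hv hw k => (Polynomial.natDegree_add_le _ _).trans (max_le (hv k) (hw k))
  smul_mem' := fun c _ hw k => (Polynomial.natDegree_smul_le c _).trans (hw k)

/-- The finite element space. -/
abbrev Vh {a b : ℝ} (𝓜 : Mesh a b) (N : ℕ) : Type := femSpace 𝓜 N

namespace Vh

variable {a b : ℝ} {𝓜 : Mesh a b} {N : ℕ}

instance : FiniteDimensional ℝ (Vh 𝓜 N) := by
  let φ : Vh 𝓜 N →ₗ[ℝ] (Fin 𝓜.K → Fin (N + 1) → ℝ) :=
    { toFun := fun w k i => (w.1 k).coeff i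
      map_add' := fun v w => by ext k i; simp
      map_smul' := fun c w => by ext k i; simp }
  refine Module.Finite.of_injective φ fun v w h => ?_
  refine Subtype.ext (funext fun k => Polynomial.ext fun i => ?_)
  by_cases hi : i < N + 1
  · exact congrFun (congrFun h k) ⟨i, hi⟩
  · rw [Polynomial.coeff_eq_zero_of_natDegree_lt (by have := v.2 k; omega),
      Polynomial.coeff_eq_zero_of_natDegree_lt (by have := w.2 k; omega)]

/-- The function on the line given by an element of the finite element space. -/
noncomputable def tf (w : Vh 𝓜 N) : ℝ → ℝ := 𝓜.toFun w.1

theorem BM_tf (w : Vh 𝓜 N) : BM a b w.tf := 𝓜.BM_toFun _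

theorem tf_add (v w : Vh 𝓜 N) (x : ℝ) : (v + w).tf x = v.tf x + w.tf x := 𝓜.toFun_add _ _ x

theorem tf_smul (c : ℝ) (w : Vh 𝓜 N) (x : ℝ) : (c • w).tf x = c * w.tf x := 𝓜.toFun_smul c _ x

theorem integral_sq_elem_eq_zero {k : Fin 𝓜.K} {q : ℝ[X]}
    (h : ∫ x in 𝓜.left k..𝓜.right k, q.eval x ^ 2 = 0) : q = 0 := by
  by_contra hq
  obtain ⟨x, hx, hx0⟩ := exists_mem_Ioo_eval_ne_zero (𝓜.left_lt_right k) hq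
  have : 0 < ∫ x in 𝓜.left k..𝓜.right k, q.eval x ^ 2 :=
    intervalIntegral.integral_pos (𝓜.left_lt_right k) (by fun_prop) (fun y _ => sq_nonneg _)
      ⟨x, Ioo_subset_Icc_self hx, by positivity⟩
  exact this.ne' h

theorem integral_sq_elem_nonneg (k : Fin 𝓜.K) (q : ℝ[X]) :
    0 ≤ ∫ x in 𝓜.left k..𝓜.right k, q.eval x ^ 2 :=
  intervalIntegral.integral_nonneg (𝓜.left_lt_right k).le fun _ _ => sq_nonneg _

/-- The `L²` inner product. -/
@[reducible]
noncomputable def core (𝓜 : Mesh a b) (N : ℕ) : InnerProductSpace.Core ℝ (Vh 𝓜 N) where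
  inner v w := ∫ x, v.tf x * w.tf x ∂vol a b
  conj_inner_symm v w := by
    simp only [conj_trivial]
    congr 1; ext x; ring
  re_inner_nonneg v := integral_nonneg fun x => mul_self_nonneg _
  add_left u v w := by
    simp only [tf_add, add_mul]
    exact integral_add (u.BM_tf.mul w.BM_tf).integrable (v.BM_tf.mul w.BM_tf).integrable
  smul_left v w c := by
    simp only [tf_smul, mul_assoc, conj_trivial]
    exact integral_const_mul _ _
  definite v h := by
    have h1 : ∑ k, ∫ x in 𝓜.left k..𝓜.right k, (v.1 k).eval x ^ 2 = 0 := by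
      rw [← 𝓜.integral_toFun_sq]
      simp only [sq]
      exact h
    rw [Finset.sum_eq_zero_iff_of_nonneg fun k _ => integral_sq_elem_nonneg k _] at h1
    exact Subtype.ext (funext fun k => integral_sq_elem_eq_zero (h1 k (Finset.mem_univ k)))

noncomputable instance : NormedAddCommGroup (Vh 𝓜 N) := (core 𝓜 N).toNormedAddCommGroup

noncomputable instance : InnerProductSpace ℝ (Vh 𝓜 N) := InnerProductSpace.ofCore (core 𝓜 N).toCore

theorem inner_def (v w : Vh 𝓜 N) : ⟪v, w⟫_ℝ = ∫ x, v.tf x * w.tf x ∂vol a b := rfl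

theorem inner_eq_sum (v w : Vh 𝓜 N) : ⟪v, w⟫_ℝ =
    ∑ k, 𝓜.inn k (fun x => (v.1 k).eval x) (fun x => (w.1 k).eval x) :=
  𝓜.integral_toFun_mul_toFun _ _

theorem norm_sq_eq (v : Vh 𝓜 N) : ‖v‖ ^ 2 = ∫ x, v.tf x ^ 2 ∂vol a b := by
  rw [← real_inner_self_eq_norm_sq, inner_def]; simp only [sq]

theorem norm_sq_eq_sum (v : Vh 𝓜 N) :
    ‖v‖ ^ 2 = ∑ k, ∫ x in 𝓜.left k..𝓜.right k, (v.1 k).eval x ^ 2 := by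
  rw [norm_sq_eq]; exact 𝓜.integral_toFun_sq _

/-- A polynomial on one element, extended by zero. -/
noncomputable def elem (k : Fin 𝓜.K) (φ : ℝ[X]) (hφ : φ.natDegree ≤ N) : Vh 𝓜 N :=
  ⟨Pi.single k φ, fun j => by
    by_cases h : j = k
    · subst h; simpa using hφ
    · simp [h]⟩

theorem elem_self (k : Fin 𝓜.K) (φ : ℝ[X]) (hφ : φ.natDegree ≤ N) : (elem k φ hφ).1 k = φ := by
  simp [elem]

theorem elem_ne {j k : Fin 𝓜.K} (h : j ≠ k) (φ : ℝ[X]) (hφ : φ.natDegree ≤ N) :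
    (elem k φ hφ).1 j = 0 := by
  simp [elem, h]

theorem integral_mul_tf {f : ℝ → ℝ} (hf : BM a b f) (w : Vh 𝓜 N) :
    ∫ x, f x * w.tf x ∂vol a b = ∑ k, 𝓜.inn k f (fun x => (w.1 k).eval x) :=
  𝓜.integral_mul_toFun hf _

theorem sum_elem (F : Fin 𝓜.K → ℝ[X] → ℝ) (h0 : ∀ k, F k 0 = 0) (k : Fin 𝓜.K) (φ : ℝ[X])
    (hφ : φ.natDegree ≤ N) : ∑ j, F j ((elem (𝓜 := 𝓜) k φ hφ).1 j) = F k φ := by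
  rw [Finset.sum_eq_single k, elem_self]
  · intro j _ hj
    rw [elem_ne hj, h0]
  · simp

theorem inner_elem (v : Vh 𝓜 N) (k : Fin 𝓜.K) (φ : ℝ[X]) (hφ : φ.natDegree ≤ N) :
    ⟪v, elem k φ hφ⟫_ℝ = 𝓜.inn k (fun x => (v.1 k).eval x) (fun x => φ.eval x) := by
  rw [inner_eq_sum]
  exact sum_elem (fun j ψ => 𝓜.inn j (fun x => (v.1 j).eval x) (fun x => ψ.eval x))
    (fun k => by simp [Mesh.inn]) k φ hφ

theorem integral_mul_elem {f : ℝ → ℝ} (hf : BM a b f) (k : Fin 𝓜.K) (φ : ℝ[X])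
    (hφ : φ.natDegree ≤ N) :
    ∫ x, f x * (elem (𝓜 := 𝓜) k φ hφ).tf x ∂vol a b = 𝓜.inn k f (fun x => φ.eval x) := by
  rw [integral_mul_tf hf]
  exact sum_elem (fun j ψ => 𝓜.inn j f (fun x => ψ.eval x)) (fun k => by simp [Mesh.inn]) k φ hφ

/-- The vector representing a linear functional. -/
noncomputable def riesz (ℓ : Vh 𝓜 N → ℝ) : Vh 𝓜 N :=
  ∑ i, ℓ (stdOrthonormalBasis ℝ (Vh 𝓜 N) i) • stdOrthonormalBasis ℝ (Vh 𝓜 N) i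

theorem inner_riesz (ℓ : Vh 𝓜 N →ₗ[ℝ] ℝ) (v : Vh 𝓜 N) : ⟪riesz ℓ, v⟫_ℝ = ℓ v := by
  rw [riesz, sum_inner]
  conv_rhs => rw [← (stdOrthonormalBasis ℝ (Vh 𝓜 N)).sum_repr' v, map_sum]
  refine Finset.sum_congr rfl fun i _ => ?_
  rw [real_inner_smul_left, map_smul, smul_eq_mul, mul_comm]

/-- The `L²` projection. -/
noncomputable def proj (𝓜 : Mesh a b) (N : ℕ) (f : ℝ → ℝ) : Vh 𝓜 N :=
  riesz fun v => ∫ x, f x * v.tf x ∂vol a b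

theorem inner_proj {f : ℝ → ℝ} (hf : BM a b f) (v : Vh 𝓜 N) :
    ⟪proj 𝓜 N f, v⟫_ℝ = ∫ x, f x * v.tf x ∂vol a b :=
  inner_riesz
    { toFun := fun v => ∫ x, f x * v.tf x ∂vol a b
      map_add' := fun v w => by
        simp only [tf_add, mul_add]
        exact integral_add (hf.mul v.BM_tf).integrable (hf.mul w.BM_tf).integrable
      map_smul' := fun c w => by
        simp only [tf_smul, RingHom.id_apply, smul_eq_mul]
        rw [← integral_const_mul]
        congr 1; ext x; ring } v

theorem ext_inner {v w : Vh 𝓜 N} (h : ∀ u, ⟪v, u⟫_ℝ = ⟪w, u⟫_ℝ) : v = w :=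
  ext_inner_right ℝ h

theorem proj_unique {f : ℝ → ℝ} (hf : BM a b f) {w : Vh 𝓜 N}
    (h : ∀ k, ∀ φ : ℝ[X], φ.natDegree ≤ N →
      𝓜.inn k (fun x => (w.1 k).eval x) (fun x => φ.eval x) = 𝓜.inn k f (fun x => φ.eval x)) :
    w = proj 𝓜 N f := by
  refine ext_inner fun u => ?_
  rw [inner_proj hf, inner_eq_sum, integral_mul_tf hf]
  exact Finset.sum_congr rfl fun k _ => h k _ (u.2 k)

theorem inn_proj {f : ℝ → ℝ} (hf : BM a b f) (k : Fin 𝓜.K) {φ : ℝ[X]} (hφ : φ.natDegree ≤ N) :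
    𝓜.inn k (fun x => ((proj 𝓜 N f).1 k).eval x) (fun x => φ.eval x) =
      𝓜.inn k f (fun x => φ.eval x) := by
  rw [← inner_elem _ k φ hφ, inner_proj hf, integral_mul_elem hf]

theorem proj_add {f g : ℝ → ℝ} (hf : BM a b f) (hg : BM a b g) :
    proj 𝓜 N (fun x => f x + g x) = proj 𝓜 N f + proj 𝓜 N g := by
  refine ext_inner fun u => ?_
  rw [inner_add_left, inner_proj (hf.add hg), inner_proj hf, inner_proj hg,
    ← integral_add (hf.mul u.BM_tf).integrable (hg.mul u.BM_tf).integrable]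
  simp only [add_mul]

theorem proj_smul (c : ℝ) {f : ℝ → ℝ} (hf : BM a b f) :
    proj 𝓜 N (fun x => c * f x) = c • proj 𝓜 N f := by
  refine ext_inner fun u => ?_
  rw [real_inner_smul_left, inner_proj (hf.const_mul c), inner_proj hf, ← integral_const_mul]
  simp only [mul_assoc]

theorem proj_tf (w : Vh 𝓜 N) : proj 𝓜 N w.tf = w :=
  ext_inner fun u => by rw [inner_proj w.BM_tf, inner_def]

theorem norm_proj_sq_le {f : ℝ → ℝ} (hf : BM a b f) :
    ‖proj 𝓜 N f‖ ^ 2 ≤ ∫ x, f x ^ 2 ∂vol a b := by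
  have h1 : ‖proj 𝓜 N f‖ ^ 2 = ∫ x, f x * (proj 𝓜 N f).tf x ∂vol a b := by
    rw [← real_inner_self_eq_norm_sq, inner_proj hf]
  have h2 := (integral_mul_sq_le (μ := vol a b) hf.meas.aestronglyMeasurable
    (proj 𝓜 N f).BM_tf.meas.aestronglyMeasurable hf.sq_integrable
    (proj 𝓜 N f).BM_tf.sq_integrable).2
  rw [← h1, ← norm_sq_eq, sq (‖proj 𝓜 N f‖ ^ 2)] at h2
  rcases (sq_nonneg ‖proj 𝓜 N f‖).eq_or_lt with h | h
  · rw [← h]; exact integral_nonneg fun x => sq_nonneg _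
  · exact le_of_mul_le_mul_right h2 h

/-- On one element the projection is `L²`-stable. -/
theorem integral_proj_sq_le_elem {f : ℝ → ℝ} (hf : BM a b f) (k : Fin 𝓜.K) :
    ∫ x in 𝓜.left k..𝓜.right k, ((proj 𝓜 N f).1 k).eval x ^ 2 ≤
      ∫ x in 𝓜.left k..𝓜.right k, f x ^ 2 := by
  have hlr := (𝓜.left_lt_right k).le
  set q := (proj 𝓜 N f).1 k
  have h1 : ∫ x in 𝓜.left k..𝓜.right k, q.eval x ^ 2 =
      ∫ x in 𝓜.left k..𝓜.right k, f x * q.eval x := by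
    have := inn_proj hf k ((proj 𝓜 N f).2 k)
    simp only [sq]; exact this
  have hfk := Mesh.BM.elem 𝓜 (k := k) hf
  have hq : BM (𝓜.left k) (𝓜.right k) fun x => q.eval x := BM.of_continuous (by fun_prop)
  have h2 := (integral_mul_sq_le (μ := vol (𝓜.left k) (𝓜.right k)) hfk.meas.aestronglyMeasurable
    hq.meas.aestronglyMeasurable hfk.sq_integrable hq.sq_integrable).2
  rw [← intervalIntegral.integral_of_le hlr, ← intervalIntegral.integral_of_le hlr,
    ← intervalIntegral.integral_of_le hlr, ← h1, sq (∫ x in 𝓜.left k..𝓜.right k, q.eval x ^ 2)]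
    at h2
  rcases (integral_sq_elem_nonneg k q).eq_or_lt with h | h
  · rw [← h]; exact intervalIntegral.integral_nonneg hlr fun x _ => sq_nonneg _
  · exact le_of_mul_le_mul_right h2 h

end Vh

open scoped InnerProductSpace

/-! ### Linearity of traces and of element inner products -/

namespace Mesh

variable {a b : ℝ} (𝓜 : Mesh a b)

/-- `traceMinus` as a linear map. -/
noncomputable def traceMinusL : 𝓜.Piecewise →ₗ[ℝ] Fin (𝓜.K + 1) → ℝ where
  toFun := 𝓜.traceMinus
  map_add' v w := by
    ext i
    refine Fin.cases ?_ (fun k => ?_) i <;> simp [traceMinus]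
  map_smul' c w := by
    ext i
    refine Fin.cases ?_ (fun k => ?_) i <;> simp [traceMinus]

/-- `tracePlus` as a linear map. -/
noncomputable def tracePlusL : 𝓜.Piecewise →ₗ[ℝ] Fin (𝓜.K + 1) → ℝ where
  toFun := 𝓜.tracePlus
  map_add' v w := by
    ext i
    refine Fin.lastCases ?_ (fun k => ?_) i <;> simp [tracePlus]
  map_smul' c w := by
    ext i
    refine Fin.lastCases ?_ (fun k => ?_) i <;> simp [tracePlus]

theorem traceMinus_succ (w : 𝓜.Piecewise) (k : Fin 𝓜.K) :
    𝓜.traceMinus w k.succ = (w k).eval (𝓜.right k) := by simp [traceMinus]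

theorem traceMinus_zero (w : 𝓜.Piecewise) : 𝓜.traceMinus w 0 = 0 := by simp [traceMinus]

theorem tracePlus_castSucc (w : 𝓜.Piecewise) (k : Fin 𝓜.K) :
    𝓜.tracePlus w k.castSucc = (w k).eval (𝓜.left k) := by simp [tracePlus]

theorem tracePlus_last (w : 𝓜.Piecewise) : 𝓜.tracePlus w (Fin.last _) = 0 := by simp [tracePlus]

theorem inn_add_poly (k : Fin 𝓜.K) (p q r : ℝ[X]) :
    𝓜.inn k (fun x => (p + q).eval x) (fun x => r.eval x) =
      𝓜.inn k (fun x => p.eval x) (fun x => r.eval x) +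
        𝓜.inn k (fun x => q.eval x) (fun x => r.eval x) := by
  simp only [inn, Polynomial.eval_add, add_mul]
  exact intervalIntegral.integral_add (Continuous.intervalIntegrable (by fun_prop) _ _)
    (Continuous.intervalIntegrable (by fun_prop) _ _)

theorem inn_smul_poly (k : Fin 𝓜.K) (c : ℝ) (p r : ℝ[X]) :
    𝓜.inn k (fun x => (c • p).eval x) (fun x => r.eval x) =
      c * 𝓜.inn k (fun x => p.eval x) (fun x => r.eval x) := by
  simp only [inn, Polynomial.eval_smul, smul_eq_mul, mul_assoc]
  exact intervalIntegral.integral_const_mul _ _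

theorem inn_comm (k : Fin 𝓜.K) (f g : ℝ → ℝ) : 𝓜.inn k f g = 𝓜.inn k g f := by
  simp only [inn, mul_comm]

end Mesh

/-! ### Discrete derivatives and the discrete Riesz potential -/

namespace Vh

variable {a b : ℝ} {𝓜 : Mesh a b} {N : ℕ}

/-- The operator on the finite element space representing a bilinear form. -/
noncomputable def ofForm (B : Vh 𝓜 N →ₗ[ℝ] Vh 𝓜 N →ₗ[ℝ] ℝ) : Vh 𝓜 N →ₗ[ℝ] Vh 𝓜 N where
  toFun w := riesz (B w)
  map_add' v w := ext_inner fun u => by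
    rw [inner_add_left, inner_riesz, inner_riesz, inner_riesz, map_add, LinearMap.add_apply]
  map_smul' c w := ext_inner fun u => by
    rw [RingHom.id_apply, real_inner_smul_left, inner_riesz, inner_riesz, map_smul,
      LinearMap.smul_apply, smul_eq_mul]

theorem inner_ofForm (B : Vh 𝓜 N →ₗ[ℝ] Vh 𝓜 N →ₗ[ℝ] ℝ) (v w : Vh 𝓜 N) :
    ⟪ofForm B v, w⟫_ℝ = B v w := inner_riesz (B v) w

/-- The weak derivative of a piecewise polynomial, with numerical trace `τ`, on one element. -/
noncomputable def weakDeriv (τ : 𝓜.Piecewise →ₗ[ℝ] Fin (𝓜.K + 1) → ℝ) (w : 𝓜.Piecewise)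
    (k : Fin 𝓜.K) (φ : ℝ[X]) : ℝ :=
  -𝓜.inn k (fun x => (w k).eval x) (fun x => φ.derivative.eval x) + 𝓜.bdry k (τ w) φ

theorem weakDeriv_add (τ : 𝓜.Piecewise →ₗ[ℝ] Fin (𝓜.K + 1) → ℝ) (v w : 𝓜.Piecewise)
    (k : Fin 𝓜.K) (φ : ℝ[X]) :
    weakDeriv τ (v + w) k φ = weakDeriv τ v k φ + weakDeriv τ w k φ := by
  rw [weakDeriv, weakDeriv, weakDeriv, map_add, Pi.add_apply, 𝓜.inn_add_poly]
  simp only [Mesh.bdry, Pi.add_apply]; ring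

theorem weakDeriv_smul (τ : 𝓜.Piecewise →ₗ[ℝ] Fin (𝓜.K + 1) → ℝ) (c : ℝ) (w : 𝓜.Piecewise)
    (k : Fin 𝓜.K) (φ : ℝ[X]) : weakDeriv τ (c • w) k φ = c * weakDeriv τ w k φ := by
  rw [weakDeriv, weakDeriv, map_smul, Pi.smul_apply, 𝓜.inn_smul_poly]
  simp only [Mesh.bdry, Pi.smul_apply, smul_eq_mul]; ring

theorem weakDeriv_add_right (τ : 𝓜.Piecewise →ₗ[ℝ] Fin (𝓜.K + 1) → ℝ) (w : 𝓜.Piecewise)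
    (k : Fin 𝓜.K) (φ ψ : ℝ[X]) :
    weakDeriv τ w k (φ + ψ) = weakDeriv τ w k φ + weakDeriv τ w k ψ := by
  simp only [weakDeriv, 𝓜.inn_comm k (fun x => (w k).eval x), Polynomial.derivative_add]
  rw [𝓜.inn_add_poly]
  simp only [Mesh.bdry, Polynomial.eval_add]; ring

theorem weakDeriv_smul_right (τ : 𝓜.Piecewise →ₗ[ℝ] Fin (𝓜.K + 1) → ℝ) (c : ℝ)
    (w : 𝓜.Piecewise) (k : Fin 𝓜.K) (φ : ℝ[X]) :
    weakDeriv τ w k (c • φ) = c * weakDeriv τ w k φ := by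
  simp only [weakDeriv, 𝓜.inn_comm k (fun x => (w k).eval x), Polynomial.derivative_smul]
  rw [𝓜.inn_smul_poly]
  simp only [Mesh.bdry, Polynomial.eval_smul, smul_eq_mul]; ring

/-- The discrete derivative with numerical trace `τ`. -/
noncomputable def discDeriv (N : ℕ) (τ : 𝓜.Piecewise →ₗ[ℝ] Fin (𝓜.K + 1) → ℝ) :
    Vh 𝓜 N →ₗ[ℝ] Vh 𝓜 N :=
  ofForm (LinearMap.mk₂ ℝ (fun w φ => ∑ k, weakDeriv τ w.1 k (φ.1 k))
    (fun v w φ => by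
      rw [← Finset.sum_add_distrib]
      exact Finset.sum_congr rfl fun k _ => weakDeriv_add τ v.1 w.1 k _)
    (fun c w φ => by
      rw [smul_eq_mul, Finset.mul_sum]
      exact Finset.sum_congr rfl fun k _ => weakDeriv_smul τ c w.1 k _)
    (fun w φ ψ => by
      rw [← Finset.sum_add_distrib]
      exact Finset.sum_congr rfl fun k _ => weakDeriv_add_right τ w.1 k _ _)
    (fun c w φ => by
      rw [smul_eq_mul, Finset.mul_sum]
      exact Finset.sum_congr rfl fun k _ => weakDeriv_smul_right τ c w.1 k _))

theorem inner_discDeriv (τ : 𝓜.Piecewise →ₗ[ℝ] Fin (𝓜.K + 1) → ℝ) (w φ : Vh 𝓜 N) :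
    ⟪discDeriv N τ w, φ⟫_ℝ = ∑ k, weakDeriv τ w.1 k (φ.1 k) := by
  rw [discDeriv, inner_ofForm]; rfl

theorem eq_discDeriv {τ : 𝓜.Piecewise →ₗ[ℝ] Fin (𝓜.K + 1) → ℝ} {w s : Vh 𝓜 N}
    (h : ∀ k, ∀ φ : ℝ[X], φ.natDegree ≤ N →
      𝓜.inn k (fun x => (s.1 k).eval x) (fun x => φ.eval x) = weakDeriv τ w.1 k φ) :
    s = discDeriv N τ w := by
  refine ext_inner fun u => ?_
  rw [inner_discDeriv, inner_eq_sum]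
  exact Finset.sum_congr rfl fun k _ => h k _ (u.2 k)

/-- The discrete derivative with the traces from the left. -/
noncomputable def Dm : Vh 𝓜 N →ₗ[ℝ] Vh 𝓜 N := discDeriv N 𝓜.traceMinusL

/-- The discrete derivative with the traces from the right. -/
noncomputable def Dp : Vh 𝓜 N →ₗ[ℝ] Vh 𝓜 N := discDeriv N 𝓜.tracePlusL

theorem inn_derivative (k : Fin 𝓜.K) (p q : ℝ[X]) :
    𝓜.inn k (fun x => p.eval x) (fun x => q.derivative.eval x) +
      𝓜.inn k (fun x => q.eval x) (fun x => p.derivative.eval x) =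
      p.eval (𝓜.right k) * q.eval (𝓜.right k) - p.eval (𝓜.left k) * q.eval (𝓜.left k) := by
  have h := intervalIntegral.integral_mul_deriv_eq_deriv_mul (a := 𝓜.left k) (b := 𝓜.right k)
    (u := fun x => p.eval x) (v := fun x => q.eval x) (fun x _ => p.hasDerivAt x)
    (fun x _ => q.hasDerivAt x) (Continuous.intervalIntegrable (by fun_prop) _ _)
    (Continuous.intervalIntegrable (by fun_prop) _ _)
  rw [𝓜.inn_comm k (fun x => q.eval x)]
  simp only [Mesh.inn]
  linarith

/-- The two discrete derivatives are negative adjoints of each other. -/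
theorem inner_Dm (w s : Vh 𝓜 N) : ⟪Dm w, s⟫_ℝ = -⟪w, Dp s⟫_ℝ := by
  rw [real_inner_comm (Dp s) w, eq_neg_iff_add_eq_zero, Dm, Dp, inner_discDeriv, inner_discDeriv,
    ← Finset.sum_add_distrib]
  -- With alternating traces the boundary terms of an element reduce to the difference of `F = w⁻
  -- s⁺` at its two nodes. They telescope, and `F` vanishes at both ends since `w⁻ = 0` at `a` and
  -- `s⁺ = 0` at `b`.
  set F : Fin (𝓜.K + 1) → ℝ := fun i => 𝓜.traceMinus w.1 i * 𝓜.tracePlus s.1 i with hF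
  have h : ∀ k, weakDeriv 𝓜.traceMinusL w.1 k (s.1 k) + weakDeriv 𝓜.tracePlusL s.1 k (w.1 k) =
      F k.succ - F k.castSucc := by
    intro k
    have := inn_derivative k (w.1 k) (s.1 k)
    simp only [weakDeriv, Mesh.bdry, hF, Mesh.traceMinusL, Mesh.tracePlusL, LinearMap.coe_mk,
      AddHom.coe_mk, 𝓜.traceMinus_succ, 𝓜.tracePlus_castSucc]
    linarith
  simp only [h]
  rw [Finset.sum_sub_distrib]
  have h1 := Fin.sum_univ_succ F
  have h2 := Fin.sum_univ_castSucc F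
  have h3 : F 0 = 0 := by simp [hF, 𝓜.traceMinus_zero]
  have h4 : F (Fin.last _) = 0 := by simp [hF, 𝓜.tracePlus_last]
  linarith

/-- The discrete Riesz potential. -/
noncomputable def pot (μ : ℝ) : Vh 𝓜 N →ₗ[ℝ] Vh 𝓜 N :=
  -- Bilinearity rests on integrability of the kernel, which is available for `0 < μ`; otherwise the
  -- junk value `0` is taken.
  if hμ : 0 < μ then ofForm (LinearMap.mk₂ ℝ (fun v w => kerForm μ a b v.tf w.tf)
    (fun u v w => by
      have := kerForm_add_smul hμ u.BM_tf v.BM_tf w.BM_tf 1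
      simpa only [one_mul, ← tf_add] using this)
    (fun c v w => by
      have := kerForm_add_smul hμ (0 : Vh 𝓜 N).BM_tf v.BM_tf w.BM_tf c
      have h0 : (0 : Vh 𝓜 N).tf = fun _ => 0 := by
        ext x; have := tf_smul 0 (0 : Vh 𝓜 N) x; simpa using this
      simpa [kerForm, h0, ← tf_smul] using this)
    (fun u v w => by
      have := kerForm_add_smul hμ v.BM_tf w.BM_tf u.BM_tf 1
      simpa only [one_mul, ← tf_add, kerForm_comm μ a b _ u.tf] using this)
    (fun c v w => by
      have := kerForm_add_smul hμ (0 : Vh 𝓜 N).BM_tf w.BM_tf v.BM_tf c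
      have h0 : (0 : Vh 𝓜 N).tf = fun _ => 0 := by
        ext x; have := tf_smul 0 (0 : Vh 𝓜 N) x; simpa using this
      rw [kerForm_comm, kerForm_comm μ a b v.tf]
      simpa [kerForm, h0, ← tf_smul] using this)) else 0

theorem inner_pot {μ : ℝ} (hμ : 0 < μ) (v w : Vh 𝓜 N) :
    ⟪pot μ v, w⟫_ℝ = kerForm μ a b v.tf w.tf := by
  rw [pot, dif_pos hμ, inner_ofForm]; rfl

theorem inner_pot_comm {μ : ℝ} (hμ : 0 < μ) (v w : Vh 𝓜 N) :
    ⟪pot μ v, w⟫_ℝ = ⟪v, pot μ w⟫_ℝ := by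
  rw [inner_pot hμ, real_inner_comm, inner_pot hμ, kerForm_comm]

/-- The scheme defines this variable by projecting a fractional integral. The identity translates
that into the symmetric form on which the energy argument relies. -/
theorem pot_eq_proj {μ : ℝ} (hμ : 0 < μ) (v : Vh 𝓜 N) :
    pot μ v = proj 𝓜 N (Ik μ a b v.tf) := by
  refine ext_inner fun u => ?_
  rw [inner_pot hμ, inner_proj (v.BM_tf.Ik hμ), kerForm_comm,
    ← integral_mul_Ik hμ u.BM_tf v.BM_tf]
  simp only [mul_comm]

end Vh

open scoped InnerProductSpace

/-! ### Projections matching one endpoint of each element -/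

/-- The bound of the endpoint-normalized Legendre polynomials. -/
noncomputable def legC (N : ℕ) : ℝ := (exists_legendre N).choose

theorem legC_pos (N : ℕ) : 0 < legC N := (exists_legendre N).choose_spec.1

/-- The Legendre polynomial of degree `N` on `[l, r]`, normalized at the endpoint `c`. -/
noncomputable def leg (N : ℕ) (l r c : ℝ) : ℝ[X] :=
  if h : l < r ∧ (c = l ∨ c = r) then ((exists_legendre N).choose_spec.2 l r c h.1 h.2).choose
  else 0

theorem leg_spec (N : ℕ) {l r c : ℝ} (h : l < r) (hc : c = l ∨ c = r) :
    (leg N l r c).natDegree ≤ N ∧ (leg N l r c).eval c = 1 ∧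
      (∀ v : ℝ[X], v.degree < N → ∫ x in l..r, (leg N l r c).eval x * v.eval x = 0) ∧
      ∀ x ∈ Icc l r, |(leg N l r c).eval x| ≤ legC N := by
  rw [leg, dif_pos ⟨h, hc⟩]
  exact ((exists_legendre N).choose_spec.2 l r c h hc).choose_spec

namespace Vh

variable {a b : ℝ} {𝓜 : Mesh a b} {N : ℕ}

/-- A choice of one endpoint for each element. -/
def IsEnd (e : Fin 𝓜.K → ℝ) : Prop := ∀ k, e k = 𝓜.left k ∨ e k = 𝓜.right k

theorem isEnd_left : IsEnd 𝓜.left := fun _ => Or.inl rfl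

theorem isEnd_right : IsEnd 𝓜.right := fun _ => Or.inr rfl

theorem leg_elem_spec (N : ℕ) {e : Fin 𝓜.K → ℝ} (he : IsEnd e) (k : Fin 𝓜.K) :
    (leg N (𝓜.left k) (𝓜.right k) (e k)).natDegree ≤ N ∧
      (leg N (𝓜.left k) (𝓜.right k) (e k)).eval (e k) = 1 ∧
      (∀ v : ℝ[X], v.degree < N → 𝓜.inn k
        (fun x => (leg N (𝓜.left k) (𝓜.right k) (e k)).eval x) (fun x => v.eval x) = 0) ∧
      ∀ x ∈ Icc (𝓜.left k) (𝓜.right k), |(leg N (𝓜.left k) (𝓜.right k) (e k)).eval x| ≤ legC N :=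
  leg_spec N (𝓜.left_lt_right k) (he k)

/-- The Legendre polynomials on all elements, with given coefficients. -/
noncomputable def legSum (N : ℕ) {e : Fin 𝓜.K → ℝ} (he : IsEnd e) :
    (Fin 𝓜.K → ℝ) →ₗ[ℝ] Vh 𝓜 N where
  toFun c := ⟨fun k => c k • leg N (𝓜.left k) (𝓜.right k) (e k), fun k =>
    (Polynomial.natDegree_smul_le _ _).trans (leg_elem_spec N he k).1⟩
  map_add' _ _ := Subtype.ext (funext fun _ => add_smul _ _ _)
  map_smul' _ _ := Subtype.ext (funext fun _ => mul_smul _ _ _)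

/-- Evaluation at the chosen endpoints. -/
noncomputable def evalEnd (e : Fin 𝓜.K → ℝ) : Vh 𝓜 N →ₗ[ℝ] (Fin 𝓜.K → ℝ) where
  toFun w k := (w.1 k).eval (e k)
  map_add' v w := by ext k; simp
  map_smul' c w := by ext k; simp

/-- The difference between the endpoint-matching and the `L²` projections. -/
noncomputable def corr (N : ℕ) {e : Fin 𝓜.K → ℝ} (he : IsEnd e) (f : ℝ → ℝ) : Vh 𝓜 N :=
  legSum N he (fun k => f (e k)) - legSum N he (evalEnd e (proj 𝓜 N f))

theorem corr_elem {e : Fin 𝓜.K → ℝ} (he : IsEnd e) (f : ℝ → ℝ) (k : Fin 𝓜.K) :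
    (corr N he f).1 k = (f (e k) - ((proj 𝓜 N f).1 k).eval (e k)) •
      leg N (𝓜.left k) (𝓜.right k) (e k) := by
  rw [sub_smul]; rfl

/-- The projection which matches `f` at one endpoint of each element. -/
noncomputable def projEnd (N : ℕ) {e : Fin 𝓜.K → ℝ} (he : IsEnd e) (f : ℝ → ℝ) : Vh 𝓜 N :=
  proj 𝓜 N f + corr N he f

theorem projEnd_elem {e : Fin 𝓜.K → ℝ} (he : IsEnd e) (f : ℝ → ℝ) (k : Fin 𝓜.K) :
    (projEnd N he f).1 k = (proj 𝓜 N f).1 k + (f (e k) - ((proj 𝓜 N f).1 k).eval (e k)) •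
      leg N (𝓜.left k) (𝓜.right k) (e k) := by
  rw [← corr_elem]; rfl

theorem projEnd_eval {e : Fin 𝓜.K → ℝ} (he : IsEnd e) (f : ℝ → ℝ) (k : Fin 𝓜.K) :
    ((projEnd N he f).1 k).eval (e k) = f (e k) := by
  rw [projEnd_elem, Polynomial.eval_add, Polynomial.eval_smul, (leg_elem_spec N he k).2.1]
  simp

theorem natDegree_le_of_degree_lt {v : ℝ[X]} (h : v.degree < N) : v.natDegree ≤ N := by
  by_cases hv : v = 0
  · simp [hv]
  · exact ((Polynomial.natDegree_lt_iff_degree_lt hv).2 h).le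

theorem projEnd_orth {e : Fin 𝓜.K → ℝ} (he : IsEnd e) {f : ℝ → ℝ} (hf : BM a b f) (k : Fin 𝓜.K)
    {v : ℝ[X]} (hv : v.degree < N) :
    𝓜.inn k (fun x => ((projEnd N he f).1 k).eval x) (fun x => v.eval x) =
      𝓜.inn k f (fun x => v.eval x) := by
  rw [projEnd_elem, 𝓜.inn_add_poly, 𝓜.inn_smul_poly, (leg_elem_spec N he k).2.2.1 v hv, mul_zero,
    add_zero, inn_proj hf k (natDegree_le_of_degree_lt hv)]

theorem inn_sub_poly (k : Fin 𝓜.K) (p q r : ℝ[X]) :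
    𝓜.inn k (fun x => (p - q).eval x) (fun x => r.eval x) =
      𝓜.inn k (fun x => p.eval x) (fun x => r.eval x) -
        𝓜.inn k (fun x => q.eval x) (fun x => r.eval x) := by
  have := 𝓜.inn_add_poly k (p - q) q r
  rw [sub_add_cancel] at this
  linarith

theorem eq_projEnd {e : Fin 𝓜.K → ℝ} (he : IsEnd e) {f : ℝ → ℝ} (hf : BM a b f) {w : Vh 𝓜 N}
    (h1 : ∀ k, (w.1 k).eval (e k) = f (e k))
    (h2 : ∀ k, ∀ v : ℝ[X], v.degree < N →
      𝓜.inn k (fun x => (w.1 k).eval x) (fun x => v.eval x) = 𝓜.inn k f (fun x => v.eval x)) :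
    w = projEnd N he f := by
  refine Subtype.ext (funext fun k => sub_eq_zero.1 ?_)
  refine eq_zero_of_orthogonal (N := N) (𝓜.left_lt_right k) (he k)
    ((w - projEnd N he f).2 k) (fun v hv => ?_) ?_
  · have := inn_sub_poly k (w.1 k) ((projEnd N he f).1 k) v
    rw [h2 k v hv, projEnd_orth he hf k hv, sub_self] at this
    exact this
  · rw [Polynomial.eval_sub, h1, projEnd_eval, sub_self]

theorem isProjMinus_iff {f : ℝ → ℝ} (hf : BM a b f) {w : 𝓜.Piecewise}
    (h : 𝓜.IsProjMinus N f w) : (⟨w, h.mem⟩ : Vh 𝓜 N) = projEnd N isEnd_right f := by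
  refine eq_projEnd isEnd_right hf (fun k => h.right_eq k) fun k v hv => ?_
  have h1 := h.orth k v hv
  simp only [Mesh.inn, sub_mul] at h1
  have hv' : Continuous fun x => v.eval x := by fun_prop
  rw [intervalIntegral.integral_sub (Continuous.intervalIntegrable (by fun_prop) _ _)
    ((Mesh.BM.intervalIntegrable_elem 𝓜 k hf).mul_continuousOn hv'.continuousOn), sub_eq_zero] at h1
  exact h1

/-- Integration by parts on one element. -/
theorem inn_parts {f f' : ℝ → ℝ} (hfc : ContinuousOn f (Icc a b)) (hf' : BM a b f') (k : Fin 𝓜.K)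
    (hd : ∀ x ∈ Ioo (𝓜.left k) (𝓜.right k), HasDerivAt f (f' x) x) (φ : ℝ[X]) :
    𝓜.inn k f' (fun x => φ.eval x) = -𝓜.inn k f (fun x => φ.derivative.eval x) +
      (f (𝓜.right k) * φ.eval (𝓜.right k) - f (𝓜.left k) * φ.eval (𝓜.left k)) := by
  have hlr := (𝓜.left_lt_right k).le
  have h := intervalIntegral.integral_mul_deriv_eq_deriv_mul_of_hasDerivAt (a := 𝓜.left k)
    (b := 𝓜.right k) (u := f) (v := fun x => φ.eval x) (u' := f')
    (v' := fun x => φ.derivative.eval x)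
    (hfc.mono (by rw [uIcc_of_le hlr]; exact 𝓜.Icc_subset k))
    (Continuous.continuousOn (by fun_prop))
    (by rw [min_eq_left hlr, max_eq_right hlr]; exact hd) (fun x _ => φ.hasDerivAt x)
    (Mesh.BM.intervalIntegrable_elem 𝓜 k hf') (Continuous.intervalIntegrable (by fun_prop) _ _)
  simp only [Mesh.inn]
  linarith

theorem degree_derivative_lt {φ : ℝ[X]} (hφ : φ.natDegree ≤ N) : φ.derivative.degree < N := by
  by_cases h : φ.derivative = 0
  · rw [h, Polynomial.degree_zero]; exact WithBot.bot_lt_coe N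
  · rw [Polynomial.degree_eq_natDegree h, Nat.cast_lt]
    have h1 : φ.natDegree ≠ 0 := fun h0 => h (Polynomial.derivative_of_natDegree_zero h0)
    exact (Polynomial.natDegree_derivative_lt h1).trans_le hφ

/-- Commuting property of the right-endpoint projection. -/
theorem Dm_projEnd {f f' : ℝ → ℝ} (hf : BM a b f) (hfc : ContinuousOn f (Icc a b))
    (hf' : BM a b f') (hd : ∀ k, ∀ x ∈ Ioo (𝓜.left k) (𝓜.right k), HasDerivAt f (f' x) x)
    (ha : f a = 0) : Dm (projEnd N (𝓜 := 𝓜) isEnd_right f) = proj 𝓜 N f' := by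
  refine Eq.symm (eq_discDeriv fun k φ hφ => ?_)
  rw [inn_proj hf' k hφ, inn_parts hfc hf' k (hd k), weakDeriv,
    projEnd_orth isEnd_right hf k (degree_derivative_lt hφ)]
  congr 1
  -- The left traces of the projection are the nodal values of `f`; at the first node this is the
  -- boundary condition `f(a) = 0`. Inside the element `φ'` has degree below `N`, so the projection
  -- may replace `f` there.
  have htr : ∀ i : Fin (𝓜.K + 1), 𝓜.traceMinus (projEnd N (𝓜 := 𝓜) isEnd_right f).1 i =
      f (𝓜.node i) := by
    intro i
    refine Fin.cases ?_ (fun k => ?_) i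
    · rw [𝓜.traceMinus_zero, 𝓜.node_zero, ha]
    · rw [𝓜.traceMinus_succ, projEnd_eval]; rfl
  change _ = 𝓜.traceMinus (projEnd N (𝓜 := 𝓜) isEnd_right f).1 k.succ * _ -
    𝓜.traceMinus (projEnd N (𝓜 := 𝓜) isEnd_right f).1 k.castSucc * _
  rw [htr, htr]; rfl

/-- Commuting property of the left-endpoint projection. -/
theorem Dp_projEnd {f f' : ℝ → ℝ} (hf : BM a b f) (hfc : ContinuousOn f (Icc a b))
    (hf' : BM a b f') (hd : ∀ k, ∀ x ∈ Ioo (𝓜.left k) (𝓜.right k), HasDerivAt f (f' x) x)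
    (hb : f b = 0) : Dp (projEnd N (𝓜 := 𝓜) isEnd_left f) = proj 𝓜 N f' := by
  refine Eq.symm (eq_discDeriv fun k φ hφ => ?_)
  rw [inn_proj hf' k hφ, inn_parts hfc hf' k (hd k), weakDeriv,
    projEnd_orth isEnd_left hf k (degree_derivative_lt hφ)]
  congr 1
  have htr : ∀ i : Fin (𝓜.K + 1), 𝓜.tracePlus (projEnd N (𝓜 := 𝓜) isEnd_left f).1 i =
      f (𝓜.node i) := by
    intro i
    refine Fin.lastCases ?_ (fun k => ?_) i
    · rw [𝓜.tracePlus_last, 𝓜.node_last, hb]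
    · rw [𝓜.tracePlus_castSucc, projEnd_eval]; rfl
  change _ = 𝓜.tracePlus (projEnd N (𝓜 := 𝓜) isEnd_left f).1 k.succ * _ -
    𝓜.tracePlus (projEnd N (𝓜 := 𝓜) isEnd_left f).1 k.castSucc * _
  rw [htr, htr]; rfl

/-! ### Inverting the discrete derivative by a primitive -/

theorem exists_abs_tf_le (w : Vh 𝓜 N) : ∃ M, ∀ x, |w.tf x| ≤ M := by
  obtain ⟨M, hM0, hM⟩ := w.BM_tf.exists_pos
  refine ⟨M, fun x => ?_⟩
  by_cases h : x ∈ Ioo a b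
  · exact hM x (Ioo_subset_Ioc_self h)
  · rw [tf, 𝓜.toFun_eq_zero _ h, abs_zero]; exact hM0.le

theorem intervalIntegrable_tf (w : Vh 𝓜 N) (x y : ℝ) : IntervalIntegrable w.tf volume x y := by
  obtain ⟨M, hM⟩ := w.exists_abs_tf_le
  rw [intervalIntegrable_iff]
  exact Measure.integrableOn_of_bounded (M := M) measure_Ioc_lt_top.ne
    w.BM_tf.meas.aestronglyMeasurable (Filter.Eventually.of_forall hM)

theorem continuous_Jb_tf (w : Vh 𝓜 N) : Continuous (Jb b w.tf) := by
  have h := (intervalIntegral.continuous_primitive w.intervalIntegrable_tf b).neg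
  refine h.congr fun x => ?_
  rw [Pi.neg_apply, Jb, intervalIntegral.integral_symm x b, neg_neg]

theorem tf_eventuallyEq (w : Vh 𝓜 N) {k : Fin 𝓜.K} {x : ℝ} (hx : x ∈ Ioo (𝓜.left k) (𝓜.right k)) :
    w.tf =ᶠ[nhds x] fun y => (w.1 k).eval y := by
  filter_upwards [Ioo_mem_nhds hx.1 hx.2] with y hy using 𝓜.toFun_eq w.1 hy

theorem hasDerivAt_Jb_tf (w : Vh 𝓜 N) {k : Fin 𝓜.K} {x : ℝ}
    (hx : x ∈ Ioo (𝓜.left k) (𝓜.right k)) : HasDerivAt (Jb b w.tf) (-w.tf x) x := by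
  have hc : ContinuousAt w.tf x :=
    (continuousAt_congr (w.tf_eventuallyEq hx)).2 (Polynomial.continuous _).continuousAt
  exact intervalIntegral.integral_hasDerivAt_left (w.intervalIntegrable_tf x b)
    w.BM_tf.meas.stronglyMeasurable.stronglyMeasurableAtFilter hc

/-- The tail integral is a primitive of `-z` that vanishes at `b`, so the commuting property
applies. This is an explicit right inverse of the discrete derivative up to sign. -/
theorem Dp_projEnd_Jb (z : Vh 𝓜 N) : Dp (projEnd N (𝓜 := 𝓜) isEnd_left (Jb b z.tf)) = -z := by
  have h := Dp_projEnd (𝓜 := 𝓜) (N := N) (f := Jb b z.tf) (f' := fun x => -1 * z.tf x)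
    (BM.of_continuous z.continuous_Jb_tf) z.continuous_Jb_tf.continuousOn (z.BM_tf.const_mul _)
    (fun k x hx => by rw [neg_one_mul]; exact z.hasDerivAt_Jb_tf hx) (by simp [Jb])
  rw [h, proj_smul _ z.BM_tf, proj_tf, neg_one_smul]

theorem Dp_bijective : Function.Bijective (Dp : Vh 𝓜 N →ₗ[ℝ] Vh 𝓜 N) := by
  have hs : Function.Surjective (Dp : Vh 𝓜 N →ₗ[ℝ] Vh 𝓜 N) := fun z =>
    ⟨_, by rw [Dp_projEnd_Jb (-z), neg_neg]⟩
  exact ⟨LinearMap.injective_iff_surjective.2 hs, hs⟩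

/-- By injectivity the right inverse is also a left inverse. Bounds on `s` may thus be read off from
the primitive of its discrete derivative, a much weaker quantity than the derivative. -/
theorem eq_neg_projEnd_Jb (s : Vh 𝓜 N) :
    s = -projEnd N (𝓜 := 𝓜) isEnd_left (Jb b (Dp s).tf) := by
  apply Dp_bijective.1
  rw [map_neg, Dp_projEnd_Jb, neg_neg]

end Vh

open scoped InnerProductSpace

/-! ### Stability and approximation properties of the projections -/

namespace Vh

/-- Stability of the endpoint projections on piecewise polynomials of degree at most `N + 1`. -/
theorem exists_norm_projEnd_le (N : ℕ) : ∃ C > 0, ∀ {a b : ℝ} (𝓜 : Mesh a b) (e : Fin 𝓜.K → ℝ)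
    (he : IsEnd e) (f : ℝ → ℝ), BM a b f →
    (∀ k, ∃ Q : ℝ[X], Q.natDegree ≤ N + 1 ∧ ∀ x ∈ Icc (𝓜.left k) (𝓜.right k), f x = Q.eval x) →
    ‖projEnd N he f‖ ^ 2 ≤ C * ∫ x, f x ^ 2 ∂vol a b := by
  obtain ⟨C, hC, h⟩ := exists_inverse_sup (N + 1)
  refine ⟨2 + 8 * (legC N ^ 2 * C), by positivity, fun {a b} 𝓜 e he f hf hQ => ?_⟩
  have hf2 : BM a b fun x => f x ^ 2 := by simpa [sq] using hf.mul hf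
  rw [norm_sq_eq_sum, 𝓜.integral_eq_sum (fun k => Mesh.BM.intervalIntegrable_elem 𝓜 k hf2),
    Finset.mul_sum]
  refine Finset.sum_le_sum fun k _ => ?_
  obtain ⟨Q, hQN, hQf⟩ := hQ k
  have hlr := 𝓜.left_lt_right k
  set l := 𝓜.left k
  set r := 𝓜.right k
  set p := (proj 𝓜 N f).1 k
  set L := leg N l r (e k)
  set I := ∫ x in l..r, f x ^ 2 with hI
  have hek : e k ∈ Icc l r := by
    rcases he k with h | h <;> rw [h]
    · exact ⟨le_rfl, hlr.le⟩
    · exact ⟨hlr.le, le_rfl⟩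
  have hp : ∫ x in l..r, p.eval x ^ 2 ≤ I := integral_proj_sq_le_elem hf k
  have hQI : ∫ x in l..r, Q.eval x ^ 2 = I :=
    𝓜.integral_congr_elem fun x hx => by rw [hQf x (Ioo_subset_Icc_self hx)]
  set c := f (e k) - p.eval (e k) with hc
  have h1 := h l r hlr Q hQN _ hek
  have h2 := h l r hlr p (((proj 𝓜 N f).2 k).trans (Nat.le_succ _)) _ hek
  rw [← hQf _ hek, hQI] at h1
  have h2' := h2.trans (mul_le_mul_of_nonneg_left hp hC.le)
  have hd : 0 < r - l := sub_pos.2 hlr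
  -- The mismatch `c` at the endpoint is bounded by the inverse sup estimate for both `Q` and `p`;
  -- it is used in degree `N + 1` because primitives of piecewise polynomials of degree `N` are to
  -- be projected. The factor `r - l` reappears when the constant bound is integrated over the
  -- element.
  have hc2 : (r - l) * c ^ 2 ≤ 4 * (C * I) := by
    have : c ^ 2 ≤ 2 * f (e k) ^ 2 + 2 * p.eval (e k) ^ 2 := by
      rw [hc]; nlinarith [sq_nonneg (f (e k) + p.eval (e k))]
    nlinarith [mul_le_mul_of_nonneg_left this hd.le]
  have hpt : ∀ x ∈ Icc l r, ((projEnd N he f).1 k).eval x ^ 2 ≤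
      2 * p.eval x ^ 2 + 2 * (c ^ 2 * legC N ^ 2) := by
    intro x hx
    have hL := (leg_elem_spec N he k).2.2.2 x hx
    have hL2 : L.eval x ^ 2 ≤ legC N ^ 2 := by
      rw [← sq_abs]; exact pow_le_pow_left₀ (abs_nonneg _) hL 2
    have := mul_le_mul_of_nonneg_left hL2 (sq_nonneg c)
    rw [projEnd_elem, Polynomial.eval_add, Polynomial.eval_smul, smul_eq_mul]
    nlinarith [sq_nonneg (p.eval x - c * L.eval x)]
  calc ∫ x in l..r, ((projEnd N he f).1 k).eval x ^ 2
      ≤ ∫ x in l..r, (2 * p.eval x ^ 2 + 2 * (c ^ 2 * legC N ^ 2)) :=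
        intervalIntegral.integral_mono_on hlr.le (Continuous.intervalIntegrable (by fun_prop) _ _)
          (Continuous.intervalIntegrable (by fun_prop) _ _) hpt
    _ = 2 * (∫ x in l..r, p.eval x ^ 2) + 2 * legC N ^ 2 * ((r - l) * c ^ 2) := by
        rw [intervalIntegral.integral_add (Continuous.intervalIntegrable (by fun_prop) _ _)
          (by simp), intervalIntegral.integral_const_mul, intervalIntegral.integral_const,
          smul_eq_mul]
        ring
    _ ≤ 2 * I + 2 * legC N ^ 2 * (4 * (C * I)) := by gcongr
    _ = _ := by ring

variable {a b : ℝ} {𝓜 : Mesh a b} {N : ℕ}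

theorem Jb_tf_eq_poly (w : Vh 𝓜 N) (k : Fin 𝓜.K) : ∃ Q : ℝ[X], Q.natDegree ≤ N + 1 ∧
    ∀ x ∈ Icc (𝓜.left k) (𝓜.right k), Jb b w.tf x = Q.eval x := by
  obtain ⟨Q, hQ, hQd, hQl⟩ := exists_antiderivative (w.2 k) (𝓜.left k) (-Jb b w.tf (𝓜.left k))
  refine ⟨-Q, by rwa [Polynomial.natDegree_neg], fun x hx => ?_⟩
  have h1 : Jb b w.tf (𝓜.left k) = (∫ s in 𝓜.left k..x, w.tf s) + Jb b w.tf x :=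
    (intervalIntegral.integral_add_adjacent_intervals (w.intervalIntegrable_tf _ _)
      (w.intervalIntegrable_tf _ _)).symm
  have h2 : ∫ s in 𝓜.left k..x, w.tf s = ∫ s in 𝓜.left k..x, Q.derivative.eval s := by
    rw [intervalIntegral.integral_of_le hx.1, intervalIntegral.integral_of_le hx.1,
      integral_Ioc_eq_integral_Ioo, integral_Ioc_eq_integral_Ioo]
    refine setIntegral_congr_fun measurableSet_Ioo fun s hs => ?_
    simp only [hQd]
    exact 𝓜.toFun_eq w.1 ⟨hs.1, hs.2.trans_le hx.2⟩
  have h3 : ∫ s in 𝓜.left k..x, Q.derivative.eval s = Q.eval x - Q.eval (𝓜.left k) :=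
    intervalIntegral.integral_eq_sub_of_hasDerivAt (fun y _ => Q.hasDerivAt y)
      (Continuous.intervalIntegrable (by fun_prop) _ _)
  rw [Polynomial.eval_neg]
  linarith

/-- The primitive of `Dp s` is piecewise polynomial of degree at most `N + 1`, where the endpoint
projection is `L²`-stable, and that projection equals `-s`. -/
theorem exists_norm_le_Jb (N : ℕ) : ∃ C > 0, ∀ {a b : ℝ} (𝓜 : Mesh a b) (s : Vh 𝓜 N),
    ‖s‖ ^ 2 ≤ C * ∫ x, Jb b (Dp s).tf x ^ 2 ∂vol a b := by
  obtain ⟨C, hC, h⟩ := exists_norm_projEnd_le N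
  refine ⟨C, hC, fun 𝓜 s => ?_⟩
  have h1 := h 𝓜 _ isEnd_left _ (BM.of_continuous (Dp s).continuous_Jb_tf) (Dp s).Jb_tf_eq_poly
  rw [← norm_neg, ← eq_neg_projEnd_Jb] at h1
  exact h1

theorem integral_Jb_sq_le_norm (w : Vh 𝓜 N) :
    ∫ x, Jb b w.tf x ^ 2 ∂vol a b ≤ (b - a) ^ 2 * ‖w‖ ^ 2 := by
  have hab := 𝓜.a_le_b
  have h1 : ∀ x ∈ Ioc a b, Jb b w.tf x ^ 2 ≤ (b - a) * ‖w‖ ^ 2 := by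
    intro x hx
    have hx' := Ioc_subset_Icc_self hx
    have h := sq_integral_le w.BM_tf hx' (right_mem_Icc.2 hab) hx.2
    have h2 := integral_sq_mono w.BM_tf hx' (right_mem_Icc.2 hab) hx.2
    rw [norm_sq_eq]
    refine h.trans ?_
    exact mul_le_mul (by linarith [hx.1]) h2
      (intervalIntegral.integral_nonneg hx.2 fun _ _ => sq_nonneg _) (by linarith)
  have h2 : ∫ x, Jb b w.tf x ^ 2 ∂vol a b ≤ ∫ _x, (b - a) * ‖w‖ ^ 2 ∂vol a b :=
    integral_mono_ae (integrable_sq_of_continuousOn w.continuous_Jb_tf.continuousOn)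
      (integrable_const _) (ae_vol h1)
  rw [← intervalIntegral.integral_of_le hab (f := fun _ => (b - a) * ‖w‖ ^ 2),
    intervalIntegral.integral_const, smul_eq_mul] at h2
  linarith

/-- Discrete Poincaré inequality. -/
theorem exists_norm_le_Dm (N : ℕ) {a b : ℝ} (hab : a < b) : ∃ C > 0, ∀ (𝓜 : Mesh a b)
    (w : Vh 𝓜 N), ‖w‖ ≤ C * ‖Dm w‖ := by
  obtain ⟨C, hC, h⟩ := exists_norm_le_Jb N
  have hba : 0 < b - a := sub_pos.2 hab
  refine ⟨√C * (b - a), by positivity, fun 𝓜 w => ?_⟩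
  -- Duality: with `Dp s = w` one has `‖w‖² = -⟪Dm w, s⟫`, and `‖s‖` is bounded through the
  -- primitive of `w`.
  obtain ⟨s, hs⟩ := (Dp_bijective (𝓜 := 𝓜) (N := N)).2 w
  have h1 : ‖s‖ ≤ √C * (b - a) * ‖w‖ := by
    have h2 := (h 𝓜 s).trans (mul_le_mul_of_nonneg_left (Dp s).integral_Jb_sq_le_norm hC.le)
    rw [hs] at h2
    refine abs_le_of_sq_le_sq' ?_ (by positivity) |>.2
    rw [mul_pow, mul_pow, Real.sq_sqrt hC.le]
    linarith
  have h3 : ‖w‖ ^ 2 ≤ ‖Dm w‖ * ‖s‖ := by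
    have h4 := inner_Dm w s
    rw [hs, real_inner_self_eq_norm_sq] at h4
    have := abs_real_inner_le_norm (Dm w) s
    rw [h4, abs_neg, abs_of_nonneg (sq_nonneg _)] at this
    exact this
  rcases (norm_nonneg w).eq_or_lt with h0 | h0
  · rw [← h0]; positivity
  · refine le_of_mul_le_mul_right ?_ h0
    calc ‖w‖ * ‖w‖ = ‖w‖ ^ 2 := by ring
      _ ≤ ‖Dm w‖ * ‖s‖ := h3
      _ ≤ ‖Dm w‖ * (√C * (b - a) * ‖w‖) := mul_le_mul_of_nonneg_left h1 (norm_nonneg _)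
      _ = _ := by ring

/-- Approximation property of the projections. -/
theorem exists_proj_approx (N : ℕ) : ∃ C > 0, ∀ {a b : ℝ} (𝓜 : Mesh a b) (f : ℝ → ℝ) (M : ℝ),
    DerivBound (N + 1) M f → ∀ k, ∀ x ∈ Icc (𝓜.left k) (𝓜.right k),
      |f x - ((proj 𝓜 N f).1 k).eval x| ≤ C * (M * (𝓜.right k - 𝓜.left k) ^ (N + 1)) := by
  obtain ⟨C, hC, h⟩ := exists_inverse_sup N
  refine ⟨1 + √C, by positivity, fun {a b} 𝓜 f M hf k x hx => ?_⟩
  have hlr := 𝓜.left_lt_right k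
  obtain ⟨T, hT, hTf⟩ := hf.exists_approx (l := 𝓜.left k) (r := 𝓜.right k)
  set l := 𝓜.left k
  set r := 𝓜.right k
  set E := M * (r - l) ^ (N + 1)
  have hd : 0 < r - l := sub_pos.2 hlr
  have hE : 0 ≤ E := (abs_nonneg _).trans (hTf x hx)
  have hfb : BM a b f := BM.of_continuous hf.continuous
  have hTb : BM a b fun x => -1 * T.eval x := BM.of_continuous (by fun_prop)
  -- The projection reproduces the approximating polynomial `T`, so stability and the inverse sup
  -- estimate are applied to the small function `f - T`.
  have hproj : (proj 𝓜 N fun x => f x + -1 * T.eval x).1 k = (proj 𝓜 N f).1 k - T := by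
    have h1 : (⟨fun _ => -T, fun _ => by rwa [Polynomial.natDegree_neg]⟩ : Vh 𝓜 N) =
        proj 𝓜 N fun x => -1 * T.eval x :=
      proj_unique hTb fun k φ _ => by simp
    rw [proj_add hfb hTb, ← h1, sub_eq_add_neg]; rfl
  have h2 := integral_proj_sq_le_elem (𝓜 := 𝓜) (N := N) (hfb.add hTb) k
  rw [hproj] at h2
  have h3 : ∫ x in l..r, (f x + -1 * T.eval x) ^ 2 ≤ ∫ _x in l..r, E ^ 2 := by
    have hcf := hf.continuous
    refine intervalIntegral.integral_mono_on hlr.le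
      (Continuous.intervalIntegrable (by fun_prop) _ _) (by simp) fun y hy => ?_
    rw [neg_one_mul, ← sub_eq_add_neg, ← sq_abs]
    exact pow_le_pow_left₀ (abs_nonneg _) (hTf y hy) 2
  rw [intervalIntegral.integral_const, smul_eq_mul] at h3
  have h4 := h l r hlr ((proj 𝓜 N f).1 k - T)
    ((Polynomial.natDegree_sub_le _ _).trans (max_le ((proj 𝓜 N f).2 k) hT)) x hx
  have h5 : (r - l) * ((proj 𝓜 N f).1 k - T).eval x ^ 2 ≤ (r - l) * (C * E ^ 2) := by
    have := mul_le_mul_of_nonneg_left (h2.trans h3) hC.le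
    linarith
  have h6 : |((proj 𝓜 N f).1 k - T).eval x| ≤ √C * E := by
    refine abs_le_of_sq_le_sq ?_ (by positivity)
    rw [mul_pow, Real.sq_sqrt hC.le]
    exact le_of_mul_le_mul_left h5 hd
  rw [Polynomial.eval_sub] at h6
  calc |f x - ((proj 𝓜 N f).1 k).eval x|
      = |(f x - T.eval x) - (((proj 𝓜 N f).1 k).eval x - T.eval x)| := by congr 1; ring
    _ ≤ |f x - T.eval x| + |((proj 𝓜 N f).1 k).eval x - T.eval x| := abs_sub _ _
    _ ≤ E + √C * E := add_le_add (hTf x hx) h6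
    _ = _ := by ring

/-- On each element the correction is the endpoint error of the `L²` projection times a Legendre
polynomial, which is bounded independently of the element. -/
theorem exists_corr_approx (N : ℕ) : ∃ C > 0, ∀ {a b : ℝ} (𝓜 : Mesh a b) (e : Fin 𝓜.K → ℝ)
    (he : IsEnd e) (f : ℝ → ℝ) (M : ℝ), DerivBound (N + 1) M f →
      ∀ k, ∀ x ∈ Icc (𝓜.left k) (𝓜.right k),
      |((corr N he f).1 k).eval x| ≤ C * (M * (𝓜.right k - 𝓜.left k) ^ (N + 1)) := by
  obtain ⟨C, hC, h⟩ := exists_proj_approx N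
  have hleg := legC_pos N
  refine ⟨legC N * C, by positivity, fun 𝓜 e he f M hf k x hx => ?_⟩
  have hlr := 𝓜.left_lt_right k
  have hek : e k ∈ Icc (𝓜.left k) (𝓜.right k) := by
    rcases he k with h | h <;> rw [h]
    · exact ⟨le_rfl, hlr.le⟩
    · exact ⟨hlr.le, le_rfl⟩
  rw [corr_elem, Polynomial.eval_smul, smul_eq_mul, abs_mul, mul_comm, mul_assoc]
  exact mul_le_mul ((leg_elem_spec N he k).2.2.2 x hx) (h 𝓜 f M hf k _ hek) (abs_nonneg _) hleg.le

end Vh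

open scoped InnerProductSpace

/-! ### Inverse inequality and mean-zero gain for the Riesz form -/

namespace Vh

variable {a b : ℝ} {𝓜 : Mesh a b} {N : ℕ}

theorem integral_tf_elem (w : Vh 𝓜 N) {k : Fin 𝓜.K} {x : ℝ}
    (hx : x ∈ Icc (𝓜.left k) (𝓜.right k)) :
    ∫ s in 𝓜.left k..x, w.tf s = ∫ s in 𝓜.left k..x, (w.1 k).eval s := by
  rw [intervalIntegral.integral_of_le hx.1, intervalIntegral.integral_of_le hx.1,
    integral_Ioc_eq_integral_Ioo, integral_Ioc_eq_integral_Ioo]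
  exact setIntegral_congr_fun measurableSet_Ioo fun s hs =>
    𝓜.toFun_eq w.1 ⟨hs.1, hs.2.trans_le hx.2⟩

theorem continuousOn_expL {t : ℝ} (ht : 0 < t) {f : ℝ → ℝ} (hf : BM a b f) (hab : a ≤ b) :
    ContinuousOn (expL a b t f) (Icc a b) := by
  have h := (continuousOn_primitive hf hab).sub
    ((continuousOn_primitive (hf.expL ht.le) hab).const_smul t)
  refine h.congr fun x hx => ?_
  have := integral_eq_expL ht hf hx
  change expL a b t f x = (∫ s in a..x, f s) - t * ∫ s in a..x, expL a b t f s
  linarith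

/-- On one element the causal average still satisfies the integrated form of `Λ' + t Λ = q`, with
some unknown initial value carrying the influence of the earlier elements. The smoothing bound is
insensitive to that value, and `t (r - l) ≤ 2` turns its factor into `9`. -/
theorem exists_elem_le_expL (N : ℕ) : ∃ C > 0, ∀ {a b : ℝ} (𝓜 : Mesh a b) (z : Vh 𝓜 N) (k : Fin 𝓜.K)
    (t : ℝ), 0 < t → t * (𝓜.right k - 𝓜.left k) ≤ 2 →
    (𝓜.right k - 𝓜.left k) ^ 2 * (∫ x in 𝓜.left k..𝓜.right k, (z.1 k).eval x ^ 2) ≤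
      C * ∫ x in 𝓜.left k..𝓜.right k, expL a b t z.tf x ^ 2 := by
  obtain ⟨C, hC, h⟩ := exists_smoothing_lower N
  refine ⟨C * 9, by positivity, fun {a b} 𝓜 z k t ht htk => ?_⟩
  have hlr := 𝓜.left_lt_right k
  have hd := sub_pos.2 hlr
  have hab := 𝓜.a_le_b
  have hc := continuousOn_expL ht z.BM_tf hab
  have hL := z.BM_tf.expL ht.le
  have h1 := h _ _ t hlr ht.le (z.1 k) (z.2 k) (expL a b t z.tf) (hc.mono (𝓜.Icc_subset k)) (by
    intro x hx
    have hxa := 𝓜.Icc_subset k hx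
    have e1 := integral_eq_expL ht z.BM_tf hxa
    have e2 := integral_eq_expL ht z.BM_tf (𝓜.left_mem k)
    have ha : a ∈ Icc a b := left_mem_Icc.2 hab
    have e3 := intervalIntegral.integral_add_adjacent_intervals
      (hL.intervalIntegrable ha (𝓜.left_mem k)) (hL.intervalIntegrable (𝓜.left_mem k) hxa)
    have e4 := intervalIntegral.integral_add_adjacent_intervals
      (z.intervalIntegrable_tf a (𝓜.left k)) (z.intervalIntegrable_tf (𝓜.left k) x)
    rw [← z.integral_tf_elem hx]
    rw [← e3] at e1
    linarith)
  refine h1.trans ?_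
  rw [mul_assoc]
  refine mul_le_mul_of_nonneg_left (mul_le_mul_of_nonneg_right ?_ ?_) hC.le
  · have : 0 < t * (𝓜.right k - 𝓜.left k) := mul_pos ht hd
    nlinarith
  · exact intervalIntegral.integral_nonneg hlr.le fun _ _ => sq_nonneg _

/-- Inverse inequality for the Riesz form on the finite element space. -/
theorem exists_inverse_kerForm (N : ℕ) {μ : ℝ} (hμ : 0 < μ) (hμ1 : μ < 1) : ∃ C > 0,
    ∀ {a b : ℝ} (𝓜 : Mesh a b) (z : Vh 𝓜 N),
    ∑ k, (𝓜.right k - 𝓜.left k) ^ μ * (∫ x in 𝓜.left k..𝓜.right k, (z.1 k).eval x ^ 2) ≤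
      C * kerForm μ a b z.tf z.tf := by
  obtain ⟨C, hC, h⟩ := exists_elem_le_expL N
  have hΓ := Real.Gamma_pos_of_pos (show 0 < 1 - μ by linarith)
  refine ⟨C * Real.Gamma (1 - μ) / 2, by positivity, fun {a b} 𝓜 z => ?_⟩
  obtain ⟨hi, hk⟩ := kerForm_eq_integral_expForm hμ hμ1 z.BM_tf
  set d : Fin 𝓜.K → ℝ := fun k => 𝓜.right k - 𝓜.left k with hd
  have hd0 : ∀ k, 0 < d k := fun k => sub_pos.2 (𝓜.left_lt_right k)
  set S : Fin 𝓜.K → ℝ := fun k => ∫ x in 𝓜.left k..𝓜.right k, (z.1 k).eval x ^ 2 with hS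
  have hS0 : ∀ k, 0 ≤ S k := fun k => integral_sq_elem_nonneg k _
  -- Each element uses its own window of frequencies, of order `1 / d k`, so no comparison between
  -- element lengths is needed. Windows may overlap freely, since the elements contribute disjoint
  -- parts of `∫ L²`.
  set g : ℝ → ℝ := fun t => ∑ k, (Icc (1 / d k) (2 / d k)).indicator
    (fun _ => 2 / C * (d k ^ (μ + 1) * S k)) t with hg
  have hgi : ∀ k, IntegrableOn ((Icc (1 / d k) (2 / d k)).indicator
      (fun _ => 2 / C * (d k ^ (μ + 1) * S k))) (Ioi 0) := fun k =>
    (integrable_indicator_iff measurableSet_Icc).2 (by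
      refine IntegrableOn.restrict ?_
      exact integrableOn_const (by simp))
  have hgint : ∫ t in Ioi 0, g t = ∑ k, 2 / C * (d k ^ μ * S k) := by
    rw [hg, integral_finsetSum _ fun k _ => hgi k]
    refine Finset.sum_congr rfl fun k _ => ?_
    have hsub : Icc (1 / d k) (2 / d k) ∩ Ioi 0 = Icc (1 / d k) (2 / d k) :=
      inter_eq_left.2 fun t ht => lt_of_lt_of_le (one_div_pos.2 (hd0 k)) ht.1
    rw [integral_indicator measurableSet_Icc, Measure.restrict_restrict measurableSet_Icc, hsub,
      setIntegral_const, Real.volume_real_Icc_of_le (show 1 / d k ≤ 2 / d k from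
        div_le_div_of_nonneg_right one_le_two (hd0 k).le), smul_eq_mul,
      Real.rpow_add_one (hd0 k).ne']
    have := (hd0 k).ne'
    field_simp
    ring
  have hle : ∀ t ∈ Ioi (0 : ℝ), g t ≤ t ^ (-μ) * expForm a b t z.tf := by
    intro t ht
    have ht : 0 < t := ht
    have hL := z.BM_tf.expL ht.le
    have hL2 : BM a b fun x => expL a b t z.tf x ^ 2 := by simpa [sq] using hL.mul hL
    -- The sum-of-squares formula for the form is used with its endpoint term dropped.
    have h1 : ∑ k, t ^ (-μ) * (2 * t * ∫ x in 𝓜.left k..𝓜.right k, expL a b t z.tf x ^ 2) ≤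
        t ^ (-μ) * expForm a b t z.tf := by
      rw [expForm_eq ht z.BM_tf, 𝓜.integral_eq_sum fun k => Mesh.BM.intervalIntegrable_elem 𝓜 k hL2,
        ← Finset.mul_sum, ← Finset.mul_sum]
      refine mul_le_mul_of_nonneg_left ?_ (Real.rpow_nonneg ht.le _)
      linarith [sq_nonneg (expL a b t z.tf b)]
    refine le_trans (Finset.sum_le_sum fun k _ => ?_) h1
    have hI0 : 0 ≤ ∫ x in 𝓜.left k..𝓜.right k, expL a b t z.tf x ^ 2 :=
      intervalIntegral.integral_nonneg (𝓜.left_lt_right k).le fun _ _ => sq_nonneg _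
    by_cases hk : t ∈ Icc (1 / d k) (2 / d k)
    · rw [indicator_of_mem hk]
      have h2 := h 𝓜 z k t ht (by
        have := hk.2
        rwa [le_div_iff₀ (hd0 k)] at this)
      set I := ∫ x in 𝓜.left k..𝓜.right k, expL a b t z.tf x ^ 2
      have h3 : d k ^ (μ - 1) ≤ t ^ (1 - μ) := by
        have : (1 / d k) ^ (1 - μ) ≤ t ^ (1 - μ) :=
          Real.rpow_le_rpow (one_div_pos.2 (hd0 k)).le hk.1 (by linarith)
        rw [one_div, Real.inv_rpow (hd0 k).le, ← Real.rpow_neg (hd0 k).le, neg_sub] at this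
        exact this
      have e1 : d k ^ (μ + 1) = d k ^ (μ - 1) * d k ^ 2 := by
        rw [← Real.rpow_natCast, ← Real.rpow_add (hd0 k)]; congr 1; push_cast; ring
      have e2 : t ^ (-μ) * (2 * t * I) = 2 * (t ^ (1 - μ) * I) := by
        rw [show 1 - μ = -μ + 1 by ring, Real.rpow_add_one ht.ne']; ring
      rw [e1, e2]
      calc 2 / C * (d k ^ (μ - 1) * d k ^ 2 * S k)
          = 2 / C * (d k ^ (μ - 1) * (d k ^ 2 * S k)) := by ring
        _ ≤ 2 / C * (t ^ (1 - μ) * (C * I)) := by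
            refine mul_le_mul_of_nonneg_left (mul_le_mul h3 h2 ?_ ?_) (by positivity)
            · exact mul_nonneg (sq_nonneg _) (hS0 k)
            · exact Real.rpow_nonneg ht.le _
        _ = _ := by field_simp
    · rw [indicator_of_notMem hk]
      have := Real.rpow_nonneg ht.le (-μ)
      positivity
  have hgI : IntegrableOn g (Ioi 0) := integrable_finsetSum _ fun k _ => hgi k
  have := setIntegral_mono_on hgI hi measurableSet_Ioi hle
  rw [hgint, ← hk, ← Finset.mul_sum] at this
  have e : ∑ k, d k ^ μ * S k = C / 2 * (2 / C * ∑ k, d k ^ μ * S k) := by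
    field_simp
  rw [e]
  calc _ ≤ C / 2 * (Real.Gamma (1 - μ) * kerForm μ a b z.tf z.tf) :=
        mul_le_mul_of_nonneg_left this (by positivity)
    _ = _ := by ring

theorem pot_injective {μ : ℝ} (hμ : 0 < μ) (hμ1 : μ < 1) :
    Function.Injective (pot μ : Vh 𝓜 N →ₗ[ℝ] Vh 𝓜 N) := by
  obtain ⟨C, hC, h⟩ := exists_inverse_kerForm N hμ hμ1
  rw [← LinearMap.ker_eq_bot, LinearMap.ker_eq_bot']
  intro z hz
  have h1 := h 𝓜 z
  rw [← inner_pot hμ, hz, inner_zero_left, mul_zero] at h1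
  have hnn : ∀ k, 0 ≤ (𝓜.right k - 𝓜.left k) ^ μ *
      (∫ x in 𝓜.left k..𝓜.right k, (z.1 k).eval x ^ 2) := fun k =>
    mul_nonneg (Real.rpow_nonneg (sub_pos.2 (𝓜.left_lt_right k)).le _) (integral_sq_elem_nonneg k _)
  have h2 := (Finset.sum_eq_zero_iff_of_nonneg fun k _ => hnn k).1
    (le_antisymm h1 (Finset.sum_nonneg fun k _ => hnn k))
  refine Subtype.ext (funext fun k => integral_sq_elem_eq_zero (𝓜 := 𝓜) (k := k) ?_)
  rcases mul_eq_zero.1 (h2 k (Finset.mem_univ k)) with h3 | h3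
  · exact absurd h3 (Real.rpow_pos_of_pos (sub_pos.2 (𝓜.left_lt_right k)) _).ne'
  · exact h3

/-- The Riesz form of a function with vanishing element means. -/
theorem exists_kerForm_le_size {μ : ℝ} (hμ : 0 < μ) (hμ1 : μ < 1) : ∃ C > 0, ∀ {a b : ℝ}
    (𝓜 : Mesh a b), a < b → ∀ f : ℝ → ℝ, BM a b f →
    (∀ k, ∫ x in 𝓜.left k..𝓜.right k, f x = 0) →
    kerForm μ a b f f ≤ C * 𝓜.size ^ μ * ∫ x, f x ^ 2 ∂vol a b := by
  have hΓ := Real.Gamma_pos_of_pos (show 0 < 1 - μ by linarith)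
  have h2 : 0 < 2 - μ := by linarith
  refine ⟨(2 / (2 - μ) + 2 / μ) / Real.Gamma (1 - μ), by positivity,
    fun {a b} 𝓜 hab f hf h0 => ?_⟩
  have ha : a ∈ Icc a b := left_mem_Icc.2 hab.le
  -- Vanishing element means make the primitive vanish at every node, so a Poincaré inequality on
  -- single elements bounds it by `h ‖f‖`.
  have hnode : ∀ i, ∫ s in a..𝓜.node i, f s = 0 := by
    intro i
    induction i using Fin.induction with
    | zero => rw [𝓜.node_zero, intervalIntegral.integral_same]
    | succ k ih =>
      have := intervalIntegral.integral_add_adjacent_intervals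
        (hf.intervalIntegrable ha (𝓜.left_mem k))
        (hf.intervalIntegrable (𝓜.left_mem k) (𝓜.right_mem k))
      rw [h0 k, add_zero] at this
      exact this.symm.trans ih
  have hsize : 0 < 𝓜.size := by
    have h1 := 𝓜.sum_len
    by_contra hcon
    have : ∑ k, (𝓜.right k - 𝓜.left k) ≤ 0 := Finset.sum_nonpos fun k _ =>
      (𝓜.len_le_size k).trans (not_lt.1 hcon)
    linarith
  refine kerForm_le_of_primitive hμ hμ1 hab.le hsize hf ?_ ?_
  · have := hnode (Fin.last _)
    rwa [𝓜.node_last] at this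
  · have hf2 : BM a b fun x => f x ^ 2 := by simpa [sq] using hf.mul hf
    have hFc : ContinuousOn (fun x => (∫ s in a..x, f s) ^ 2) (Icc a b) :=
      (continuousOn_primitive hf hab.le).pow 2
    have hFi : ∀ k, IntervalIntegrable (fun x => (∫ s in a..x, f s) ^ 2) volume (𝓜.left k)
        (𝓜.right k) := fun k => (hFc.mono (by
      rw [uIcc_of_le (𝓜.left_lt_right k).le]; exact 𝓜.Icc_subset k)).intervalIntegrable
    rw [𝓜.integral_eq_sum hFi, 𝓜.integral_eq_sum fun k => Mesh.BM.intervalIntegrable_elem 𝓜 k hf2,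
      Finset.mul_sum]
    refine Finset.sum_le_sum fun k _ => ?_
    have hlr := (𝓜.left_lt_right k).le
    set I := ∫ x in 𝓜.left k..𝓜.right k, f x ^ 2
    have hI : 0 ≤ I := intervalIntegral.integral_nonneg hlr fun _ _ => sq_nonneg _
    have hpt : ∀ x ∈ Icc (𝓜.left k) (𝓜.right k), (∫ s in a..x, f s) ^ 2 ≤ 𝓜.size * I := by
      intro x hx
      have hxa := 𝓜.Icc_subset k hx
      have e := intervalIntegral.integral_add_adjacent_intervals
        (hf.intervalIntegrable ha (𝓜.left_mem k)) (hf.intervalIntegrable (𝓜.left_mem k) hxa)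
      have e0 : ∫ s in a..𝓜.left k, f s = 0 := hnode _
      rw [← e, e0, zero_add]
      have hfk := Mesh.BM.elem 𝓜 (k := k) hf
      have hl := left_mem_Icc.2 hlr
      refine (sq_integral_le hfk hl hx hx.1).trans ?_
      have h3 := integral_sq_mono hfk hl hx hx.1
      rw [← intervalIntegral.integral_of_le hlr] at h3
      refine mul_le_mul ?_ h3 (intervalIntegral.integral_nonneg hx.1 fun _ _ => sq_nonneg _)
        hsize.le
      linarith [𝓜.len_le_size k, hx.2]
    have h4 := intervalIntegral.integral_mono_on hlr (hFi k) (by simp) hpt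
    rw [intervalIntegral.integral_const, smul_eq_mul] at h4
    refine h4.trans ?_
    have := mul_le_mul_of_nonneg_right (𝓜.len_le_size k) (mul_nonneg hsize.le hI)
    linarith

end Vh

open scoped InnerProductSpace

/-! ### From the potential of the discrete derivative to the `L²` norm -/

theorem BM_const {a b : ℝ} (c : ℝ) : BM a b fun _ => c := BM.of_continuous continuous_const

/-- Schur's argument: `g(x) g(s)` is at most the mean of the squares, and the row integrals of the
kernel, the potential of the constant `1`, are bounded. -/
theorem exists_kerForm_self_le {μ a b : ℝ} (hμ : 0 < μ) : ∃ C > 0, ∀ g : ℝ → ℝ, BM a b g →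
    kerForm μ a b g g ≤ C * ∫ x, g x ^ 2 ∂vol a b := by
  obtain ⟨C, hC0, hC⟩ := ((BM_const (a := a) (b := b) 1).Ik hμ).exists_pos
  refine ⟨C, hC0, fun g hg => ?_⟩
  have hg2 : BM a b fun x => g x ^ 2 := by simpa [sq] using hg.mul hg
  have h1 : kerForm μ a b g g ≤ kerForm μ a b (fun x => g x ^ 2) fun _ => 1 := by
    have i1 := integrable_kerForm hμ hg2 (BM_const 1)
    have i2 := integrable_kerForm hμ (BM_const 1) hg2
    have e : kerForm μ a b (fun x => g x ^ 2) (fun _ => 1) =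
        (kerForm μ a b (fun x => g x ^ 2) (fun _ => 1) +
          kerForm μ a b (fun _ => 1) fun x => g x ^ 2) / 2 := by
      rw [kerForm_comm μ a b (fun _ => 1)]; ring
    rw [e]
    unfold kerForm
    rw [← integral_add i1 i2, ← integral_div]
    refine integral_mono (integrable_kerForm hμ hg hg) ((i1.add i2).div_const 2) fun p => ?_
    have hk : 0 ≤ |p.1 - p.2| ^ (μ - 1) := Real.rpow_nonneg (abs_nonneg _) _
    simp only
    nlinarith [mul_nonneg (sq_nonneg (g p.1 - g p.2)) hk]
  refine h1.trans ?_
  rw [← integral_mul_Ik hμ hg2 (BM_const 1), ← integral_const_mul]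
  refine integral_mono_ae (hg2.mul ((BM_const 1).Ik hμ)).integrable (hg2.integrable.const_mul C)
    (ae_vol fun x hx => ?_)
  change g x ^ 2 * _ ≤ C * g x ^ 2
  rw [mul_comm C]
  exact mul_le_mul_of_nonneg_left ((le_abs_self _).trans (hC x hx)) (sq_nonneg _)

namespace Vh

variable {a b : ℝ} {𝓜 : Mesh a b} {N : ℕ}

theorem integral_sq_le_of_abs_le {k : Fin 𝓜.K} {q : ℝ[X]} {c : ℝ}
    (h : ∀ x ∈ Icc (𝓜.left k) (𝓜.right k), |q.eval x| ≤ c) :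
    ∫ x in 𝓜.left k..𝓜.right k, q.eval x ^ 2 ≤ (𝓜.right k - 𝓜.left k) * c ^ 2 := by
  have hlr := (𝓜.left_lt_right k).le
  have h4 := intervalIntegral.integral_mono_on (f := fun x => q.eval x ^ 2) (g := fun _ => c ^ 2)
    (μ := volume) hlr
    ((q.continuous.pow 2).intervalIntegrable _ _) (by simp) (fun x hx => by
      have := abs_le.1 (h x hx)
      nlinarith)
  rwa [intervalIntegral.integral_const, smul_eq_mul] at h4

theorem norm_sq_le_of_abs_le (v : Vh 𝓜 N) {c : ℝ}
    (h : ∀ k, ∀ x ∈ Icc (𝓜.left k) (𝓜.right k), |(v.1 k).eval x| ≤ c) :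
    ‖v‖ ^ 2 ≤ (b - a) * c ^ 2 := by
  rw [norm_sq_eq_sum, ← 𝓜.sum_len, Finset.sum_mul]
  exact Finset.sum_le_sum fun k _ => integral_sq_le_of_abs_le (h k)

/-- If `pot (Dp X)` is the projection of a fractional integral, then `X` is controlled by the
density. -/
theorem exists_norm_le_of_pot_eq (N : ℕ) {μ : ℝ} (hμ : 0 < μ) (hμ1 : μ < 1) {a b : ℝ}
    (hab : a < b) : ∃ C > 0, ∀ (𝓜 : Mesh a b) (X : Vh 𝓜 N) (g : ℝ → ℝ), BM a b g →
    pot μ (Dp X) = proj 𝓜 N (Ik μ a b g) → ‖X‖ ^ 2 ≤ C * ∫ x, g x ^ 2 ∂vol a b := by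
  obtain ⟨C1, hC1, h1⟩ := exists_norm_le_Jb N
  obtain ⟨C2, hC2, h2⟩ := integral_Jb_sq_le hμ hμ1 hab.le
  obtain ⟨C3, hC3, h3⟩ := exists_kerForm_self_le (a := a) (b := b) hμ
  refine ⟨C1 * (C2 * C3), by positivity, fun 𝓜 X g hg h => ?_⟩
  set z := Dp X with hz
  -- The equation tested with `z` itself. Cauchy–Schwarz for the form then bounds the energy of `z`
  -- by that of `g`.
  have e1 : kerForm μ a b z.tf z.tf = kerForm μ a b z.tf g := by
    rw [← inner_pot hμ, h, inner_proj (hg.Ik hμ), ← integral_mul_Ik hμ z.BM_tf hg]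
    exact integral_congr_ae (Filter.Eventually.of_forall fun x => mul_comm _ _)
  have e2 := kerForm_sq_le hμ hμ1 z.BM_tf hg
  rw [← e1] at e2
  have hzz := kerForm_self_nonneg hμ hμ1 z.BM_tf
  have hgg := kerForm_self_nonneg hμ hμ1 hg
  have e3 : kerForm μ a b z.tf z.tf ≤ kerForm μ a b g g := by
    rcases hzz.eq_or_lt with h0 | h0
    · rwa [← h0]
    · nlinarith
  calc ‖X‖ ^ 2 ≤ C1 * (C2 * kerForm μ a b z.tf z.tf) :=
        (h1 𝓜 X).trans (mul_le_mul_of_nonneg_left (h2 _ z.BM_tf) hC1.le)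
    _ ≤ C1 * (C2 * (C3 * ∫ x, g x ^ 2 ∂vol a b)) := by gcongr; exact e3.trans (h3 g hg)
    _ = _ := by ring

/-- The energy of `z` is `⟪pot μ z, z⟫`. A Young inequality on each element with weight `d_k ^ μ`
lets the inverse inequality absorb half of the energy; the other half is a sum of `d_k ^ (-μ)` times
local squares of the potential, where the local smallness `d_k ^ (N + 1)` compensates the negative
power. -/
theorem kerForm_le_of_pot_small {μ : ℝ} (hμ : 0 < μ) (hμ1 : μ < 1) {C : ℝ} (hC : 0 < C)
    (z : Vh 𝓜 N)
    (h : ∑ k, (𝓜.right k - 𝓜.left k) ^ μ * (∫ x in 𝓜.left k..𝓜.right k, (z.1 k).eval x ^ 2) ≤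
      C * kerForm μ a b z.tf z.tf) {G : ℝ}
    (hG : ∀ k, ∀ x ∈ Icc (𝓜.left k) (𝓜.right k),
      |((pot μ z).1 k).eval x| ≤ G * (𝓜.right k - 𝓜.left k) ^ (N + 1)) :
    𝓜.size ^ μ * kerForm μ a b z.tf z.tf ≤ C * ((b - a) * (G * 𝓜.size ^ (N + 1)) ^ 2) := by
  set d : Fin 𝓜.K → ℝ := fun k => 𝓜.right k - 𝓜.left k with hd
  have hd0 : ∀ k, 0 < d k := fun k => sub_pos.2 (𝓜.left_lt_right k)
  set ρ := pot μ z with hρ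
  have hS := 𝓜.size_nonneg
  have e1 : kerForm μ a b z.tf z.tf ≤ ∑ k, (1 / (2 * C) * (d k ^ μ *
      ∫ x in 𝓜.left k..𝓜.right k, (z.1 k).eval x ^ 2) + C / 2 * (d k ^ (-μ) *
      ∫ x in 𝓜.left k..𝓜.right k, (ρ.1 k).eval x ^ 2)) := by
    rw [← inner_pot hμ, inner_eq_sum]
    refine Finset.sum_le_sum fun k _ => ?_
    rw [← mul_assoc, ← mul_assoc, ← intervalIntegral.integral_const_mul,
      ← intervalIntegral.integral_const_mul, ← intervalIntegral.integral_add]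
    · refine intervalIntegral.integral_mono_on (𝓜.left_lt_right k).le ?_ ?_ ?_
      · exact ((ρ.1 k).continuous.mul (z.1 k).continuous).intervalIntegrable _ _
      · exact (((z.1 k).continuous.pow 2).const_mul _ |>.add
          (((ρ.1 k).continuous.pow 2).const_mul _)).intervalIntegrable _ _
      · intro x _
        have hp := Real.rpow_pos_of_pos (hd0 k) μ
        rw [Real.rpow_neg (hd0 k).le]
        set P := d k ^ μ
        set r := (ρ.1 k).eval x
        set s := (z.1 k).eval x
        -- The coefficient `1 / (2 C)` is chosen so that exactly half of the energy is absorbed.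
        have : 1 / (2 * C) * P * s ^ 2 + C / 2 * P⁻¹ * r ^ 2 - r * s =
            1 / (2 * C * P) * (P * s - C * r) ^ 2 := by
          field_simp
          ring
        have : 0 ≤ 1 / (2 * C * P) * (P * s - C * r) ^ 2 := by positivity
        linarith
    · exact (((z.1 k).continuous.pow 2).const_mul _).intervalIntegrable _ _
    · exact (((ρ.1 k).continuous.pow 2).const_mul _).intervalIntegrable _ _
  rw [Finset.sum_add_distrib, ← Finset.mul_sum, ← Finset.mul_sum] at e1
  have e2 : 1 / (2 * C) * ∑ k, d k ^ μ * (∫ x in 𝓜.left k..𝓜.right k, (z.1 k).eval x ^ 2) ≤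
      1 / 2 * kerForm μ a b z.tf z.tf := by
    calc _ ≤ 1 / (2 * C) * (C * kerForm μ a b z.tf z.tf) :=
          mul_le_mul_of_nonneg_left h (by positivity)
      _ = _ := by field_simp
  have e3 : 𝓜.size ^ μ * ∑ k, d k ^ (-μ) * (∫ x in 𝓜.left k..𝓜.right k, (ρ.1 k).eval x ^ 2) ≤
      (b - a) * (G * 𝓜.size ^ (N + 1)) ^ 2 := by
    rw [← 𝓜.sum_len, Finset.sum_mul, Finset.mul_sum]
    refine Finset.sum_le_sum fun k _ => ?_
    have hs : 0 < 𝓜.size := (hd0 k).trans_le (𝓜.len_le_size k)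
    have h5 := integral_sq_le_of_abs_le (hG k)
    -- The ratio `h / d k` is at least `1`, so its power `μ < 1` may be raised to `2 (N + 1)`. Small
    -- elements are harmless for this reason.
    have h6 : 𝓜.size ^ μ * d k ^ (-μ) * (d k ^ (N + 1)) ^ 2 ≤ (𝓜.size ^ (N + 1)) ^ 2 := by
      rw [Real.rpow_neg (hd0 k).le, ← div_eq_mul_inv, ← Real.div_rpow hs.le (hd0 k).le]
      have h7 : 1 ≤ 𝓜.size / d k := (one_le_div (hd0 k)).2 (𝓜.len_le_size k)
      have h8 : (𝓜.size / d k) ^ μ ≤ 𝓜.size / d k := by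
        simpa using Real.rpow_le_rpow_of_exponent_le h7 hμ1.le
      have h9 : 𝓜.size / d k ≤ (𝓜.size / d k) ^ (2 * (N + 1)) := by
        simpa using pow_le_pow_right₀ h7 (show 1 ≤ 2 * (N + 1) by omega)
      calc _ ≤ (𝓜.size / d k) ^ (2 * (N + 1)) * (d k ^ (N + 1)) ^ 2 :=
            mul_le_mul_of_nonneg_right (h8.trans h9) (sq_nonneg _)
        _ = _ := by
            rw [div_pow, mul_comm 2, pow_mul, pow_mul]
            have := (pow_pos (hd0 k) (N + 1)).ne'
            field_simp
    have hp := Real.rpow_pos_of_pos hs μ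
    have hp' := Real.rpow_pos_of_pos (hd0 k) (-μ)
    calc _ ≤ 𝓜.size ^ μ * (d k ^ (-μ) * (d k * (G * d k ^ (N + 1)) ^ 2)) := by gcongr
      _ = d k * G ^ 2 * (𝓜.size ^ μ * d k ^ (-μ) * (d k ^ (N + 1)) ^ 2) := by ring
      _ ≤ d k * G ^ 2 * (𝓜.size ^ (N + 1)) ^ 2 := by
        have := (hd0 k).le
        gcongr
      _ = _ := by ring
  have hp := Real.rpow_nonneg hS μ
  set Z := kerForm μ a b z.tf z.tf
  have e4 : Z ≤ C * ∑ k, d k ^ (-μ) * (∫ x in 𝓜.left k..𝓜.right k, (ρ.1 k).eval x ^ 2) := by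
    linarith
  calc _ ≤ 𝓜.size ^ μ * (C * ∑ k, d k ^ (-μ) *
        (∫ x in 𝓜.left k..𝓜.right k, (ρ.1 k).eval x ^ 2)) := mul_le_mul_of_nonneg_left e4 hp
    _ = C * (𝓜.size ^ μ * ∑ k, d k ^ (-μ) *
        (∫ x in 𝓜.left k..𝓜.right k, (ρ.1 k).eval x ^ 2)) := by ring
    _ ≤ _ := mul_le_mul_of_nonneg_left e3 hC.le

/-- If `pot (Dp X)` is of size `h^(N+1)`, then so is `X`. -/
theorem exists_norm_le_of_pot_small (N : ℕ) {μ : ℝ} (hμ : 0 < μ) (hμ1 : μ < 1) {a b : ℝ}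
    (hab : a < b) : ∃ C > 0, ∀ (𝓜 : Mesh a b) (X : Vh 𝓜 N) (G : ℝ), 0 ≤ G →
    (∀ k, ∀ x ∈ Icc (𝓜.left k) (𝓜.right k),
      |((pot μ (Dp X)).1 k).eval x| ≤ G * (𝓜.right k - 𝓜.left k) ^ (N + 1)) →
    ‖X‖ ≤ C * (G * 𝓜.size ^ (N + 1)) := by
  obtain ⟨C1, hC1, h1⟩ := exists_norm_le_Jb N
  obtain ⟨C2, hC2, h2⟩ := integral_Jb_sq_le_Ik hab hμ hμ1
  obtain ⟨C4, hC4, h4⟩ := exists_inverse_kerForm N hμ hμ1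
  obtain ⟨C6, hC6, h6⟩ := exists_kerForm_le_size hμ hμ1
  set A := C1 * (C2 * ((2 * (C6 * C4) + 2) * (b - a))) with hA
  have hA0 : 0 ≤ A := by
    have := sub_pos.2 hab
    positivity
  refine ⟨Real.sqrt A + 1, by positivity, fun 𝓜 X G hG0 hG => ?_⟩
  set z := Dp X with hz
  set ρ := pot μ z with hρ
  have hS := 𝓜.size_nonneg
  -- The part of the full potential lost by projection. It is orthogonal to the finite element
  -- space; in particular its element means vanish.
  set f : ℝ → ℝ := fun x => Ik μ a b z.tf x - ρ.tf x with hf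
  have hI := z.BM_tf.Ik hμ
  have hfB : BM a b f := hI.sub ρ.BM_tf
  have hρp : ρ = proj 𝓜 N (Ik μ a b z.tf) := pot_eq_proj hμ z
  have hmean : ∀ k, ∫ x in 𝓜.left k..𝓜.right k, f x = 0 := by
    intro k
    have := inn_proj hI k (φ := (1 : ℝ[X])) (N := N) (by simp)
    rw [← hρp] at this
    simp only [Mesh.inn, Polynomial.eval_one, mul_one] at this
    have e : ∫ x in 𝓜.left k..𝓜.right k, f x =
        ∫ x in 𝓜.left k..𝓜.right k, (Ik μ a b z.tf x - (ρ.1 k).eval x) :=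
      𝓜.integral_congr_elem fun x hx => by
        change Ik μ a b z.tf x - 𝓜.toFun ρ.1 x = _
        rw [𝓜.toFun_eq _ hx]
    rw [e, intervalIntegral.integral_sub (Mesh.BM.intervalIntegrable_elem 𝓜 k hI)
      ((ρ.1 k).continuous.intervalIntegrable _ _), this, sub_self]
  have i1 : Integrable (fun x => f x * Ik μ a b z.tf x) (vol a b) := (hfB.mul hI).integrable
  have i2 : Integrable (fun x => f x * ρ.tf x) (vol a b) := (hfB.mul ρ.BM_tf).integrable
  have horth : ∫ x, f x * ρ.tf x ∂vol a b = 0 := by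
    have e1 := inner_proj hI ρ
    rw [← hρp, inner_def] at e1
    have : ∀ x, f x * ρ.tf x = Ik μ a b z.tf x * ρ.tf x - ρ.tf x * ρ.tf x := fun x => by
      simp only [hf]; ring
    simp only [this]
    rw [integral_sub (hI.mul ρ.BM_tf).integrable (ρ.BM_tf.mul ρ.BM_tf).integrable, e1, sub_self]
  have hff : ∫ x, f x ^ 2 ∂vol a b = kerForm μ a b f z.tf := by
    rw [← integral_mul_Ik hμ hfB z.BM_tf]
    have : ∀ x, f x ^ 2 = f x * Ik μ a b z.tf x - f x * ρ.tf x := fun x => by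
      simp only [hf]; ring
    simp only [this]
    rw [integral_sub i1 i2, horth, sub_zero]
  set I := ∫ x, f x ^ 2 ∂vol a b with hIdef
  have hI0 : 0 ≤ I := integral_nonneg fun _ => sq_nonneg _
  set Z := kerForm μ a b z.tf z.tf with hZ
  have hZ0 : 0 ≤ Z := kerForm_self_nonneg hμ hμ1 z.BM_tf
  have hp := Real.rpow_nonneg hS μ
  -- By orthogonality `‖f‖²` is the form paired with `z`. Cauchy–Schwarz and the gain `h ^ μ` for
  -- mean-zero functions leave `‖f‖²` on both sides, and one copy cancels.
  have e1 : I ≤ C6 * (𝓜.size ^ μ * Z) := by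
    have s1 := kerForm_sq_le hμ hμ1 hfB z.BM_tf
    rw [← hff] at s1
    have s2 := h6 𝓜 hab f hfB hmean
    rcases hI0.eq_or_lt with h0 | h0
    · rw [← h0]; positivity
    · have s3 : I ^ 2 ≤ (C6 * 𝓜.size ^ μ * I) * Z :=
        s1.trans (mul_le_mul_of_nonneg_right s2 hZ0)
      nlinarith
  have e2 := kerForm_le_of_pot_small hμ hμ1 hC4 z (h4 𝓜 z) hG
  set B := (G * 𝓜.size ^ (N + 1)) with hB
  have e3 : ‖ρ‖ ^ 2 ≤ (b - a) * B ^ 2 := norm_sq_le_of_abs_le ρ fun k x hx =>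
    (hG k x hx).trans (mul_le_mul_of_nonneg_left (pow_le_pow_left₀
      (sub_pos.2 (𝓜.left_lt_right k)).le (𝓜.len_le_size k) _) hG0)
  have e4 : ∫ x, Ik μ a b z.tf x ^ 2 ∂vol a b ≤ 2 * I + 2 * ‖ρ‖ ^ 2 := by
    rw [norm_sq_eq, hIdef, ← integral_const_mul, ← integral_const_mul,
      ← integral_add (hfB.sq_integrable.const_mul _) (ρ.BM_tf.sq_integrable.const_mul _)]
    refine integral_mono hI.sq_integrable
      ((hfB.sq_integrable.const_mul _).add (ρ.BM_tf.sq_integrable.const_mul _)) fun x => ?_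
    simp only [hf]
    nlinarith [sq_nonneg (Ik μ a b z.tf x - 2 * ρ.tf x)]
  have e5 : ‖X‖ ^ 2 ≤ (Real.sqrt A * B) ^ 2 := by
    rw [mul_pow, Real.sq_sqrt hA0]
    calc ‖X‖ ^ 2 ≤ C1 * (C2 * ∫ x, Ik μ a b z.tf x ^ 2 ∂vol a b) :=
          (h1 𝓜 X).trans (mul_le_mul_of_nonneg_left (h2 _ z.BM_tf) hC1.le)
      _ ≤ C1 * (C2 * (2 * (C6 * (C4 * ((b - a) * B ^ 2))) + 2 * ((b - a) * B ^ 2))) := by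
          gcongr
          refine e4.trans (add_le_add ?_ (mul_le_mul_of_nonneg_left e3 two_pos.le))
          exact mul_le_mul_of_nonneg_left (e1.trans (mul_le_mul_of_nonneg_left e2 hC6.le))
            two_pos.le
      _ = _ := by rw [hA]; ring
  have hB0 : 0 ≤ B := mul_nonneg hG0 (pow_nonneg hS _)
  have := abs_le_of_sq_le_sq e5 (by positivity)
  nlinarith [le_abs_self ‖X‖, Real.sqrt_nonneg A]

end Vh

open scoped InnerProductSpace

/-! ### Stability of the abstract coupled system -/

/-- The real form of the linear coupled Schrödinger system, for an abstract operator `A`. -/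
structure IsSystem {E : Type} [NormedAddCommGroup E] [InnerProductSpace ℝ E] (A : E →ₗ[ℝ] E)
    (l₁ l₃ k₁ k₃ w T : ℝ) (e r : Fin 4 → ℝ → E) : Prop where
  eq0 : ∀ t ∈ Icc 0 T, HasDerivWithinAt (e 0)
    (-(l₁ • A (e 1 t)) - k₁ • e 1 t - w • e 3 t + r 0 t) (Icc 0 T) t
  eq1 : ∀ t ∈ Icc 0 T, HasDerivWithinAt (e 1)
    (l₁ • A (e 0 t) + k₁ • e 0 t + w • e 2 t + r 1 t) (Icc 0 T) t
  eq2 : ∀ t ∈ Icc 0 T, HasDerivWithinAt (e 2)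
    (-(l₃ • A (e 3 t)) - k₃ • e 3 t - w • e 1 t + r 2 t) (Icc 0 T) t
  eq3 : ∀ t ∈ Icc 0 T, HasDerivWithinAt (e 3)
    (l₃ • A (e 2 t) + k₃ • e 2 t + w • e 0 t + r 3 t) (Icc 0 T) t

/-- The function `exp(-t) f - M t` is nonincreasing on the interval, because `exp(-t) ≤ 1` there. -/
theorem gronwall_sq {T M : ℝ} (hM : 0 ≤ M) {f f' : ℝ → ℝ}
    (hf : ∀ t ∈ Icc 0 T, HasDerivWithinAt f (f' t) (Icc 0 T) t)
    (hle : ∀ t ∈ Icc 0 T, f' t ≤ f t + M) (h0 : f 0 ≤ M) (hf0 : ∀ t, 0 ≤ f t) :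
    ∀ t ∈ Icc 0 T, f t ≤ Real.exp T * (1 + T) * M := by
  intro t ht
  have hT : 0 ≤ T := ht.1.trans ht.2
  set g : ℝ → ℝ := fun s => Real.exp (-s) * f s - M * s with hg
  have hgd : ∀ s ∈ Icc 0 T, HasDerivWithinAt g
      (Real.exp (-s) * (f' s - f s) - M) (Icc 0 T) s := by
    intro s hs
    have h1 : HasDerivWithinAt (fun s => Real.exp (-s)) (Real.exp (-s) * -1) (Icc 0 T) s :=
      ((hasDerivAt_neg s).exp).hasDerivWithinAt
    have := (h1.mul (hf s hs)).sub ((hasDerivWithinAt_id s (Icc 0 T)).const_mul M)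
    refine this.congr_deriv ?_
    ring
  have hanti : AntitoneOn g (Icc 0 T) := by
    refine antitoneOn_of_hasDerivWithinAt_nonpos (convex_Icc 0 T)
      (fun s hs => (hgd s hs).continuousWithinAt)
      (f' := fun s => Real.exp (-s) * (f' s - f s) - M) ?_ ?_
    · intro s hs
      exact (hgd s (interior_subset hs)).mono interior_subset
    · intro s hs
      have hs' := interior_subset hs
      have h1 : Real.exp (-s) ≤ 1 := Real.exp_le_one_iff.2 (by linarith [hs'.1])
      have h2 := hle s hs'
      have h3 := Real.exp_pos (-s)
      nlinarith
  have h1 := hanti (left_mem_Icc.2 hT) ht ht.1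
  simp only [hg, neg_zero, Real.exp_zero, one_mul, mul_zero, sub_zero] at h1
  have h2 : Real.exp t * Real.exp (-t) = 1 := by rw [← Real.exp_add]; simp
  have h3 : f t = Real.exp t * (Real.exp (-t) * f t) := by rw [← mul_assoc, h2, one_mul]
  rw [h3]
  have h4 : Real.exp (-t) * f t ≤ (1 + T) * M := by nlinarith [ht.2]
  rw [mul_assoc]
  refine mul_le_mul (Real.exp_le_exp.2 ht.2) h4 ?_ (Real.exp_pos _).le
  exact mul_nonneg (Real.exp_pos _).le (hf0 t)

variable {E : Type} [NormedAddCommGroup E] [InnerProductSpace ℝ E]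

theorem hasDerivWithinAt_map [FiniteDimensional ℝ E] (D : E →ₗ[ℝ] E) {f : ℝ → E} {f' : E} {s : Set ℝ} {t : ℝ}
    (h : HasDerivWithinAt f f' s t) : HasDerivWithinAt (fun t => D (f t)) (D f') s t :=
  (LinearMap.toContinuousLinearMap D).hasFDerivAt.comp_hasDerivWithinAt t h

/-- Growth constant of the energy. -/
noncomputable def growth (T : ℝ) : ℝ := Real.sqrt (Real.exp T * (1 + T) * 4)

namespace IsSystem

variable {A D : E →ₗ[ℝ] E} {l₁ l₃ k₁ k₃ w T : ℝ} {e r : Fin 4 → ℝ → E}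

theorem swap (h : IsSystem A l₁ l₃ k₁ k₃ w T e r) :
    IsSystem A l₃ l₁ k₃ k₁ w T (fun i => e (i + 2)) (fun i => r (i + 2)) :=
  ⟨h.eq2, h.eq3, h.eq0, h.eq1⟩

/-- Symmetry of `A` for the form of `D` cancels the dispersive terms inside the pairs `(0, 1)` and
`(2, 3)`; the coupling terms cancel inside `(0, 3)` and `(1, 2)`, as `w` occurs there with opposite
signs. Only the pairings with the residual remain, so the constant depends neither on `A` nor on the
coefficients. -/
theorem energy_bound [FiniteDimensional ℝ E] (h : IsSystem A l₁ l₃ k₁ k₃ w T e r)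
    (hA : ∀ x y, ⟪D (A x), D y⟫_ℝ = ⟪D x, D (A y)⟫_ℝ) {ε : ℝ} (hε : 0 ≤ ε)
    (h0 : ∀ i, ‖D (e i 0)‖ ≤ ε) (hr : ∀ t ∈ Icc 0 T, ∀ i, ‖D (r i t)‖ ≤ ε) :
    ∀ t ∈ Icc 0 T, ∀ i, ‖D (e i t)‖ ≤ growth T * ε := by
  intro t ht i
  have hT : 0 ≤ T := ht.1.trans ht.2
  set f : ℝ → ℝ := fun t => ‖D (e 0 t)‖ ^ 2 + ‖D (e 1 t)‖ ^ 2 + ‖D (e 2 t)‖ ^ 2 + ‖D (e 3 t)‖ ^ 2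
    with hf
  have key := gronwall_sq (T := T) (M := 4 * ε ^ 2) (f := f)
    (f' := fun t => 2 * ⟪D (e 0 t), D (r 0 t)⟫_ℝ + 2 * ⟪D (e 1 t), D (r 1 t)⟫_ℝ +
      2 * ⟪D (e 2 t), D (r 2 t)⟫_ℝ + 2 * ⟪D (e 3 t), D (r 3 t)⟫_ℝ) (by positivity) (by
      intro s hs
      have d0 := (hasDerivWithinAt_map D (h.eq0 s hs)).norm_sq
      have d1 := (hasDerivWithinAt_map D (h.eq1 s hs)).norm_sq
      have d2 := (hasDerivWithinAt_map D (h.eq2 s hs)).norm_sq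
      have d3 := (hasDerivWithinAt_map D (h.eq3 s hs)).norm_sq
      refine (((d0.add d1).add d2).add d3).congr_deriv ?_
      simp only [map_add, map_sub, map_neg, map_smul, inner_add_right, inner_sub_right,
        inner_neg_right, real_inner_smul_right]
      have a1 := hA (e 0 s) (e 1 s)
      have a2 := hA (e 2 s) (e 3 s)
      rw [real_inner_comm] at a1 a2
      rw [← a1, ← a2, real_inner_comm (D (e 1 s)) (D (e 0 s)),
        real_inner_comm (D (e 3 s)) (D (e 2 s)), real_inner_comm (D (e 3 s)) (D (e 0 s)),
        real_inner_comm (D (e 2 s)) (D (e 1 s))]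
      ring) (by
      intro s hs
      have hb : ∀ i, 2 * ⟪D (e i s), D (r i s)⟫_ℝ ≤ ‖D (e i s)‖ ^ 2 + ε ^ 2 := by
        intro i
        have h1 := real_inner_le_norm (D (e i s)) (D (r i s))
        have h2 := hr s hs i
        nlinarith [norm_nonneg (D (e i s)), norm_nonneg (D (r i s)),
          sq_nonneg (‖D (e i s)‖ - ‖D (r i s)‖)]
      simp only [hf]
      linarith [hb 0, hb 1, hb 2, hb 3]) (by
      have hb : ∀ i, ‖D (e i 0)‖ ^ 2 ≤ ε ^ 2 := fun i =>
        pow_le_pow_left₀ (norm_nonneg _) (h0 i) 2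
      simp only [hf]
      linarith [hb 0, hb 1, hb 2, hb 3]) (fun s => by positivity) t ht
  have hi : ‖D (e i t)‖ ^ 2 ≤ f t := by
    have := fun i => sq_nonneg ‖D (e i t)‖
    simp only [hf]
    fin_cases i <;> simp <;> linarith [this 0, this 1, this 2, this 3]
  have h2 : ‖D (e i t)‖ ^ 2 ≤ (growth T * ε) ^ 2 := by
    rw [growth, mul_pow, Real.sq_sqrt (by positivity)]
    linarith
  exact le_of_sq_le_sq h2 (mul_nonneg (Real.sqrt_nonneg _) hε)

/-- Subtracting a solution of another system. -/
theorem sub {e' r' : Fin 4 → ℝ → E} (h : IsSystem A l₁ l₃ k₁ k₃ w T e r)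
    (h' : IsSystem A l₁ l₃ k₁ k₃ w T e' r') :
    IsSystem A l₁ l₃ k₁ k₃ w T (fun i t => e i t - e' i t) (fun i t => r i t - r' i t) := by
  refine ⟨fun t ht => ((h.eq0 t ht).sub (h'.eq0 t ht)).congr_deriv ?_,
    fun t ht => ((h.eq1 t ht).sub (h'.eq1 t ht)).congr_deriv ?_,
    fun t ht => ((h.eq2 t ht).sub (h'.eq2 t ht)).congr_deriv ?_,
    fun t ht => ((h.eq3 t ht).sub (h'.eq3 t ht)).congr_deriv ?_⟩ <;>
  · simp only [map_sub, smul_sub]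
    abel

/-- The residual of arbitrary functions. -/
theorem of_hasDeriv {y y' : Fin 4 → ℝ → E} (A : E →ₗ[ℝ] E) (l₁ l₃ k₁ k₃ w : ℝ)
    (hy : ∀ i, ∀ t ∈ Icc 0 T, HasDerivWithinAt (y i) (y' i t) (Icc 0 T) t) :
    IsSystem A l₁ l₃ k₁ k₃ w T y
      ![fun t => y' 0 t + l₁ • A (y 1 t) + k₁ • y 1 t + w • y 3 t,
        fun t => y' 1 t - l₁ • A (y 0 t) - k₁ • y 0 t - w • y 2 t,
        fun t => y' 2 t + l₃ • A (y 3 t) + k₃ • y 3 t + w • y 1 t,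
        fun t => y' 3 t - l₃ • A (y 2 t) - k₃ • y 2 t - w • y 0 t] := by
  refine ⟨fun t ht => (hy 0 t ht).congr_deriv ?_, fun t ht => (hy 1 t ht).congr_deriv ?_,
    fun t ht => (hy 2 t ht).congr_deriv ?_, fun t ht => (hy 3 t ht).congr_deriv ?_⟩ <;>
  · simp
    try abel

/-- Energy bound for residuals that are images of `A` with nonzero coefficient. -/
theorem energy_bound_range [FiniteDimensional ℝ E] (h : IsSystem A l₁ l₃ k₁ k₃ w T e r)
    (hA : ∀ x y, ⟪D (A x), D y⟫_ℝ = ⟪D x, D (A y)⟫_ℝ) {ε : ℝ} (hε : 0 ≤ ε)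
    (h0 : ∀ i, e i 0 = 0) {y y' : Fin 4 → ℝ → E}
    (hy : ∀ i, ∀ t ∈ Icc 0 T, HasDerivWithinAt (y i) (y' i t) (Icc 0 T) t)
    (hr0 : ∀ t ∈ Icc 0 T, r 0 t = l₁ • A (y 1 t)) (hr1 : ∀ t ∈ Icc 0 T, r 1 t = -(l₁ • A (y 0 t)))
    (hr2 : ∀ t ∈ Icc 0 T, r 2 t = l₃ • A (y 3 t)) (hr3 : ∀ t ∈ Icc 0 T, r 3 t = -(l₃ • A (y 2 t)))
    (hb : ∀ t ∈ Icc 0 T, ∀ i, ‖D (y i t)‖ ≤ ε) (hb' : ∀ t ∈ Icc 0 T, ∀ i, ‖D (y' i t)‖ ≤ ε) :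
    ∀ t ∈ Icc 0 T, ∀ i, ‖D (e i t)‖ ≤ (growth T * (1 + |k₁| + |k₃| + |w|) + 1) * ε := by
  intro t ht i
  have hT : 0 ≤ T := ht.1.trans ht.2
  set κ := 1 + |k₁| + |k₃| + |w| with hκ
  -- After subtracting `y` the terms with `A` cancel, and the residual consists of `y'`, `k y` and
  -- `w y`, all small for `D`. Adding `y` back accounts for the `+ 1` in the constant.
  have h1 := (h.sub (of_hasDeriv A l₁ l₃ k₁ k₃ w hy)).energy_bound hA (ε := κ * ε)
    (by positivity) (fun i => by
      rw [h0, zero_sub, map_neg, norm_neg]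
      refine (hb 0 (left_mem_Icc.2 hT) i).trans ?_
      nlinarith [abs_nonneg k₁, abs_nonneg k₃, abs_nonneg w]) (fun s hs i => by
      have hbd : ∀ i j l (k : ℝ), |k| ≤ |k₁| + |k₃| →
          ‖D (y' i s)‖ + ‖D (k • y j s)‖ + ‖D (w • y l s)‖ ≤ κ * ε := by
        intro i j l k hk
        simp only [map_smul, norm_smul, Real.norm_eq_abs]
        have m1 := mul_le_mul hk (hb s hs j) (norm_nonneg _) (by positivity)
        have m2 := mul_le_mul_of_nonneg_left (hb s hs l) (abs_nonneg w)
        have := hb' s hs i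
        rw [hκ]
        linarith
      have q1 : |k₁| ≤ |k₁| + |k₃| := by linarith [abs_nonneg k₃]
      have q3 : |k₃| ≤ |k₁| + |k₃| := by linarith [abs_nonneg k₁]
      have tri : ∀ a b c : E, ‖D (-(a + b + c))‖ ≤ ‖D a‖ + ‖D b‖ + ‖D c‖ := by
        intro a b c
        rw [map_neg, norm_neg, map_add, map_add]
        exact norm_add₃_le
      fin_cases i
      · have : r 0 s - (y' 0 s + l₁ • A (y 1 s) + k₁ • y 1 s + w • y 3 s) =
            -(y' 0 s + k₁ • y 1 s + w • y 3 s) := by rw [hr0 s hs]; abel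
        simp only [Fin.zero_eta, Matrix.cons_val_zero]
        rw [this]
        exact (tri _ _ _).trans (hbd _ _ _ _ q1)
      · have : r 1 s - (y' 1 s - l₁ • A (y 0 s) - k₁ • y 0 s - w • y 2 s) =
            -(y' 1 s + (-k₁) • y 0 s + -(w • y 2 s)) := by rw [hr1 s hs, neg_smul]; abel
        simp only [Fin.mk_one, Matrix.cons_val_one, Matrix.cons_val_zero]
        rw [this]
        refine (tri _ _ _).trans ?_
        rw [map_neg D (w • _), norm_neg]
        exact hbd _ _ _ _ (by rwa [abs_neg])
      · have : r 2 s - (y' 2 s + l₃ • A (y 3 s) + k₃ • y 3 s + w • y 1 s) =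
            -(y' 2 s + k₃ • y 3 s + w • y 1 s) := by rw [hr2 s hs]; abel
        change ‖D (r 2 s - (y' 2 s + l₃ • A (y 3 s) + k₃ • y 3 s + w • y 1 s))‖ ≤ _
        rw [this]
        exact (tri _ _ _).trans (hbd _ _ _ _ q3)
      · have : r 3 s - (y' 3 s - l₃ • A (y 2 s) - k₃ • y 2 s - w • y 0 s) =
            -(y' 3 s + (-k₃) • y 2 s + -(w • y 0 s)) := by rw [hr3 s hs, neg_smul]; abel
        change ‖D (r 3 s - (y' 3 s - l₃ • A (y 2 s) - k₃ • y 2 s - w • y 0 s))‖ ≤ _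
        rw [this]
        refine (tri _ _ _).trans ?_
        rw [map_neg D (w • _), norm_neg]
        exact hbd _ _ _ _ (by rwa [abs_neg])) t ht i
  rw [map_sub] at h1
  have h2 := norm_sub_norm_le (D (e i t)) (D (y i t))
  have h3 := hb t ht i
  nlinarith

end IsSystem

/-- Duhamel solution of the rotation system. -/
theorem exists_rotation_solution [FiniteDimensional ℝ E] (k : ℝ) {T : ℝ} (hT : 0 ≤ T) {g₁ g₂ : ℝ → E}
    (h₁ : ContinuousOn g₁ (Icc 0 T)) (h₂ : ContinuousOn g₂ (Icc 0 T)) :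
    ∃ c₁ c₂ : ℝ → E, c₁ 0 = 0 ∧ c₂ 0 = 0 ∧
      (∀ t ∈ Icc 0 T, HasDerivWithinAt c₁ (-(k • c₂ t) + g₁ t) (Icc 0 T) t) ∧
      (∀ t ∈ Icc 0 T, HasDerivWithinAt c₂ (k • c₁ t + g₂ t) (Icc 0 T) t) := by
  have := FiniteDimensional.complete ℝ E
  -- Continuity is known on `[0, T]` only; constant extension beyond the endpoints gives two-sided
  -- derivatives of the primitives.
  set G₁ := IccExtend hT ((Icc 0 T).domRestrict g₁)
  set G₂ := IccExtend hT ((Icc 0 T).domRestrict g₂)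
  have hG₁ : Continuous G₁ := (continuousOn_iff_continuous_domRestrict.1 h₁).Icc_extend'
  have hG₂ : Continuous G₂ := (continuousOn_iff_continuous_domRestrict.1 h₂).Icc_extend'
  have e₁ : ∀ t ∈ Icc 0 T, G₁ t = g₁ t := fun t ht => IccExtend_of_mem _ _ ht
  have e₂ : ∀ t ∈ Icc 0 T, G₂ t = g₂ t := fun t ht => IccExtend_of_mem _ _ ht
  set C : ℝ → ℝ := fun t => Real.cos (k * t) with hC
  set S : ℝ → ℝ := fun t => Real.sin (k * t) with hS
  have hCc : Continuous C := by fun_prop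
  have hSc : Continuous S := by fun_prop
  have hCd : ∀ t, HasDerivAt C (-(k * S t)) t := fun t => by
    have := ((hasDerivAt_id t).const_mul k).cos
    exact this.congr_deriv (by simp [hS, mul_comm])
  have hSd : ∀ t, HasDerivAt S (k * C t) t := fun t => by
    have := ((hasDerivAt_id t).const_mul k).sin
    exact this.congr_deriv (by simp [hC, mul_comm])
  -- Variation of constants: the forcing is integrated in the rotating frame and the result rotated
  -- back.
  set p : ℝ → E := fun t => C t • G₁ t + S t • G₂ t
  set q : ℝ → E := fun t => -(S t • G₁ t) + C t • G₂ t
  have hp : Continuous p := (hCc.smul hG₁).add (hSc.smul hG₂)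
  have hq : Continuous q := (hSc.smul hG₁).neg.add (hCc.smul hG₂)
  set P : ℝ → E := fun t => ∫ s in (0 : ℝ)..t, p s
  set Q : ℝ → E := fun t => ∫ s in (0 : ℝ)..t, q s
  have hP : ∀ t, HasDerivAt P (p t) t := fun t => hp.integral_hasStrictDerivAt 0 t |>.hasDerivAt
  have hQ : ∀ t, HasDerivAt Q (q t) t := fun t => hq.integral_hasStrictDerivAt 0 t |>.hasDerivAt
  have hCS : ∀ t, C t * C t + S t * S t = 1 := fun t => by
    have := Real.sin_sq_add_cos_sq (k * t)
    simp only [hC, hS]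
    linarith
  refine ⟨fun t => C t • P t - S t • Q t, fun t => S t • P t + C t • Q t, ?_, ?_, ?_, ?_⟩
  · simp [P, Q]
  · simp [P, Q]
  · intro t ht
    have := (((hCd t).smul (hP t)).sub ((hSd t).smul (hQ t))).hasDerivWithinAt (s := Icc 0 T)
    refine this.congr_deriv ?_
    rw [← e₁ t ht]
    have : G₁ t = (C t * C t + S t * S t) • G₁ t := by rw [hCS, one_smul]
    conv_rhs => rw [this]
    simp only [p, q]
    module
  · intro t ht
    have := (((hSd t).smul (hP t)).add ((hCd t).smul (hQ t))).hasDerivWithinAt (s := Icc 0 T)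
    refine this.congr_deriv ?_
    rw [← e₂ t ht]
    have : G₂ t = (C t * C t + S t * S t) • G₂ t := by rw [hCS, one_smul]
    conv_rhs => rw [this]
    simp only [p, q]
    module

open scoped InnerProductSpace

variable {E : Type} [NormedAddCommGroup E] [InnerProductSpace ℝ E]

/-- Residuals `r = A y` with `y` and its time derivative of size `ε` for `D`, and of size `ε` in norm
where the dispersion coefficient vanishes. -/
structure IsSmallResidual (A D : E →ₗ[ℝ] E) (l₁ l₃ T ε : ℝ) (r y y' : Fin 4 → ℝ → E) : Prop where
  deriv : ∀ i, ∀ t ∈ Icc 0 T, HasDerivWithinAt (y i) (y' i t) (Icc 0 T) t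
  eq : ∀ i, ∀ t ∈ Icc 0 T, r i t = A (y i t)
  le : ∀ t ∈ Icc 0 T, ∀ i, ‖D (y i t)‖ ≤ ε
  le' : ∀ t ∈ Icc 0 T, ∀ i, ‖D (y' i t)‖ ≤ ε
  zero₁ : l₁ = 0 → ∀ t ∈ Icc 0 T, ‖r 0 t‖ ≤ ε ∧ ‖r 1 t‖ ≤ ε
  zero₃ : l₃ = 0 → ∀ t ∈ Icc 0 T, ‖r 2 t‖ ≤ ε ∧ ‖r 3 t‖ ≤ ε

variable {A D : E →ₗ[ℝ] E} {l₁ l₃ k₁ k₃ w T ε : ℝ} {e r y y' : Fin 4 → ℝ → E}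

theorem IsSmallResidual.swap (h : IsSmallResidual A D l₁ l₃ T ε r y y') :
    IsSmallResidual A D l₃ l₁ T ε (fun i => r (i + 2)) (fun i => y (i + 2)) (fun i => y' (i + 2)) :=
  ⟨fun _ => h.deriv _, fun _ => h.eq _, fun t ht _ => h.le t ht _, fun t ht _ => h.le' t ht _,
    h.zero₃, h.zero₁⟩

variable [FiniteDimensional ℝ E]

/-- With nonzero dispersion, `r = A y = l A (l⁻¹ y)` has the form that a shift of the unknown
absorbs; the bound for `D` is then turned into one for the norm by the Poincaré inequality. -/
theorem norm_le_of_ne_ne {Cp : ℝ} (hCp : 0 ≤ Cp) (h₁ : l₁ ≠ 0) (h₃ : l₃ ≠ 0)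
    (hA : ∀ x y, ⟪D (A x), D y⟫_ℝ = ⟪D x, D (A y)⟫_ℝ) (hP : ∀ x, ‖x‖ ≤ Cp * ‖D x‖) (hε : 0 ≤ ε)
    (h : IsSystem A l₁ l₃ k₁ k₃ w T e r) (h0 : ∀ i, e i 0 = 0)
    (hr : IsSmallResidual A D l₁ l₃ T ε r y y') : ∀ t ∈ Icc 0 T, ∀ i,
    ‖e i t‖ ≤ Cp * ((growth T * (1 + |k₁| + |k₃| + |w|) + 1) * ((|l₁|⁻¹ + |l₃|⁻¹) * ε)) := by
  intro t ht i
  refine (hP _).trans (mul_le_mul_of_nonneg_left ?_ hCp)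
  have b1 : 0 ≤ |l₁|⁻¹ * ε := by positivity
  have b3 : 0 ≤ |l₃|⁻¹ * ε := by positivity
  have bd : ∀ (l : ℝ) (v : E), ‖D v‖ ≤ ε → |l|⁻¹ * ε ≤ (|l₁|⁻¹ + |l₃|⁻¹) * ε →
      ‖D (l⁻¹ • v)‖ ≤ (|l₁|⁻¹ + |l₃|⁻¹) * ε := fun l v hv hl => by
    rw [map_smul, norm_smul, norm_inv, Real.norm_eq_abs]
    exact (mul_le_mul_of_nonneg_left hv (by positivity)).trans hl
  have bdn : ∀ (l : ℝ) (v : E), ‖D v‖ ≤ ε → |l|⁻¹ * ε ≤ (|l₁|⁻¹ + |l₃|⁻¹) * ε →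
      ‖D (-(l⁻¹ • v))‖ ≤ (|l₁|⁻¹ + |l₃|⁻¹) * ε := fun l v hv hl => by
    rw [map_neg, norm_neg]
    exact bd l v hv hl
  have c1 : |l₁|⁻¹ * ε ≤ (|l₁|⁻¹ + |l₃|⁻¹) * ε := by linarith
  have c3 : |l₃|⁻¹ * ε ≤ (|l₁|⁻¹ + |l₃|⁻¹) * ε := by linarith
  -- The exchange of components with a sign is multiplication by a complex unit in real form: the
  -- operator acts on the partner component in each equation.
  refine h.energy_bound_range hA (by positivity) h0
    (y := ![fun t => -(l₁⁻¹ • y 1 t), fun t => l₁⁻¹ • y 0 t, fun t => -(l₃⁻¹ • y 3 t),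
      fun t => l₃⁻¹ • y 2 t])
    (y' := ![fun t => -(l₁⁻¹ • y' 1 t), fun t => l₁⁻¹ • y' 0 t, fun t => -(l₃⁻¹ • y' 3 t),
      fun t => l₃⁻¹ • y' 2 t]) ?_ ?_ ?_ ?_ ?_ ?_ ?_ t ht i
  · intro i t ht
    fin_cases i
    · exact ((hr.deriv 1 t ht).const_smul _).neg
    · exact (hr.deriv 0 t ht).const_smul _
    · exact ((hr.deriv 3 t ht).const_smul _).neg
    · exact (hr.deriv 2 t ht).const_smul _
  · intro t ht; simp [hr.eq 0 t ht, h₁]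
  · intro t ht; simp [hr.eq 1 t ht, h₁]
  · intro t ht; simp [hr.eq 2 t ht, h₃]
  · intro t ht; simp [hr.eq 3 t ht, h₃]
  · intro t ht i
    fin_cases i
    · exact bdn _ _ (hr.le t ht 1) c1
    · exact bd _ _ (hr.le t ht 0) c1
    · exact bdn _ _ (hr.le t ht 3) c3
    · exact bd _ _ (hr.le t ht 2) c3
  · intro t ht i
    fin_cases i
    · exact bdn _ _ (hr.le' t ht 1) c1
    · exact bd _ _ (hr.le' t ht 0) c1
    · exact bdn _ _ (hr.le' t ht 3) c3
    · exact bd _ _ (hr.le' t ht 2) c3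

/-- Without dispersion `A` may be replaced by `0` and `D` by the identity, and the residuals are
small in norm by assumption. -/
theorem norm_le_of_eq_eq (h₁ : l₁ = 0) (h₃ : l₃ = 0) (hε : 0 ≤ ε)
    (h : IsSystem A l₁ l₃ k₁ k₃ w T e r) (h0 : ∀ i, e i 0 = 0)
    (hr : IsSmallResidual A D l₁ l₃ T ε r y y') : ∀ t ∈ Icc 0 T, ∀ i,
    ‖e i t‖ ≤ growth T * ε := by
  have h' : IsSystem (0 : E →ₗ[ℝ] E) l₁ l₃ k₁ k₃ w T e r := by
    subst h₁ h₃
    refine ⟨fun t ht => (h.eq0 t ht).congr_deriv ?_, fun t ht => (h.eq1 t ht).congr_deriv ?_,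
      fun t ht => (h.eq2 t ht).congr_deriv ?_, fun t ht => (h.eq3 t ht).congr_deriv ?_⟩ <;> simp
  refine h'.energy_bound (D := LinearMap.id) (by simp) hε (by simpa [h0] using hε) ?_
  intro t ht i
  fin_cases i
  · exact (hr.zero₁ h₁ t ht).1
  · exact (hr.zero₁ h₁ t ht).2
  · exact (hr.zero₃ h₃ t ht).1
  · exact (hr.zero₃ h₃ t ht).2

/-- The first pair has no dispersive term to absorb `A y`. The rotation system with forcing `y` is
solved by `c`, and `A c` then carries the residual of the first pair exactly. Subtracting it moves
the difficulty to the second pair, where the new residual `w A c` is again in the range of `A` and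
the nonzero `l₃` absorbs it. -/
theorem norm_le_of_eq_ne {Cp : ℝ} (hCp : 0 ≤ Cp) (h₁ : l₁ = 0) (h₃ : l₃ ≠ 0)
    (hA : ∀ x y, ⟪D (A x), D y⟫_ℝ = ⟪D x, D (A y)⟫_ℝ) (hP : ∀ x, ‖x‖ ≤ Cp * ‖D x‖) (hε : 0 ≤ ε)
    (hT : 0 ≤ T) (h : IsSystem A l₁ l₃ k₁ k₃ w T e r) (h0 : ∀ i, e i 0 = 0)
    (hr : IsSmallResidual A D l₁ l₃ T ε r y y') : ∀ t ∈ Icc 0 T, ∀ i,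
    ‖e i t‖ ≤ Cp * ((growth T * (1 + |k₁| + |k₃| + |w|) + 1) *
      (|l₃|⁻¹ * (1 + |w| * (1 + (1 + |k₁|) * growth T)) * ε)) + growth T * ε := by
  obtain ⟨c₁, c₂, c₁0, c₂0, hc₁, hc₂⟩ := exists_rotation_solution k₁ hT
    (fun t ht => (hr.deriv 0 t ht).continuousWithinAt)
    (fun t ht => (hr.deriv 1 t ht).continuousWithinAt)
  set g := growth T with hg
  have hg0 : 0 ≤ g := Real.sqrt_nonneg _
  have hc : IsSystem (0 : E →ₗ[ℝ] E) 0 0 k₁ 0 0 T ![c₁, c₂, fun _ => 0, fun _ => 0]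
      ![y 0, y 1, fun _ => 0, fun _ => 0] := by
    refine ⟨fun t ht => (hc₁ t ht).congr_deriv ?_, fun t ht => (hc₂ t ht).congr_deriv ?_,
      fun t ht => (hasDerivWithinAt_const t _ (0 : E)).congr_deriv ?_,
      fun t ht => (hasDerivWithinAt_const t _ (0 : E)).congr_deriv ?_⟩ <;> simp
  have hDc := hc.energy_bound (D := D) (by simp) hε (by
    intro i; fin_cases i <;> simp [c₁0, c₂0, hε]) (by
    intro t ht i
    fin_cases i
    · exact hr.le t ht 0
    · exact hr.le t ht 1
    · simpa using hε
    · simpa using hε)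
  have hD1 : ∀ t ∈ Icc 0 T, ‖D (c₁ t)‖ ≤ g * ε := fun t ht => hDc t ht 0
  have hD2 : ∀ t ∈ Icc 0 T, ‖D (c₂ t)‖ ≤ g * ε := fun t ht => hDc t ht 1
  -- The function `A c` solves the rotation system with forcing `A y = r`. It is therefore small in
  -- norm, which `D`-bounds on `c` would not give.
  have hAc : IsSystem (0 : E →ₗ[ℝ] E) 0 0 k₁ 0 0 T
      ![fun t => A (c₁ t), fun t => A (c₂ t), fun _ => 0, fun _ => 0]
      ![r 0, r 1, fun _ => 0, fun _ => 0] := by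
    refine ⟨fun t ht => (hasDerivWithinAt_map A (hc₁ t ht)).congr_deriv ?_,
      fun t ht => (hasDerivWithinAt_map A (hc₂ t ht)).congr_deriv ?_,
      fun t ht => (hasDerivWithinAt_const t _ (0 : E)).congr_deriv ?_,
      fun t ht => (hasDerivWithinAt_const t _ (0 : E)).congr_deriv ?_⟩ <;>
    simp [hr.eq 0 t ht, hr.eq 1 t ht]
  have hLc := hAc.energy_bound (D := LinearMap.id) (by simp) hε (by
    intro i; fin_cases i <;> simp [c₁0, c₂0, hε]) (by
    intro t ht i
    fin_cases i
    · exact (hr.zero₁ h₁ t ht).1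
    · exact (hr.zero₁ h₁ t ht).2
    · simpa using hε
    · simpa using hε)
  have hsys : IsSystem A l₁ l₃ k₁ k₃ w T
      ![fun t => A (c₁ t), fun t => A (c₂ t), fun _ => 0, fun _ => 0]
      ![r 0, r 1, fun t => w • A (c₂ t), fun t => -(w • A (c₁ t))] := by
    subst h₁
    refine ⟨fun t ht => (hasDerivWithinAt_map A (hc₁ t ht)).congr_deriv ?_,
      fun t ht => (hasDerivWithinAt_map A (hc₂ t ht)).congr_deriv ?_,
      fun t ht => (hasDerivWithinAt_const t _ (0 : E)).congr_deriv ?_,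
      fun t ht => (hasDerivWithinAt_const t _ (0 : E)).congr_deriv ?_⟩ <;>
    simp [hr.eq 0 t ht, hr.eq 1 t ht]
  set κ := |l₃|⁻¹ * (1 + |w| * (1 + (1 + |k₁|) * g)) * ε with hκ
  have hwε : ∀ v v' : E, ‖D v‖ ≤ ε → ‖D v'‖ ≤ (1 + (1 + |k₁|) * g) * ε →
      ∀ σ : ℝ, |σ| = |w| → ‖D (l₃⁻¹ • (v + σ • v'))‖ ≤ κ := by
    intro v v' hv hv' σ hσ
    rw [map_smul, map_add, map_smul, norm_smul, norm_inv, Real.norm_eq_abs, hκ, mul_assoc]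
    refine mul_le_mul_of_nonneg_left ((norm_add_le _ _).trans ?_) (by positivity)
    rw [norm_smul, Real.norm_eq_abs, hσ]
    have := mul_le_mul_of_nonneg_left hv' (abs_nonneg w)
    linarith
  have hgε : g * ε ≤ (1 + (1 + |k₁|) * g) * ε := by
    have : 0 ≤ |k₁| * g := by positivity
    nlinarith
  have hrot : ∀ (σ : ℝ) (v v' : E), |σ| = |k₁| → ‖D v‖ ≤ g * ε → ‖D v'‖ ≤ ε →
      ‖D (σ • v + v')‖ ≤ (1 + (1 + |k₁|) * g) * ε := by
    intro σ v v' hσ hv hv'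
    rw [map_add, map_smul]
    refine (norm_add_le _ _).trans ?_
    rw [norm_smul, Real.norm_eq_abs, hσ]
    have := mul_le_mul_of_nonneg_left hv (abs_nonneg k₁)
    have : 0 ≤ g * ε := by positivity
    linarith
  have hκ0 : 0 ≤ κ := by positivity
  -- In the first pair nothing is left to absorb, so its shifts are zero. The time derivative of `c`
  -- needed in the second pair is read off from the rotation system.
  have main := (h.sub hsys).energy_bound_range hA (ε := κ) hκ0
    (by intro i; fin_cases i <;> simp [c₁0, c₂0, h0])
    (y := ![fun _ => 0, fun _ => 0, fun t => -(l₃⁻¹ • (y 3 t + w • c₁ t)),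
      fun t => l₃⁻¹ • (y 2 t + (-w) • c₂ t)])
    (y' := ![fun _ => 0, fun _ => 0,
      fun t => -(l₃⁻¹ • (y' 3 t + w • ((-k₁) • c₂ t + y 0 t))),
      fun t => l₃⁻¹ • (y' 2 t + (-w) • (k₁ • c₁ t + y 1 t))])
    (by
      intro i t ht
      fin_cases i
      · exact hasDerivWithinAt_const _ _ _
      · exact hasDerivWithinAt_const _ _ _
      · have := (((hr.deriv 3 t ht).add ((hc₁ t ht).const_smul w)).const_smul l₃⁻¹).neg
        refine this.congr_deriv ?_
        simp
      · exact ((hr.deriv 2 t ht).add ((hc₂ t ht).const_smul (-w))).const_smul l₃⁻¹)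
    (by intro t ht; simp) (by intro t ht; simp)
    (by
      intro t ht
      simp [hr.eq 2 t ht, h₃, sub_eq_add_neg])
    (by
      intro t ht
      simp [hr.eq 3 t ht, h₃])
    (by
      intro t ht i
      fin_cases i
      · simpa using hκ0
      · simpa using hκ0
      · change ‖D (-(l₃⁻¹ • (y 3 t + w • c₁ t)))‖ ≤ κ
        rw [map_neg, norm_neg]
        exact hwε _ _ (hr.le t ht 3) ((hD1 t ht).trans hgε) w rfl
      · exact hwε _ _ (hr.le t ht 2) ((hD2 t ht).trans hgε) (-w) (abs_neg w))
    (by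
      intro t ht i
      fin_cases i
      · simpa using hκ0
      · simpa using hκ0
      · change ‖D (-(l₃⁻¹ • (y' 3 t + w • ((-k₁) • c₂ t + y 0 t))))‖ ≤ κ
        rw [map_neg, norm_neg]
        exact hwε _ _ (hr.le' t ht 3)
          (hrot _ _ _ (abs_neg k₁) (hD2 t ht) (hr.le t ht 0)) w rfl
      · exact hwε _ _ (hr.le' t ht 2)
          (hrot _ _ _ rfl (hD1 t ht) (hr.le t ht 1)) (-w) (abs_neg w))
  intro t ht i
  have m1 := (hP _).trans (mul_le_mul_of_nonneg_left (main t ht i) hCp)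
  have m2 : ‖(![fun t => A (c₁ t), fun t => A (c₂ t), fun _ => 0, fun _ => 0] :
      Fin 4 → ℝ → E) i t‖ ≤ g * ε := hLc t ht i
  have m3 := norm_le_norm_sub_add (e i t)
    ((![fun t => A (c₁ t), fun t => A (c₂ t), fun _ => 0, fun _ => 0] : Fin 4 → ℝ → E) i t)
  linarith

/-- Stability of the system: the error is controlled by the residuals. -/
theorem exists_stability (l₁ l₃ k₁ k₃ w : ℝ) {T Cp : ℝ} (hT : 0 ≤ T) (hCp : 0 ≤ Cp) :
    ∃ C > 0, ∀ {E : Type} [NormedAddCommGroup E] [InnerProductSpace ℝ E] [FiniteDimensional ℝ E]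
      (A D : E →ₗ[ℝ] E), (∀ x y, ⟪D (A x), D y⟫_ℝ = ⟪D x, D (A y)⟫_ℝ) →
      (∀ x, ‖x‖ ≤ Cp * ‖D x‖) → ∀ (ε : ℝ) (e r y y' : Fin 4 → ℝ → E), 0 ≤ ε →
      IsSystem A l₁ l₃ k₁ k₃ w T e r → (∀ i, e i 0 = 0) →
      IsSmallResidual A D l₁ l₃ T ε r y y' → ∀ t ∈ Icc 0 T, ∀ i, ‖e i t‖ ≤ C * ε := by
  have hg : 0 ≤ growth T := Real.sqrt_nonneg _
  -- The two mixed cases are exchanged by swapping the unknowns; the swap applied twice is the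
  -- identity on `Fin 4`.
  by_cases h₁ : l₁ = 0 <;> by_cases h₃ : l₃ = 0
  · refine ⟨growth T + 1, by positivity, fun {E} _ _ _ A D hA hP ε e r y y' hε h h0 hr t ht i => ?_⟩
    have := norm_le_of_eq_eq h₁ h₃ hε h h0 hr t ht i
    linarith
  · refine ⟨Cp * ((growth T * (1 + |k₁| + |k₃| + |w|) + 1) *
      (|l₃|⁻¹ * (1 + |w| * (1 + (1 + |k₁|) * growth T)))) + growth T + 1, by positivity,
      fun {E} _ _ _ A D hA hP ε e r y y' hε h h0 hr t ht i => ?_⟩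
    have := norm_le_of_eq_ne hCp h₁ h₃ hA hP hε hT h h0 hr t ht i
    linarith
  · refine ⟨Cp * ((growth T * (1 + |k₃| + |k₁| + |w|) + 1) *
      (|l₁|⁻¹ * (1 + |w| * (1 + (1 + |k₃|) * growth T)))) + growth T + 1, by positivity,
      fun {E} _ _ _ A D hA hP ε e r y y' hε h h0 hr t ht i => ?_⟩
    have := norm_le_of_eq_ne hCp h₃ h₁ hA hP hε hT h.swap (fun i => h0 _) hr.swap t ht (i + 2)
    simp only [show i + 2 + 2 = i by rw [add_assoc]; exact add_zero i] at this
    linarith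
  · refine ⟨Cp * ((growth T * (1 + |k₁| + |k₃| + |w|) + 1) * (|l₁|⁻¹ + |l₃|⁻¹)) + 1,
      by positivity, fun {E} _ _ _ A D hA hP ε e r y y' hε h h0 hr t ht i => ?_⟩
    have := norm_le_of_ne_ne hCp h₁ h₃ hA hP hε h h0 hr t ht i
    linarith

/-! ### Mixed partial derivatives of the exact solution -/

/-- The closed strip `ℝ × [0, T]`. -/
def strip (T : ℝ) : Set (ℝ × ℝ) := univ ×ˢ Icc 0 T

theorem mem_strip {T x t : ℝ} (ht : t ∈ Icc 0 T) : (x, t) ∈ strip T := ⟨mem_univ _, ht⟩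

theorem uniqueDiffOn_strip {T : ℝ} (hT : 0 < T) : UniqueDiffOn ℝ (strip T) :=
  uniqueDiffOn_univ.prod (uniqueDiffOn_Icc hT)

theorem mem_closure_interior_strip {T : ℝ} (hT : 0 < T) {z : ℝ × ℝ} (hz : z ∈ strip T) :
    z ∈ closure (interior (strip T)) := by
  rw [strip, interior_prod_eq, interior_univ, interior_Icc, closure_prod_eq, closure_univ,
    closure_Ioo hT.ne]
  exact hz

/-- Directional derivative on the strip. -/
noncomputable def dirD (T : ℝ) (v : ℝ × ℝ) (g : ℝ × ℝ → ℝ) (z : ℝ × ℝ) : ℝ :=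
  fderivWithin ℝ g (strip T) z v

theorem dirD_congr {T : ℝ} {v : ℝ × ℝ} {f g : ℝ × ℝ → ℝ} (h : EqOn f g (strip T)) :
    EqOn (dirD T v f) (dirD T v g) (strip T) := fun z hz => by
  rw [dirD, dirD, fderivWithin_congr h (h hz)]

/-- `g` is `C^m` on the strip with derivatives bounded by `R`. -/
def BddSmooth (m : ℕ) (R T : ℝ) (g : ℝ × ℝ → ℝ) : Prop :=
  ContDiffOn ℝ m g (strip T) ∧ ∀ j ≤ m, ∀ z ∈ strip T, ‖iteratedFDerivWithin ℝ j g (strip T) z‖ ≤ R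

namespace BddSmooth

variable {m : ℕ} {R T : ℝ} {g : ℝ × ℝ → ℝ}

theorem norm_comp_le {E F : Type*} [NormedAddCommGroup E] [NormedSpace ℝ E]
    [NormedAddCommGroup F] [NormedSpace ℝ F] {L : E →L[ℝ] F} (hL : ‖L‖ ≤ 1)
    {f : ℝ × ℝ → E} {n j : ℕ} (hT : 0 < T) (hf : ContDiffOn ℝ n f (strip T)) (hj : j ≤ n)
    {z : ℝ × ℝ} (hz : z ∈ strip T) :
    ‖iteratedFDerivWithin ℝ j (L ∘ f) (strip T) z‖ ≤ ‖iteratedFDerivWithin ℝ j f (strip T) z‖ := by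
  rw [L.iteratedFDerivWithin_comp_left (hf z hz) (uniqueDiffOn_strip hT) hz (by exact_mod_cast hj)]
  refine (L.norm_compContinuousMultilinearMap_le _).trans ?_
  exact mul_le_of_le_one_left (norm_nonneg _) hL

theorem dirD (hT : 0 < T) (h : BddSmooth (m + 1) R T g) {v : ℝ × ℝ} (hv : ‖v‖ ≤ 1) :
    BddSmooth m R T (dirD T v g) := by
  have hu := uniqueDiffOn_strip hT
  have hd : ContDiffOn ℝ m (fderivWithin ℝ g (strip T)) (strip T) :=
    h.1.fderivWithin hu (by norm_cast)
  set L := ContinuousLinearMap.apply ℝ ℝ v with hLdef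
  have hL : ‖L‖ ≤ 1 := ContinuousLinearMap.opNorm_le_bound _ zero_le_one fun f => by
    refine (f.le_opNorm v).trans ?_
    rw [mul_comm]
    exact mul_le_mul_of_nonneg_right hv (norm_nonneg _)
  have e : FracLDG.dirD T v g = L ∘ fderivWithin ℝ g (strip T) := rfl
  rw [e]
  refine ⟨L.contDiff.comp_contDiffOn hd, fun j hj z hz => ?_⟩
  refine (norm_comp_le hL hT hd hj hz).trans ?_
  rw [norm_iteratedFDerivWithin_fderivWithin hu hz]
  exact h.2 _ (by omega) z hz

theorem mono {n : ℕ} (h : BddSmooth m R T g) (hn : n ≤ m) : BddSmooth n R T g :=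
  ⟨h.1.of_le (by exact_mod_cast hn), fun j hj => h.2 j (hj.trans hn)⟩

theorem iterate (hT : 0 < T) {v : ℝ × ℝ} (hv : ‖v‖ ≤ 1) (i : ℕ) :
    ∀ {m : ℕ} {g : ℝ × ℝ → ℝ}, BddSmooth (m + i) R T g →
      BddSmooth m R T ((FracLDG.dirD T v)^[i] g) := by
  induction i with
  | zero => exact fun h => h
  | succ i ih =>
    intro m g h
    rw [Function.iterate_succ_apply]
    exact ih (h.dirD hT hv)

theorem abs_le (h : BddSmooth m R T g) {z : ℝ × ℝ} (hz : z ∈ strip T) : |g z| ≤ R := by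
  have := h.2 0 (Nat.zero_le _) z hz
  rwa [norm_iteratedFDerivWithin_zero] at this

theorem hasFDerivWithinAt (h : BddSmooth (m + 1) R T g) {z : ℝ × ℝ} (hz : z ∈ strip T) :
    HasFDerivWithinAt g (fderivWithin ℝ g (strip T) z) (strip T) z :=
  ((h.1.differentiableOn (by simp)) z hz).hasFDerivWithinAt

theorem hasDerivAt_fst (h : BddSmooth (m + 1) R T g) {t : ℝ} (ht : t ∈ Icc 0 T) (x : ℝ) :
    HasDerivAt (fun x => g (x, t)) (FracLDG.dirD T (1, 0) g (x, t)) x := by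
  have h1 : HasDerivWithinAt (fun x : ℝ => (x, t)) (1, 0) univ x :=
    ((hasDerivAt_id x).prodMk (hasDerivAt_const x t)).hasDerivWithinAt
  rw [← hasDerivWithinAt_univ]
  exact (h.hasFDerivWithinAt (mem_strip ht)).comp_hasDerivWithinAt x h1
    fun y _ => mem_strip ht

theorem hasDerivWithinAt_snd (h : BddSmooth (m + 1) R T g) {t : ℝ} (ht : t ∈ Icc 0 T) (x : ℝ) :
    HasDerivWithinAt (fun t => g (x, t)) (FracLDG.dirD T (0, 1) g (x, t)) (Icc 0 T) t := by
  have h1 : HasDerivWithinAt (fun t : ℝ => (x, t)) (0, 1) (Icc 0 T) t :=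
    ((hasDerivAt_const t x).prodMk (hasDerivAt_id t)).hasDerivWithinAt
  exact (h.hasFDerivWithinAt (mem_strip ht)).comp_hasDerivWithinAt t h1
    fun y hy => mem_strip hy

/-- Symmetry of second derivatives extends to the boundary of the strip, every point of which is a
limit of interior points. -/
theorem dirD_comm (hT : 0 < T) (h : BddSmooth (m + 2) R T g) (v w : ℝ × ℝ) :
    EqOn (FracLDG.dirD T v (FracLDG.dirD T w g)) (FracLDG.dirD T w (FracLDG.dirD T v g))
      (strip T) := by
  intro z hz
  have hu := uniqueDiffOn_strip hT
  have hs : IsSymmSndFDerivWithinAt ℝ g (strip T) z :=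
    (h.1 z hz).isSymmSndFDerivWithinAt (by simp) hu (mem_closure_interior_strip hT hz) hz
  have hd : DifferentiableWithinAt ℝ (fderivWithin ℝ g (strip T)) (strip T) z :=
    ((h.1.fderivWithin (m := 1) hu (by norm_cast; omega)).differentiableOn (by simp)) z hz
  have e : ∀ v w : ℝ × ℝ, FracLDG.dirD T v (FracLDG.dirD T w g) z =
      fderivWithin ℝ (fderivWithin ℝ g (strip T)) (strip T) z v w := by
    intro v w
    have := hd.hasFDerivWithinAt.clm_apply (hasFDerivWithinAt_const w z (strip T))
    change fderivWithin ℝ (fun z => fderivWithin ℝ g (strip T) z w) (strip T) z v = _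
    rw [this.fderivWithin (hu z hz)]
    simp
  rw [e, e, hs v w]

theorem dirD_iterate_comm (hT : 0 < T) {v : ℝ × ℝ} (hv : ‖v‖ ≤ 1) (w : ℝ × ℝ) (i : ℕ)
    (h : BddSmooth (i + 1) R T g) :
    EqOn (FracLDG.dirD T w ((FracLDG.dirD T v)^[i] g)) ((FracLDG.dirD T v)^[i] (FracLDG.dirD T w g))
      (strip T) := by
  induction i with
  | zero => exact fun _ _ => rfl
  | succ i ih =>
    intro z hz
    rw [Function.iterate_succ_apply', Function.iterate_succ_apply']
    have h1 : BddSmooth (0 + 2) R T ((FracLDG.dirD T v)^[i] g) :=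
      iterate hT hv i (h.mono (by omega))
    rw [dirD_comm hT h1 w v hz]
    exact dirD_congr (ih (h.mono (by omega))) hz

end BddSmooth

/-- A family `D i j` of mixed partial derivatives (`i` in space, `j` in time), bounded by `R`, of a
function which vanishes outside `(a, b)`. -/
structure SmoothFam (m : ℕ) (R T a b : ℝ) (D : ℕ → ℕ → ℝ → ℝ → ℝ) : Prop where
  dx : ∀ i j, i + j < m → ∀ t ∈ Icc 0 T, ∀ x, HasDerivAt (D i j t) (D (i + 1) j t x) x
  dt : ∀ i j, i + j < m → ∀ t ∈ Icc 0 T, ∀ x,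
    HasDerivWithinAt (fun t => D i j t x) (D i (j + 1) t x) (Icc 0 T) t
  bd : ∀ i j, i + j ≤ m → ∀ t ∈ Icc 0 T, ∀ x, |D i j t x| ≤ R
  zero : ∀ i j, i + j ≤ m → ∀ t ∈ Icc 0 T, ∀ x, x ∉ Ioo a b → D i j t x = 0

/-- The family is made of iterated directional derivatives, space outermost. Commutation is needed
only for the time derivative. -/
theorem exists_smoothFam {m : ℕ} {R T a b : ℝ} (hT : 0 < T) {g : ℝ × ℝ → ℝ}
    (hg : BddSmooth m R T g) (h0 : ∀ t ∈ Icc 0 T, ∀ x, x ∉ Ioo a b → g (x, t) = 0) :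
    ∃ D, SmoothFam m R T a b D ∧ ∀ t x, D 0 0 t x = g (x, t) := by
  have hv1 : ‖((1, 0) : ℝ × ℝ)‖ ≤ 1 := by simp [Prod.norm_def]
  have hv2 : ‖((0, 1) : ℝ × ℝ)‖ ≤ 1 := by simp [Prod.norm_def]
  set D : ℕ → ℕ → ℝ → ℝ → ℝ := fun i j t x =>
    ((dirD T (1, 0))^[i] ((dirD T (0, 1))^[j] g)) (x, t) with hD
  have hB : ∀ i j n, i + j + n ≤ m →
      BddSmooth n R T ((dirD T (1, 0))^[i] ((dirD T (0, 1))^[j] g)) := fun i j n hn =>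
    BddSmooth.iterate hT hv1 i (BddSmooth.iterate hT hv2 j (hg.mono (by omega)))
  have hdx : ∀ i j, i + j < m → ∀ t ∈ Icc 0 T, ∀ x, HasDerivAt (D i j t) (D (i + 1) j t x) x := by
    intro i j hij t ht x
    have := (hB i j (0 + 1) (by omega)).hasDerivAt_fst ht x
    simpa only [hD, Function.iterate_succ_apply'] using this
  have hdt : ∀ i j, i + j < m → ∀ t ∈ Icc 0 T, ∀ x,
      HasDerivWithinAt (fun t => D i j t x) (D i (j + 1) t x) (Icc 0 T) t := by
    intro i j hij t ht x
    have := (hB i j (0 + 1) (by omega)).hasDerivWithinAt_snd ht x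
    refine this.congr_deriv ?_
    have hj : BddSmooth (i + 1) R T ((dirD T (0, 1))^[j] g) :=
      BddSmooth.iterate hT hv2 j (hg.mono (by omega))
    simp only [hD, Function.iterate_succ_apply']
    exact BddSmooth.dirD_iterate_comm hT hv1 _ i hj (mem_strip ht)
  refine ⟨D, ⟨hdx, hdt, fun i j hij t ht x => ?_, ?_⟩, fun t x => rfl⟩
  · exact (hB i j 0 (by omega)).abs_le (mem_strip ht)
  · intro i j
    induction i with
    | zero =>
      induction j with
      | zero => exact fun _ t ht x hx => h0 t ht x hx
      | succ j ih =>
        intro hj t ht x hx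
        have h1 := hdt 0 j (by omega) t ht x
        have h2 : HasDerivWithinAt (fun t => D 0 j t x) 0 (Icc 0 T) t :=
          (hasDerivWithinAt_const t _ (0 : ℝ)).congr (fun s hs => ih (by omega) s hs x hx)
            (ih (by omega) t ht x hx)
        exact (uniqueDiffOn_Icc hT t ht).eq_deriv _ h1 h2
    | succ i ih =>
      intro hij t ht x hx
      have h1 := hdx i j (by omega) t ht x
      rcases not_and_or.1 hx with h | h
      -- At `a` and `b` themselves the function vanishes on one side only; the one-sided derivative
      -- nevertheless determines the derivative.
      · have hx' : x ∈ Iic a := not_lt.1 h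
        have h2 : HasDerivWithinAt (D i j t) 0 (Iic x) x :=
          (hasDerivWithinAt_const x _ (0 : ℝ)).congr
            (fun y hy => ih (by omega) t ht y fun hy' => absurd hy'.1 (not_lt.2 (hy.trans hx')))
            (ih (by omega) t ht x hx)
        exact (uniqueDiffWithinAt_Iic x).eq_deriv _ h1.hasDerivWithinAt h2
      · have hx' : b ≤ x := not_lt.1 h
        have h2 : HasDerivWithinAt (D i j t) 0 (Ici x) x :=
          (hasDerivWithinAt_const x _ (0 : ℝ)).congr
            (fun y hy => ih (by omega) t ht y fun hy' => absurd hy'.2 (not_lt.2 (hx'.trans hy)))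
            (ih (by omega) t ht x hx)
        exact (uniqueDiffWithinAt_Ici x).eq_deriv _ h1.hasDerivWithinAt h2

namespace SmoothFam

variable {m : ℕ} {R T a b : ℝ} {D : ℕ → ℕ → ℝ → ℝ → ℝ}

theorem derivBound (h : SmoothFam m R T a b D) (n : ℕ) : ∀ i j, i + j + n ≤ m → ∀ t ∈ Icc 0 T,
    DerivBound n R (D i j t) := by
  induction n with
  | zero => exact fun i j hij t ht => h.bd i j (by omega) t ht
  | succ n ih => exact fun i j hij t ht =>
      ⟨_, h.dx i j (by omega) t ht, ih (i + 1) j (by omega) t ht⟩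

theorem continuous (h : SmoothFam m R T a b D) {i j : ℕ} (hij : i + j < m) {t : ℝ}
    (ht : t ∈ Icc 0 T) : Continuous (D i j t) :=
  continuous_iff_continuousAt.2 fun x => (h.dx i j hij t ht x).continuousAt

theorem BM (h : SmoothFam m R T a b D) {i j : ℕ} (hij : i + j < m) {t : ℝ}
    (ht : t ∈ Icc 0 T) : BM a b (D i j t) :=
  BM.of_continuous (h.continuous hij ht)

/-- A remainder quadratic in `s - t` and uniform in `x` is what allows differentiation in time under
any operator bounded for the supremum. -/
theorem taylor (h : SmoothFam m R T a b D) {i j : ℕ} (hij : i + j + 2 ≤ m) {s t : ℝ}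
    (hs : s ∈ Icc 0 T) (ht : t ∈ Icc 0 T) (x : ℝ) :
    |D i j s x - D i j t x - (s - t) * D i (j + 1) t x| ≤ R * |s - t| ^ 2 := by
  have hsub : uIcc t s ⊆ Icc 0 T := uIcc_subset_Icc ht hs
  have h1 : ∀ τ ∈ uIcc t s, |D i (j + 1) τ x - D i (j + 1) t x| ≤ R * |s - t| := by
    intro τ hτ
    have := (convex_uIcc t s).norm_image_sub_le_of_norm_hasDerivWithin_le (C := R)
      (fun σ hσ => (h.dt i (j + 1) (by omega) σ (hsub hσ) x).mono hsub)
      (fun σ hσ => h.bd i (j + 2) (by omega) σ (hsub hσ) x) left_mem_uIcc hτ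
    refine this.trans (mul_le_mul_of_nonneg_left ?_ ?_)
    · exact abs_sub_left_of_mem_uIcc hτ
    · exact (abs_nonneg _).trans (h.bd i j (by omega) t ht x)
  have := (convex_uIcc t s).norm_image_sub_le_of_norm_hasDerivWithin_le (C := R * |s - t|)
    (f := fun τ => D i j τ x - τ * D i (j + 1) t x)
    (f' := fun τ => D i (j + 1) τ x - 1 * D i (j + 1) t x)
    (fun σ hσ => ((h.dt i j (by omega) σ (hsub hσ) x).mono hsub).sub
      ((hasDerivWithinAt_id σ _).mul_const _))
    (fun σ hσ => by rw [one_mul]; exact h1 σ hσ) left_mem_uIcc right_mem_uIcc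
  rw [Real.norm_eq_abs, Real.norm_eq_abs] at this
  calc _ = |D i j s x - s * D i (j + 1) t x - (D i j t x - t * D i (j + 1) t x)| := by
        congr 1; ring
    _ ≤ _ := this
    _ = _ := by ring

end SmoothFam

open scoped InnerProductSpace

/-! ### Time differentiation under operators bounded in the supremum norm -/

/-- A linear operator on bounded measurable functions, bounded for the supremum on `[a, b]`. -/
structure IsSupOp (a b : ℝ) {V : Type} [NormedAddCommGroup V] [InnerProductSpace ℝ V]
    (L : (ℝ → ℝ) → V) : Prop where
  add : ∀ f g, BM a b f → BM a b g → L (fun x => f x + g x) = L f + L g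
  smul : ∀ (c : ℝ) f, BM a b f → L (fun x => c * f x) = c • L f
  bdd : ∃ C, 0 ≤ C ∧ ∀ f G, BM a b f → (∀ x ∈ Icc a b, |f x| ≤ G) → ‖L f‖ ≤ C * G

namespace IsSupOp

variable {a b : ℝ} {V : Type} [NormedAddCommGroup V] [InnerProductSpace ℝ V]
  {L L' : (ℝ → ℝ) → V}

theorem map [FiniteDimensional ℝ V] (h : IsSupOp a b L) (A : V →ₗ[ℝ] V) :
    IsSupOp a b fun f => A (L f) := by
  obtain ⟨C, hC, hb⟩ := h.bdd
  refine ⟨fun f g hf hg => by rw [h.add f g hf hg, map_add],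
    fun c f hf => by rw [h.smul c f hf, map_smul],
    ‖LinearMap.toContinuousLinearMap A‖ * C, by positivity, fun f G hf hG => ?_⟩
  rw [mul_assoc]
  exact ((LinearMap.toContinuousLinearMap A).le_opNorm _).trans
    (mul_le_mul_of_nonneg_left (hb f G hf hG) (norm_nonneg _))

theorem sub (h : IsSupOp a b L) (h' : IsSupOp a b L') : IsSupOp a b fun f => L f - L' f := by
  obtain ⟨C, hC, hb⟩ := h.bdd
  obtain ⟨C', hC', hb'⟩ := h'.bdd
  refine ⟨fun f g hf hg => by rw [h.add f g hf hg, h'.add f g hf hg]; abel,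
    fun c f hf => by rw [h.smul c f hf, h'.smul c f hf, smul_sub],
    C + C', by positivity, fun f G hf hG => ?_⟩
  rw [add_mul]
  exact (norm_sub_le _ _).trans (add_le_add (hb f G hf hG) (hb' f G hf hG))

/-- By linearity the difference quotient error is the image of the Taylor remainder. The constant of
the operator may depend on the mesh, since only differentiability is claimed. -/
theorem hasDerivWithinAt (h : IsSupOp a b L) {T R : ℝ} {f f' : ℝ → ℝ → ℝ} {t : ℝ}
    (ht : t ∈ Icc 0 T) (hf : ∀ s ∈ Icc 0 T, BM a b (f s)) (hf' : BM a b (f' t))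
    (hR : ∀ s ∈ Icc 0 T, ∀ x, |f s x - f t x - (s - t) * f' t x| ≤ R * |s - t| ^ 2) :
    HasDerivWithinAt (fun s => L (f s)) (L (f' t)) (Icc 0 T) t := by
  obtain ⟨C, hC, hb⟩ := h.bdd
  rw [hasDerivWithinAt_iff_isLittleO]
  have h1 : (fun s => L (f s) - L (f t) - (s - t) • L (f' t)) =O[nhdsWithin t (Icc 0 T)]
      fun s => ‖s - t‖ ^ 2 := by
    refine Asymptotics.IsBigO.of_bound (C * R) ?_
    filter_upwards [self_mem_nhdsWithin] with s hs
    have e : L (fun x => f s x + ((-1) * f t x + (-(s - t)) * f' t x)) =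
        L (f s) - L (f t) - (s - t) • L (f' t) := by
      rw [h.add _ _ (hf s hs) (((hf t ht).const_mul _).add (hf'.const_mul _)),
        h.add _ _ ((hf t ht).const_mul _) (hf'.const_mul _), h.smul _ _ (hf t ht),
        h.smul _ _ hf']
      module
    rw [← e, Real.norm_of_nonneg (by positivity), mul_assoc]
    refine hb _ _ ((hf s hs).add (((hf t ht).const_mul _).add (hf'.const_mul _))) fun x _ => ?_
    rw [Real.norm_eq_abs]
    refine le_trans (le_of_eq ?_) (hR s hs x)
    congr 1
    ring
  exact h1.trans_isLittleO
    ((Asymptotics.isLittleO_pow_sub_sub t one_lt_two).mono nhdsWithin_le_nhds)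

theorem hasDerivWithinAt_fam (h : IsSupOp a b L) {m : ℕ} {R T : ℝ} {D : ℕ → ℕ → ℝ → ℝ → ℝ}
    (hD : SmoothFam m R T a b D) {i j : ℕ} (hij : i + j + 2 ≤ m) {t : ℝ} (ht : t ∈ Icc 0 T) :
    HasDerivWithinAt (fun s => L (D i j s)) (L (D i (j + 1) t)) (Icc 0 T) t :=
  h.hasDerivWithinAt ht (fun _ hs => hD.BM (by omega) hs) (hD.BM (by omega) ht)
    fun _ hs x => hD.taylor hij hs ht x

end IsSupOp

theorem integral_sq_le_of_abs_le {a b : ℝ} (hab : a ≤ b) {g : ℝ → ℝ} (hg : BM a b g) {G : ℝ}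
    (hG : ∀ x ∈ Icc a b, |g x| ≤ G) : ∫ x, g x ^ 2 ∂vol a b ≤ (b - a) * G ^ 2 := by
  have h : ∫ x, g x ^ 2 ∂vol a b ≤ ∫ _, G ^ 2 ∂vol a b :=
    integral_mono_ae hg.sq_integrable (integrable_const _) (ae_vol fun x hx => by
      have := abs_le.1 (hG x (Ioc_subset_Icc_self hx))
      change g x ^ 2 ≤ G ^ 2
      nlinarith)
  rw [integral_const, smul_eq_mul] at h
  simpa [Measure.real, ENNReal.toReal_ofReal (sub_nonneg.2 hab)] using h

theorem sq_le_of_sup {a b C : ℝ} (hab : a ≤ b) (hC : 0 ≤ C) {V : Type} [NormedAddCommGroup V]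
    {v : V} {g : ℝ → ℝ} (hg : BM a b g) {G : ℝ} (hG : ∀ x ∈ Icc a b, |g x| ≤ G)
    (h : ‖v‖ ^ 2 ≤ C * ∫ x, g x ^ 2 ∂vol a b) : ‖v‖ ≤ Real.sqrt (C * (b - a)) * G := by
  have hG0 : 0 ≤ G := (abs_nonneg _).trans (hG a (left_mem_Icc.2 hab))
  have hba := sub_nonneg.2 hab
  refine le_of_sq_le_sq ?_ (by positivity)
  rw [mul_pow, Real.sq_sqrt (by positivity), mul_assoc]
  exact h.trans (mul_le_mul_of_nonneg_left (integral_sq_le_of_abs_le hab hg hG) hC)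

/-! ### The discrete Riesz derivative and negative-norm consistency -/

namespace Vh

variable {a b : ℝ} {𝓜 : Mesh a b} {N : ℕ}

theorem isSupOp_proj : IsSupOp a b (proj 𝓜 N) := by
  refine ⟨fun f g hf hg => proj_add hf hg, fun c f hf => proj_smul c hf,
    Real.sqrt (1 * (b - a)), Real.sqrt_nonneg _, fun f G hf hG => ?_⟩
  refine sq_le_of_sup 𝓜.a_le_b zero_le_one hf hG ?_
  rw [one_mul]
  exact norm_proj_sq_le hf

theorem inner_proj_Ik {μ : ℝ} (hμ : 0 < μ) {f : ℝ → ℝ} (hf : BM a b f) (v : Vh 𝓜 N) :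
    ⟪proj 𝓜 N (Ik μ a b f), v⟫_ℝ = kerForm μ a b f v.tf := by
  rw [inner_proj (hf.Ik hμ), kerForm_comm, ← integral_mul_Ik hμ v.BM_tf hf]
  simp only [mul_comm]

theorem isSupOp_proj_Ik {μ : ℝ} (hμ : 0 < μ) (hμ1 : μ < 1) :
    IsSupOp a b fun f => proj 𝓜 N (Ik μ a b f) := by
  obtain ⟨C, hC, h⟩ := exists_kerForm_self_le (a := a) (b := b) hμ
  refine ⟨fun f g hf hg => ext_inner fun v => ?_, fun c f hf => ext_inner fun v => ?_,
    Real.sqrt (C ^ 2 * (b - a)), Real.sqrt_nonneg _, fun f G hf hG => ?_⟩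
  · have := kerForm_add_smul hμ hf hg v.BM_tf 1
    simp only [one_mul] at this
    rw [inner_add_left, inner_proj_Ik hμ hf, inner_proj_Ik hμ hg, inner_proj_Ik hμ (hf.add hg),
      this]
  · have := kerForm_add_smul hμ (BM_const 0) hf v.BM_tf c
    have h0 : kerForm μ a b (fun _ => 0) v.tf = 0 := by simp [kerForm]
    simp only [zero_add, h0] at this
    rw [real_inner_smul_left, inner_proj_Ik hμ hf, inner_proj_Ik hμ (hf.const_mul c), this]
  · refine sq_le_of_sup 𝓜.a_le_b (by positivity) hf hG ?_
    set w := proj 𝓜 N (Ik μ a b f) with hw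
    have e1 : ‖w‖ ^ 2 = kerForm μ a b f w.tf := by
      rw [← real_inner_self_eq_norm_sq, ← inner_proj_Ik hμ hf]
    have e2 := kerForm_sq_le hμ hμ1 hf w.BM_tf
    have e3 := h _ w.BM_tf
    rw [← norm_sq_eq] at e3
    have e4 := h f hf
    have hI : 0 ≤ ∫ x, f x ^ 2 ∂vol a b := integral_nonneg fun _ => sq_nonneg _
    rw [← e1] at e2
    have e5 : (‖w‖ ^ 2) ^ 2 ≤ (C * ∫ x, f x ^ 2 ∂vol a b) * (C * ‖w‖ ^ 2) :=
      e2.trans (mul_le_mul e4 e3 (kerForm_self_nonneg hμ hμ1 w.BM_tf) (by positivity))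
    rcases (sq_nonneg ‖w‖).eq_or_lt with h0 | h0
    · rw [← h0]; positivity
    · nlinarith

theorem isSupOp_corr {e : Fin 𝓜.K → ℝ} (he : IsEnd e) : IsSupOp a b (corr N he) := by
  have h1 : IsSupOp a b fun f : ℝ → ℝ => legSum N he fun k => f (e k) := by
    refine ⟨fun f g _ _ => (legSum N he).map_add _ _, fun c f _ => (legSum N he).map_smul _ _,
      ‖LinearMap.toContinuousLinearMap (legSum N he)‖,
      ContinuousLinearMap.opNorm_nonneg _, fun f G _ hG => ?_⟩
    refine ((LinearMap.toContinuousLinearMap (legSum N he)).le_opNorm _).trans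
      (mul_le_mul_of_nonneg_left ?_ (ContinuousLinearMap.opNorm_nonneg _))
    have hG0 : 0 ≤ G := (abs_nonneg _).trans (hG a (left_mem_Icc.2 𝓜.a_le_b))
    refine (pi_norm_le_iff_of_nonneg hG0).2 fun k => hG _ ?_
    rcases he k with h | h <;> rw [h]
    · exact 𝓜.left_mem k
    · exact 𝓜.right_mem k
  exact h1.sub (isSupOp_proj.map ((legSum N he).comp (evalEnd e)))

/-- The discrete Riesz derivative. -/
noncomputable def rieszOp (c μ : ℝ) : Vh 𝓜 N →ₗ[ℝ] Vh 𝓜 N :=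
  c • (pot μ : Vh 𝓜 N →ₗ[ℝ] Vh 𝓜 N).comp ((Dp : Vh 𝓜 N →ₗ[ℝ] Vh 𝓜 N).comp Dm)

theorem rieszOp_apply (c μ : ℝ) (w : Vh 𝓜 N) : rieszOp c μ w = c • pot μ (Dp (Dm w)) := rfl

/-- Moving the outer `Dm` across gives `-c` times the potential form of `Dp (Dm v)` and `Dp (Dm w)`,
which is symmetric. The energy of the scheme is for this reason the one of the discrete derivative.
-/
theorem inner_Dm_rieszOp (c : ℝ) {μ : ℝ} (hμ : 0 < μ) (v w : Vh 𝓜 N) :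
    ⟪Dm (rieszOp c μ v), Dm w⟫_ℝ = ⟪Dm v, Dm (rieszOp c μ w)⟫_ℝ := by
  rw [real_inner_comm (Dm (rieszOp c μ w)), inner_Dm, inner_Dm, rieszOp_apply, rieszOp_apply,
    real_inner_smul_left, real_inner_smul_left, inner_pot_comm hμ, real_inner_comm]

theorem Dm_bijective (hab : a < b) : Function.Bijective (Dm : Vh 𝓜 N →ₗ[ℝ] Vh 𝓜 N) := by
  obtain ⟨C, hC, h⟩ := exists_norm_le_Dm N hab
  have hi : Function.Injective (Dm : Vh 𝓜 N →ₗ[ℝ] Vh 𝓜 N) := by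
    rw [← LinearMap.ker_eq_bot, LinearMap.ker_eq_bot']
    intro w hw
    have := h 𝓜 w
    rw [hw, norm_zero, mul_zero] at this
    exact norm_le_zero_iff.1 this
  exact ⟨hi, LinearMap.injective_iff_surjective.1 hi⟩

/-- All three factors are injective, and the space is finite dimensional. Residuals can therefore be
written as images of the operator. -/
theorem rieszOp_bijective (hab : a < b) {c μ : ℝ} (hc : c ≠ 0) (hμ : 0 < μ) (hμ1 : μ < 1) :
    Function.Bijective (rieszOp c μ : Vh 𝓜 N →ₗ[ℝ] Vh 𝓜 N) := by
  have hi : Function.Injective (rieszOp c μ : Vh 𝓜 N →ₗ[ℝ] Vh 𝓜 N) := fun v w h => by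
    rw [rieszOp_apply, rieszOp_apply] at h
    exact (Dm_bijective hab).1 (Dp_bijective.1 (pot_injective hμ hμ1 (smul_right_injective _ hc h)))
  exact ⟨hi, LinearMap.injective_iff_surjective.1 hi⟩

/-- The inverse of the discrete Riesz derivative. -/
noncomputable def rieszInv (hab : a < b) {c μ : ℝ} (hc : c ≠ 0) (hμ : 0 < μ) (hμ1 : μ < 1) :
    Vh 𝓜 N →ₗ[ℝ] Vh 𝓜 N :=
  ((LinearEquiv.ofBijective _ (rieszOp_bijective (𝓜 := 𝓜) (N := N) hab hc hμ hμ1)).symm :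
    Vh 𝓜 N →ₗ[ℝ] Vh 𝓜 N)

section

variable (hab : a < b) {c μ : ℝ} (hc : c ≠ 0) (hμ : 0 < μ) (hμ1 : μ < 1)

theorem rieszOp_rieszInv (v : Vh 𝓜 N) : rieszOp c μ (rieszInv hab hc hμ hμ1 v) = v :=
  (LinearEquiv.ofBijective _ (rieszOp_bijective hab hc hμ hμ1)).apply_symm_apply v

theorem smul_pot_Dp_Dm_rieszInv (v : Vh 𝓜 N) :
    c • pot μ (Dp (Dm (rieszInv hab hc hμ hμ1 v))) = v := rieszOp_rieszInv hab hc hμ hμ1 v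

theorem Dm_rieszInv (X : Vh 𝓜 N) : Dm (rieszInv hab hc hμ hμ1 (c • pot μ (Dp X))) = X := by
  have h := smul_pot_Dp_Dm_rieszInv hab hc hμ hμ1 (c • pot μ (Dp X))
  exact Dp_bijective.1 (pot_injective hμ hμ1 (smul_right_injective _ hc h))

/-- The negative-norm size of the difference of the projections. -/
theorem exists_corr_negnorm (N : ℕ) {a b : ℝ} (hab : a < b) {c μ : ℝ} (hc : c ≠ 0) (hμ : 0 < μ)
    (hμ1 : μ < 1) : ∃ C > 0, ∀ (𝓜 : Mesh a b) (f : ℝ → ℝ) (M : ℝ), 0 ≤ M → DerivBound (N + 1) M f →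
    ‖Dm (rieszInv hab hc hμ hμ1 (corr (𝓜 := 𝓜) N isEnd_right f))‖ ≤ C * (M * 𝓜.size ^ (N + 1)) := by
  obtain ⟨C1, hC1, h1⟩ := exists_corr_approx N
  obtain ⟨C2, hC2, h2⟩ := exists_norm_le_of_pot_small N hμ hμ1 hab
  refine ⟨C2 * (|c|⁻¹ * C1), by positivity, fun 𝓜 f M hM hf => ?_⟩
  set v := corr (𝓜 := 𝓜) N isEnd_right f with hv
  set X := Dm (rieszInv hab hc hμ hμ1 v) with hX
  -- Only the local pointwise size of `v` is used, so each element keeps its own power of its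
  -- length.
  have e : pot μ (Dp X) = c⁻¹ • v := by
    rw [eq_inv_smul_iff₀ hc]
    exact smul_pot_Dp_Dm_rieszInv hab hc hμ hμ1 v
  have := h2 𝓜 X (|c|⁻¹ * (C1 * M)) (by positivity) (fun k x hx => by
    have e1 : ((pot μ (Dp X)).1 k).eval x = c⁻¹ * (v.1 k).eval x := by
      rw [e]; exact Polynomial.eval_smul _ _ _
    rw [e1, abs_mul, abs_inv, mul_assoc, mul_assoc]
    exact mul_le_mul_of_nonneg_left (h1 𝓜 _ isEnd_right f M hf k x hx) (by positivity))
  calc _ ≤ _ := this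
    _ = _ := by ring

theorem exists_norm_corr (N : ℕ) {a b : ℝ} (hab : a < b) : ∃ C > 0, ∀ (𝓜 : Mesh a b)
    (e : Fin 𝓜.K → ℝ) (he : IsEnd e) (f : ℝ → ℝ) (M : ℝ), 0 ≤ M → DerivBound (N + 1) M f →
    ‖corr (𝓜 := 𝓜) N he f‖ ≤ C * (M * 𝓜.size ^ (N + 1)) := by
  obtain ⟨C1, hC1, h1⟩ := exists_corr_approx N
  have hba := sub_pos.2 hab
  refine ⟨Real.sqrt (b - a) * C1, by positivity, fun 𝓜 e he f M hM hf => ?_⟩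
  have hS := 𝓜.size_nonneg
  refine le_of_sq_le_sq ?_ (by positivity)
  have h2 := norm_sq_le_of_abs_le (corr (𝓜 := 𝓜) N he f) (c := C1 * (M * 𝓜.size ^ (N + 1)))
    fun k x hx => (h1 𝓜 e he f M hf k x hx).trans (by
      have := (sub_pos.2 (𝓜.left_lt_right k)).le
      gcongr
      exact 𝓜.len_le_size k)
  rw [mul_assoc, mul_pow, Real.sq_sqrt hba.le]
  exact h2

/-- The consistency error of the discrete Riesz derivative. -/
noncomputable def rieszErr (𝓜 : Mesh a b) (N : ℕ) (c μ : ℝ) (f₁ f₂ : ℝ → ℝ) : Vh 𝓜 N :=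
  c • pot μ (Dp (proj 𝓜 N f₁)) - c • proj 𝓜 N (Ik μ a b f₂)

/-- The commuting property of the left-endpoint projection, available as `f₁(b) = 0`, replaces `Dp
(proj f₁)` by `proj f₂` minus the image of the correction `X₁`. The latter contributes exactly `-X₁`
to the negative norm; the former leaves the potential of the projection error `g` of `f₂`, for which
the energy argument gives a bound by `‖g‖`. -/
theorem exists_rieszErr_negnorm (N : ℕ) {a b : ℝ} (hab : a < b) {c μ : ℝ} (hc : c ≠ 0) (hμ : 0 < μ)
    (hμ1 : μ < 1) : ∃ C > 0, ∀ (𝓜 : Mesh a b) (f₁ f₂ : ℝ → ℝ) (M : ℝ), 0 ≤ M →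
    DerivBound (N + 1) M f₁ → DerivBound (N + 1) M f₂ → (∀ x, HasDerivAt f₁ (f₂ x) x) → f₁ b = 0 →
    ‖Dm (rieszInv hab hc hμ hμ1 (rieszErr 𝓜 N c μ f₁ f₂))‖ ≤ C * (M * 𝓜.size ^ (N + 1)) := by
  obtain ⟨C1, hC1, h1⟩ := exists_norm_corr N hab
  obtain ⟨C2, hC2, h2⟩ := exists_proj_approx N
  obtain ⟨C3, hC3, h3⟩ := exists_norm_le_of_pot_eq N hμ hμ1 hab
  have hba := sub_pos.2 hab
  refine ⟨C1 + Real.sqrt (C3 * (b - a)) * C2, by positivity, fun 𝓜 f₁ f₂ M hM hf₁ hf₂ hd hb => ?_⟩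
  have hS := 𝓜.size_nonneg
  have B₁ : BM a b f₁ := BM.of_continuous hf₁.continuous
  have B₂ : BM a b f₂ := BM.of_continuous hf₂.continuous
  set g : ℝ → ℝ := fun x => f₂ x + (-1) * (proj 𝓜 N f₂).tf x with hg
  have Bg : BM a b g := B₂.add ((proj 𝓜 N f₂).BM_tf.const_mul _)
  have hDp := Dp_projEnd (𝓜 := 𝓜) (N := N) B₁ hf₁.continuous.continuousOn B₂
    (fun k x _ => hd x) hb
  rw [projEnd, map_add] at hDp
  have hg' : proj 𝓜 N (Ik μ a b g) = proj 𝓜 N (Ik μ a b f₂) - pot μ (proj 𝓜 N f₂) := by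
    have hop := isSupOp_proj_Ik (𝓜 := 𝓜) (N := N) hμ hμ1
    have := hop.add _ _ B₂ ((proj 𝓜 N f₂).BM_tf.const_mul (-1))
    rw [hop.smul _ _ (proj 𝓜 N f₂).BM_tf, ← pot_eq_proj hμ] at this
    rw [hg, this]
    module
  set X₁ := corr (𝓜 := 𝓜) N isEnd_left f₁ with hX₁
  set X₂ := Dm (rieszInv hab hc hμ hμ1 (c • proj 𝓜 N (Ik μ a b g))) with hX₂
  have e : rieszErr 𝓜 N c μ f₁ f₂ = -(c • pot μ (Dp X₁)) - c • proj 𝓜 N (Ik μ a b g) := by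
    have : Dp (proj 𝓜 N f₁) = proj 𝓜 N f₂ - Dp X₁ := by rw [← hDp]; abel
    rw [rieszErr, this, map_sub, hg']
    module
  have e2 : pot μ (Dp X₂) = proj 𝓜 N (Ik μ a b g) :=
    smul_right_injective _ hc (smul_pot_Dp_Dm_rieszInv hab hc hμ hμ1 _)
  have e3 : Dm (rieszInv hab hc hμ hμ1 (rieszErr 𝓜 N c μ f₁ f₂)) = -X₁ - X₂ := by
    rw [e, map_sub, map_sub, map_neg, map_neg, Dm_rieszInv]
  have b1 : ‖X₁‖ ≤ C1 * (M * 𝓜.size ^ (N + 1)) := h1 𝓜 _ isEnd_left f₁ M hM hf₁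
  have b2 : ‖X₂‖ ≤ Real.sqrt (C3 * (b - a)) * (C2 * (M * 𝓜.size ^ (N + 1))) := by
    refine le_of_sq_le_sq ?_ (by positivity)
    rw [mul_pow, Real.sq_sqrt (by positivity), mul_assoc]
    refine (h3 𝓜 X₂ g Bg e2).trans (mul_le_mul_of_nonneg_left ?_ hC3.le)
    have Bg2 : BM a b fun x => g x ^ 2 := by simpa [sq] using Bg.mul Bg
    rw [𝓜.integral_eq_sum fun k => Mesh.BM.intervalIntegrable_elem 𝓜 k Bg2, ← 𝓜.sum_len,
      Finset.sum_mul]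
    refine Finset.sum_le_sum fun k _ => ?_
    have hlr := (𝓜.left_lt_right k).le
    have : ∫ x in 𝓜.left k..𝓜.right k, g x ^ 2 =
        ∫ x in 𝓜.left k..𝓜.right k, (f₂ x - ((proj 𝓜 N f₂).1 k).eval x) ^ 2 :=
      𝓜.integral_congr_elem fun x hx => by
        change (f₂ x + (-1) * 𝓜.toFun (proj 𝓜 N f₂).1 x) ^ 2 = _
        rw [𝓜.toFun_eq _ hx]
        ring
    rw [this]
    have h4 := intervalIntegral.integral_mono_on (μ := volume)
      (f := fun x => (f₂ x - ((proj 𝓜 N f₂).1 k).eval x) ^ 2) (g := fun _ => (C2 * (M * 𝓜.size ^ (N + 1))) ^ 2) hlr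
      (((hf₂.continuous.sub ((proj 𝓜 N f₂).1 k).continuous).pow 2).intervalIntegrable _ _)
      (by simp) (fun x hx => by
        have h5 := (h2 𝓜 f₂ M hf₂ k x hx).trans (show _ ≤ C2 * (M * 𝓜.size ^ (N + 1)) by
          have := (sub_pos.2 (𝓜.left_lt_right k)).le
          gcongr
          exact 𝓜.len_le_size k)
        rw [← sq_abs]
        exact pow_le_pow_left₀ (abs_nonneg _) h5 2)
    rwa [intervalIntegral.integral_const, smul_eq_mul] at h4
  rw [e3]
  refine (norm_sub_le _ _).trans ?_
  rw [norm_neg]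
  linarith

end

end Vh

/-! ### The continuous fractional operators as Riesz potentials -/

/-- The constant of the Riesz potential. -/
noncomputable def rieszC (μ : ℝ) : ℝ := (2 * Real.cos (Real.pi * μ / 2))⁻¹ * (Real.Gamma μ)⁻¹

theorem rieszC_ne_zero {μ : ℝ} (hμ : 0 < μ) (hμ1 : μ < 1) : rieszC μ ≠ 0 := by
  have h1 : 0 < Real.cos (Real.pi * μ / 2) := Real.cos_pos_of_mem_Ioo
    ⟨by nlinarith [Real.pi_pos], by nlinarith [Real.pi_pos]⟩
  have h2 := Real.Gamma_pos_of_pos hμ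
  unfold rieszC
  positivity

section

variable {E : Type*} [NormedAddCommGroup E] [NormedSpace ℝ E]

theorem fracInt_eq_integral {μ x : ℝ} {f : ℝ → E}
    (hf : Integrable fun s => |x - s| ^ (μ - 1) • f s) :
    fracInt μ f x = rieszC μ • ∫ s, |x - s| ^ (μ - 1) • f s := by
  have h1 : ∫ s in Iio x, (x - s) ^ (μ - 1) • f s = ∫ s in Iio x, |x - s| ^ (μ - 1) • f s :=
    setIntegral_congr_fun measurableSet_Iio fun s hs => by
      rw [abs_of_pos (sub_pos.2 hs)]
  have h2 : ∫ s in Ioi x, (s - x) ^ (μ - 1) • f s = ∫ s in Ioi x, |x - s| ^ (μ - 1) • f s :=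
    setIntegral_congr_fun measurableSet_Ioi fun s hs => by
      rw [abs_sub_comm, abs_of_pos (sub_pos.2 hs)]
  have h3 := integral_add_compl (measurableSet_Iio (a := x)) hf
  rw [compl_Iio, integral_Ici_eq_integral_Ioi] at h3
  rw [fracInt, rlLeft, rlRight, h1, h2, ← smul_add, h3, smul_smul, rieszC]

/-- For `1 < α < 2` the Caputo derivatives are integrals of order `2 - α` of the second derivative,
both with sign `+`, and `cos(π (2 - α) / 2) = -cos(π α / 2)` matches the constants. -/
theorem rieszDeriv_eq_fracInt {α : ℝ} (h1 : 1 < α) (h2 : α < 2) (f : ℝ → E) (x : ℝ) :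
    rieszDeriv α f x = fracInt (2 - α) (iteratedDeriv 2 f) x := by
  have hc : ⌈α⌉₊ = 2 := (Nat.ceil_eq_iff two_ne_zero).2 ⟨by norm_num; linarith, by norm_num; linarith⟩
  have hcos : Real.cos (Real.pi * (2 - α) / 2) = -Real.cos (Real.pi * α / 2) := by
    rw [← Real.cos_pi_sub]
    congr 1
    ring
  rw [rieszDeriv, fracInt, caputoLeft, caputoRight, hc, hcos]
  norm_num

end

theorem integrable_riesz {μ a b : ℝ} (hμ : 0 < μ) {f : ℝ → ℝ} (hf : BM a b f)
    (h0 : ∀ x, x ∉ Ioo a b → f x = 0) {x : ℝ} (hx : x ∈ Icc a b) :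
    Integrable fun s => |x - s| ^ (μ - 1) * f s := by
  have h1 : Integrable (fun s => |x - s| ^ (μ - 1) * f s) (vol a b) := by
    obtain ⟨M, hM0, hM⟩ := hf.exists_pos
    have := (integrable_abs_rpow hμ hx).1.bdd_mul (c := M) hf.meas.aestronglyMeasurable
      (ae_vol fun s hs => hM s hs)
    simpa only [mul_comm] using this
  rw [← integrableOn_univ]
  refine IntegrableOn.of_forall_sdiff_eq_zero (s := Ioc a b) h1 MeasurableSet.univ fun s hs => ?_
  rw [h0 s fun h => hs.2 (Ioo_subset_Ioc_self h), mul_zero]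

theorem integral_riesz {μ a b : ℝ} {f : ℝ → ℝ} (h0 : ∀ x, x ∉ Ioo a b → f x = 0) (x : ℝ) :
    ∫ s, |x - s| ^ (μ - 1) * f s = Ik μ a b f x := by
  rw [Ik, vol, setIntegral_eq_integral_of_forall_compl_eq_zero fun s hs => ?_]
  rw [h0 s fun h => hs (Ioo_subset_Ioc_self h), mul_zero]

theorem fracInt_eq_Ik {μ a b : ℝ} (hμ : 0 < μ) {f : ℝ → ℝ} (hf : BM a b f)
    (h0 : ∀ x, x ∉ Ioo a b → f x = 0) {x : ℝ} (hx : x ∈ Icc a b) :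
    fracInt μ f x = rieszC μ * Ik μ a b f x := by
  rw [fracInt_eq_integral (by simpa using integrable_riesz hμ hf h0 hx), ← integral_riesz h0 x]
  rfl

theorem hasDerivAt_complex {u : ℝ → ℂ} {f g : ℝ → ℝ} {f' g' x : ℝ} (hu : ∀ y, u y = ⟨f y, g y⟩)
    (hf : HasDerivAt f f' x) (hg : HasDerivAt g g' x) : HasDerivAt u ⟨f', g'⟩ x := by
  have := hf.ofReal_comp.add (hg.ofReal_comp.mul_const Complex.I)
  rw [← Complex.mk_eq_add_mul_I] at this
  refine this.congr_of_eventuallyEq (Filter.Eventually.of_forall fun y => ?_)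
  rw [hu, Complex.mk_eq_add_mul_I]
  rfl

/-- The Riesz derivative of a complex function through its real and imaginary parts. -/
theorem rieszDeriv_complex {α a b : ℝ} (h1 : 1 < α) (h2 : α < 2) {u : ℝ → ℂ}
    {f f₁ f₂ g g₁ g₂ : ℝ → ℝ} (hu : ∀ y, u y = ⟨f y, g y⟩)
    (hf : ∀ x, HasDerivAt f (f₁ x) x) (hf₁ : ∀ x, HasDerivAt f₁ (f₂ x) x)
    (hg : ∀ x, HasDerivAt g (g₁ x) x) (hg₁ : ∀ x, HasDerivAt g₁ (g₂ x) x)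
    (hf₂ : BM a b f₂) (hg₂ : BM a b g₂) (hf0 : ∀ x, x ∉ Ioo a b → f₂ x = 0)
    (hg0 : ∀ x, x ∉ Ioo a b → g₂ x = 0) {x : ℝ} (hx : x ∈ Icc a b) :
    rieszDeriv α u x = ⟨rieszC (2 - α) * Ik (2 - α) a b f₂ x,
      rieszC (2 - α) * Ik (2 - α) a b g₂ x⟩ := by
  have hμ : 0 < 2 - α := by linarith
  have e1 : deriv u = fun y => (⟨f₁ y, g₁ y⟩ : ℂ) :=
    funext fun y => (hasDerivAt_complex hu (hf y) (hg y)).deriv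
  have e2 : iteratedDeriv 2 u = fun y => (⟨f₂ y, g₂ y⟩ : ℂ) := by
    rw [iteratedDeriv_succ, iteratedDeriv_one, e1]
    exact funext fun y => (hasDerivAt_complex (fun _ => rfl) (hf₁ y) (hg₁ y)).deriv
  have i1 := integrable_riesz hμ hf₂ hf0 hx
  have i2 := integrable_riesz hμ hg₂ hg0 hx
  have e3 : (fun s => |x - s| ^ (2 - α - 1) • (⟨f₂ s, g₂ s⟩ : ℂ)) = fun s =>
      ((|x - s| ^ (2 - α - 1) * f₂ s : ℝ) : ℂ) + ((|x - s| ^ (2 - α - 1) * g₂ s : ℝ) : ℂ) *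
        Complex.I := by
    ext s
    rw [Complex.mk_eq_add_mul_I, Complex.real_smul]
    push_cast
    ring
  have i3 : Integrable fun s => |x - s| ^ (2 - α - 1) • (⟨f₂ s, g₂ s⟩ : ℂ) := by
    rw [e3]
    exact i1.ofReal.add (i2.ofReal.mul_const _)
  rw [rieszDeriv_eq_fracInt h1 h2, e2, fracInt_eq_integral i3, e3,
    integral_add i1.ofReal (i2.ofReal.mul_const _), integral_mul_const, integral_complex_ofReal,
    integral_complex_ofReal, integral_riesz hf0, integral_riesz hg0, Complex.mk_eq_add_mul_I,
    Complex.real_smul]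
  push_cast
  ring

open scoped InnerProductSpace

/-! ### Residuals of the projected exact solution -/

namespace Vh

variable {a b : ℝ} {𝓜 : Mesh a b} {N : ℕ}

/-- Residual of the projected exact solution in one component of the scheme; `j` counts the time
derivatives. -/
noncomputable def residual (𝓜 : Mesh a b) (N : ℕ) (c μ l k w : ℝ) (D D' D'' : ℕ → ℕ → ℝ → ℝ → ℝ)
    (j : ℕ) (t : ℝ) : Vh 𝓜 N :=
  corr N isEnd_right (D 0 (j + 1) t) + k • corr N isEnd_right (D' 0 j t) +
    w • corr N isEnd_right (D'' 0 j t) + l • rieszErr 𝓜 N c μ (D' 1 j t) (D' 2 j t)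

section

variable {m : ℕ} {R T : ℝ} {D D' D'' : ℕ → ℕ → ℝ → ℝ → ℝ} {c μ : ℝ}

theorem hasDerivWithinAt_residual (hμ : 0 < μ) (hμ1 : μ < 1) (l k w : ℝ) (hm : 4 ≤ m)
    (h : SmoothFam m R T a b D) (h' : SmoothFam m R T a b D') (h'' : SmoothFam m R T a b D'')
    {t : ℝ} (ht : t ∈ Icc 0 T) :
    HasDerivWithinAt (residual 𝓜 N c μ l k w D D' D'' 0) (residual 𝓜 N c μ l k w D D' D'' 1 t)
      (Icc 0 T) t := by
  have hc := isSupOp_corr (N := N) (𝓜 := 𝓜) isEnd_right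
  have e1 := hc.hasDerivWithinAt_fam h (i := 0) (j := 1) (by omega) ht
  have e2 := hc.hasDerivWithinAt_fam h' (i := 0) (j := 0) (by omega) ht
  have e3 := hc.hasDerivWithinAt_fam h'' (i := 0) (j := 0) (by omega) ht
  have e4 := (isSupOp_proj (N := N) (𝓜 := 𝓜)).hasDerivWithinAt_fam h' (i := 1) (j := 0)
    (by omega) ht
  have e4' := hasDerivWithinAt_map ((pot μ : Vh 𝓜 N →ₗ[ℝ] Vh 𝓜 N).comp Dp) e4
  have e5 := (isSupOp_proj_Ik (N := N) (𝓜 := 𝓜) hμ hμ1).hasDerivWithinAt_fam h' (i := 2) (j := 0)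
    (by omega) ht
  exact ((e1.add (e2.const_smul k)).add (e3.const_smul w)).add
    (((e4'.const_smul c).sub (e5.const_smul c)).const_smul l)

end

/-- Needed for `j = 0` and `j = 1`, the residual and its time derivative: the shift of the unknown
in the energy argument enters with its derivative. -/
theorem exists_residual_negnorm (N : ℕ) {a b : ℝ} (hab : a < b) {c μ : ℝ} (hc : c ≠ 0) (hμ : 0 < μ)
    (hμ1 : μ < 1) (l k w : ℝ) : ∃ C > 0, ∀ (𝓜 : Mesh a b) (m : ℕ) (R T : ℝ)
    (D D' D'' : ℕ → ℕ → ℝ → ℝ → ℝ) (j : ℕ), 0 ≤ R → j + N + 4 ≤ m → SmoothFam m R T a b D →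
    SmoothFam m R T a b D' → SmoothFam m R T a b D'' → ∀ t ∈ Icc 0 T,
    ‖Dm (rieszInv hab hc hμ hμ1 (residual 𝓜 N c μ l k w D D' D'' j t))‖ ≤
      C * (R * 𝓜.size ^ (N + 1)) := by
  obtain ⟨C1, hC1, h1⟩ := exists_corr_negnorm N hab hc hμ hμ1
  obtain ⟨C2, hC2, h2⟩ := exists_rieszErr_negnorm N hab hc hμ hμ1
  refine ⟨C1 * (1 + |k| + |w|) + |l| * C2, by positivity,
    fun 𝓜 m R T D D' D'' j hR hm h h' h'' t ht => ?_⟩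
  set B := R * 𝓜.size ^ (N + 1) with hB
  have q1 := h1 𝓜 _ R hR (h.derivBound (N + 1) 0 (j + 1) (by omega) t ht)
  have q2 := h1 𝓜 _ R hR (h'.derivBound (N + 1) 0 j (by omega) t ht)
  have q3 := h1 𝓜 _ R hR (h''.derivBound (N + 1) 0 j (by omega) t ht)
  have q4 := h2 𝓜 _ _ R hR (h'.derivBound (N + 1) 1 j (by omega) t ht)
    (h'.derivBound (N + 1) 2 j (by omega) t ht) (fun x => h'.dx 1 j (by omega) t ht x)
    (h'.zero 1 j (by omega) t ht b fun hb => lt_irrefl _ hb.2)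
  rw [residual, map_add, map_add, map_add, map_add, map_add, map_add, map_smul, map_smul, map_smul,
    map_smul, map_smul, map_smul]
  have tri : ∀ p q r s : Vh 𝓜 N, ‖p + k • q + w • r + l • s‖ ≤
      ‖p‖ + |k| * ‖q‖ + |w| * ‖r‖ + |l| * ‖s‖ := fun p q r s => by
    refine (norm_add_le _ _).trans (add_le_add ((norm_add₃_le).trans ?_) ?_) <;>
    simp only [norm_smul, Real.norm_eq_abs, le_refl]
  refine (tri _ _ _ _).trans ?_
  have q2' := mul_le_mul_of_nonneg_left q2 (abs_nonneg k)
  have q3' := mul_le_mul_of_nonneg_left q3 (abs_nonneg w)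
  have q4' := mul_le_mul_of_nonneg_left q4 (abs_nonneg l)
  linarith

/-- Without dispersion the residual contains projection corrections only, and these are small in
`L²` directly. -/
theorem exists_norm_residual (N : ℕ) {a b : ℝ} (hab : a < b) (c μ : ℝ) (k w : ℝ) :
    ∃ C > 0, ∀ (𝓜 : Mesh a b) (m : ℕ) (R T : ℝ) (D D' D'' : ℕ → ℕ → ℝ → ℝ → ℝ), 0 ≤ R →
    N + 2 ≤ m → SmoothFam m R T a b D → SmoothFam m R T a b D' → SmoothFam m R T a b D'' →
    ∀ t ∈ Icc 0 T, ‖residual 𝓜 N c μ 0 k w D D' D'' 0 t‖ ≤ C * (R * 𝓜.size ^ (N + 1)) := by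
  obtain ⟨C1, hC1, h1⟩ := exists_norm_corr N hab
  refine ⟨C1 * (1 + |k| + |w|), by positivity, fun 𝓜 m R T D D' D'' hR hm h h' h'' t ht => ?_⟩
  have q1 := h1 𝓜 _ isEnd_right _ R hR (h.derivBound (N + 1) 0 1 (by omega) t ht)
  have q2 := h1 𝓜 _ isEnd_right _ R hR (h'.derivBound (N + 1) 0 0 (by omega) t ht)
  have q3 := h1 𝓜 _ isEnd_right _ R hR (h''.derivBound (N + 1) 0 0 (by omega) t ht)
  rw [residual, zero_smul, add_zero]
  refine norm_add₃_le.trans ?_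
  simp only [norm_smul, Real.norm_eq_abs]
  have q2' := mul_le_mul_of_nonneg_left q2 (abs_nonneg k)
  have q3' := mul_le_mul_of_nonneg_left q3 (abs_nonneg w)
  linarith

/-- The error equation for one component. -/
theorem hasDerivWithinAt_error {m : ℕ} {R T : ℝ} {D D' D'' : ℕ → ℕ → ℝ → ℝ → ℝ} {c μ : ℝ}
    (hμ : 0 < μ) (l k w : ℝ) (hm : 4 ≤ m)
    (h : SmoothFam m R T a b D) (h' : SmoothFam m R T a b D') (h'' : SmoothFam m R T a b D'')
    {t : ℝ} (ht : t ∈ Icc 0 T) {p q θ : ℝ → Vh 𝓜 N} {P : Vh 𝓜 N}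
    (hp : HasDerivWithinAt p P (Icc 0 T) t)
    (heq : P + l • rieszOp c μ (q t) + k • q t + w • θ t = proj 𝓜 N fun x =>
      D 0 1 t x + (l * (c * Ik μ a b (D' 2 0 t) x) + (k * D' 0 0 t x + w * D'' 0 0 t x))) :
    HasDerivWithinAt (fun s => projEnd N isEnd_right (D 0 0 s) - p s)
      (-(l • rieszOp c μ (projEnd N isEnd_right (D' 0 0 t) - q t)) -
        k • (projEnd N isEnd_right (D' 0 0 t) - q t) -
        w • (projEnd N isEnd_right (D'' 0 0 t) - θ t) +
        residual 𝓜 N c μ l k w D D' D'' 0 t) (Icc 0 T) t := by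
  have hop := isSupOp_proj (N := N) (𝓜 := 𝓜)
  have d1 := hop.hasDerivWithinAt_fam h (i := 0) (j := 0) (by omega) ht
  have d2 := (isSupOp_corr (N := N) (𝓜 := 𝓜) isEnd_right).hasDerivWithinAt_fam h (i := 0) (j := 0)
    (by omega) ht
  have B1 := h.BM (i := 0) (j := 1) (by omega) ht
  have B2 := (h'.BM (i := 2) (j := 0) (by omega) ht).Ik hμ
  have B3 := h'.BM (i := 0) (j := 0) (by omega) ht
  have B4 := h''.BM (i := 0) (j := 0) (by omega) ht
  rw [hop.add _ _ B1 (((B2.const_mul c).const_mul l).add ((B3.const_mul k).add (B4.const_mul w))),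
    hop.add _ _ ((B2.const_mul c).const_mul l) ((B3.const_mul k).add (B4.const_mul w)),
    hop.add _ _ (B3.const_mul k) (B4.const_mul w), hop.smul _ _ (B2.const_mul c),
    hop.smul _ _ B2, hop.smul _ _ B3, hop.smul _ _ B4] at heq
  -- The right-endpoint projection is the one that commutes with the inner derivative, so the first
  -- derivative of the chain causes no further error.
  have hDm : Dm (projEnd (𝓜 := 𝓜) N isEnd_right (D' 0 0 t)) = proj 𝓜 N (D' 1 0 t) :=
    Dm_projEnd B3 (h'.continuous (by omega) ht).continuousOn (h'.BM (by omega) ht)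
      (fun k x _ => h'.dx 0 0 (by omega) t ht x)
      (h'.zero 0 0 (by omega) t ht a fun ha => lt_irrefl _ ha.1)
  refine ((d1.add d2).sub hp).congr_deriv ?_
  have hP : P = _ := eq_sub_of_add_eq (eq_sub_of_add_eq (eq_sub_of_add_eq heq))
  have hA : rieszOp c μ (projEnd (𝓜 := 𝓜) N isEnd_right (D' 0 0 t)) =
      c • pot μ (Dp (proj 𝓜 N (D' 1 0 t))) := by rw [rieszOp_apply, hDm]
  rw [hP, map_sub, hA, residual, rieszErr, projEnd, projEnd]
  module

end Vh

open scoped InnerProductSpace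

/-! ### The scheme as an equation in the finite element space -/

namespace Vh

variable {a b : ℝ} {𝓜 : Mesh a b} {N : ℕ}

/-- Evaluation of one piece at a point. -/
noncomputable def evalAt (k : Fin 𝓜.K) (x : ℝ) : Vh 𝓜 N →ₗ[ℝ] ℝ where
  toFun w := (w.1 k).eval x
  map_add' _ _ := Polynomial.eval_add
  map_smul' _ _ := Polynomial.eval_smul _ _ _

/-- A piecewise polynomial as an element of the finite element space. -/
noncomputable def ofPiecewise (N : ℕ) (w : 𝓜.Piecewise) : Vh 𝓜 N :=
  open Classical in if h : w ∈ 𝓜.space N then ⟨w, h⟩ else 0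

theorem ofPiecewise_val {w : 𝓜.Piecewise} (h : w ∈ 𝓜.space N) : (ofPiecewise N w).1 = w := by
  rw [ofPiecewise, dif_pos h]

/-- A polynomial of degree at most `N` is determined by its values at `0, …, N`, whether or not
these lie in the element. This turns differentiability in time of point values into
differentiability in the finite element space. -/
theorem exists_nodal_leftInverse (𝓜 : Mesh a b) (N : ℕ) :
    ∃ Ψ : (Fin 𝓜.K → Fin (N + 1) → ℝ) →ₗ[ℝ] Vh 𝓜 N,
      ∀ w : Vh 𝓜 N, Ψ (fun k j => (w.1 k).eval (j : ℝ)) = w := by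
  set Φ : Vh 𝓜 N →ₗ[ℝ] (Fin 𝓜.K → Fin (N + 1) → ℝ) :=
    LinearMap.pi fun k => LinearMap.pi fun j => evalAt k (j : ℝ) with hΦ
  have hi : LinearMap.ker Φ = ⊥ := by
    refine LinearMap.ker_eq_bot'.2 fun w hw => Subtype.ext (funext fun k => ?_)
    refine Polynomial.eq_zero_of_natDegree_lt_card_of_eval_eq_zero (w.1 k)
      (f := fun j : Fin (N + 1) => (j : ℝ)) (fun i j hij => Fin.ext (Nat.cast_injective (R := ℝ) hij))
      (fun j => congrFun (congrFun hw k) j) ?_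
    rw [Fintype.card_fin]
    exact Nat.lt_succ_of_le (w.2 k)
  obtain ⟨Ψ, hΨ⟩ := LinearMap.exists_leftInverse_of_injective Φ hi
  exact ⟨Ψ, fun w => LinearMap.congr_fun hΨ w⟩

theorem exists_timeDeriv {T : ℝ} (hT : 0 < T) {w : ℝ → 𝓜.Piecewise}
    (hw : ∀ t ∈ Icc 0 T, w t ∈ 𝓜.space N) (hd : TimeDiff T w) {t : ℝ} (ht : t ∈ Icc 0 T) :
    ∃ P : Vh 𝓜 N, HasDerivWithinAt (fun s => ofPiecewise N (w s)) P (Icc 0 T) t ∧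
      ∀ k x, (P.1 k).eval x = timeDeriv T w t k x := by
  obtain ⟨Ψ, hΨ⟩ := exists_nodal_leftInverse 𝓜 N
  have hdiff : DifferentiableWithinAt ℝ (fun s => ofPiecewise N (w s)) (Icc 0 T) t := by
    have h1 : DifferentiableWithinAt ℝ (fun s => fun (k : Fin 𝓜.K) (j : Fin (N + 1)) =>
        (w s k).eval (j : ℝ)) (Icc 0 T) t :=
      differentiableWithinAt_pi.2 fun k => differentiableWithinAt_pi.2 fun j => hd k _ t ht
    have h2 := (LinearMap.toContinuousLinearMap Ψ).differentiableAt.comp_differentiableWithinAt t h1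
    have h3 : ∀ s ∈ Icc 0 T, ofPiecewise N (w s) =
        Ψ fun (k : Fin 𝓜.K) (j : Fin (N + 1)) => (w s k).eval (j : ℝ) := fun s hs => by
      have := hΨ (ofPiecewise N (w s))
      rw [ofPiecewise_val (hw s hs)] at this
      exact this.symm
    exact h2.congr h3 (h3 t ht)
  refine ⟨_, hdiff.hasDerivWithinAt, fun k x => ?_⟩
  have h1 := (LinearMap.toContinuousLinearMap (evalAt (N := N) k x)).hasFDerivAt.comp_hasDerivWithinAt
    t hdiff.hasDerivWithinAt
  have h2 : HasDerivWithinAt (fun s => (w s k).eval x) _ (Icc 0 T) t := h1.congr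
    (fun s hs => by
      change _ = ((ofPiecewise N (w s)).1 k).eval x
      rw [ofPiecewise_val (hw s hs)]) (by
      change _ = ((ofPiecewise N (w t)).1 k).eval x
      rw [ofPiecewise_val (hw t ht)])
  exact (h2.derivWithin (uniqueDiffOn_Icc hT t ht)).symm

/-- The three equations of a chain determine the auxiliary variables one after the other, so these
can be eliminated in favour of a single operator. -/
theorem ofPiecewise_chain {α : ℝ} (h2 : α < 2) {q s r e : 𝓜.Piecewise}
    (h : 𝓜.FracChain N α q s r e) (hq : q ∈ 𝓜.space N) (hs : s ∈ 𝓜.space N) (hr : r ∈ 𝓜.space N)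
    (he : e ∈ 𝓜.space N) :
    ofPiecewise N e = rieszOp (rieszC (2 - α)) (2 - α) (ofPiecewise N q) := by
  have hμ : 0 < 2 - α := by linarith
  have es : ofPiecewise N s = Dm (ofPiecewise N q) := eq_discDeriv fun k φ hφ => by
    rw [ofPiecewise_val hs, ofPiecewise_val hq]
    exact h.eq_s k φ hφ
  have er : ofPiecewise N r = Dp (ofPiecewise N s) := eq_discDeriv fun k φ hφ => by
    rw [ofPiecewise_val hs, ofPiecewise_val hr]
    exact h.eq_r k φ hφ
  set r' := ofPiecewise N r with hr'
  have hI := r'.BM_tf.Ik hμ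
  rw [rieszOp_apply, ← es, ← er, pot_eq_proj hμ, ← proj_smul _ hI]
  refine proj_unique (hI.const_mul _) fun k φ hφ => ?_
  rw [ofPiecewise_val he, h.eq_e k φ hφ]
  refine 𝓜.integral_congr_elem fun x hx => ?_
  have e1 : r'.tf = 𝓜.toFun r := by rw [tf, hr', ofPiecewise_val hr]
  rw [e1, fracInt_eq_Ik hμ (𝓜.BM_toFun r) (fun y hy => 𝓜.toFun_eq_zero r hy)
    (𝓜.Icc_subset k (Ioo_subset_Icc_self hx))]

theorem inn_comb (P e q θ : Vh 𝓜 N) (l κ w : ℝ) (k : Fin 𝓜.K) (φ : ℝ[X]) :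
    𝓜.inn k (fun x => ((P + l • e + κ • q + w • θ).1 k).eval x) (fun x => φ.eval x) =
      𝓜.inn k (fun x => (P.1 k).eval x) (fun x => φ.eval x) +
      l * 𝓜.inn k (fun x => (e.1 k).eval x) (fun x => φ.eval x) +
      κ * 𝓜.inn k (fun x => (q.1 k).eval x) (fun x => φ.eval x) +
      w * 𝓜.inn k (fun x => (θ.1 k).eval x) (fun x => φ.eval x) := by
  change 𝓜.inn k (fun x => (P.1 k + l • e.1 k + κ • q.1 k + w • θ.1 k).eval x) _ = _
  rw [𝓜.inn_add_poly, 𝓜.inn_add_poly, 𝓜.inn_add_poly, 𝓜.inn_smul_poly, 𝓜.inn_smul_poly,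
    𝓜.inn_smul_poly]

/-- One component of the scheme as an equation in the finite element space. -/
theorem exists_component {α T : ℝ} (h2 : α < 2) (hT : 0 < T) {p : ℝ → 𝓜.Piecewise}
    (hp : ∀ t ∈ Icc 0 T, p t ∈ 𝓜.space N) (hd : TimeDiff T p) {t : ℝ} (ht : t ∈ Icc 0 T)
    {q s r e θ : 𝓜.Piecewise} (hc : 𝓜.FracChain N α q s r e) (hq : q ∈ 𝓜.space N)
    (hs : s ∈ 𝓜.space N) (hr : r ∈ 𝓜.space N) (he : e ∈ 𝓜.space N) (hθ : θ ∈ 𝓜.space N)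
    (l κ w : ℝ) {g : ℝ → ℝ} (hg : BM a b g)
    (heq : ∀ k, ∀ φ : ℝ[X], φ.natDegree ≤ N →
      𝓜.inn k (timeDeriv T p t k) (fun x => φ.eval x) +
      l * 𝓜.inn k (fun x => (e k).eval x) (fun x => φ.eval x) +
      κ * 𝓜.inn k (fun x => (q k).eval x) (fun x => φ.eval x) +
      w * 𝓜.inn k (fun x => (θ k).eval x) (fun x => φ.eval x) = 𝓜.inn k g (fun x => φ.eval x)) :
    ∃ P : Vh 𝓜 N, HasDerivWithinAt (fun s => ofPiecewise N (p s)) P (Icc 0 T) t ∧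
      P + l • rieszOp (rieszC (2 - α)) (2 - α) (ofPiecewise N q) + κ • ofPiecewise N q +
        w • ofPiecewise N θ = proj 𝓜 N g := by
  obtain ⟨P, hP, hPe⟩ := exists_timeDeriv hT hp hd ht
  refine ⟨P, hP, ?_⟩
  rw [← ofPiecewise_chain h2 hc hq hs hr he]
  refine proj_unique hg fun k φ hφ => ?_
  rw [inn_comb, ofPiecewise_val he, ofPiecewise_val hq, ofPiecewise_val hθ, ← heq k φ hφ]
  simp only [hPe]

/-- The error is the approximation error of the endpoint projection, small pointwise, plus the
discrete error that the stability argument controls. -/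
theorem exists_l2_error (N : ℕ) {a b : ℝ} (hab : a < b) : ∃ C > 0, ∀ (𝓜 : Mesh a b) (f : ℝ → ℝ)
    (R : ℝ) (p : Vh 𝓜 N), 0 ≤ R → DerivBound (N + 1) R f →
    ∑ k, ∫ x in 𝓜.left k..𝓜.right k, (f x - (p.1 k).eval x) ^ 2 ≤
      C * (R * 𝓜.size ^ (N + 1)) ^ 2 + 2 * ‖projEnd N isEnd_right f - p‖ ^ 2 := by
  obtain ⟨C1, hC1, h1⟩ := exists_proj_approx N
  obtain ⟨C2, hC2, h2⟩ := exists_corr_approx N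
  have hba := sub_pos.2 hab
  refine ⟨2 * ((b - a) * (C1 + C2) ^ 2), by positivity, fun 𝓜 f R p hR hf => ?_⟩
  set e := projEnd N isEnd_right f - p with he
  set B := R * 𝓜.size ^ (N + 1) with hB
  have hpt : ∀ k, ∀ x ∈ Icc (𝓜.left k) (𝓜.right k), (f x - (p.1 k).eval x) ^ 2 ≤
      2 * ((C1 + C2) * B) ^ 2 + 2 * (e.1 k).eval x ^ 2 := by
    intro k x hx
    have hd := (sub_pos.2 (𝓜.left_lt_right k)).le
    have hB' : R * (𝓜.right k - 𝓜.left k) ^ (N + 1) ≤ B := by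
      rw [hB]
      gcongr
      exact 𝓜.len_le_size k
    have q1 := (h1 𝓜 f R hf k x hx).trans (mul_le_mul_of_nonneg_left hB' hC1.le)
    have q2 := (h2 𝓜 _ isEnd_right f R hf k x hx).trans (mul_le_mul_of_nonneg_left hB' hC2.le)
    have e1 : e.1 k = (proj 𝓜 N f).1 k + (corr (𝓜 := 𝓜) N isEnd_right f).1 k - p.1 k := rfl
    rw [e1, Polynomial.eval_sub, Polynomial.eval_add]
    set A := f x - ((proj 𝓜 N f).1 k).eval x
    set K := ((corr (𝓜 := 𝓜) N isEnd_right f).1 k).eval x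
    have q3 : (A - K) ^ 2 ≤ ((C1 + C2) * B) ^ 2 := by
      rw [← sq_abs]
      refine pow_le_pow_left₀ (abs_nonneg _) ((abs_sub A K).trans ?_) 2
      linarith
    have : f x - (p.1 k).eval x = (A - K) + (((proj 𝓜 N f).1 k).eval x + K - (p.1 k).eval x) := by
      simp only [A]; ring
    rw [this]
    nlinarith [sq_nonneg ((A - K) - (((proj 𝓜 N f).1 k).eval x + K - (p.1 k).eval x))]
  have hsum : ∑ k, ∫ x in 𝓜.left k..𝓜.right k, (f x - (p.1 k).eval x) ^ 2 ≤
      ∑ k, ((𝓜.right k - 𝓜.left k) * (2 * ((C1 + C2) * B) ^ 2) +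
        2 * ∫ x in 𝓜.left k..𝓜.right k, (e.1 k).eval x ^ 2) := by
    refine Finset.sum_le_sum fun k _ => ?_
    have hi : IntervalIntegrable (fun x => 2 * (e.1 k).eval x ^ 2) volume (𝓜.left k) (𝓜.right k) :=
      (((e.1 k).continuous.pow 2).const_mul 2).intervalIntegrable _ _
    have := intervalIntegral.integral_mono_on (μ := volume)
      (f := fun x => (f x - (p.1 k).eval x) ^ 2)
      (g := fun x => 2 * ((C1 + C2) * B) ^ 2 + 2 * (e.1 k).eval x ^ 2) (𝓜.left_lt_right k).le
      (((hf.continuous.sub (p.1 k).continuous).pow 2).intervalIntegrable _ _)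
      ((by simp : IntervalIntegrable (fun _ => 2 * ((C1 + C2) * B) ^ 2) volume _ _).add hi) (hpt k)
    rwa [intervalIntegral.integral_add (by simp) hi, intervalIntegral.integral_const, smul_eq_mul,
      intervalIntegral.integral_const_mul] at this
  refine hsum.trans (le_of_eq ?_)
  rw [Finset.sum_add_distrib, ← Finset.sum_mul, 𝓜.sum_len, ← Finset.mul_sum, norm_sq_eq_sum]
  ring

end Vh

open scoped InnerProductSpace

/-! ### Real and imaginary parts of the exact solution -/

theorem SmoothBound.exists_fam {m : ℕ} {R T a b : ℝ} (hT : 0 < T) {u : ℝ → ℝ → ℂ}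
    (hu : SmoothBound m R T u) (h0 : ∀ t ∈ Icc 0 T, ∀ x, x ∉ Ioo a b → u x t = 0) :
    ∃ U V, SmoothFam m R T a b U ∧ SmoothFam m R T a b V ∧
      ∀ t x, u x t = ⟨U 0 0 t x, V 0 0 t x⟩ := by
  have key : ∀ L : ℂ →L[ℝ] ℝ, ‖L‖ ≤ 1 → BddSmooth m R T (L ∘ Function.uncurry u) := fun L hL =>
    ⟨L.contDiff.comp_contDiffOn hu.1, fun j hj z hz =>
      (BddSmooth.norm_comp_le hL hT hu.1 hj hz).trans (hu.2 j hj z hz)⟩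
  obtain ⟨U, hU, hU0⟩ := exists_smoothFam hT (key Complex.reCLM Complex.reCLM_norm.le)
    (a := a) (b := b) fun t ht x hx => by
      change (u x t).re = 0
      rw [h0 t ht x hx, Complex.zero_re]
  obtain ⟨V, hV, hV0⟩ := exists_smoothFam hT (key Complex.imCLM Complex.imCLM_norm.le)
    (a := a) (b := b) fun t ht x hx => by
      change (u x t).im = 0
      rw [h0 t ht x hx, Complex.zero_im]
  exact ⟨U, V, hU, hV, fun t x => Complex.ext (hU0 t x).symm (hV0 t x).symm⟩

theorem source_eq {m : ℕ} {R T a b α : ℝ} (hm : 4 ≤ m) (hα : 1 < α) (hα2 : α < 2) (hT : 0 < T)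
    {u : ℝ → ℝ → ℂ} {U V : ℕ → ℕ → ℝ → ℝ → ℝ} (hU : SmoothFam m R T a b U)
    (hV : SmoothFam m R T a b V) (hu : ∀ t x, u x t = ⟨U 0 0 t x, V 0 0 t x⟩) {t x : ℝ}
    (ht : t ∈ Icc 0 T) (hx : x ∈ Ioo a b) :
    derivWithin (fun σ => u x σ) (Icc 0 T) t = ⟨U 0 1 t x, V 0 1 t x⟩ ∧
    rieszDeriv α (fun y => u y t) x = ⟨rieszC (2 - α) * Ik (2 - α) a b (U 2 0 t) x,
      rieszC (2 - α) * Ik (2 - α) a b (V 2 0 t) x⟩ := by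
  constructor
  · have h1 := ((hU.dt 0 0 (by omega) t ht x).ofReal_comp).add
      (((hV.dt 0 0 (by omega) t ht x).ofReal_comp).mul_const Complex.I)
    rw [← Complex.mk_eq_add_mul_I] at h1
    refine HasDerivWithinAt.derivWithin (h1.congr_of_eventuallyEq
      (Filter.Eventually.of_forall fun s => ?_) ?_) (uniqueDiffOn_Icc hT t ht)
    · change u x s = _
      rw [hu, Complex.mk_eq_add_mul_I]
      rfl
    · rw [hu, Complex.mk_eq_add_mul_I]
      rfl
  · exact rieszDeriv_complex hα hα2 (fun y => hu t y) (hU.dx 0 0 (by omega) t ht)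
      (hU.dx 1 0 (by omega) t ht) (hV.dx 0 0 (by omega) t ht) (hV.dx 1 0 (by omega) t ht)
      (hU.BM (by omega) ht) (hV.BM (by omega) ht) (hU.zero 2 0 (by omega) t ht)
      (hV.zero 2 0 (by omega) t ht) (Ioo_subset_Icc_self hx)

theorem Mesh.inn_neg {a b : ℝ} (𝓜 : Mesh a b) (k : Fin 𝓜.K) (f g : ℝ → ℝ) :
    -𝓜.inn k f g = 𝓜.inn k (fun x => -f x) g := by
  simp only [Mesh.inn, neg_mul, intervalIntegral.integral_neg]

theorem Mesh.inn_congr {a b : ℝ} (𝓜 : Mesh a b) (k : Fin 𝓜.K) {f f' : ℝ → ℝ} (g : ℝ → ℝ)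
    (h : ∀ x ∈ Ioo a b, f x = f' x) : 𝓜.inn k f g = 𝓜.inn k f' g :=
  𝓜.integral_congr_elem fun x hx => by
    rw [h x (Ioo_subset_Ioo (𝓜.left_mem k).1 (𝓜.right_mem k).2 hx)]

theorem Mesh.l2Norm_sq_eq {a b : ℝ} (𝓜 : Mesh a b) {f g : ℝ → ℝ} {p q : 𝓜.Piecewise} {u : ℝ → ℂ}
    (hf : Continuous f) (hg : Continuous g) (hu : ∀ x, u x = ⟨f x, g x⟩) :
    𝓜.l2Norm (fun k x => u x - (⟨(p k).eval x, (q k).eval x⟩ : ℂ)) =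
      Real.sqrt ((∑ k, ∫ x in 𝓜.left k..𝓜.right k, (f x - (p k).eval x) ^ 2) +
        ∑ k, ∫ x in 𝓜.left k..𝓜.right k, (g x - (q k).eval x) ^ 2) := by
  rw [Mesh.l2Norm, ← Finset.sum_add_distrib]
  congr 1
  refine Finset.sum_congr rfl fun k _ => ?_
  have h1 : IntervalIntegrable (fun x => (f x - (p k).eval x) ^ 2) volume (𝓜.left k) (𝓜.right k) :=
    ((hf.sub (p k).continuous).pow 2).intervalIntegrable _ _
  have h2 : IntervalIntegrable (fun x => (g x - (q k).eval x) ^ 2) volume (𝓜.left k) (𝓜.right k) :=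
    ((hg.sub (q k).continuous).pow 2).intervalIntegrable _ _
  rw [← intervalIntegral.integral_add h1 h2]
  refine intervalIntegral.integral_congr fun x _ => ?_
  rw [hu, ← Complex.normSq_eq_norm_sq, Complex.normSq_apply]
  simp only [Complex.sub_re, Complex.sub_im, sq]

/-! ### Assembling the error system -/

namespace Vh

variable {a b : ℝ} {𝓜 : Mesh a b} {N : ℕ}

theorem BM_source {m : ℕ} {R T : ℝ} {D D' D'' : ℕ → ℕ → ℝ → ℝ → ℝ} {μ : ℝ} (hμ : 0 < μ)
    (c l k w : ℝ) (hm : 4 ≤ m) (h : SmoothFam m R T a b D) (h' : SmoothFam m R T a b D')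
    (h'' : SmoothFam m R T a b D'') {t : ℝ} (ht : t ∈ Icc 0 T) : BM a b fun x =>
      D 0 1 t x + (l * (c * Ik μ a b (D' 2 0 t) x) + (k * D' 0 0 t x + w * D'' 0 0 t x)) :=
  (h.BM (by omega) ht).add (((((h'.BM (by omega) ht).Ik hμ).const_mul c).const_mul l).add
    (((h'.BM (by omega) ht).const_mul k).add ((h''.BM (by omega) ht).const_mul w)))

variable {α T R : ℝ} {c : Coeffs} {G₁ G₂ u v : ℝ → ℝ → ℂ} {F : Fields 𝓜} {m : ℕ}
  {U V U₂ V₂ : ℕ → ℕ → ℝ → ℝ → ℝ}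

/-- The errors of the four components. -/
noncomputable def errors (N : ℕ) (F : Fields 𝓜) (U V U₂ V₂ : ℕ → ℕ → ℝ → ℝ → ℝ) :
    Fin 4 → ℝ → Vh 𝓜 N :=
  ![fun t => projEnd N isEnd_right (U 0 0 t) - ofPiecewise N (F.p t),
    fun t => projEnd N isEnd_right (V 0 0 t) - ofPiecewise N (F.q t),
    fun t => projEnd N isEnd_right (U₂ 0 0 t) - ofPiecewise N (F.υ t),
    fun t => projEnd N isEnd_right (V₂ 0 0 t) - ofPiecewise N (F.θ t)]

/-- The residuals of the four components; `j` counts the time derivatives. -/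
noncomputable def residuals (𝓜 : Mesh a b) (N : ℕ) (c : Coeffs) (μ : ℝ)
    (U V U₂ V₂ : ℕ → ℕ → ℝ → ℝ → ℝ) (j : ℕ) : Fin 4 → ℝ → Vh 𝓜 N :=
  ![residual 𝓜 N (rieszC μ) μ c.l1 (c.w1 + c.l2) c.w2 U V V₂ j,
    residual 𝓜 N (rieszC μ) μ (-c.l1) (-(c.w1 + c.l2)) (-c.w2) V U U₂ j,
    residual 𝓜 N (rieszC μ) μ c.l3 (c.w1 + c.l4) c.w2 U₂ V₂ V j,
    residual 𝓜 N (rieszC μ) μ (-c.l3) (-(c.w1 + c.l4)) (-c.w2) V₂ U₂ U j]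

theorem isSystem_errors (hα : 1 < α) (hα2 : α < 2) (hT : 0 < T) (hm : 4 ≤ m)
    (hU : SmoothFam m R T a b U) (hV : SmoothFam m R T a b V) (hU₂ : SmoothFam m R T a b U₂)
    (hV₂ : SmoothFam m R T a b V₂) (hu : ∀ t x, u x t = ⟨U 0 0 t x, V 0 0 t x⟩)
    (hv : ∀ t x, v x t = ⟨U₂ 0 0 t x, V₂ 0 0 t x⟩)
    (hex : IsExactSolution a b α c T G₁ G₂ u v) (hF : IsLDGSolution 𝓜 N α c T G₁ G₂ F) :
    IsSystem (rieszOp (rieszC (2 - α)) (2 - α)) c.l1 c.l3 (c.w1 + c.l2) (c.w1 + c.l4) c.w2 T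
      (errors N F U V U₂ V₂) (residuals 𝓜 N c (2 - α) U V U₂ V₂ 0) := by
  have hμ : 0 < 2 - α := by linarith
  -- The exact equation expresses the sources through the solution on `(a, b)`. Arbitrary sources
  -- thus enter the discrete equations only through bounded measurable data.
  have hG₁ : ∀ t ∈ Icc 0 T, ∀ x ∈ Ioo a b,
      (G₁ x t).im = U 0 1 t x + (c.l1 * (rieszC (2 - α) * Ik (2 - α) a b (V 2 0 t) x) +
        ((c.w1 + c.l2) * V 0 0 t x + c.w2 * V₂ 0 0 t x)) ∧
      -(G₁ x t).re = V 0 1 t x + (-c.l1 * (rieszC (2 - α) * Ik (2 - α) a b (U 2 0 t) x) +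
        (-(c.w1 + c.l2) * U 0 0 t x + -c.w2 * U₂ 0 0 t x)) := by
    intro t ht x hx
    obtain ⟨s1, s2⟩ := source_eq hm hα hα2 hT hU hV hu ht hx
    rw [← hex.eq_u t ht x hx, s1, s2, hu, hv]
    constructor <;> simp <;> ring
  have hG₂ : ∀ t ∈ Icc 0 T, ∀ x ∈ Ioo a b,
      (G₂ x t).im = U₂ 0 1 t x + (c.l3 * (rieszC (2 - α) * Ik (2 - α) a b (V₂ 2 0 t) x) +
        ((c.w1 + c.l4) * V₂ 0 0 t x + c.w2 * V 0 0 t x)) ∧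
      -(G₂ x t).re = V₂ 0 1 t x + (-c.l3 * (rieszC (2 - α) * Ik (2 - α) a b (U₂ 2 0 t) x) +
        (-(c.w1 + c.l4) * U₂ 0 0 t x + -c.w2 * U 0 0 t x)) := by
    intro t ht x hx
    obtain ⟨s1, s2⟩ := source_eq hm hα hα2 hT hU₂ hV₂ hv ht hx
    rw [← hex.eq_v t ht x hx, s1, s2, hu, hv]
    constructor <;> simp <;> ring
  have M1 : ∀ t ∈ Icc 0 T, F.p t ∈ 𝓜.space N := fun t ht => (hF.mem t ht).1
  have M2 : ∀ t ∈ Icc 0 T, F.q t ∈ 𝓜.space N := fun t ht => (hF.mem t ht).2.1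
  have M3 : ∀ t ∈ Icc 0 T, F.υ t ∈ 𝓜.space N := fun t ht => (hF.mem t ht).2.2.2.2.2.2.2.2.1
  have M4 : ∀ t ∈ Icc 0 T, F.θ t ∈ 𝓜.space N := fun t ht => (hF.mem t ht).2.2.2.2.2.2.2.2.2.1
  refine ⟨fun t ht => ?_, fun t ht => ?_, fun t ht => ?_, fun t ht => ?_⟩ <;>
    obtain ⟨-, -, ms, mr, mT, mz, mw, mH, -, -, mϖ, mρ, mL, mϱ, mξ, mE⟩ := hF.mem t ht
  · obtain ⟨P, hP, hPe⟩ := exists_component hα2 hT M1 hF.diff.1 ht (hF.chain_q t ht) (M2 t ht)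
      ms mr mT (M4 t ht) c.l1 (c.w1 + c.l2) c.w2
      (BM_source hμ (rieszC (2 - α)) c.l1 (c.w1 + c.l2) c.w2 hm hU hV hV₂ ht) (fun k φ hφ => by
        rw [← 𝓜.inn_congr k _ fun x hx => (hG₁ t ht x hx).1, ← hF.eq_p t ht k φ hφ]
        ring)
    exact hasDerivWithinAt_error hμ c.l1 (c.w1 + c.l2) c.w2 hm hU hV hV₂ ht
      (q := fun s => ofPiecewise N (F.q s)) (θ := fun s => ofPiecewise N (F.θ s)) hP hPe
  -- The equations for `q` and `θ` have the shape of those for `p` and `υ` with all coefficients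
  -- negated.
  · obtain ⟨P, hP, hPe⟩ := exists_component hα2 hT M2 hF.diff.2.1 ht (hF.chain_p t ht) (M1 t ht)
      mz mw mH (M3 t ht) (-c.l1) (-(c.w1 + c.l2)) (-c.w2)
      (BM_source hμ (rieszC (2 - α)) (-c.l1) (-(c.w1 + c.l2)) (-c.w2) hm hV hU hU₂ ht)
      (fun k φ hφ => by
        rw [← 𝓜.inn_congr k _ fun x hx => (hG₁ t ht x hx).2, ← 𝓜.inn_neg,
          ← hF.eq_q t ht k φ hφ]
        ring)
    have := hasDerivWithinAt_error hμ (-c.l1) (-(c.w1 + c.l2)) (-c.w2) hm hV hU hU₂ ht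
      (q := fun s => ofPiecewise N (F.p s)) (θ := fun s => ofPiecewise N (F.υ s)) hP hPe
    simp only [neg_smul, neg_neg, sub_neg_eq_add] at this
    exact this
  · obtain ⟨P, hP, hPe⟩ := exists_component hα2 hT M3 hF.diff.2.2.1 ht (hF.chain_θ t ht) (M4 t ht)
      mϖ mρ mL (M2 t ht) c.l3 (c.w1 + c.l4) c.w2
      (BM_source hμ (rieszC (2 - α)) c.l3 (c.w1 + c.l4) c.w2 hm hU₂ hV₂ hV ht) (fun k φ hφ => by
        rw [← 𝓜.inn_congr k _ fun x hx => (hG₂ t ht x hx).1, ← hF.eq_υ t ht k φ hφ]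
        ring)
    exact hasDerivWithinAt_error hμ c.l3 (c.w1 + c.l4) c.w2 hm hU₂ hV₂ hV ht
      (q := fun s => ofPiecewise N (F.θ s)) (θ := fun s => ofPiecewise N (F.q s)) hP hPe
  · obtain ⟨P, hP, hPe⟩ := exists_component hα2 hT M4 hF.diff.2.2.2 ht (hF.chain_υ t ht) (M3 t ht)
      mϱ mξ mE (M1 t ht) (-c.l3) (-(c.w1 + c.l4)) (-c.w2)
      (BM_source hμ (rieszC (2 - α)) (-c.l3) (-(c.w1 + c.l4)) (-c.w2) hm hV₂ hU₂ hU ht)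
      (fun k φ hφ => by
        rw [← 𝓜.inn_congr k _ fun x hx => (hG₂ t ht x hx).2, ← 𝓜.inn_neg,
          ← hF.eq_θ t ht k φ hφ]
        ring)
    have := hasDerivWithinAt_error hμ (-c.l3) (-(c.w1 + c.l4)) (-c.w2) hm hV₂ hU₂ hU ht
      (q := fun s => ofPiecewise N (F.υ s)) (θ := fun s => ofPiecewise N (F.p s)) hP hPe
    simp only [neg_smul, neg_neg, sub_neg_eq_add] at this
    exact this

/-- The initial values are the very endpoint projections from which the error is measured. No
discretely differentiated initial error, which would cost a power of `h`, has to be bounded. -/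
theorem errors_zero (hm : 1 ≤ m) (hT : 0 ≤ T)
    (hU : SmoothFam m R T a b U) (hV : SmoothFam m R T a b V) (hU₂ : SmoothFam m R T a b U₂)
    (hV₂ : SmoothFam m R T a b V₂) (hu : ∀ t x, u x t = ⟨U 0 0 t x, V 0 0 t x⟩)
    (hv : ∀ t x, v x t = ⟨U₂ 0 0 t x, V₂ 0 0 t x⟩)
    (hI : HasInitialData 𝓜 N (fun x => u x 0) (fun x => v x 0) F) (i : Fin 4) :
    errors N F U V U₂ V₂ i 0 = 0 := by
  have h0 : (0 : ℝ) ∈ Icc 0 T := left_mem_Icc.2 hT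
  have key : ∀ {D : ℕ → ℕ → ℝ → ℝ → ℝ} {f : ℝ → ℝ} {w : 𝓜.Piecewise}, SmoothFam m R T a b D →
      𝓜.IsProjMinus N f w → (∀ x, f x = D 0 0 0 x) →
      projEnd N isEnd_right (D 0 0 0) - ofPiecewise N w = 0 := by
    intro D f w hD hw hf
    have hf' : f = D 0 0 0 := funext hf
    rw [hf'] at hw
    rw [← isProjMinus_iff (hD.BM (by omega) h0) hw, ofPiecewise, dif_pos hw.mem, sub_self]
  fin_cases i
  · exact key hU hI.p fun x => by rw [hu]
  · exact key hV hI.q fun x => by rw [hu]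
  · exact key hU₂ hI.υ fun x => by rw [hv]
  · exact key hV₂ hI.θ fun x => by rw [hv]

/-- The preimages are taken by the inverse of the discrete Riesz derivative; as a fixed linear map
it commutes with the time derivative, so the preimage of the differentiated residual is the
derivative of the preimage. -/
theorem exists_isSmallResidual (N : ℕ) {a b : ℝ} (hab : a < b) {μ : ℝ} (hμ : 0 < μ) (hμ1 : μ < 1)
    (c : Coeffs) : ∃ C > 0, ∀ (𝓜 : Mesh a b) (m : ℕ) (R T : ℝ) (U V U₂ V₂ : ℕ → ℕ → ℝ → ℝ → ℝ),
    0 ≤ R → N + 5 ≤ m → SmoothFam m R T a b U → SmoothFam m R T a b V → SmoothFam m R T a b U₂ →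
    SmoothFam m R T a b V₂ →
    IsSmallResidual (rieszOp (rieszC μ) μ) Dm c.l1 c.l3 T (C * (R * 𝓜.size ^ (N + 1)))
      (residuals 𝓜 N c μ U V U₂ V₂ 0)
      (fun i t => rieszInv hab (rieszC_ne_zero hμ hμ1) hμ hμ1 (residuals 𝓜 N c μ U V U₂ V₂ 0 i t))
      (fun i t => rieszInv hab (rieszC_ne_zero hμ hμ1) hμ hμ1
        (residuals 𝓜 N c μ U V U₂ V₂ 1 i t)) := by
  have hc := rieszC_ne_zero hμ hμ1
  obtain ⟨C0, hC0, n0⟩ := exists_residual_negnorm N hab hc hμ hμ1 c.l1 (c.w1 + c.l2) c.w2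
  obtain ⟨C1, hC1, n1⟩ := exists_residual_negnorm N hab hc hμ hμ1 (-c.l1) (-(c.w1 + c.l2)) (-c.w2)
  obtain ⟨C2, hC2, n2⟩ := exists_residual_negnorm N hab hc hμ hμ1 c.l3 (c.w1 + c.l4) c.w2
  obtain ⟨C3, hC3, n3⟩ := exists_residual_negnorm N hab hc hμ hμ1 (-c.l3) (-(c.w1 + c.l4)) (-c.w2)
  obtain ⟨K0, hK0, k0⟩ := exists_norm_residual N hab (rieszC μ) μ (c.w1 + c.l2) c.w2
  obtain ⟨K1, hK1, k1⟩ := exists_norm_residual N hab (rieszC μ) μ (-(c.w1 + c.l2)) (-c.w2)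
  obtain ⟨K2, hK2, k2⟩ := exists_norm_residual N hab (rieszC μ) μ (c.w1 + c.l4) c.w2
  obtain ⟨K3, hK3, k3⟩ := exists_norm_residual N hab (rieszC μ) μ (-(c.w1 + c.l4)) (-c.w2)
  refine ⟨C0 + C1 + C2 + C3 + K0 + K1 + K2 + K3, by positivity,
    fun 𝓜 m R T U V U₂ V₂ hR hm hU hV hU₂ hV₂ => ?_⟩
  have hB : 0 ≤ R * 𝓜.size ^ (N + 1) := mul_nonneg hR (pow_nonneg 𝓜.size_nonneg _)
  set B := R * 𝓜.size ^ (N + 1)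
  have up : ∀ {s K : ℝ}, s ≤ K * B → K ≤ C0 + C1 + C2 + C3 + K0 + K1 + K2 + K3 →
      s ≤ (C0 + C1 + C2 + C3 + K0 + K1 + K2 + K3) * B := fun h1 h2 =>
    h1.trans (mul_le_mul_of_nonneg_right h2 hB)
  have star : ∀ j, j ≤ 1 → ∀ t ∈ Icc 0 T, ∀ i, ‖Dm (rieszInv hab hc hμ hμ1
      (residuals 𝓜 N c μ U V U₂ V₂ j i t))‖ ≤ (C0 + C1 + C2 + C3 + K0 + K1 + K2 + K3) * B := by
    intro j hj t ht i
    fin_cases i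
    · exact up (n0 𝓜 m R T U V V₂ j hR (by omega) hU hV hV₂ t ht) (by linarith)
    · exact up (n1 𝓜 m R T V U U₂ j hR (by omega) hV hU hU₂ t ht) (by linarith)
    · exact up (n2 𝓜 m R T U₂ V₂ V j hR (by omega) hU₂ hV₂ hV t ht) (by linarith)
    · exact up (n3 𝓜 m R T V₂ U₂ U j hR (by omega) hV₂ hU₂ hU t ht) (by linarith)
  refine ⟨fun i t ht => hasDerivWithinAt_map _ ?_, fun i t _ => (rieszOp_rieszInv _ _ _ _ _).symm,
    star 0 zero_le_one, star 1 le_rfl, fun h1 t ht => ⟨?_, ?_⟩, fun h3 t ht => ⟨?_, ?_⟩⟩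
  · fin_cases i
    · exact hasDerivWithinAt_residual hμ hμ1 _ _ _ (by omega) hU hV hV₂ ht
    · exact hasDerivWithinAt_residual hμ hμ1 _ _ _ (by omega) hV hU hU₂ ht
    · exact hasDerivWithinAt_residual hμ hμ1 _ _ _ (by omega) hU₂ hV₂ hV ht
    · exact hasDerivWithinAt_residual hμ hμ1 _ _ _ (by omega) hV₂ hU₂ hU ht
  · change ‖residual 𝓜 N (rieszC μ) μ c.l1 _ _ U V V₂ 0 t‖ ≤ _
    rw [h1]
    exact up (k0 𝓜 m R T U V V₂ hR (by omega) hU hV hV₂ t ht) (by linarith)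
  · change ‖residual 𝓜 N (rieszC μ) μ (-c.l1) _ _ V U U₂ 0 t‖ ≤ _
    rw [h1, neg_zero]
    exact up (k1 𝓜 m R T V U U₂ hR (by omega) hV hU hU₂ t ht) (by linarith)
  · change ‖residual 𝓜 N (rieszC μ) μ c.l3 _ _ U₂ V₂ V 0 t‖ ≤ _
    rw [h3]
    exact up (k2 𝓜 m R T U₂ V₂ V hR (by omega) hU₂ hV₂ hV t ht) (by linarith)
  · change ‖residual 𝓜 N (rieszC μ) μ (-c.l3) _ _ V₂ U₂ U 0 t‖ ≤ _
    rw [h3, neg_zero]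
    exact up (k3 𝓜 m R T V₂ U₂ U hR (by omega) hV₂ hU₂ hU t ht) (by linarith)

/-- The four components of the scheme converge with optimal order. -/
theorem exists_errors_bound (N : ℕ) {a b α T : ℝ} (hab : a < b) (hα : 1 < α) (hα2 : α < 2)
    (hT : 0 < T) (c : Coeffs) : ∃ C > 0, ∀ (𝓜 : Mesh a b) (F : Fields 𝓜) (m : ℕ) (R : ℝ)
    (G₁ G₂ u v : ℝ → ℝ → ℂ) (U V U₂ V₂ : ℕ → ℕ → ℝ → ℝ → ℝ), 0 ≤ R → N + 5 ≤ m →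
    SmoothFam m R T a b U → SmoothFam m R T a b V → SmoothFam m R T a b U₂ →
    SmoothFam m R T a b V₂ → (∀ t x, u x t = ⟨U 0 0 t x, V 0 0 t x⟩) →
    (∀ t x, v x t = ⟨U₂ 0 0 t x, V₂ 0 0 t x⟩) → IsExactSolution a b α c T G₁ G₂ u v →
    IsLDGSolution 𝓜 N α c T G₁ G₂ F → HasInitialData 𝓜 N (fun x => u x 0) (fun x => v x 0) F →
    ∀ i, ‖errors N F U V U₂ V₂ i T‖ ≤ C * (R * 𝓜.size ^ (N + 1)) := by
  have hμ : 0 < 2 - α := by linarith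
  have hμ1 : 2 - α < 1 := by linarith
  obtain ⟨Cp, hCp, hP⟩ := exists_norm_le_Dm N hab
  obtain ⟨C1, hC1, h1⟩ := exists_stability c.l1 c.l3 (c.w1 + c.l2) (c.w1 + c.l4) c.w2 hT.le hCp.le
  obtain ⟨C2, hC2, h2⟩ := exists_isSmallResidual N hab hμ hμ1 c
  refine ⟨C1 * C2, by positivity,
    fun 𝓜 F m R G₁ G₂ u v U V U₂ V₂ hR hm hU hV hU₂ hV₂ hu hv hex hF hI i => ?_⟩
  have hB : 0 ≤ R * 𝓜.size ^ (N + 1) := mul_nonneg hR (pow_nonneg 𝓜.size_nonneg _)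
  rw [mul_assoc]
  exact h1 (rieszOp (rieszC (2 - α)) (2 - α)) Dm (inner_Dm_rieszOp _ hμ) (hP 𝓜) _ _ _ _ _
    (mul_nonneg hC2.le hB)
    (isSystem_errors hα hα2 hT (by omega) hU hV hU₂ hV₂ hu hv hex hF)
    (errors_zero (by omega) hT.le hU hV hU₂ hV₂ hu hv hI)
    (h2 𝓜 m R T U V U₂ V₂ hR hm hU hV hU₂ hV₂) T (right_mem_Icc.2 hT.le) i

end Vh

end FracLDG

/-! ### The convergence theorem -/

open FracLDG in
theorem mainTheorem4 (N : ℕ) :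
    ∃ m : ℕ, ∀ (α a b T R : ℝ) (c : Coeffs), 1 < α → α < 2 → a < b → 0 < T →
      ∃ C > 0, ∃ h₀ > 0, ∀ (G₁ G₂ u v : ℝ → ℝ → ℂ),
        SmoothBound m R T u → SmoothBound m R T v →
        IsExactSolution a b α c T G₁ G₂ u v →
        ∀ (𝓜 : Mesh a b) (F : Fields 𝓜), 𝓜.size ≤ h₀ →
          IsLDGSolution 𝓜 N α c T G₁ G₂ F →
          HasInitialData 𝓜 N (fun x => u x 0) (fun x => v x 0) F →
          ldgError 𝓜 F u v T ≤ C * 𝓜.size ^ (N + 1) := by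
  -- Approximation needs `N + 1` further derivatives of second space derivatives, after one time
  -- derivative of the residual; `N + 5` leaves room for this.
  refine ⟨N + 5, fun α a b T R c hα hα2 hab hT => ?_⟩
  obtain ⟨C1, hC1, h1⟩ := Vh.exists_errors_bound N hab hα hα2 hT c
  obtain ⟨C2, hC2, h2⟩ := Vh.exists_l2_error N hab
  set K := Real.sqrt (2 * (C2 + 2 * C1 ^ 2)) with hK
  -- The constant is chosen before `R ≥ 0` is known, whence `|R|`; the summand `1` keeps it
  -- positive. The threshold `1` is arbitrary.
  refine ⟨2 * (K * |R|) + 1, by positivity, 1, one_pos, fun G₁ G₂ u v hu hv hex 𝓜 F _ hF hI => ?_⟩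
  have hTm : T ∈ Icc 0 T := right_mem_Icc.2 hT.le
  -- The derivative bound of order zero at a point of the strip forces `R` to be nonnegative.
  have hR : 0 ≤ R := (norm_nonneg _).trans (hu.2 0 (Nat.zero_le _) (0, T) (mem_strip hTm))
  obtain ⟨U, V, hU, hV, huU⟩ := hu.exists_fam hT fun t ht x hx => (hex.bdry t ht x hx).1
  obtain ⟨U₂, V₂, hU₂, hV₂, hvU⟩ := hv.exists_fam hT fun t ht x hx => (hex.bdry t ht x hx).2
  have he := h1 𝓜 F (N + 5) R G₁ G₂ u v U V U₂ V₂ hR le_rfl hU hV hU₂ hV₂ huU hvU hex hF hI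
  have hS := 𝓜.size_nonneg
  set B := R * 𝓜.size ^ (N + 1) with hB
  have hB0 : 0 ≤ B := by positivity
  obtain ⟨m1, m2, -, -, -, -, -, -, m3, m4, -⟩ := hF.mem T hTm
  have key : ∀ {D : ℕ → ℕ → ℝ → ℝ → ℝ} {w : 𝓜.Piecewise}, SmoothFam (N + 5) R T a b D →
      w ∈ 𝓜.space N →
      ‖Vh.projEnd N Vh.isEnd_right (D 0 0 T) - Vh.ofPiecewise N w‖ ≤ C1 * B →
      ∑ k, ∫ x in 𝓜.left k..𝓜.right k, (D 0 0 T x - (w k).eval x) ^ 2 ≤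
        (C2 + 2 * C1 ^ 2) * B ^ 2 := by
    intro D w hD hw h
    have h3 := h2 𝓜 _ R (Vh.ofPiecewise N w) hR (hD.derivBound (N + 1) 0 0 (by omega) T hTm)
    rw [Vh.ofPiecewise_val hw] at h3
    have h4 := pow_le_pow_left₀ (norm_nonneg _) h 2
    refine h3.trans ?_
    rw [mul_pow] at h4
    linarith
  have half : ∀ {f g : ℝ}, f ≤ (C2 + 2 * C1 ^ 2) * B ^ 2 → g ≤ (C2 + 2 * C1 ^ 2) * B ^ 2 →
      Real.sqrt (f + g) ≤ K * B := by
    intro f g hf hg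
    refine Real.sqrt_le_iff.2 ⟨by positivity, ?_⟩
    rw [mul_pow, hK, Real.sq_sqrt (by positivity)]
    linarith
  have e1 := half (key hU m1 (he 0)) (key hV m2 (he 1))
  have e2 := half (key hU₂ m3 (he 2)) (key hV₂ m4 (he 3))
  rw [ldgError, 𝓜.l2Norm_sq_eq (hU.continuous (by omega) hTm) (hV.continuous (by omega) hTm)
    (fun x => huU T x), 𝓜.l2Norm_sq_eq (hU₂.continuous (by omega) hTm)
    (hV₂.continuous (by omega) hTm) (fun x => hvU T x), abs_of_nonneg hR]
  have h5 : 0 ≤ 𝓜.size ^ (N + 1) := pow_nonneg hS _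
  refine (add_le_add e1 e2).trans ?_
  rw [hB]
  linarith
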